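/- **Setting.** Let $\mathbb T^2=(\mathbb R/2\pi\mathbb Z)^2$ with Lebesgue measure, $H=L^2(\mathbb T^2;\mathbb R)$, $\mathbf e_k(x)=\frac1{2\pi}e^{ik\cdot x}$ $(k\in\mathbb Z^2)$. A distribution $u$ on $\mathbb T^2$ has Fourier coefficients $\hat u(k)=\langle u,\mathbf e_k\rangle$ (the pairing extending $\int f\overline g\,dx$). For $s\in\mathbb R$, $H^s=H^s(\mathbb T^2)$ is the real Hilbert space of distributions $u$ with $\hat u(-k)=\overline{\hat u(k)}$ and $\|u\|_{H^s}^2=\sum_k(1+|k|^2)^s|\hat u(k)|^2<\infty$, and ${}_{H^{-s}}\langle u,v\rangle_{H^s}=\sum_k\hat u(k)\hat v(-k)$. Fix $\delta>0$, put $E=H^{-\delta}$ and $A=(1-\Delta)^{-1}$, and let $\mu_0=N(0,A^{1+\delta})$ be the centred Gaussian measure on $E$ with $\int_E(l_1,z)_E(l_2,z)_E\,\mu_0(dz)=(A^{1+\delta}l_1,l_2)_E$ for $l_1,l_2\in E$. Let $\mathbb H_n(\xi)=\frac{(-1)^n}{\sqrt{n!}}e^{\xi^2/2}\frac{d^n}{d\xi^n}e^{-\xi^2/2}$.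 A cutoff is a compact set $\Lambda\subset\mathbb R^2$ with $\Lambda=-\Lambda$ and $0$ in its interior. For a cutoff $\Lambda$ and $z\in E$ put $(\Pi_\Lambda z)(x)=\sum_{k\in\Lambda\cap\mathbb Z^2}\hat z(k)\mathbf e_k(x)$, $\rho_\Lambda=\frac1{2\pi}\bigl(\sum_{k\in\Lambda\cap\mathbb Z^2}(1+|k|^2)^{-1}\bigr)^{1/2}$, $$\Phi_{n,\Lambda}(z)_x=\sqrt{n!}\,\rho_\Lambda^n\,\mathbb H_n\bigl(\rho_\Lambda^{-1}(\Pi_\Lambda z)(x)\bigr),\qquad (\Phi_{n,\Lambda}(z),g)_H=\int_{\mathbb T^2}\Phi_{n,\Lambda}(z)_x\,g(x)\,dx\quad(g\in H).$$ For $f\in H^{-1}$ let $W_f\in L^2(\mu_0)$ be the white noise function: $W_f(z)=\langle z,f\rangle$ for $f\in H^\delta$, extended by $L^2(\mu_0)$-limits to $f\in H^{-1}$. Let $\mathcal C_n$ be the closed linear span in $L^2(\mu_0)$ of $\{\mathbb H_n(W_f):\|f\|_{H^{-1}}=1\}$. **Proposition 3.1.** (1) For every $n\ge0$ there is a map $\Phi_n$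 on $E$, written $\Phi_n(z)={:}z^n{:}$, with values in $\bigcap_{\alpha>0}H^{-\alpha}$, such that for all $p\ge1$, all $\alpha>0$ and every cutoff $\Lambda$, the sequence $(\Phi_{n,N\Lambda})_N$ is a Cauchy sequence in $L^p(\mu_0;H^{-\alpha})$ and converges there to $\Phi_n\in L^p(\mu_0;H^{-\alpha})$. In particular the limit does not depend on $\Lambda$. Moreover, for $p\ge2$, $n\ge1$ and $\varepsilon>0$, $$\|\Phi_n\|_{L^p(\mu_0;H^{-\alpha})}\le C(p-1)^{n/2}\sqrt{n!}\Bigl\{\alpha^{-2}\Bigl(\frac{1+\varepsilon}{4\pi\alpha}\Bigr)^{n-1}n!+C^n\Bigl(\frac{1+\varepsilon}{\varepsilon}\Bigr)^{n-1}\Bigr\}^{1/2},$$ with a constant $C>0$ as follows: for every $\alpha_0<1$ one can take the same $C$ for all $\alpha\in(0,\alpha_0]$, all $n\ge1$, $p\ge2$ and $\varepsilon>0$; for $\alpha\ge1$ the bound holds with a $C$ that may depend on $\alpha$ and $n$, but not on $p$ and $\varepsilon$. (2) For every $n\ge0$ and $g\in H$ there is a function $\Phi_n(\cdot)(g)$ on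 $E$, written $\Phi_n(z)(g)={:}z^n{:}(g)$, such that for all $p\ge1$ and every cutoff $\Lambda$, $(\Phi_{n,N\Lambda}(\cdot),g)_H\to\Phi_n(\cdot)(g)$ in $L^p(\mu_0)$ as $N\to\infty$. In particular the limit does not depend on $\Lambda$. We have $\Phi_n(\cdot)(g)\in\mathcal C_n$, and there is a constant $C>0$ such that for all $n\ge1$, $g\in H$, $p\ge2$ and $\varepsilon>0$ $$\|\Phi_n(\cdot)(g)\|_{L^p(\mu_0)}\le C(p-1)^{n/2}\sqrt{n!}\Bigl\{\Bigl(\frac{1+\varepsilon}{4\pi}\Bigr)^{n-1}n!+C^n\Bigl(\frac{1+\varepsilon}{\varepsilon}\Bigr)^{n-1}\Bigr\}^{1/2}\|g\|_H.$$ Furthermore, for all $\alpha>0$ and $g\in H\cap H^\alpha$, $\Phi_n(z)(g)={}_{H^{-\alpha}}\langle{:}z^n{:},g\rangle_{H^\alpha}$ for $\mu_0$-a.e. $z\in E$. -/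

import Mathlib

open MeasureTheory ProbabilityTheory Filter Topology
open scoped ContDiff ENNReal Pointwise InnerProductSpace

noncomputable section

namespace WickTorus

/-! ### The torus and the trigonometric functions -/

instance factTwoPiPos : Fact ((0 : ℝ) < 2 * Real.pi) := ⟨Real.two_pi_pos⟩

/-- The torus `(ℝ / 2πℤ)²`; its `volume` is Lebesgue measure, of total mass `4π²`. -/
abbrev T2 : Type := AddCircle (2 * Real.pi) × AddCircle (2 * Real.pi)

/-- The canonical projection `ℝ² → T2`. -/
def proj (x : ℝ × ℝ) : T2 := ((x.1 : AddCircle (2 * Real.pi)), (x.2 : AddCircle (2 * Real.pi)))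

/-- `e_k(x) = (2π)⁻¹ exp(i k·x)`. -/
def expFn (k : ℤ × ℤ) (x : T2) : ℂ :=
  ((2 * Real.pi : ℝ) : ℂ)⁻¹ * (fourier k.1 x.1 * fourier k.2 x.2)

/-- `λ_k = 1 + |k|²`. -/
def lam (k : ℤ × ℤ) : ℝ := 1 + ((k.1 : ℝ) ^ 2 + (k.2 : ℝ) ^ 2)

lemma one_le_lam (k : ℤ × ℤ) : 1 ≤ lam k := by
  unfold lam; nlinarith [sq_nonneg (k.1 : ℝ), sq_nonneg (k.2 : ℝ)]

lemma lam_pos (k : ℤ × ℤ) : 0 < lam k := lt_of_lt_of_le one_pos (one_le_lam k)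

lemma lam_neg (k : ℤ × ℤ) : lam (-k) = lam k := by simp [lam]

lemma continuous_expFn (k : ℤ × ℤ) : Continuous (expFn k) := by
  unfold expFn; fun_prop

lemma expFn_proj (k : ℤ × ℤ) (x : ℝ × ℝ) :
    expFn k (proj x) = ((2 * Real.pi : ℝ) : ℂ)⁻¹ *
      Complex.exp (Complex.I * ((k.1 * x.1 + k.2 * x.2 : ℝ) : ℂ)) := by
  have hpi : (Real.pi : ℂ) ≠ 0 := by exact_mod_cast Real.pi_ne_zero
  simp only [expFn, proj, fourier_coe_apply, ← Complex.exp_add]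
  congr 2
  push_cast
  field_simp

lemma conj_expFn (k : ℤ × ℤ) (x : T2) :
    (starRingEnd ℂ) (expFn k x) = expFn (-k) x := by
  simp only [expFn, map_mul, map_inv₀, Complex.conj_ofReal, Prod.fst_neg, Prod.snd_neg, fourier_neg]

/-! ### Smooth functions and distributions on the torus -/

/-- Smooth complex functions on the torus: those whose periodic lift to `ℝ²` is smooth. -/
def testFn : Submodule ℂ (T2 → ℂ) where
  carrier := {φ | ContDiff ℝ ∞ fun x : ℝ × ℝ => φ (proj x)}
  add_mem' := by
    intro φ ψ hφ hψ
    rw [Set.mem_ofPred_eq] at hφ hψ ⊢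
    exact hφ.add hψ
  zero_mem' := by
    rw [Set.mem_ofPred_eq]
    exact contDiff_const
  smul_mem' := by
    intro c φ hφ
    rw [Set.mem_ofPred_eq] at hφ ⊢
    exact hφ.const_smul c

/-- The partial derivative `∂^{i+j} φ / ∂x₁^i ∂x₂^j`, as a periodic function on `ℝ²`. -/
def partialDeriv (i j : ℕ) (φ : T2 → ℂ) (x : ℝ × ℝ) : ℂ :=
  iteratedDeriv i (fun s => iteratedDeriv j (fun t => φ (proj (s, t))) x.2) x.1

lemma expFn_mem (k : ℤ × ℤ) : expFn k ∈ testFn := by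
  change ContDiff ℝ ∞ fun x : ℝ × ℝ => expFn k (proj x)
  simp only [expFn_proj]
  refine contDiff_const.mul (ContDiff.cexp (contDiff_const.mul ?_))
  exact Complex.ofRealCLM.contDiff.comp
    ((contDiff_const.mul contDiff_fst).add (contDiff_const.mul contDiff_snd))

lemma continuous_of_mem {φ : T2 → ℂ} (h : φ ∈ testFn) : Continuous φ := by
  have hq : IsOpenQuotientMap (Prod.map (QuotientAddGroup.mk : ℝ → AddCircle (2 * Real.pi))
      (QuotientAddGroup.mk : ℝ → AddCircle (2 * Real.pi))) :=
    IsOpenQuotientMap.prodMap QuotientAddGroup.isOpenQuotientMap_mk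
      QuotientAddGroup.isOpenQuotientMap_mk
  rw [hq.isQuotientMap.continuous_iff]
  exact ContDiff.continuous (𝕜 := ℝ) (n := ∞) h

/-- Complex distributions on the torus: the linear forms `u` on smooth functions such that
`|u(φ)| ≤ C max_{i+j ≤ N} sup |∂₁^i ∂₂^j φ|` for some `N` and `C`. -/
def distr : Submodule ℂ (testFn →ₗ[ℂ] ℂ) where
  carrier := {u | ∃ (N : ℕ) (C : ℝ), 0 < C ∧ ∀ (φ : testFn) (M : ℝ),
    (∀ i j : ℕ, i + j ≤ N → ∀ x, ‖partialDeriv i j φ x‖ ≤ M) → ‖u φ‖ ≤ C * M}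
  add_mem' := by
    rintro u v ⟨N, C, hC, hu⟩ ⟨N', C', hC', hv⟩
    refine ⟨max N N', C + C', by positivity, fun φ M hM => ?_⟩
    have h1 := hu φ M fun i j hij => hM i j (hij.trans (le_max_left _ _))
    have h2 := hv φ M fun i j hij => hM i j (hij.trans (le_max_right _ _))
    calc ‖(u + v) φ‖ ≤ ‖u φ‖ + ‖v φ‖ := norm_add_le _ _
      _ ≤ (C + C') * M := by linarith
  zero_mem' := by
    refine ⟨0, 1, one_pos, fun φ M hM => ?_⟩
    simpa using (norm_nonneg _).trans (hM 0 0 le_rfl 0)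
  smul_mem' := by
    rintro c u ⟨N, C, hC, hu⟩
    refine ⟨N, (‖c‖ + 1) * C, by positivity, fun φ M hM => ?_⟩
    have hM0 : 0 ≤ M := (norm_nonneg _).trans (hM 0 0 (Nat.zero_le _) 0)
    have h1 := hu φ M hM
    calc ‖(c • u) φ‖ = ‖c‖ * ‖u φ‖ := norm_mul c (u φ)
      _ ≤ ‖c‖ * (C * M) := by gcongr
      _ ≤ (‖c‖ + 1) * C * M := by nlinarith [mul_nonneg hC.le hM0]

/-- The Fourier coefficient `û(k) = ⟨u, e_k⟩`. The pairing extends the `L²` inner product, which is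
conjugate linear in `e_k`, so it is the value of `u` at the conjugate `e_{-k}` of `e_k`. -/
def fc (u : distr) (k : ℤ × ℤ) : ℂ := u.1 ⟨expFn (-k), expFn_mem (-k)⟩

lemma fc_add (u v : distr) (k : ℤ × ℤ) : fc (u + v) k = fc u k + fc v k := rfl

lemma fc_zero (k : ℤ × ℤ) : fc 0 k = 0 := rfl

lemma fc_smul (c : ℝ) (u : distr) (k : ℤ × ℤ) : fc (c • u) k = c * fc u k := by
  change c • fc u k = _
  simp

/-! ### Fourier coefficients determine a distribution -/

lemma proj_add (x y : ℝ × ℝ) : proj (x + y) = proj x + proj y := by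
  simp [proj]

lemma proj_surjective : Function.Surjective proj := by
  rintro ⟨a, b⟩
  obtain ⟨s, rfl⟩ := QuotientAddGroup.mk_surjective a
  obtain ⟨t, rfl⟩ := QuotientAddGroup.mk_surjective b
  exact ⟨(s, t), rfl⟩

lemma hasDerivAt_line {φ : T2 → ℂ} (h : φ ∈ testFn) (v x : ℝ × ℝ) (r : ℝ) :
    HasDerivAt (fun r : ℝ => φ (proj x + proj (r • v)))
      (fderiv ℝ (fun y => φ (proj y)) (x + r • v) v) r := by
  have h1 : DifferentiableAt ℝ (fun y : ℝ × ℝ => φ (proj y)) (x + r • v) :=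
    (ContDiff.differentiable (n := ∞) h (by simp)).differentiableAt
  have h2 : HasDerivAt (fun r : ℝ => x + r • v) v r := by
    simpa using ((hasDerivAt_id r).smul_const v).const_add x
  have h3 := h1.hasFDerivAt.comp_hasDerivAt r h2
  simpa only [Function.comp_def, proj_add] using h3

/-- The derivative of a function on the torus in the direction `v`. -/
def dirFn (v : ℝ × ℝ) (φ : T2 → ℂ) (x : T2) : ℂ :=
  deriv (fun r : ℝ => φ (x + proj (r • v))) 0

lemma dirFn_proj {φ : T2 → ℂ} (h : φ ∈ testFn) (v x : ℝ × ℝ) :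
    dirFn v φ (proj x) = fderiv ℝ (fun y => φ (proj y)) x v := by
  have h1 := (hasDerivAt_line h v x 0).deriv
  rw [zero_smul, add_zero] at h1
  exact h1

lemma dirFn_mem {φ : T2 → ℂ} (h : φ ∈ testFn) (v : ℝ × ℝ) : dirFn v φ ∈ testFn := by
  change ContDiff ℝ ∞ fun x => dirFn v φ (proj x)
  simp only [dirFn_proj h]
  exact (ContDiff.fderiv_right (m := ∞) (n := ∞) h (by simp)).clm_apply contDiff_const

/-- The derivative in the direction `v`, as an operator on smooth functions. -/
def dirDeriv (v : ℝ × ℝ) : testFn →ₗ[ℂ] testFn where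
  toFun φ := ⟨dirFn v φ.1, dirFn_mem φ.2 v⟩
  map_add' φ ψ := by
    ext x
    obtain ⟨x, rfl⟩ := proj_surjective x
    change dirFn v (φ.1 + ψ.1) (proj x) = dirFn v φ.1 (proj x) + dirFn v ψ.1 (proj x)
    have h := ((hasDerivAt_line φ.2 v x 0).add (hasDerivAt_line ψ.2 v x 0)).deriv
    rw [dirFn_proj φ.2, dirFn_proj ψ.2]
    rw [zero_smul, add_zero] at h
    exact h
  map_smul' c φ := by
    ext x
    obtain ⟨x, rfl⟩ := proj_surjective x
    change dirFn v (c • φ.1) (proj x) = c • dirFn v φ.1 (proj x)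
    have h := ((hasDerivAt_line φ.2 v x 0).const_smul c).deriv
    rw [dirFn_proj φ.2]
    rw [zero_smul, add_zero] at h
    exact h

lemma hasDerivAt_dirDeriv (φ : testFn) (v : ℝ × ℝ) (x : T2) (r : ℝ) :
    HasDerivAt (fun r : ℝ => φ.1 (x + proj (r • v))) ((dirDeriv v φ).1 (x + proj (r • v))) r := by
  obtain ⟨x, rfl⟩ := proj_surjective x
  have h := hasDerivAt_line φ.2 v x r
  rwa [← dirFn_proj φ.2, proj_add] at h

lemma partialDeriv_eq (i j : ℕ) (φ : testFn) (x : ℝ × ℝ) :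
    partialDeriv i j φ x = ((dirDeriv (1, 0))^[i] ((dirDeriv (0, 1))^[j] φ)).1 (proj x) := by
  have hj : ∀ (j : ℕ) (φ : testFn) (s t : ℝ), iteratedDeriv j (fun t => φ.1 (proj (s, t))) t =
      ((dirDeriv (0, 1))^[j] φ).1 (proj (s, t)) := by
    intro j
    induction j with
    | zero => intro φ s t; simp
    | succ j ih =>
      intro φ s t
      rw [iteratedDeriv_succ', Function.iterate_succ_apply, ← ih]
      congr 1
      funext t
      have h := (hasDerivAt_dirDeriv φ (0, 1) (proj (s, 0)) t).deriv
      simpa [← proj_add] using h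
  have hi : ∀ (i : ℕ) (φ : testFn) (s t : ℝ), iteratedDeriv i (fun s => φ.1 (proj (s, t))) s =
      ((dirDeriv (1, 0))^[i] φ).1 (proj (s, t)) := by
    intro i
    induction i with
    | zero => intro φ s t; simp
    | succ i ih =>
      intro φ s t
      rw [iteratedDeriv_succ', Function.iterate_succ_apply, ← ih]
      congr 1
      funext s
      have h := (hasDerivAt_dirDeriv φ (1, 0) (proj (0, t)) s).deriv
      simpa [← proj_add] using h
  unfold partialDeriv
  simp only [hj, hi]

lemma expFn_add (k : ℤ × ℤ) (x y : T2) :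
    expFn k (x + y) = expFn k x * (fourier k.1 y.1 * fourier k.2 y.2) := by
  simp only [expFn, Prod.fst_add, Prod.snd_add, fourier_apply, smul_add, AddCircle.toCircle_add,
    Circle.coe_mul]
  ring

lemma norm_expFn_le (k : ℤ × ℤ) (x : T2) : ‖expFn k x‖ ≤ 1 := by
  have h : (1 : ℝ) ≤ 2 * Real.pi := by linarith [Real.pi_gt_three]
  simp only [expFn, norm_mul, norm_inv, Complex.norm_real, fourier_apply, Circle.norm_coe,
    Real.norm_of_nonneg Real.two_pi_pos.le, mul_one]
  exact inv_le_one_of_one_le₀ h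

/-- The `k`-th Fourier coefficient of a function. -/
def fcFn (φ : T2 → ℂ) (k : ℤ × ℤ) : ℂ := ∫ x, φ x * expFn (-k) x

lemma hasDerivAt_char (k : ℤ × ℤ) (v : ℝ × ℝ) :
    HasDerivAt (fun r : ℝ => fourier k.1 (proj (r • v)).1 * fourier k.2 (proj (r • v)).2)
      (Complex.I * (k.1 * v.1 + k.2 * v.2 : ℝ)) 0 := by
  have hpi : (Real.pi : ℂ) ≠ 0 := by exact_mod_cast Real.pi_ne_zero
  have h1 : (fun r : ℝ => (fourier k.1 (proj (r • v)).1 * fourier k.2 (proj (r • v)).2 : ℂ)) =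
      fun r : ℝ => Complex.exp (r * (Complex.I * (k.1 * v.1 + k.2 * v.2 : ℝ))) := by
    funext r
    simp only [proj, fourier_coe_apply, ← Complex.exp_add, Prod.smul_fst, Prod.smul_snd,
      smul_eq_mul]
    congr 1
    push_cast
    field_simp
  rw [h1]
  have h2 : HasDerivAt (fun r : ℝ => (r : ℂ) * (Complex.I * (k.1 * v.1 + k.2 * v.2 : ℝ)))
      (Complex.I * (k.1 * v.1 + k.2 * v.2 : ℝ)) 0 := by
    simpa using (Complex.ofRealCLM.hasDerivAt (x := (0 : ℝ))).mul_const
      (Complex.I * (k.1 * v.1 + k.2 * v.2 : ℝ))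
  simpa using h2.cexp

lemma exists_bound (φ : testFn) : ∃ K, ∀ x, ‖φ.1 x‖ ≤ K := by
  obtain ⟨K, hK⟩ := isCompact_univ.exists_bound_of_continuousOn
    (continuous_of_mem φ.2).continuousOn
  exact ⟨K, fun x => hK x (Set.mem_univ x)⟩

lemma integrable_of_continuous {f : T2 → ℂ} (hf : Continuous f) : Integrable f :=
  hf.integrable_of_hasCompactSupport (HasCompactSupport.of_compactSpace f)

lemma fcFn_dirDeriv (φ : testFn) (v : ℝ × ℝ) (k : ℤ × ℤ) :
    fcFn (dirDeriv v φ).1 k = Complex.I * (k.1 * v.1 + k.2 * v.2 : ℝ) * fcFn φ.1 k := by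
  obtain ⟨K, hK⟩ := exists_bound (dirDeriv v φ)
  have hφ := continuous_of_mem φ.2
  have hD := continuous_of_mem (dirDeriv v φ).2
  have h1 : HasDerivAt (fun r : ℝ => ∫ x, φ.1 (x + proj (r • v)) * expFn (-k) x)
      (∫ x, (dirDeriv v φ).1 (x + proj ((0 : ℝ) • v)) * expFn (-k) x) 0 := by
    refine (hasDerivAt_integral_of_dominated_loc_of_deriv_le (μ := volume)
      (F := fun (r : ℝ) (x : T2) => φ.1 (x + proj (r • v)) * expFn (-k) x)
      (F' := fun (r : ℝ) (x : T2) => (dirDeriv v φ).1 (x + proj (r • v)) * expFn (-k) x)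
      (bound := fun _ => K) (s := Set.univ) Filter.univ_mem ?_ ?_ ?_ ?_ ?_ ?_).2
    · exact Eventually.of_forall fun r => ((hφ.comp (continuous_add_const _)).mul
        (continuous_expFn _)).aestronglyMeasurable
    · exact integrable_of_continuous ((hφ.comp (continuous_add_const _)).mul (continuous_expFn _))
    · exact ((hD.comp (continuous_add_const _)).mul (continuous_expFn _)).aestronglyMeasurable
    · refine Eventually.of_forall fun x r _ => ?_
      rw [norm_mul]
      have h0 : 0 ≤ K := (norm_nonneg _).trans (hK 0)
      calc _ ≤ K * 1 := by gcongr; exacts [hK _, norm_expFn_le _ _]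
        _ = K := mul_one K
    · exact integrable_const K
    · exact Eventually.of_forall fun x r _ => (hasDerivAt_dirDeriv φ v x r).mul_const _
  have : (volume : Measure T2).IsAddRightInvariant := by
    rw [Measure.volume_eq_prod]; infer_instance
  have h2 : ∀ r : ℝ, ∫ x, φ.1 (x + proj (r • v)) * expFn (-k) x =
      (fourier k.1 (proj (r • v)).1 * fourier k.2 (proj (r • v)).2) * fcFn φ.1 k := by
    intro r
    rw [fcFn, ← integral_add_right_eq_self (μ := (volume : Measure T2))
      (fun x => φ.1 x * expFn (-k) x) (proj (r • v)), ← integral_const_mul]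
    congr 1
    ext x
    rw [expFn_add]
    have e1 : ∀ (n : ℤ) (y : AddCircle (2 * Real.pi)),
        (fourier n y : ℂ) * fourier (-n) y = 1 := by
      intro n y
      rw [← fourier_add]
      simp
    have a1 := e1 k.1 (proj (r • v)).1
    have a2 := e1 k.2 (proj (r • v)).2
    simp only [Prod.fst_neg, Prod.snd_neg]
    linear_combination (-(φ.1 (x + proj (r • v)) * expFn (-k) x)) *
      (fourier k.2 (proj (r • v)).2 * fourier (-k.2) (proj (r • v)).2) * a1 -
      (φ.1 (x + proj (r • v)) * expFn (-k) x) * a2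
  simp only [h2] at h1
  have h3 := h1.unique ((hasDerivAt_char k v).mul_const (fcFn φ.1 k))
  have h4 : ∀ x : T2, x + proj ((0 : ℝ) • v) = x := fun x => by
    rw [zero_smul]
    exact add_zero x
  simp only [h4] at h3
  exact h3

lemma norm_fcFn_le (φ : testFn) : ∃ K, 0 ≤ K ∧ ∀ k, ‖fcFn φ.1 k‖ ≤ K := by
  refine ⟨∫ x, ‖φ.1 x‖, integral_nonneg fun x => norm_nonneg _, fun k => ?_⟩
  refine norm_integral_le_of_norm_le (integrable_of_continuous (continuous_of_mem φ.2)).norm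
    (Eventually.of_forall fun x => ?_)
  rw [norm_mul]
  exact mul_le_of_le_one_right (norm_nonneg _) (norm_expFn_le _ _)

lemma fcFn_sub (φ ψ : testFn) (k : ℤ × ℤ) :
    fcFn (φ - ψ : testFn).1 k = fcFn φ.1 k - fcFn ψ.1 k := by
  unfold fcFn
  rw [← integral_sub]
  · congr 1
    ext x
    exact sub_mul _ _ _
  · exact integrable_of_continuous ((continuous_of_mem φ.2).mul (continuous_expFn _))
  · exact integrable_of_continuous ((continuous_of_mem ψ.2).mul (continuous_expFn _))

lemma summable_inv_sq : Summable fun n : ℤ => (1 + (n : ℝ) ^ 2)⁻¹ := by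
  have h : Summable fun n : ℤ => 1 / (n : ℝ) ^ 2 := Real.summable_one_div_int_pow.2 (by norm_num)
  refine Summable.of_norm_bounded_eventually h ?_
  rw [Filter.eventually_cofinite]
  refine (Set.finite_singleton (0 : ℤ)).subset fun n hn => ?_
  by_contra h0
  refine hn ?_
  have : (0 : ℝ) < (n : ℝ) ^ 2 := by
    have : (n : ℝ) ≠ 0 := by exact_mod_cast h0
    positivity
  rw [Real.norm_of_nonneg (by positivity), one_div]
  exact inv_anti₀ this (by linarith)

lemma summable_fcFn (φ : testFn) : Summable fun k => ‖fcFn φ.1 k‖ := by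
  have hL : ∀ (v : ℝ × ℝ) (ψ : testFn) (k : ℤ × ℤ),
      fcFn (ψ - dirDeriv v (dirDeriv v ψ) : testFn).1 k =
        ((1 + (k.1 * v.1 + k.2 * v.2) ^ 2 : ℝ) : ℂ) * fcFn ψ.1 k := by
    intro v ψ k
    rw [fcFn_sub, fcFn_dirDeriv, fcFn_dirDeriv]
    push_cast
    linear_combination (-((k.1 * v.1 + k.2 * v.2 : ℂ) ^ 2 * fcFn ψ.1 k)) * Complex.I_sq
  set ψ : testFn := φ - dirDeriv (1, 0) (dirDeriv (1, 0) φ)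
  obtain ⟨K, hK0, hK⟩ := norm_fcFn_le (ψ - dirDeriv (0, 1) (dirDeriv (0, 1) ψ))
  have hs := (summable_inv_sq.mul_of_nonneg summable_inv_sq (fun n => by positivity)
    (fun n => by positivity)).mul_left K
  refine Summable.of_nonneg_of_le (fun k => norm_nonneg _) (fun k => ?_) hs
  have h := hK k
  rw [hL, hL, norm_mul, norm_mul, Complex.norm_real, Complex.norm_real] at h
  simp only [mul_zero, mul_one, zero_add, add_zero] at h
  rw [Real.norm_of_nonneg (by positivity), Real.norm_of_nonneg (by positivity)] at h
  have p1 : 0 < 1 + (k.1 : ℝ) ^ 2 := by positivity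
  have p2 : 0 < 1 + (k.2 : ℝ) ^ 2 := by positivity
  rw [← mul_inv, ← div_eq_mul_inv, le_div_iff₀ (by positivity)]
  linarith

/-- `∫ fourier n = 2π` if `n = 0` and `0` otherwise. -/
lemma integral_fourier_eq (n : ℤ) :
    ∫ t : AddCircle (2 * Real.pi), fourier n t = if n = 0 then ((2 * Real.pi : ℝ) : ℂ) else 0 := by
  split_ifs with h
  · subst h
    simp [Measure.real, Real.pi_pos.le]
  · exact integral_eq_zero_of_add_right_eq_neg (μ := volume)
      (fourier_add_half_inv_index h Real.two_pi_pos)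

lemma integral_expFn (k l : ℤ × ℤ) :
    ∫ x, expFn l x * expFn (-k) x = if k = l then 1 else 0 := by
  have h0 : ((2 * Real.pi : ℝ) : ℂ) ≠ 0 := by exact_mod_cast Real.two_pi_pos.ne'
  have h1 : ∀ x : T2, expFn l x * expFn (-k) x =
      (((2 * Real.pi : ℝ) : ℂ)⁻¹ ^ 2 * fourier (l.1 - k.1) x.1) * fourier (l.2 - k.2) x.2 := by
    intro x
    rw [sub_eq_add_neg, sub_eq_add_neg, fourier_add, fourier_add]
    simp only [expFn, Prod.fst_neg, Prod.snd_neg]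
    ring
  simp only [h1]
  rw [Measure.volume_eq_prod, integral_prod_mul (μ := volume) (ν := volume)
    (fun t : AddCircle (2 * Real.pi) => ((2 * Real.pi : ℝ) : ℂ)⁻¹ ^ 2 * fourier (l.1 - k.1) t)
    (fun t : AddCircle (2 * Real.pi) => fourier (l.2 - k.2) t), integral_const_mul,
    integral_fourier_eq, integral_fourier_eq]
  by_cases h : k = l
  · subst h
    simp only [sub_self, if_true]
    field_simp
  · rw [if_neg h]
    have : l.1 - k.1 ≠ 0 ∨ l.2 - k.2 ≠ 0 := by
      by_contra hc
      push Not at hc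
      exact h (Prod.ext (by omega) (by omega))
    rcases this with h' | h' <;> simp [h']

/-- A continuous function on the circle with vanishing Fourier coefficients is zero. -/
lemma eq_zero_of_circle (f : C(AddCircle (2 * Real.pi), ℂ))
    (h : ∀ n : ℤ, ∫ t, fourier (-n) t * f t = 0) : f = 0 := by
  have hc : ∀ n, fourierCoeff f n = 0 := by
    intro n
    simp only [fourierCoeff, AddCircle.integral_haarAddCircle, smul_eq_mul, h, smul_zero]
  have h1 := hasSum_fourier_series_of_summable (f := f) (by simp [funext hc])
  simp only [hc, zero_smul] at h1
  exact h1.unique hasSum_zero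

lemma eq_zero_of_fcFn {f : T2 → ℂ} (hf : Continuous f) (h : ∀ k, fcFn f k = 0) : f = 0 := by
  have h0 : ((2 * Real.pi : ℝ) : ℂ) ≠ 0 := by exact_mod_cast Real.two_pi_pos.ne'
  have hcont : ∀ n : ℤ, Continuous fun s : AddCircle (2 * Real.pi) =>
      ∫ t : AddCircle (2 * Real.pi), fourier (-n) t * f (s, t) := by
    intro n
    have := continuous_parametric_integral_of_continuous (μ := volume)
      (f := fun (s t : AddCircle (2 * Real.pi)) => (fourier (-n) t : ℂ) * f (s, t))
      (by fun_prop) isCompact_univ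
    simpa using this
  have h1 : ∀ n : ℤ, (⟨_, hcont n⟩ : C(AddCircle (2 * Real.pi), ℂ)) = 0 := by
    intro n
    refine eq_zero_of_circle _ fun m => ?_
    have h2 := h (m, n)
    rw [fcFn, Measure.volume_eq_prod, integral_prod] at h2
    · simp only [ContinuousMap.coe_mk, ← integral_const_mul]
      have h3 : ∀ s t : AddCircle (2 * Real.pi), f (s, t) * expFn (-(m, n)) (s, t) =
          ((2 * Real.pi : ℝ) : ℂ)⁻¹ * (fourier (-m) s * (fourier (-n) t * f (s, t))) := by
        intro s t
        simp only [expFn, Prod.fst_neg, Prod.snd_neg]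
        ring
      simp only [h3, integral_const_mul] at h2
      simp only [integral_const_mul]
      exact (mul_eq_zero.1 h2).resolve_left (inv_ne_zero h0)
    · rw [← Measure.volume_eq_prod]
      exact integrable_of_continuous (hf.mul (continuous_expFn _))
  funext x
  have h4 := eq_zero_of_circle ⟨fun t => f (x.1, t), by fun_prop⟩ fun n =>
    DFunLike.congr_fun (h1 n) x.1
  exact DFunLike.congr_fun h4 x.2

/-- `e_k` as a continuous map. -/
def expC (k : ℤ × ℤ) : C(T2, ℂ) := ⟨expFn k, continuous_expFn k⟩

lemma hasSum_fcFn (φ : testFn) :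
    HasSum (fun k => fcFn φ.1 k • expC k) (⟨φ.1, continuous_of_mem φ.2⟩ : C(T2, ℂ)) := by
  have hs : Summable fun k => fcFn φ.1 k • expC k := by
    refine Summable.of_norm_bounded (summable_fcFn φ) fun k => ?_
    rw [norm_smul]
    refine mul_le_of_le_one_right (norm_nonneg _) ?_
    exact (ContinuousMap.norm_le _ zero_le_one).2 fun x => norm_expFn_le k x
  obtain ⟨f, hf⟩ := hs
  suffices h : f = ⟨φ.1, continuous_of_mem φ.2⟩ by rwa [h] at hf
  have hint : ∀ (k : ℤ × ℤ), HasSum (fun l => fcFn (fcFn φ.1 l • expC l : C(T2, ℂ)) k)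
      (fcFn f k) := by
    intro k
    let L : C(T2, ℂ) →L[ℂ] ℂ := LinearMap.mkContinuous
      { toFun := fun g => fcFn g k
        map_add' := fun g g' => by
          simp only [fcFn]
          rw [← integral_add]
          · simp [add_mul]
          · exact integrable_of_continuous (g.continuous.mul (continuous_expFn _))
          · exact integrable_of_continuous (g'.continuous.mul (continuous_expFn _))
        map_smul' := fun c g => by
          simp only [fcFn, RingHom.id_apply, smul_eq_mul, ← integral_const_mul]
          simp [mul_assoc] }
      ((volume : Measure T2).real Set.univ) fun g => by
        change ‖∫ x, g x * expFn (-k) x‖ ≤ _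
        calc _ ≤ ∫ _ : T2, ‖g‖ := by
              refine norm_integral_le_of_norm_le (integrable_const _)
                (Eventually.of_forall fun x => ?_)
              rw [norm_mul]
              exact (mul_le_of_le_one_right (norm_nonneg _) (norm_expFn_le _ _)).trans
                (g.norm_coe_le_norm x)
          _ = _ := by simp
    exact L.hasSum hf
  have hk : ∀ k, fcFn f k = fcFn φ.1 k := by
    intro k
    refine (hint k).unique ?_
    have h1 : ∀ l, fcFn (fcFn φ.1 l • expC l : C(T2, ℂ)) k = if k = l then fcFn φ.1 k else 0 := by
      intro l
      have : fcFn (fcFn φ.1 l • expC l : C(T2, ℂ)) k =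
          fcFn φ.1 l * ∫ x, expFn l x * expFn (-k) x := by
        rw [← integral_const_mul]
        simp only [fcFn, ContinuousMap.coe_smul, Pi.smul_apply, smul_eq_mul, expC,
          ContinuousMap.coe_mk, mul_assoc]
      rw [this, integral_expFn]
      split_ifs with h
      · rw [h, mul_one]
      · rw [mul_zero]
    simp only [h1]
    exact hasSum_ite_eq' k _
  have h2 : (fun x => f x - φ.1 x) = 0 := by
    refine eq_zero_of_fcFn (f.continuous.sub (continuous_of_mem φ.2)) fun k => ?_
    have h3 : fcFn (fun x => f x - φ.1 x) k = fcFn f k - fcFn φ.1 k := by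
      simp only [fcFn, sub_mul]
      exact integral_sub (integrable_of_continuous (f.continuous.mul (continuous_expFn _)))
        (integrable_of_continuous ((continuous_of_mem φ.2).mul (continuous_expFn _)))
    rw [h3, hk, sub_self]
  ext x
  exact sub_eq_zero.1 (congrFun h2 x)

/-- The exponential `e_k` as a smooth function. -/
def expT (k : ℤ × ℤ) : testFn := ⟨expFn k, expFn_mem k⟩

lemma dirDeriv_expT (v : ℝ × ℝ) (k : ℤ × ℤ) :
    dirDeriv v (expT k) = (Complex.I * (k.1 * v.1 + k.2 * v.2 : ℝ)) • expT k := by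
  ext x
  change deriv (fun r : ℝ => expFn k (x + proj (r • v))) 0 =
    (Complex.I * (k.1 * v.1 + k.2 * v.2 : ℝ)) * expFn k x
  simp only [expFn_add]
  rw [((hasDerivAt_char k v).const_mul (expFn k x)).deriv, mul_comm]

/-- A distribution with vanishing Fourier coefficients is zero. -/
theorem eq_zero_of_fc (u : distr) (h : ∀ k, fc u k = 0) : u = 0 := by
  obtain ⟨N, C, hC, hu⟩ := u.2
  have hexp : ∀ k, u.1 (expT k) = 0 := fun k => by
    have := h (-k)
    rw [fc] at this
    simpa [expT] using this
  -- partial Fourier sums commute with the derivatives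
  let S : Finset (ℤ × ℤ) → testFn → testFn := fun F φ => ∑ k ∈ F, fcFn φ.1 k • expT k
  have hS1 : ∀ (v : ℝ × ℝ) (F : Finset (ℤ × ℤ)) (φ : testFn),
      dirDeriv v (φ - S F φ) = dirDeriv v φ - S F (dirDeriv v φ) := by
    intro v F φ
    simp only [S, map_sub, map_sum, map_smul, dirDeriv_expT, fcFn_dirDeriv, smul_smul]
    congr 1
    exact Finset.sum_congr rfl fun k _ => by rw [mul_comm]
  have hS2 : ∀ (v : ℝ × ℝ) (F : Finset (ℤ × ℤ)) (j : ℕ) (φ : testFn),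
      (dirDeriv v)^[j] (φ - S F φ) = (dirDeriv v)^[j] φ - S F ((dirDeriv v)^[j] φ) := by
    intro v F j
    induction j with
    | zero => intro φ; rfl
    | succ j ih => intro φ; rw [Function.iterate_succ_apply, hS1, ih]; rfl
  have hlim : ∀ (φ : testFn) (η : ℝ), 0 < η → ∀ᶠ F in atTop, ∀ x, ‖(φ - S F φ).1 x‖ ≤ η := by
    intro φ η hη
    have h1 := hasSum_fcFn φ
    filter_upwards [(Metric.tendsto_nhds.1 h1) η hη] with F hF x
    rw [dist_comm, dist_eq_norm] at hF
    have h2 := (ContinuousMap.norm_coe_le_norm _ x).trans hF.le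
    have h3 : (φ - S F φ).1 x = φ.1 x - ∑ k ∈ F, fcFn φ.1 k * expFn k x := by
      simp [S, expT]
    rw [h3]
    simpa [expC] using h2
  have hφ : ∀ (φ : testFn) (η : ℝ), 0 < η → ‖u.1 φ‖ ≤ C * η := by
    intro φ η hη
    have h1 : ∀ᶠ F in atTop, ∀ i ∈ Finset.range (N + 1), ∀ j ∈ Finset.range (N + 1), ∀ x,
        ‖partialDeriv i j (φ - S F φ : testFn) x‖ ≤ η := by
      refine (Finset.eventually_all _).2 fun i _ => (Finset.eventually_all _).2 fun j _ => ?_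
      filter_upwards [hlim ((dirDeriv (1, 0))^[i] ((dirDeriv (0, 1))^[j] φ)) η hη] with F hF x
      rw [partialDeriv_eq, hS2, hS2]
      exact hF _
    obtain ⟨F, hF⟩ := h1.exists
    have h2 := hu (φ - S F φ) η fun i j hij x =>
      hF i (Finset.mem_range.2 (by omega)) j (Finset.mem_range.2 (by omega)) x
    have h3 : u.1 (S F φ) = 0 := by
      simp [S, hexp]
    rwa [map_sub, h3, sub_zero] at h2
  ext φ
  change u.1 φ = 0
  by_contra hne
  have hpos : 0 < ‖u.1 φ‖ := norm_pos_iff.2 hne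
  have h1 := hφ φ (‖u.1 φ‖ / (2 * C)) (by positivity)
  have h2 : C * (‖u.1 φ‖ / (2 * C)) = ‖u.1 φ‖ / 2 := by field_simp
  linarith

/-- The bilinear pairing `⟨u, v⟩ = ∑_k û(k) v̂(-k)`, which extends the real `L²` inner product and
gives the duality between `H^{-s}` and `H^s`. -/
def pairing (u v : distr) : ℝ := (∑' k : ℤ × ℤ, fc u k * fc v (-k)).re

/-! ### Sobolev spaces -/

lemma summable_add_sq {w : ℤ × ℤ → ℝ} (hw : ∀ k, 0 ≤ w k) {a b : ℤ × ℤ → ℂ}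
    (ha : Summable fun k => w k * ‖a k‖ ^ 2) (hb : Summable fun k => w k * ‖b k‖ ^ 2) :
    Summable fun k => w k * ‖a k + b k‖ ^ 2 := by
  refine Summable.of_nonneg_of_le (fun k => mul_nonneg (hw k) (sq_nonneg _)) (fun k => ?_)
    ((ha.mul_left 2).add (hb.mul_left 2))
  have h1 : ‖a k + b k‖ ^ 2 ≤ 2 * ‖a k‖ ^ 2 + 2 * ‖b k‖ ^ 2 := by
    have := norm_add_le (a k) (b k)
    nlinarith [sq_nonneg (‖a k‖ - ‖b k‖), norm_nonneg (a k + b k)]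
  nlinarith [mul_le_mul_of_nonneg_left h1 (hw k)]

/-- The distributions that belong to the real Sobolev space `H^s`. -/
def sobolevSet (s : ℝ) : Submodule ℝ distr where
  carrier := {u | (Summable fun k => lam k ^ s * ‖fc u k‖ ^ 2) ∧
    ∀ k, fc u (-k) = (starRingEnd ℂ) (fc u k)}
  add_mem' := by
    rintro u v ⟨hu, hu'⟩ ⟨hv, hv'⟩
    refine ⟨?_, fun k => by simp [fc_add, hu' k, hv' k]⟩
    exact summable_add_sq (fun k => (Real.rpow_pos_of_pos (lam_pos k) s).le) hu hv
  zero_mem' := ⟨by simp [fc_zero], fun k => by simp [fc_zero]⟩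
  smul_mem' := by
    rintro c u ⟨hu, hu'⟩
    refine ⟨?_, fun k => by simp [fc_smul, hu' k]⟩
    refine (hu.mul_left (c ^ 2)).congr fun k => ?_
    rw [fc_smul, norm_mul, mul_pow, Complex.norm_real, Real.norm_eq_abs, sq_abs]
    ring

/-- The real Sobolev space `H^s(T2)`. -/
def Sobolev (s : ℝ) : Type := sobolevSet s

instance (s : ℝ) : AddCommGroup (Sobolev s) := inferInstanceAs (AddCommGroup (sobolevSet s))

instance (s : ℝ) : Module ℝ (Sobolev s) := inferInstanceAs (Module ℝ (sobolevSet s))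

/-- The distribution underlying an element of `H^s`. -/
def Sobolev.toDistr {s : ℝ} (u : Sobolev s) : distr := u.1

/-- `û(k)` for `u ∈ H^s`. -/
abbrev Sobolev.coeff {s : ℝ} (u : Sobolev s) (k : ℤ × ℤ) : ℂ := fc u.toDistr k

lemma summable_inner {s : ℝ} (u v : Sobolev s) :
    Summable fun k => lam k ^ s * (u.coeff k * v.coeff (-k)).re := by
  have hu := u.2.1
  have hv := v.2.1
  refine Summable.of_norm_bounded (hu.add hv) fun k => ?_
  have hw : 0 ≤ lam k ^ s := (Real.rpow_pos_of_pos (lam_pos k) s).le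
  have h2 : v.coeff (-k) = (starRingEnd ℂ) (v.coeff k) := v.2.2 k
  have h1 : |(u.coeff k * v.coeff (-k)).re| ≤ ‖u.coeff k‖ ^ 2 + ‖v.coeff k‖ ^ 2 := by
    refine (Complex.abs_re_le_norm _).trans ?_
    rw [norm_mul, h2, RCLike.norm_conj]
    nlinarith [sq_nonneg (‖u.coeff k‖ - ‖v.coeff k‖), sq_nonneg ‖u.coeff k‖,
      sq_nonneg ‖v.coeff k‖]
  rw [norm_mul, Real.norm_of_nonneg hw, Real.norm_eq_abs]
  calc lam k ^ s * |(u.coeff k * v.coeff (-k)).re|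
      ≤ lam k ^ s * (‖u.coeff k‖ ^ 2 + ‖v.coeff k‖ ^ 2) := by gcongr
    _ = _ := mul_add _ _ _

/-- The inner product `(u, v)_{H^s} = ∑_k (1 + |k|²)^s û(k) v̂(-k)`; the terms for `k` and `-k` are
conjugate, so the sum is the sum of the real parts. -/
@[reducible]
def sobolevCore (s : ℝ) : InnerProductSpace.Core ℝ (Sobolev s) where
  inner u v := ∑' k, lam k ^ s * (u.coeff k * v.coeff (-k)).re
  conj_inner_symm u v := by
    simp only [conj_trivial]
    refine tsum_congr fun k => ?_
    have hu : u.coeff (-k) = (starRingEnd ℂ) (u.coeff k) := u.2.2 k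
    have hv : v.coeff (-k) = (starRingEnd ℂ) (v.coeff k) := v.2.2 k
    rw [hu, hv]
    simp only [Complex.mul_re, Complex.conj_re, Complex.conj_im]
    ring
  re_inner_nonneg u := by
    refine tsum_nonneg fun k => mul_nonneg (Real.rpow_pos_of_pos (lam_pos k) s).le ?_
    have hu : u.coeff (-k) = (starRingEnd ℂ) (u.coeff k) := u.2.2 k
    rw [hu, Complex.mul_conj, Complex.ofReal_re]
    exact Complex.normSq_nonneg _
  add_left u v w := by
    rw [← (summable_inner u w).tsum_add (summable_inner v w)]
    refine tsum_congr fun k => ?_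
    have : (u + v).coeff k = u.coeff k + v.coeff k := rfl
    rw [this, add_mul, Complex.add_re, mul_add]
  smul_left u v r := by
    simp only [conj_trivial]
    rw [← tsum_mul_left]
    refine tsum_congr fun k => ?_
    have : (r • u).coeff k = r * u.coeff k := fc_smul r u.toDistr k
    rw [this, mul_assoc, Complex.re_ofReal_mul]
    ring
  definite u h := by
    have hterm : ∀ k, lam k ^ s * (u.coeff k * u.coeff (-k)).re = lam k ^ s * ‖u.coeff k‖ ^ 2 := by
      intro k
      have hu : u.coeff (-k) = (starRingEnd ℂ) (u.coeff k) := u.2.2 k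
      rw [hu, Complex.mul_conj, Complex.ofReal_re, Complex.normSq_eq_norm_sq]
    have hpos : ∀ k, 0 < lam k ^ s := fun k => Real.rpow_pos_of_pos (lam_pos k) s
    have hsum := (summable_inner u u).hasSum
    rw [show ∑' k, lam k ^ s * (u.coeff k * u.coeff (-k)).re = 0 from h,
      hasSum_zero_iff_of_nonneg
        (fun k => by rw [hterm]; exact mul_nonneg (hpos k).le (sq_nonneg _))] at hsum
    refine Subtype.ext (eq_zero_of_fc u.toDistr fun k => ?_)
    have hk : lam k ^ s * (u.coeff k * u.coeff (-k)).re = 0 := congrFun hsum k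
    rw [hterm] at hk
    simpa [(hpos k).ne'] using hk

instance (s : ℝ) : NormedAddCommGroup (Sobolev s) :=
  letI := sobolevCore s
  InnerProductSpace.Core.toNormedAddCommGroup (𝕜 := ℝ)

instance (s : ℝ) : InnerProductSpace ℝ (Sobolev s) :=
  InnerProductSpace.ofCore (sobolevCore s).toCore

instance (s : ℝ) : MeasurableSpace (Sobolev s) := borel _

instance (s : ℝ) : BorelSpace (Sobolev s) := ⟨rfl⟩

/-- The inclusion `H^t ⊆ H^s` for `s ≤ t`. -/
def Sobolev.incl {s t : ℝ} (h : s ≤ t) (u : Sobolev t) : Sobolev s :=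
  ⟨u.1, by
    refine ⟨Summable.of_nonneg_of_le (fun k => ?_) (fun k => ?_) u.2.1, u.2.2⟩
    · exact mul_nonneg (Real.rpow_pos_of_pos (lam_pos k) s).le (sq_nonneg _)
    · exact mul_le_mul_of_nonneg_right (Real.rpow_le_rpow_of_exponent_le (one_le_lam k) h)
        (sq_nonneg _)⟩

/-- The intersection of the spaces `H^{-α}`, `α > 0`. -/
def SobolevMinus : Type := {u : distr // ∀ α : ℝ, 0 < α → u ∈ sobolevSet (-α)}

/-- An element of the intersection, seen in `H^{-α}`. -/
def SobolevMinus.toSobolev (u : SobolevMinus) (α : ℝ) (hα : 0 < α) : Sobolev (-α) :=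
  ⟨u.1, u.2 α hα⟩

/-! ### The space `H = L²(T2; ℝ)` and its embedding into distributions -/

/-- The real Hilbert space `L²(T2)`. -/
abbrev L2 : Type := Lp ℝ 2 (volume : Measure T2)

lemma integrable_mul_testFn (g : L2) (φ : testFn) :
    Integrable (fun x => (g x : ℂ) * φ.1 x) := by
  have hg : Integrable (fun x => (g x : ℂ)) :=
    (Lp.memLp g |>.integrable one_le_two).ofReal
  obtain ⟨K, hK⟩ := isCompact_univ.exists_bound_of_continuousOn
    (continuous_of_mem φ.2).continuousOn
  exact hg.mul_bdd (c := K) (continuous_of_mem φ.2).aestronglyMeasurable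
    (Eventually.of_forall fun x => hK x (Set.mem_univ x))

/-- The distribution `φ ↦ ∫ g φ dx` of a function `g ∈ L²(T2)`. -/
def L2.toDistr (g : L2) : distr :=
  ⟨{ toFun := fun φ => ∫ x, (g x : ℂ) * φ.1 x
     map_add' := fun φ ψ => by
      rw [← integral_add (integrable_mul_testFn g φ) (integrable_mul_testFn g ψ)]
      simp [mul_add]
     map_smul' := fun c φ => by
      simp only [RingHom.id_apply, smul_eq_mul, ← integral_const_mul]
      congr 1; ext x; simp; ring }, by
    refine ⟨0, (∫ x, ‖g x‖) + 1, by positivity, fun φ M hM => ?_⟩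
    have hb : ∀ y, ‖φ.1 y‖ ≤ M := fun y => by
      obtain ⟨x, rfl⟩ := proj_surjective y
      simpa [partialDeriv] using hM 0 0 le_rfl x
    have hM0 : 0 ≤ M := (norm_nonneg _).trans (hb 0)
    have hg : Integrable (fun x => ‖g x‖) := (Lp.memLp g |>.integrable one_le_two).norm
    calc ‖∫ x, (g x : ℂ) * φ.1 x‖ ≤ ∫ x, ‖g x‖ * M := by
          refine norm_integral_le_of_norm_le (hg.mul_const M) (Eventually.of_forall fun x => ?_)
          rw [norm_mul, Complex.norm_real]
          exact mul_le_mul_of_nonneg_left (hb x) (norm_nonneg _)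
      _ = (∫ x, ‖g x‖) * M := integral_mul_const _ _
      _ ≤ ((∫ x, ‖g x‖) + 1) * M := by linarith⟩

lemma fc_toDistr (g : L2) (k : ℤ × ℤ) :
    fc (L2.toDistr g) k = ∫ x, (g x : ℂ) * expFn (-k) x := rfl

/-- `e_k` as an element of `L²(T2; ℂ)`. -/
def expLp (k : ℤ × ℤ) : Lp ℂ 2 (volume : Measure T2) :=
  ContinuousMap.toLp (E := ℂ) 2 (volume : Measure T2) ℂ ⟨expFn k, continuous_expFn k⟩

lemma orthonormal_expLp : Orthonormal ℂ expLp := by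
  rw [orthonormal_iff_ite]
  intro k l
  rw [expLp, expLp, ContinuousMap.inner_toLp]
  simp only [ContinuousMap.coe_mk, conj_expFn]
  exact integral_expFn k l

lemma summable_fc (g : L2) : Summable fun k => ‖fc (L2.toDistr g) k‖ ^ 2 := by
  have hg : MemLp (fun x => (g x : ℂ)) 2 (volume : Measure T2) := (Lp.memLp g).ofReal
  refine (orthonormal_expLp.inner_products_summable (x := hg.toLp _)).congr fun k => ?_
  congr 2
  rw [fc_toDistr, L2.inner_def]
  refine integral_congr_ae ?_
  filter_upwards [hg.coeFn_toLp, ContinuousMap.coeFn_toLp (E := ℂ) (p := 2) (𝕜 := ℂ)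
    (volume : Measure T2) ⟨expFn k, continuous_expFn k⟩] with x hx hk
  rw [hx, expLp, hk, ContinuousMap.coe_mk, RCLike.inner_apply, conj_expFn]

/-- The embedding `L²(T2) ⊆ H^{-α}` for `α ≥ 0`. -/
def L2.toSobolev (g : L2) (α : ℝ) (hα : 0 ≤ α) : Sobolev (-α) :=
  ⟨L2.toDistr g, by
    refine ⟨Summable.of_nonneg_of_le (fun k => ?_) (fun k => ?_) (summable_fc g), fun k => ?_⟩
    · exact mul_nonneg (Real.rpow_pos_of_pos (lam_pos k) _).le (sq_nonneg _)
    · exact mul_le_of_le_one_left (sq_nonneg _)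
        (Real.rpow_le_one_of_one_le_of_nonpos (one_le_lam k) (by linarith))
    · rw [fc_toDistr, fc_toDistr, ← integral_conj]
      congr 1
      ext x
      rw [map_mul, conj_expFn, Complex.conj_ofReal]⟩

/-! ### The free field -/

/-- `μ` is the massive Gaussian free field on `E = H^{-δ}(T2)`, that is, the centred Gaussian
measure `N(0, A^{1+δ})`, where `A = (1 - Δ)⁻¹`. As `A^{1+δ}` multiplies the `k`-th Fourier
coefficient by `λ_k^{-(1+δ)}`, the sum in the last field is `(A^{1+δ} l₁, l₂)_E`. -/
structure IsFreeField (δ : ℝ) (μ : Measure (Sobolev (-δ))) : Prop where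
  isGaussian : IsGaussian μ
  mean : ∀ l : Sobolev (-δ), ∫ z, ⟪l, z⟫_ℝ ∂μ = 0
  covariance : ∀ l₁ l₂ : Sobolev (-δ), ∫ z, ⟪l₁, z⟫_ℝ * ⟪l₂, z⟫_ℝ ∂μ =
    ∑' k, lam k ^ (-δ) * ((lam k ^ (-(1 + δ)) : ℝ) * l₁.coeff k * l₂.coeff (-k)).re

/-! ### Regularized Wick powers -/

/-- The sets used for the frequency cutoff: compact symmetric neighbourhoods of `0` in `ℝ²`. -/
structure IsCutoff (Λ : Set (ℝ × ℝ)) : Prop where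
  isCompact : IsCompact Λ
  symm : -Λ = Λ
  zero_mem : (0 : ℝ × ℝ) ∈ interior Λ

/-- The integer points of `Λ`. -/
def intPts (Λ : Set (ℝ × ℝ)) : Set (ℤ × ℤ) := {k | ((k.1 : ℝ), (k.2 : ℝ)) ∈ Λ}

lemma finite_intPts {Λ : Set (ℝ × ℝ)} (h : IsCompact Λ) : (intPts Λ).Finite := by
  have hc : Topology.IsClosedEmbedding
      (Prod.map (Int.cast : ℤ → ℝ) (Int.cast : ℤ → ℝ)) :=
    Int.isClosedEmbedding_coe_real.prodMap Int.isClosedEmbedding_coe_real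
  exact (hc.isCompact_preimage h).finite_of_discrete

open Classical in
/-- The integer points of `Λ` as a finset (the default value is not used when `Λ` is compact). -/
def intFinset (Λ : Set (ℝ × ℝ)) : Finset (ℤ × ℤ) :=
  if h : (intPts Λ).Finite then h.toFinset else ∅

lemma mem_intFinset {Λ : Set (ℝ × ℝ)} (h : IsCompact Λ) (k : ℤ × ℤ) :
    k ∈ intFinset Λ ↔ ((k.1 : ℝ), (k.2 : ℝ)) ∈ Λ := by
  rw [intFinset, dif_pos (finite_intPts h), Set.Finite.mem_toFinset]
  rfl

/-- `(Π_Λ z)(x) = ∑_{k ∈ Λ} ẑ(k) e_k(x)`, which is real as `Λ` is symmetric. -/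
def cutoffField (Λ : Set (ℝ × ℝ)) {s : ℝ} (z : Sobolev s) (x : T2) : ℝ :=
  (∑ k ∈ intFinset Λ, z.coeff k * expFn k x).re

/-- `ρ_Λ = (2π)⁻¹ (∑_{k ∈ Λ} (1 + |k|²)⁻¹)^{1/2}`, the standard deviation of `(Π_Λ z)(x)` under the
free field, for every `x`. -/
def rho (Λ : Set (ℝ × ℝ)) : ℝ :=
  1 / (2 * Real.pi) * √(∑ k ∈ intFinset Λ, (lam k)⁻¹)

/-- The normalized Hermite polynomial `ℍ_n`, as a function. -/
def hermiteFn (n : ℕ) (ξ : ℝ) : ℝ :=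
  Polynomial.aeval ξ (Polynomial.hermite n) / √(n.factorial : ℝ)

lemma hermiteFn_eq (n : ℕ) (ξ : ℝ) :
    hermiteFn n ξ = (-1) ^ n / √(n.factorial : ℝ) * Real.exp (ξ ^ 2 / 2) *
      iteratedDeriv n (fun y => Real.exp (-(y ^ 2 / 2))) ξ := by
  rw [hermiteFn, Polynomial.hermite_eq_deriv_gaussian', iteratedDeriv_eq_iterate]
  ring

/-- The regularized Wick power `Φ_{n,Λ}(z)_x = √(n!) ρ_Λ^n ℍ_n(ρ_Λ⁻¹ (Π_Λ z)(x))`. -/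
def wickReg (n : ℕ) (Λ : Set (ℝ × ℝ)) {s : ℝ} (z : Sobolev s) (x : T2) : ℝ :=
  √(n.factorial : ℝ) * rho Λ ^ n * hermiteFn n ((rho Λ)⁻¹ * cutoffField Λ z x)

lemma continuous_wickReg (n : ℕ) (Λ : Set (ℝ × ℝ)) {s : ℝ} (z : Sobolev s) :
    Continuous (wickReg n Λ z) := by
  have h1 : Continuous (cutoffField Λ z) := Complex.continuous_re.comp
    (continuous_finsetSum _ fun k _ => continuous_const.mul (continuous_expFn k))
  have h2 : Continuous (hermiteFn n) :=
    (Polynomial.continuous_aeval (Polynomial.hermite n)).div_const _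
  exact continuous_const.mul (h2.comp (continuous_const.mul h1))

lemma memLp_wickReg (n : ℕ) (Λ : Set (ℝ × ℝ)) {s : ℝ} (z : Sobolev s) :
    MemLp (wickReg n Λ z) 2 (volume : Measure T2) := by
  obtain ⟨K, hK⟩ := isCompact_univ.exists_bound_of_continuousOn
    (continuous_wickReg n Λ z).continuousOn
  exact MemLp.of_bound (continuous_wickReg n Λ z).aestronglyMeasurable K
    (Eventually.of_forall fun x => hK x (Set.mem_univ x))

/-- `Φ_{n,Λ}(z)` as an element of `H^{-α}`. -/
def wickRegSobolev (n : ℕ) (Λ : Set (ℝ × ℝ)) (α : ℝ) (hα : 0 ≤ α) {s : ℝ} (z : Sobolev s) :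
    Sobolev (-α) :=
  L2.toSobolev ((memLp_wickReg n Λ z).toLp _) α hα

/-- `(Φ_{n,Λ}(z), g)_H = ∫ Φ_{n,Λ}(z)_x g(x) dx`. -/
def wickRegTest (n : ℕ) (Λ : Set (ℝ × ℝ)) (g : L2) {s : ℝ} (z : Sobolev s) : ℝ :=
  ∫ x, wickReg n Λ z x * g x

/-! ### White noise functions and Wiener chaos -/

/-- `X` is a version of the white noise function `W_f`, `f ∈ H^{-1}`. For `l ∈ H^δ`, the dual of
`E = H^{-δ}`, it is `W_l(z) = ⟨z, l⟩`; in general it is the limit in `L²(μ)` of `W_{l_j}` for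
`l_j ∈ H^δ` tending to `f` in `H^{-1}`. -/
def IsWhiteNoise {δ : ℝ} (hδ : 0 < δ) (μ : Measure (Sobolev (-δ))) (f : Sobolev (-1))
    (X : Sobolev (-δ) → ℝ) : Prop :=
  MemLp X 2 μ ∧ ∃ l : ℕ → Sobolev δ,
    Tendsto (fun j => (l j).incl (by linarith : -1 ≤ δ)) atTop (𝓝 f) ∧
    Tendsto (fun j => eLpNorm (fun z => pairing z.toDistr (l j).toDistr - X z) 2 μ) atTop (𝓝 0)

/-- The Wiener chaos `𝒞_n` of order `n`: the closed linear span in `L²(μ)` of the `ℍ_n(W_f)` with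
`‖f‖_{H^{-1}} = 1` (for `n = 0`, the constants). -/
def wienerChaos {δ : ℝ} (hδ : 0 < δ) (μ : Measure (Sobolev (-δ))) (n : ℕ) :
    Submodule ℝ (Lp ℝ 2 μ) :=
  (Submodule.span ℝ {F : Lp ℝ 2 μ | ∃ (f : Sobolev (-1)) (X : Sobolev (-δ) → ℝ),
    ‖f‖ = 1 ∧ IsWhiteNoise hδ μ f X ∧ F =ᵐ[μ] fun z => hermiteFn n (X z)}).topologicalClosure

end WickTorus

end

open WickTorus

noncomputable section

namespace WickTorus

/-! ### Hermite polynomials with a variance parameter -/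

/-! Fix a finite symmetric set `S` of frequencies containing `0`. In the real coordinates `rc` the
free field is a family of independent centred Gaussians of variances `(lam k)⁻¹`, so the field
truncated to `S` is, at each point, a linear form in finitely many standard Gaussians. Its variance
`rhoSq S` does not depend on the point, and the regularized Wick power is the Hermite polynomial
`H_n(·; rhoSq S)` of the field (`wickReg_eq`).

Convergence in `L²`. For centred jointly Gaussian `X`, `Y` one has `E[H_n(X) H_n(Y)] = n! Cov(X,
Y)ⁿ` (`integral_hermiteVar_mul`), and the fields truncated to `S` and `S'` are correlated only
through `S ∩ S'`. Hence the powers tested against `g` satisfy `E[Φ_S(g) Φ_{S'}(g)] = V(S ∩ S')`,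
where `V = wickVar` is a sum of nonnegative terms over `n`-tuples of frequencies
(`integral_wickInt_mul`). So `V` is increasing in `S`. Once `V` is bounded, the squared distance of
two regularizations that both contain the box of size `M` is at most `2 (sup V - V(box M))`, which
tends to `0`. The dilates of any cutoff eventually contain every box, so all cutoffs give the same
limit.

The bound for `V`. The sum over tuples with prescribed sum is a Fourier coefficient of the `n`-th
power of the Green function of `1 - Δ`. As all terms are nonnegative, the Green function may be
smoothed by the heat flow and the smoothing removed afterwards. Poisson summation bounds the heat
kernel, and integration in time gives `2π log⁺(1/|x|) + C` for the unnormalized Green function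
(`exists_enorm_green_le`). A weighted convexity inequality separates the powers of the logarithm and
of the constant; the logarithm contributes `n!` with the base `(1 + ε)/(4π)`, the constant
contributes `Cⁿ` (`lintegral_greenBound_le`). For values in `H^{-α}` one sums over the trigonometric
basis, which puts the weight `λ^{-α}` on the sum of the tuple. This weight is dominated by a time
integral of the heat flow, hence in space by a multiple of `α |x|^{2α-2}` plus a constant, and the
same estimate applies with `4π` replaced by `4πα`. A larger `α` only makes the weight smaller.

Passage to `L^p`. Tested powers of order `n` are eigenfunctions of the Ornstein–Uhlenbeck semigroup
with eigenvalue `ρⁿ` (`isMehler_hermiteInt`). Nelson's inequality then bounds their `L^p` norm by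
`(p-1)^{n/2}` times their `L²` norm (`eLpNorm_gaussPi_le`). It is proved from the two-point
inequality, which is tensorized and carried to Gaussian vectors by the central limit theorem. For
Sobolev-valued maps the coordinates are recombined by the triangle inequality in `L^{p/2}`
(`eLpNorm_sobolev_le`).

The chaos property holds because the field at a point, divided by its standard deviation, is a white
noise function, and testing against `g` stays in a closed subspace. The duality identity holds
because both sides are `L²` limits of the same regularized quantity. -/

/-- The Hermite polynomial `H_n(·; s)`, monic and orthogonal for the centred Gaussian of
variance `s`. -/
def hermiteVar (s : ℝ) : ℕ → Polynomial ℝ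
  | 0 => 1
  | 1 => Polynomial.X
  | n + 2 => Polynomial.X * hermiteVar s (n + 1) - Polynomial.C (s * (n + 1)) * hermiteVar s n

lemma hermiteVar_eval_add_two (s : ℝ) (n : ℕ) (u : ℝ) :
    (hermiteVar s (n + 2)).eval u =
      u * (hermiteVar s (n + 1)).eval u - s * (n + 1) * (hermiteVar s n).eval u := by
  simp [hermiteVar]

/-- The Appell property, independent of the variance parameter; with Gaussian integration by parts
it replaces every use of generating functions. -/
lemma derivative_hermiteVar (s : ℝ) (n : ℕ) :
    (hermiteVar s (n + 1)).derivative = Polynomial.C ((n : ℝ) + 1) * hermiteVar s n := by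
  induction n using Nat.twoStepInduction with
  | zero => simp [hermiteVar]
  | one => simp [hermiteVar]; ring
  | more n ih1 ih2 =>
    rw [hermiteVar, Polynomial.derivative_sub, Polynomial.derivative_mul,
      Polynomial.derivative_C_mul, ih1, ih2, Polynomial.derivative_X]
    conv_rhs => rw [hermiteVar]
    simp only [map_add, map_mul, Polynomial.C_1, map_natCast, Nat.cast_add, Nat.cast_one]
    conv_lhs => rw [hermiteVar]
    simp only [map_add, map_mul, Polynomial.C_1, map_natCast]
    ring

lemma derivative_hermite (n : ℕ) :
    (Polynomial.hermite (n + 1)).derivative = ((n : Polynomial ℤ) + 1) * Polynomial.hermite n := by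
  induction n with
  | zero => simp
  | succ n ih =>
    rw [Polynomial.hermite_succ (n + 1), Polynomial.derivative_sub, Polynomial.derivative_mul, ih,
      Polynomial.derivative_mul, Polynomial.derivative_X, Polynomial.hermite_succ n]
    simp only [Polynomial.derivative_add, Polynomial.derivative_natCast, Polynomial.derivative_one,
      Nat.cast_add, Nat.cast_one]
    ring

/-- `H_n(u; ρ²) = ρⁿ He_n(u / ρ)`. -/
lemma pow_mul_aeval_hermite {ρ : ℝ} (hρ : ρ ≠ 0) (n : ℕ) (u : ℝ) :
    ρ ^ n * Polynomial.aeval (ρ⁻¹ * u) (Polynomial.hermite n) =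
      (hermiteVar (ρ ^ 2) n).eval u := by
  induction n using Nat.twoStepInduction with
  | zero => simp [hermiteVar]
  | one => simp [hermiteVar]; field_simp
  | more n ih1 ih2 =>
    rw [hermiteVar_eval_add_two, ← ih1, ← ih2, Polynomial.hermite_succ (n + 1), derivative_hermite]
    simp only [map_sub, map_mul, map_add, Polynomial.aeval_X, map_natCast, map_one]
    field_simp
    ring

lemma hermiteVar_eval_mul (a t : ℝ) (n : ℕ) (u : ℝ) :
    (hermiteVar (a ^ 2 * t) n).eval (a * u) = a ^ n * (hermiteVar t n).eval u := by
  induction n using Nat.twoStepInduction with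
  | zero => simp [hermiteVar]
  | one => simp [hermiteVar]
  | more n ih1 ih2 =>
    rw [hermiteVar_eval_add_two, hermiteVar_eval_add_two, ih1, ih2]
    ring

/-! ### Gaussian integration by parts for polynomials -/

lemma integrable_polynomial_gaussianReal (v : NNReal) (p : Polynomial ℝ) :
    Integrable (fun x => p.eval x) (gaussianReal 0 v) := by
  simp only [Polynomial.eval_eq_sum_range]
  refine integrable_finsetSum _ fun i _ => Integrable.const_mul ?_ _
  by_cases hi : i = 0
  · subst hi; simp
  have h := (memLp_id_gaussianReal' (μ := 0) (v := v) (i : ℝ≥0∞) (by simp)).integrable_norm_pow hi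
  refine (integrable_norm_iff (by fun_prop)).1 ?_
  simpa using h

/-- Stein's identity: the density satisfies `φ' = -(x/v) φ`, and one integrates by parts on the
line. For `v = 0` the law is the point mass at `0` and both sides vanish. -/
lemma integral_mul_polynomial_gaussianReal (v : NNReal) (p : Polynomial ℝ) :
    ∫ x, x * p.eval x ∂(gaussianReal 0 v) = v * ∫ x, p.derivative.eval x ∂(gaussianReal 0 v) := by
  by_cases hv : v = 0
  · subst hv; simp
  have hv' : (v : ℝ) ≠ 0 := by exact_mod_cast hv
  have hd : ∀ x : ℝ, HasDerivAt (gaussianPDFReal 0 v) (-(x / v) * gaussianPDFReal 0 v x) x := by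
    intro x
    have h1 : HasDerivAt (fun x : ℝ => -(x - 0) ^ 2 / (2 * v)) (-(x / v)) x := by
      have := (((hasDerivAt_id x).sub_const 0).pow 2).neg.div_const (2 * (v : ℝ))
      refine this.congr_deriv ?_
      simp; field_simp
    refine (h1.exp.const_mul ((√(2 * Real.pi * v))⁻¹)).congr_deriv ?_
    rw [gaussianPDFReal]; ring
  have hint : ∀ q : Polynomial ℝ, Integrable (fun x => q.eval x * gaussianPDFReal 0 v x) := by
    intro q
    have h := integrable_polynomial_gaussianReal v q
    rw [gaussianReal_of_var_ne_zero _ hv, integrable_withDensity_iff_integrable_smul'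
      (measurable_gaussianPDF _ _) (Eventually.of_forall fun _ => gaussianPDF_lt_top)] at h
    refine h.congr (Eventually.of_forall fun x => ?_)
    simp [toReal_gaussianPDF, mul_comm]
  have h := integral_mul_deriv_eq_deriv_mul_of_integrable (u := fun x => p.eval x)
    (v := gaussianPDFReal 0 v) (u' := fun x => p.derivative.eval x)
    (v' := fun x => -(x / v) * gaussianPDFReal 0 v x) (fun x _ => p.hasDerivAt x) (fun x _ => hd x)
    ?_ (hint _) (hint _)
  · rw [integral_gaussianReal_eq_integral_smul hv, integral_gaussianReal_eq_integral_smul hv]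
    simp only [smul_eq_mul]
    have e1 : ∀ x, gaussianPDFReal 0 v x * (x * p.eval x) =
        -v * (p.eval x * (-(x / v) * gaussianPDFReal 0 v x)) := fun x => by field_simp
    simp only [e1, integral_const_mul, h]
    simp only [mul_comm, mul_neg, neg_neg, neg_mul]
  · refine ((hint (Polynomial.X * p)).const_mul (-(v : ℝ)⁻¹)).congr
      (Eventually.of_forall fun x => ?_)
    simp; field_simp

/-- Adding an independent Gaussian of variance `v` to the argument compensates the increase of the
variance parameter by `v`. -/
lemma integral_hermiteVar_add (s : ℝ) (v : NNReal) (n : ℕ) (u : ℝ) :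
    ∫ r, (hermiteVar (s + v) n).eval (u + r) ∂(gaussianReal 0 v) = (hermiteVar s n).eval u := by
  have hI : ∀ p : Polynomial ℝ, Integrable (fun r => p.eval (u + r)) (gaussianReal 0 v) := by
    intro p
    have := integrable_polynomial_gaussianReal v (p.comp (Polynomial.C u + Polynomial.X))
    simpa using this
  have hI' : ∀ p : Polynomial ℝ, Integrable (fun r => r * p.eval (u + r)) (gaussianReal 0 v) := by
    intro p
    have := integrable_polynomial_gaussianReal v
      (Polynomial.X * p.comp (Polynomial.C u + Polynomial.X))
    simpa using this
  induction n using Nat.twoStepInduction with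
  | zero => simp [hermiteVar]
  | one =>
    simp only [hermiteVar, Polynomial.eval_X]
    have hX := integrable_polynomial_gaussianReal v Polynomial.X
    simp only [Polynomial.eval_X] at hX
    rw [integral_add (integrable_const _) hX, integral_id_gaussianReal]
    simp
  | more n ih1 ih2 =>
    -- Integration by parts trades the factor `r` for `v` times a derivative, and the derivative is
    -- `n + 1` times the polynomial of order `n`. This cancels the extra `v` in the three-term
    -- recurrence for variance `s + v`.
    have h1 := integral_mul_polynomial_gaussianReal v
      ((hermiteVar (s + v) (n + 1)).comp (Polynomial.C u + Polynomial.X))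
    simp only [Polynomial.derivative_comp, derivative_hermiteVar, Polynomial.eval_comp,
      Polynomial.eval_add, Polynomial.eval_C, Polynomial.eval_X, Polynomial.eval_mul,
      Polynomial.derivative_add, Polynomial.derivative_C, Polynomial.derivative_X, zero_add,
      one_mul, integral_const_mul, ih1] at h1
    have h2 : ∀ r, (hermiteVar (s + v) (n + 2)).eval (u + r) =
        u * (hermiteVar (s + v) (n + 1)).eval (u + r) +
          r * (hermiteVar (s + v) (n + 1)).eval (u + r) -
          (s + v) * (n + 1) * (hermiteVar (s + v) n).eval (u + r) := fun r => by
      rw [hermiteVar_eval_add_two]; ring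
    simp only [h2]
    rw [integral_sub (((hI _).const_mul _).fun_add (hI' _)) ((hI _).const_mul _),
      integral_add ((hI _).const_mul _) (hI' _), integral_const_mul, integral_const_mul, ih1, ih2,
      h1, hermiteVar_eval_add_two]
    ring

/-- Integration by parts yields the recursion `E[H_{n+1}²] = t (n+1) E[H_n²]`. -/
lemma integral_hermiteVar_sq (t : NNReal) (n : ℕ) :
    ∫ y, (hermiteVar t n).eval y ^ 2 ∂(gaussianReal 0 t) = n.factorial * (t : ℝ) ^ n := by
  have hI : ∀ p : Polynomial ℝ, Integrable (fun r => p.eval r) (gaussianReal 0 t) :=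
    integrable_polynomial_gaussianReal t
  induction n with
  | zero => simp [hermiteVar]
  | succ n ih =>
    have key : ∫ y, (hermiteVar t (n + 1)).eval y ^ 2 ∂(gaussianReal 0 t) =
        t * (n + 1) * ∫ y, (hermiteVar t n).eval y ^ 2 ∂(gaussianReal 0 t) := by
      have h := integral_mul_polynomial_gaussianReal t (hermiteVar t n * hermiteVar t (n + 1))
      cases n with
      | zero => simpa [hermiteVar, sq] using h
      | succ n =>
        -- Only one of the two factors is expanded by the recurrence. The mixed integral of `H_n
        -- H_{n+2}` then occurs twice with opposite signs, so orthogonality is not needed.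
        have h1 : ∀ y, (hermiteVar t (n + 2)).eval y ^ 2 =
            y * (hermiteVar t (n + 1) * hermiteVar t (n + 2)).eval y -
              t * (n + 1) * (hermiteVar t n * hermiteVar t (n + 2)).eval y := fun y => by
          simp only [Polynomial.eval_mul]
          conv_lhs => rw [sq]
          conv_lhs => enter [1]; rw [hermiteVar_eval_add_two]
          ring
        have h2 : ∀ y, (hermiteVar t (n + 1) * hermiteVar t (n + 2)).derivative.eval y =
            (n + 1) * (hermiteVar t n * hermiteVar t (n + 2)).eval y +
              (n + 2) * (hermiteVar t (n + 1)).eval y ^ 2 := fun y => by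
          simp only [Polynomial.derivative_mul, derivative_hermiteVar, Polynomial.eval_mul,
            Polynomial.eval_add, Polynomial.eval_C]
          push_cast
          ring
        have hi1 : Integrable (fun y => (hermiteVar t (n + 1)).eval y ^ 2) (gaussianReal 0 t) := by
          have h3 := hI (hermiteVar t (n + 1) ^ 2)
          simp only [Polynomial.eval_pow] at h3
          exact h3
        have hi2 : Integrable (fun y => y * (hermiteVar t (n + 1) * hermiteVar t (n + 2)).eval y)
            (gaussianReal 0 t) := by
          have h3 := hI (Polynomial.X * (hermiteVar t (n + 1) * hermiteVar t (n + 2)))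
          simp only [Polynomial.eval_mul (p := Polynomial.X), Polynomial.eval_X] at h3
          exact h3
        simp only [h2] at h
        rw [integral_add ((hI _).const_mul _) (hi1.const_mul _), integral_const_mul,
          integral_const_mul] at h
        simp only [h1]
        rw [integral_sub hi2 ((hI _).const_mul _), integral_const_mul, h]
        push_cast
        ring
    rw [key, ih, Nat.factorial_succ]
    push_cast
    ring

/-- Polynomials of a real Gaussian variable are in `L²`. -/
lemma memLp_polynomial_gaussian {Ω : Type*} {mΩ : MeasurableSpace Ω} {P : Measure Ω} {X : Ω → ℝ}
    (hX : HasGaussianLaw X P) (h0 : P[X] = 0) (p : Polynomial ℝ) :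
    MemLp (fun η => p.eval (X η)) 2 P := by
  have h1 := hX.map_eq_gaussianReal
  rw [h0] at h1
  have h2 : MemLp (fun x => p.eval x) 2 (P.map X) := by
    rw [h1, memLp_two_iff_integrable_sq (by fun_prop)]
    have h3 := integrable_polynomial_gaussianReal Var[X; P].toNNReal (p ^ 2)
    simp only [Polynomial.eval_pow] at h3
    exact h3
  exact h2.comp_of_map hX.aemeasurable

/-- `E[H_n(X; Var X) H_n(Y; Var Y)] = n! Cov(X, Y)ⁿ` for centred jointly Gaussian `X`, `Y`. -/
lemma integral_hermiteVar_mul {Ω : Type*} {mΩ : MeasurableSpace Ω} {P : Measure Ω} {X Y : Ω → ℝ}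
    (hXY : HasGaussianLaw (fun η => (X η, Y η)) P) (hX0 : P[X] = 0) (hY0 : P[Y] = 0)
    {s t c : ℝ} (hs : ∫ η, X η ^ 2 ∂P = s) (ht : ∫ η, Y η ^ 2 ∂P = t)
    (hc : ∫ η, X η * Y η ∂P = c) (ht0 : t ≠ 0) (n : ℕ) :
    ∫ η, (hermiteVar s n).eval (X η) * (hermiteVar t n).eval (Y η) ∂P = n.factorial * c ^ n := by
  have := hXY.isProbabilityMeasure
  have hX := hXY.fst
  have hY := hXY.snd
  have hX2 := hX.memLp_two
  have hY2 := hY.memLp_two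
  have htpos : 0 < t := lt_of_le_of_ne (ht ▸ integral_nonneg fun _ => sq_nonneg _) ht0.symm
  -- The regression coefficient of `X` on `Y`: the residual `R = X - aY` is uncorrelated with `Y`,
  -- hence independent of it by joint Gaussianity.
  set a := c / t with ha
  set R : Ω → ℝ := fun η => X η - a * Y η with hR
  have hRY : HasGaussianLaw (fun η => (R η, Y η)) P :=
    hXY.map_fun (((ContinuousLinearMap.fst ℝ ℝ ℝ) - a • (ContinuousLinearMap.snd ℝ ℝ ℝ)).prod
      (ContinuousLinearMap.snd ℝ ℝ ℝ))
  have hRg := hRY.fst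
  have hR2 := hRg.memLp_two
  have hXi := hX2.integrable one_le_two
  have hYi := hY2.integrable one_le_two
  have hR0 : P[R] = 0 := by
    simp only [hR]
    rw [integral_sub hXi (hYi.const_mul _), integral_const_mul, hX0, hY0]
    simp
  have hXYi : Integrable (fun η => X η * Y η) P := hX2.integrable_mul hY2
  have hcov : cov[R, Y; P] = 0 := by
    rw [covariance_eq_sub hR2 hY2, hY0, mul_zero, sub_zero]
    have : ∀ η, (R * Y) η = X η * Y η - a * Y η ^ 2 := fun η => by simp [hR]; ring
    simp only [this]
    rw [integral_sub hXYi (hY2.integrable_sq.const_mul _), integral_const_mul, hc, ht, ha]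
    field_simp
    simp
  have hind : IndepFun R Y P := hRY.indepFun_of_covariance_eq_zero hcov
  have hvarR : ∫ η, R η ^ 2 ∂P = s - a ^ 2 * t := by
    have : ∀ η, R η ^ 2 = X η ^ 2 - 2 * a * (X η * Y η) + a ^ 2 * Y η ^ 2 := fun η => by
      simp [hR]; ring
    simp only [this]
    have hi : Integrable (fun η => X η ^ 2 - 2 * a * (X η * Y η)) P :=
      hX2.integrable_sq.sub (hXYi.const_mul _)
    rw [integral_add hi (hY2.integrable_sq.const_mul _),
      integral_sub hX2.integrable_sq (hXYi.const_mul _), integral_const_mul, integral_const_mul,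
      hs, ht, hc, ha]
    field_simp
    ring
  have lawR : P.map R = gaussianReal 0 (s - a ^ 2 * t).toNNReal := by
    rw [hRg.map_eq_gaussianReal, hR0, variance_eq_sub hR2, hR0]
    congr 2
    simp only [Pi.pow_apply]
    rw [hvarR]; ring
  have lawY : P.map Y = gaussianReal 0 t.toNNReal := by
    rw [hY.map_eq_gaussianReal, hY0, variance_eq_sub hY2, hY0]
    congr 2
    simp only [Pi.pow_apply]
    rw [ht]; ring
  have hnn : 0 ≤ s - a ^ 2 * t := hvarR ▸ integral_nonneg fun _ => sq_nonneg _
  have hlaw := (indepFun_iff_map_prod_eq_prod_map_map hRg.aemeasurable hY.aemeasurable).1 hind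
  rw [lawR, lawY] at hlaw
  have hint : Integrable (fun η => (hermiteVar s n).eval (X η) * (hermiteVar t n).eval (Y η)) P :=
    (memLp_polynomial_gaussian hX hX0 _).integrable_mul (memLp_polynomial_gaussian hY hY0 _)
  set G : ℝ × ℝ → ℝ := fun q => (hermiteVar s n).eval (a * q.2 + q.1) * (hermiteVar t n).eval q.2
    with hG
  have hGm : Continuous G := by simp only [hG]; fun_prop
  have hGc : ∀ η, G (R η, Y η) = (hermiteVar s n).eval (X η) * (hermiteVar t n).eval (Y η) := by
    intro η; simp [hG, hR]
  have hm : AEMeasurable (fun η => (R η, Y η)) P := hRY.aemeasurable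
  have h1 : ∫ η, (hermiteVar s n).eval (X η) * (hermiteVar t n).eval (Y η) ∂P =
      ∫ q, G q ∂((gaussianReal 0 (s - a ^ 2 * t).toNNReal).prod (gaussianReal 0 t.toNNReal)) := by
    rw [← hlaw, integral_map hm hGm.aestronglyMeasurable]
    simp only [hGc]
  have hGi : Integrable G
      ((gaussianReal 0 (s - a ^ 2 * t).toNNReal).prod (gaussianReal 0 t.toNNReal)) := by
    rw [← hlaw, integrable_map_measure hGm.aestronglyMeasurable hm]
    exact hint.congr (Eventually.of_forall fun η => (hGc η).symm)
  rw [h1, integral_prod_symm _ hGi]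
  -- Averaging over `R`, of variance `s - a²t`, lowers the variance parameter from `s` to `a²t`; by
  -- homogeneity `H_n(ay; a²t) = aⁿ H_n(y; t)`.
  have h2 : ∀ y, ∫ r, G (r, y) ∂(gaussianReal 0 (s - a ^ 2 * t).toNNReal) =
      a ^ n * (hermiteVar t n).eval y ^ 2 := by
    intro y
    simp only [hG, integral_mul_const]
    have h3 := integral_hermiteVar_add (a ^ 2 * t) (s - a ^ 2 * t).toNNReal n (a * y)
    rw [Real.coe_toNNReal _ hnn, add_sub_cancel, hermiteVar_eval_mul] at h3
    rw [h3]; ring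
  simp only [h2, integral_const_mul]
  have h4 := integral_hermiteVar_sq t.toNNReal n
  rw [Real.coe_toNNReal _ htpos.le] at h4
  rw [h4, ha, div_pow]
  field_simp

section

/-! ### The two-point inequality -/

/-- The two sides agree at `0`, and the derivative of the difference is `s((1+x)^{s-1} + (1-x)^{s-1}
- 2)`. It is nonnegative by the arithmetic-geometric inequality, as the product of the two powers is
at least `1`. -/
lemma two_mul_le_one_add_rpow_sub {s x : ℝ} (hs0 : 0 < s) (hs1 : s ≤ 1) (hx0 : 0 ≤ x)
    (hx1 : x ≤ 1) : 2 * s * x ≤ (1 + x) ^ s - (1 - x) ^ s := by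
  have hmono : MonotoneOn (fun x : ℝ => (1 + x) ^ s - (1 - x) ^ s - 2 * s * x) (Set.Icc 0 1) := by
    refine monotoneOn_of_hasDerivWithinAt_nonneg (convex_Icc 0 1)
      (f' := fun x => s * (1 + x) ^ (s - 1) + s * (1 - x) ^ (s - 1) - 2 * s) ?_ ?_ ?_
    · refine ContinuousOn.sub (ContinuousOn.sub ?_ ?_) (by fun_prop)
      · exact ContinuousOn.rpow_const (by fun_prop) fun x _ => Or.inr hs0.le
      · exact ContinuousOn.rpow_const (by fun_prop) fun x _ => Or.inr hs0.le
    · intro x hx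
      rw [interior_Icc] at hx
      have h1 : HasDerivAt (fun x : ℝ => (1 + x) ^ s) (s * (1 + x) ^ (s - 1)) x := by
        have := ((hasDerivAt_id x).const_add 1).rpow_const (p := s)
          (Or.inl (by simp only [id]; linarith [hx.1]))
        refine this.congr_deriv ?_
        simp
      have h2 : HasDerivAt (fun x : ℝ => (1 - x) ^ s) (-(s * (1 - x) ^ (s - 1))) x := by
        have := ((hasDerivAt_id x).const_sub 1).rpow_const (p := s)
          (Or.inl (by simp only [id]; linarith [hx.2]))
        refine this.congr_deriv ?_
        simp
      refine (((h1.sub h2).sub ((hasDerivAt_id x).const_mul (2 * s))).congr_deriv ?_).hasDerivWithinAt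
      ring
    · intro x hx
      rw [interior_Icc] at hx
      have p1 : 0 < 1 + x := by linarith [hx.1]
      have p2 : 0 < 1 - x := by linarith [hx.2]
      have h3 : 1 ≤ (1 + x) ^ (s - 1) * (1 - x) ^ (s - 1) := by
        rw [← Real.mul_rpow p1.le p2.le]
        refine Real.one_le_rpow_of_pos_of_le_one_of_nonpos (by positivity) ?_ (by linarith)
        nlinarith [sq_nonneg x]
      have q1 : 0 < (1 + x) ^ (s - 1) := Real.rpow_pos_of_pos p1 _
      have q2 : 0 < (1 - x) ^ (s - 1) := Real.rpow_pos_of_pos p2 _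
      have h4 : 2 ≤ (1 + x) ^ (s - 1) + (1 - x) ^ (s - 1) := by
        nlinarith [sq_nonneg ((1 + x) ^ (s - 1) - (1 - x) ^ (s - 1))]
      nlinarith
  have h := hmono ⟨le_rfl, zero_le_one⟩ ⟨hx0, hx1⟩ hx0
  simp at h
  linarith

/-- The derivative of the difference of the two sides is `q` times the difference in
`two_mul_le_one_add_rpow_sub` with `s = q - 1`. -/
lemma one_add_sq_le_rpow {q x : ℝ} (hq1 : 1 < q) (hq2 : q ≤ 2) (hx0 : 0 ≤ x) (hx1 : x ≤ 1) :
    2 + q * (q - 1) * x ^ 2 ≤ (1 + x) ^ q + (1 - x) ^ q := by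
  have hmono : MonotoneOn (fun x : ℝ => (1 + x) ^ q + (1 - x) ^ q - q * (q - 1) * x ^ 2)
      (Set.Icc 0 1) := by
    refine monotoneOn_of_hasDerivWithinAt_nonneg (convex_Icc 0 1)
      (f' := fun x => q * (1 + x) ^ (q - 1) - q * (1 - x) ^ (q - 1) - q * (q - 1) * (2 * x)) ?_ ?_ ?_
    · refine ContinuousOn.sub (ContinuousOn.add ?_ ?_) (by fun_prop)
      · exact ContinuousOn.rpow_const (by fun_prop) fun x _ => Or.inr (by linarith)
      · exact ContinuousOn.rpow_const (by fun_prop) fun x _ => Or.inr (by linarith)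
    · intro x hx
      rw [interior_Icc] at hx
      have h1 : HasDerivAt (fun x : ℝ => (1 + x) ^ q) (q * (1 + x) ^ (q - 1)) x := by
        have := ((hasDerivAt_id x).const_add 1).rpow_const (p := q) (Or.inr hq1.le)
        refine this.congr_deriv ?_
        simp
      have h2 : HasDerivAt (fun x : ℝ => (1 - x) ^ q) (-(q * (1 - x) ^ (q - 1))) x := by
        have := ((hasDerivAt_id x).const_sub 1).rpow_const (p := q) (Or.inr hq1.le)
        refine this.congr_deriv ?_
        simp
      refine (((h1.add h2).sub
        ((hasDerivAt_pow 2 x).const_mul (q * (q - 1)))).congr_deriv ?_).hasDerivWithinAt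
      simp
      ring
    · intro x hx
      rw [interior_Icc] at hx
      have := two_mul_le_one_add_rpow_sub (s := q - 1) (by linarith) (by linarith) hx.1.le hx.2.le
      nlinarith
  have h := hmono ⟨le_rfl, zero_le_one⟩ ⟨hx0, hx1⟩ hx0
  simp at h
  linarith

/-- The two-point inequality `‖T f‖_2 ≤ ‖f‖_q`, for the function with values `a`, `b` and the noise
operator `T` that multiplies its odd part by `√(q-1)`. By symmetry and scaling `a = m(1+x)` and `b =
m(1-x)` with `0 ≤ x ≤ 1`. Bernoulli's inequality with exponent `q/2 ≤ 1` then reduces the claim to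
`one_add_sq_le_rpow`. -/
lemma sq_add_le_rpow {q a b : ℝ} (hq1 : 1 < q) (hq2 : q ≤ 2) (ha : 0 ≤ a) (hb : 0 ≤ b) :
    (((a + b) / 2) ^ 2 + (q - 1) * ((a - b) / 2) ^ 2) ^ (1 / 2 : ℝ) ≤
      ((a ^ q + b ^ q) / 2) ^ (1 / q) := by
  wlog hab : b ≤ a generalizing a b
  · have := this hb ha (le_of_not_ge hab)
    rw [add_comm b a, add_comm (b ^ q)] at this
    convert this using 3
    ring
  rcases ha.eq_or_lt with ha0 | ha0
  · have hb0 : b = 0 := by linarith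
    subst hb0
    rw [← ha0]
    simp [Real.zero_rpow (by linarith : q ≠ 0), Real.rpow_nonneg]
  set m := (a + b) / 2 with hm
  have hmpos : 0 < m := by positivity
  set x := (a - b) / 2 / m with hx
  have hxm : (a - b) / 2 = m * x := by rw [hx]; field_simp
  have hx0 : 0 ≤ x := by apply div_nonneg _ hmpos.le; linarith
  have hx1 : x ≤ 1 := by rw [hx, div_le_one hmpos]; linarith
  have ea : a = m * (1 + x) := by rw [mul_add, ← hxm, hm]; ring
  have eb : b = m * (1 - x) := by rw [mul_sub, ← hxm, hm]; ring
  have hbase : 0 ≤ 1 + (q - 1) * x ^ 2 := by nlinarith [sq_nonneg x]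
  have h1 : (1 + (q - 1) * x ^ 2) ^ (q / 2) ≤ ((1 + x) ^ q + (1 - x) ^ q) / 2 := by
    have h2 := one_add_sq_le_rpow hq1 hq2 hx0 hx1
    have h3 := rpow_one_add_le_one_add_mul_self (s := (q - 1) * x ^ 2)
      (by nlinarith [sq_nonneg x]) (p := q / 2) (by linarith) (by linarith)
    linarith
  have h4 : (1 + (q - 1) * x ^ 2) ^ (1 / 2 : ℝ) ≤ (((1 + x) ^ q + (1 - x) ^ q) / 2) ^ (1 / q) := by
    have h5 := Real.rpow_le_rpow (z := 1 / q) (by positivity) h1 (by positivity)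
    rw [← Real.rpow_mul hbase] at h5
    convert h5 using 2
    field_simp
  have e1 : m ^ 2 + (q - 1) * ((a - b) / 2) ^ 2 = m ^ (2 : ℝ) * (1 + (q - 1) * x ^ 2) := by
    rw [hxm, Real.rpow_two]; ring
  have e2 : (a ^ q + b ^ q) / 2 = m ^ q * (((1 + x) ^ q + (1 - x) ^ q) / 2) := by
    rw [ea, eb, Real.mul_rpow hmpos.le (by linarith), Real.mul_rpow hmpos.le (by linarith)]; ring
  rw [e1, e2, Real.mul_rpow (by positivity) hbase, Real.mul_rpow (by positivity)
    (by have := Real.rpow_nonneg (by linarith : 0 ≤ 1 + x) q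
        have := Real.rpow_nonneg (by linarith : 0 ≤ 1 - x) q
        linarith), ← Real.rpow_mul hmpos.le,
    ← Real.rpow_mul hmpos.le]
  rw [mul_one_div_cancel (by norm_num), mul_one_div_cancel (by linarith), Real.rpow_one]
  exact mul_le_mul_of_nonneg_left h4 hmpos.le

/-- The two-point hypercontractive inequality in bilinear form. -/
lemma two_point_real {q ρ a b c d : ℝ} (hq1 : 1 < q) (hq2 : q ≤ 2) (hρ : ρ ^ 2 = q - 1)
    (ha : 0 ≤ a) (hb : 0 ≤ b) (hc : 0 ≤ c) (hd : 0 ≤ d) :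
    (1 + ρ) / 4 * (a * c + b * d) + (1 - ρ) / 4 * (a * d + b * c) ≤
      ((a ^ q + b ^ q) / 2) ^ (1 / q) * ((c ^ (2 : ℝ) + d ^ (2 : ℝ)) / 2) ^ (1 / 2 : ℝ) := by
  have h1 := sq_add_le_rpow hq1 hq2 ha hb
  refine le_trans ?_ (mul_le_mul_of_nonneg_right h1 (by positivity))
  rw [← hρ, Real.rpow_two, Real.rpow_two, ← Real.mul_rpow (by positivity) (by positivity),
    ← Real.sqrt_eq_rpow]
  refine Real.le_sqrt_of_sq_le ?_
  -- The left side equals `m m' + ρ h h'`, with `m`, `m'` the means and `h`, `h'` the half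
  -- differences of the pairs. This is Cauchy–Schwarz for `(m, ρh)` and `(m', h')`, and the square
  -- is the defect in Lagrange's identity.
  nlinarith [sq_nonneg ((a + b) / 2 * ((c - d) / 2) - ρ * ((a - b) / 2) * ((c + d) / 2))]

lemma two_point_ennreal {q ρ : ℝ} (hq1 : 1 < q) (hq2 : q ≤ 2) (hρ : ρ ^ 2 = q - 1)
    (hρ0 : 0 ≤ ρ) (hρ1 : ρ ≤ 1) (a b c d : ℝ≥0∞) :
    ENNReal.ofReal ((1 + ρ) / 4) * (a * c + b * d) +
      ENNReal.ofReal ((1 - ρ) / 4) * (a * d + b * c) ≤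
      ((a ^ q + b ^ q) / 2) ^ (1 / q) * ((c ^ (2 : ℝ) + d ^ (2 : ℝ)) / 2) ^ (1 / 2 : ℝ) := by
  have hq0 : 0 < q := by linarith
  -- Functions that vanish identically come first: afterwards both factors on the right are nonzero,
  -- so an infinite value makes the right side infinite instead of `0 · ∞ = 0`.
  by_cases hcd : c = 0 ∧ d = 0
  · simp [hcd.1, hcd.2]
  by_cases hab : a = 0 ∧ b = 0
  · simp [hab.1, hab.2]
  have h1 : ((a ^ q + b ^ q) / 2) ^ (1 / q) ≠ 0 := by
    intro h
    rw [ENNReal.rpow_eq_zero_iff_of_pos (by positivity), ENNReal.div_eq_zero_iff] at h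
    simp [hq0, ENNReal.rpow_eq_zero_iff, hq0.not_gt] at h
    exact hab h
  have h2 : ((c ^ (2 : ℝ) + d ^ (2 : ℝ)) / 2) ^ (1 / 2 : ℝ) ≠ 0 := by
    intro h
    rw [ENNReal.rpow_eq_zero_iff_of_pos (by positivity), ENNReal.div_eq_zero_iff] at h
    simp at h
    exact hcd h
  by_cases ha : a = ⊤
  · subst ha
    rw [show (((⊤ : ℝ≥0∞) ^ q + b ^ q) / 2) ^ (1 / q) = ⊤ by
      simp [ENNReal.top_rpow_of_pos hq0, ENNReal.top_div, hq0], ENNReal.top_mul h2]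
    exact le_top
  by_cases hb : b = ⊤
  · subst hb
    rw [show ((a ^ q + (⊤ : ℝ≥0∞) ^ q) / 2) ^ (1 / q) = ⊤ by
      simp [ENNReal.top_rpow_of_pos hq0, ENNReal.top_div, hq0], ENNReal.top_mul h2]
    exact le_top
  by_cases hc : c = ⊤
  · subst hc
    rw [show (((⊤ : ℝ≥0∞) ^ (2 : ℝ) + d ^ (2 : ℝ)) / 2) ^ (1 / 2 : ℝ) = ⊤ by simp [ENNReal.top_div], ENNReal.mul_top h1]
    exact le_top
  by_cases hd : d = ⊤
  · subst hd
    rw [show ((c ^ (2 : ℝ) + (⊤ : ℝ≥0∞) ^ (2 : ℝ)) / 2) ^ (1 / 2 : ℝ) = ⊤ by simp [ENNReal.top_div], ENNReal.mul_top h1]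
    exact le_top
  lift a to NNReal using ha
  lift b to NNReal using hb
  lift c to NNReal using hc
  lift d to NNReal using hd
  have h := two_point_real hq1 hq2 hρ a.2 b.2 c.2 d.2
  have h' := ENNReal.ofReal_le_ofReal h
  have p1 : 0 ≤ (1 + ρ) / 4 := by linarith
  have p2 : 0 ≤ (1 - ρ) / 4 := by linarith
  have e : ∀ x : NNReal, ENNReal.ofReal (x : ℝ) = x := fun x => ENNReal.ofReal_coe_nnreal
  change ENNReal.ofReal ((1 + ρ) / 4 * ((a : ℝ) * c + b * d) + (1 - ρ) / 4 * ((a : ℝ) * d + b * c)) ≤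
    ENNReal.ofReal ((((a : ℝ) ^ q + (b : ℝ) ^ q) / 2) ^ (1 / q) *
      (((c : ℝ) ^ (2 : ℝ) + (d : ℝ) ^ (2 : ℝ)) / 2) ^ (1 / 2 : ℝ)) at h'
  rw [ENNReal.ofReal_add (by positivity) (by positivity), ENNReal.ofReal_mul p1,
    ENNReal.ofReal_mul p2, ENNReal.ofReal_add (by positivity) (by positivity),
    ENNReal.ofReal_add (by positivity) (by positivity), ENNReal.ofReal_mul (by positivity),
    ENNReal.ofReal_mul (by positivity), ENNReal.ofReal_mul (by positivity),
    ENNReal.ofReal_mul (by positivity), ENNReal.ofReal_mul (by positivity), e, e, e, e,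
    ← ENNReal.ofReal_rpow_of_nonneg (by positivity) (by positivity),
    ← ENNReal.ofReal_rpow_of_nonneg (by positivity) (by positivity),
    ENNReal.ofReal_div_of_pos two_pos, ENNReal.ofReal_div_of_pos two_pos,
    ENNReal.ofReal_add (by positivity) (by positivity),
    ENNReal.ofReal_add (by positivity) (by positivity),
    ← ENNReal.ofReal_rpow_of_nonneg (by positivity) (by positivity),
    ← ENNReal.ofReal_rpow_of_nonneg (by positivity) (by positivity),
    ← ENNReal.ofReal_rpow_of_nonneg (by positivity) (by positivity),
    ← ENNReal.ofReal_rpow_of_nonneg (by positivity) (by positivity), e, e, e, e,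
    ENNReal.ofReal_ofNat] at h'
  exact h'

/-! ### Hypercontractive couplings -/

/-- The pair of random variables `x`, `y` satisfies the hypercontractive inequality
`E[f(x) g(y)] ≤ ‖f(x)‖_q ‖g(y)‖_2`. -/
def HyperPair (q : ℝ) {Ω X Y : Type*} [MeasurableSpace Ω] [MeasurableSpace X] [MeasurableSpace Y]
    (μ : Measure Ω) (x : Ω → X) (y : Ω → Y) : Prop :=
  ∀ (f : X → ℝ≥0∞) (g : Y → ℝ≥0∞), Measurable f → Measurable g →
    ∫⁻ a, f (x a) * g (y a) ∂μ ≤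
      (∫⁻ a, f (x a) ^ q ∂μ) ^ (1 / q) * (∫⁻ a, g (y a) ^ (2 : ℝ) ∂μ) ^ (1 / 2 : ℝ)

section HyperPair

variable {q : ℝ} {Ω Ω' X Y X' Y' : Type*} [MeasurableSpace Ω] [MeasurableSpace Ω']
  [MeasurableSpace X] [MeasurableSpace Y] [MeasurableSpace X'] [MeasurableSpace Y']
  {μ : Measure Ω} {ν : Measure Ω'} {x : Ω → X} {y : Ω → Y} {x' : Ω' → X'} {y' : Ω' → Y'}

lemma HyperPair.comp (h : HyperPair q μ x y) {φ : X → X'} {ψ : Y → Y'} (hφ : Measurable φ)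
    (hψ : Measurable ψ) : HyperPair q μ (fun a => φ (x a)) (fun a => ψ (y a)) :=
  fun f g hf hg => h (fun a => f (φ a)) (fun a => g (ψ a)) (hf.comp hφ) (hg.comp hψ)

lemma HyperPair.of_measurePreserving (h : HyperPair q μ x y) (hx : Measurable x)
    (hy : Measurable y) {e : Ω' → Ω} (he : MeasurePreserving e ν μ) :
    HyperPair q ν (fun a => x (e a)) (fun a => y (e a)) := by
  intro f g hf hg
  rw [he.lintegral_comp (f := fun a => f (x a) * g (y a)) (by fun_prop),
    he.lintegral_comp (f := fun a => f (x a) ^ q) (by fun_prop),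
    he.lintegral_comp (f := fun a => g (y a) ^ (2 : ℝ)) (by fun_prop)]
  exact h f g hf hg

/-- Tensorization: the inequality for the second pair is applied with the first variables frozen,
and the inequality for the first pair is applied to the partial norms `F` and `G`, whose norms are
the full norms of `f` and `g`. -/
lemma HyperPair.prod [SFinite μ] [SFinite ν] (hq : 0 < q) (h : HyperPair q μ x y)
    (h' : HyperPair q ν x' y') (hx : Measurable x) (hy : Measurable y) (hx' : Measurable x')
    (hy' : Measurable y') :
    HyperPair q (μ.prod ν) (fun a => (x a.1, x' a.2)) (fun a => (y a.1, y' a.2)) := by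
  intro f g hf hg
  rw [lintegral_prod _ (by fun_prop), lintegral_prod _ (by fun_prop),
    lintegral_prod _ (by fun_prop)]
  set F : X → ℝ≥0∞ := fun u => (∫⁻ b, f (u, x' b) ^ q ∂ν) ^ (1 / q)
  set G : Y → ℝ≥0∞ := fun u => (∫⁻ b, g (u, y' b) ^ (2 : ℝ) ∂ν) ^ (1 / 2 : ℝ)
  have hF : Measurable F := by
    refine Measurable.pow_const (Measurable.lintegral_prod_right ?_) _
    fun_prop
  have hG : Measurable G := by
    refine Measurable.pow_const (Measurable.lintegral_prod_right ?_) _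
    fun_prop
  calc ∫⁻ a, ∫⁻ b, f (x a, x' b) * g (y a, y' b) ∂ν ∂μ
      ≤ ∫⁻ a, F (x a) * G (y a) ∂μ := by
        refine lintegral_mono fun a => ?_
        exact h' (fun b => f (x a, b)) (fun b => g (y a, b)) (by fun_prop) (by fun_prop)
    _ ≤ _ := h F G hF hG
    _ = _ := by
        congr 2
        · refine lintegral_congr fun a => ?_
          rw [← ENNReal.rpow_mul, one_div_mul_cancel hq.ne', ENNReal.rpow_one]
        · refine lintegral_congr fun a => ?_
          rw [← ENNReal.rpow_mul, one_div_mul_cancel two_ne_zero, ENNReal.rpow_one]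

lemma HyperPair.pi [SigmaFinite μ] (hq : 0 < q) (h : HyperPair q μ x y) (hx : Measurable x)
    (hy : Measurable y) (m : ℕ) :
    HyperPair q (Measure.pi fun _ : Fin m => μ) (fun a i => x (a i)) (fun a i => y (a i)) := by
  induction m with
  | zero =>
    intro f g hf hg
    rw [Measure.pi_of_empty]
    rw [lintegral_dirac' _ (by fun_prop), lintegral_dirac' _ (by fun_prop),
      lintegral_dirac' _ (by fun_prop), ← ENNReal.rpow_mul, ← ENNReal.rpow_mul,
      mul_one_div_cancel hq.ne', mul_one_div_cancel two_ne_zero, ENNReal.rpow_one, ENNReal.rpow_one]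
  | succ m ih =>
    have h1 := (HyperPair.prod hq h ih hx hy (by fun_prop)
      (by fun_prop)).of_measurePreserving
      (by fun_prop) (by fun_prop) (measurePreserving_piFinSuccAbove (fun _ : Fin (m + 1) => μ) 0)
    have h2 := h1.comp (φ := (MeasurableEquiv.piFinSuccAbove (fun _ : Fin (m + 1) => X) 0).symm)
      (ψ := (MeasurableEquiv.piFinSuccAbove (fun _ : Fin (m + 1) => Y) 0).symm)
      (MeasurableEquiv.measurable _) (MeasurableEquiv.measurable _)
    convert h2 using 1
    · ext a i
      refine Fin.cases ?_ (fun j => ?_) i <;> simp [MeasurableEquiv.piFinSuccAbove, Fin.tail]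
    · ext a i
      refine Fin.cases ?_ (fun j => ?_) i <;> simp [MeasurableEquiv.piFinSuccAbove, Fin.tail]

end HyperPair

end

/-! ### Correlated signs and the central limit theorem -/

/-- The law of a pair of signs with correlation `ρ`. -/
def signPair (ρ : ℝ) : Measure (ℝ × ℝ) :=
  ENNReal.ofReal ((1 + ρ) / 4) • (Measure.dirac (1, 1) + Measure.dirac (-1, -1)) +
    ENNReal.ofReal ((1 - ρ) / 4) • (Measure.dirac (1, -1) + Measure.dirac (-1, 1))

lemma lintegral_signPair (ρ : ℝ) {f : ℝ × ℝ → ℝ≥0∞} (hf : Measurable f) :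
    ∫⁻ p, f p ∂(signPair ρ) = ENNReal.ofReal ((1 + ρ) / 4) * (f (1, 1) + f (-1, -1)) +
      ENNReal.ofReal ((1 - ρ) / 4) * (f (1, -1) + f (-1, 1)) := by
  simp [signPair, lintegral_add_measure, lintegral_dirac' _ hf, mul_add]

lemma isProbabilityMeasure_signPair {ρ : ℝ} (hρ0 : 0 ≤ ρ) (hρ1 : ρ ≤ 1) :
    IsProbabilityMeasure (signPair ρ) := by
  constructor
  have h := lintegral_signPair ρ (f := fun _ => 1) measurable_const
  rw [lintegral_one] at h
  rw [h, ← two_mul, mul_one, ← add_mul, ← ENNReal.ofReal_add (by linarith) (by linarith),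
    ← ENNReal.ofReal_ofNat, ← ENNReal.ofReal_mul (by linarith), ← ENNReal.ofReal_one]
  congr 1
  ring

lemma integral_signPair {ρ : ℝ} (hρ0 : 0 ≤ ρ) (hρ1 : ρ ≤ 1) {f : ℝ × ℝ → ℂ} (hf : Continuous f) :
    ∫ p, f p ∂(signPair ρ) = ((1 + ρ) / 4 : ℝ) * (f (1, 1) + f (-1, -1)) +
      ((1 - ρ) / 4 : ℝ) * (f (1, -1) + f (-1, 1)) := by
  have hm := hf.stronglyMeasurable
  have hi : ∀ a : ℝ × ℝ, Integrable f (Measure.dirac a) := fun a =>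
    integrable_dirac' hm (by simp)
  rw [signPair, integral_add_measure, integral_smul_measure, integral_smul_measure,
    integral_add_measure (hi _) (hi _), integral_add_measure (hi _) (hi _),
    integral_dirac' _ _ hm, integral_dirac' _ _ hm, integral_dirac' _ _ hm, integral_dirac' _ _ hm,
    ENNReal.toReal_ofReal (by linarith), ENNReal.toReal_ofReal (by linarith)]
  · simp [mul_add]
  · exact ((hi _).add_measure (hi _)).smul_measure (by simp)
  · exact ((hi _).add_measure (hi _)).smul_measure (by simp)

lemma hyperPair_signPair {q ρ : ℝ} (hq1 : 1 < q) (hq2 : q ≤ 2) (hρ : ρ ^ 2 = q - 1)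
    (hρ0 : 0 ≤ ρ) (hρ1 : ρ ≤ 1) : HyperPair q (signPair ρ) Prod.fst Prod.snd := by
  intro f g hf hg
  rw [lintegral_signPair ρ (by fun_prop), lintegral_signPair ρ (by fun_prop),
    lintegral_signPair ρ (by fun_prop)]
  refine (two_point_ennreal hq1 hq2 hρ hρ0 hρ1 (f 1) (f (-1)) (g 1) (g (-1))).trans (le_of_eq ?_)
  have h : ENNReal.ofReal ((1 + ρ) / 4) + ENNReal.ofReal ((1 - ρ) / 4) = 2⁻¹ := by
    rw [← ENNReal.ofReal_add (by linarith) (by linarith), ← ENNReal.ofReal_ofNat,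
      ← ENNReal.ofReal_inv_of_pos two_pos]
    congr 1
    ring
  congr 2
  · simp only
    rw [← add_mul, h, ENNReal.div_eq_inv_mul]
  · simp only
    rw [add_comm (g (-1) ^ (2 : ℝ)), ← add_mul, h, ENNReal.div_eq_inv_mul]

lemma charFun_signPair {ρ : ℝ} (hρ0 : 0 ≤ ρ) (hρ1 : ρ ≤ 1) (s t : ℝ) :
    ∫ p, Complex.exp (((s * p.1 + t * p.2 : ℝ) : ℂ) * Complex.I) ∂(signPair ρ) =
      (((1 + ρ) / 2 * Real.cos (s + t) + (1 - ρ) / 2 * Real.cos (s - t) : ℝ) : ℂ) := by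
  rw [integral_signPair hρ0 hρ1 (by fun_prop)]
  have h : ∀ r : ℝ, Complex.exp ((r : ℂ) * Complex.I) + Complex.exp (((-r : ℝ) : ℂ) * Complex.I) =
      ((2 * Real.cos r : ℝ) : ℂ) := fun r => by
    push_cast
    rw [Complex.two_cos]
  have h1 := h (s + t)
  have h2 := h (s - t)
  simp only
  rw [show s * 1 + t * 1 = s + t by ring, show s * -1 + t * -1 = -(s + t) by ring,
    show s * 1 + t * -1 = s - t by ring, show s * -1 + t * 1 = -(s - t) by ring, h1, h2]
  push_cast
  ring

/-- From `cos y - 1 = -2 sin²(y/2)` and `√m sin(x/(2√m)) → x/2`. -/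
lemma tendsto_mul_cos_sub_one (x : ℝ) :
    Tendsto (fun m : ℕ => (m : ℝ) * (Real.cos (x / √m) - 1)) atTop (𝓝 (-(x ^ 2 / 2))) := by
  have hs : Tendsto (fun m : ℕ => √(m : ℝ) * Real.sin (x / 2 / √m)) atTop (𝓝 (x / 2)) := by
    by_cases hx : x / 2 = 0
    · simp [hx]
    have h1 := (Real.hasDerivAt_sin 0).tendsto_slope_zero
    have h2 : Tendsto (fun m : ℕ => x / 2 / √(m : ℝ)) atTop (𝓝[≠] 0) := by
      refine tendsto_nhdsWithin_iff.2 ⟨?_, ?_⟩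
      · exact tendsto_const_nhds.div_atTop
          (Real.tendsto_sqrt_atTop.comp tendsto_natCast_atTop_atTop)
      · filter_upwards [eventually_gt_atTop 0] with m hm
        have : (0 : ℝ) < √(m : ℝ) := Real.sqrt_pos.2 (by exact_mod_cast hm)
        exact div_ne_zero hx this.ne'
    have h3 := (h1.comp h2).const_mul (x / 2)
    simp only [Function.comp_def, zero_add, Real.sin_zero, sub_zero, smul_eq_mul, Real.cos_zero,
      mul_one] at h3
    refine h3.congr fun m => ?_
    have hx0 : x ≠ 0 := fun h => hx (by simp [h])
    rw [inv_div]
    field_simp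
  have h4 := (hs.pow 2).const_mul (-2)
  have e : -2 * (x / 2) ^ 2 = -(x ^ 2 / 2) := by ring
  rw [e] at h4
  refine h4.congr fun m => ?_
  have h5 : Real.cos (x / √m) = 1 - 2 * Real.sin (x / 2 / √m) ^ 2 := by
    have := Real.cos_sq' (x / 2 / √m)
    have h6 := Real.cos_two_mul (x / 2 / √m)
    rw [show 2 * (x / 2 / √m) = x / √m by ring] at h6
    linarith
  rw [h5, mul_pow, Real.sq_sqrt (Nat.cast_nonneg m)]
  ring

/-- The central limit theorem on characteristic functions: the base is `1 + c_m/m` with `c_m`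
converging, and the limit is the characteristic function of a standard Gaussian pair with
correlation `ρ`. -/
lemma tendsto_charFun_signPair_pow (ρ s t : ℝ) :
    Tendsto (fun m : ℕ => (((1 + ρ) / 2 * Real.cos (s / √m + t / √m) +
        (1 - ρ) / 2 * Real.cos (s / √m - t / √m) : ℝ) : ℂ) ^ m) atTop
      (𝓝 (Complex.exp ((-((s ^ 2 + t ^ 2 + 2 * ρ * s * t) / 2) : ℝ) : ℂ))) := by
  have h : Tendsto (fun m : ℕ => (m : ℝ) * ((1 + ρ) / 2 * (Real.cos ((s + t) / √m) - 1) +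
      (1 - ρ) / 2 * (Real.cos ((s - t) / √m) - 1))) atTop
      (𝓝 (-((s ^ 2 + t ^ 2 + 2 * ρ * s * t) / 2))) := by
    have h1 := ((tendsto_mul_cos_sub_one (s + t)).const_mul ((1 + ρ) / 2)).add
      ((tendsto_mul_cos_sub_one (s - t)).const_mul ((1 - ρ) / 2))
    convert h1 using 2
    · ring
    · ring
  have h2 := (Complex.continuous_ofReal.tendsto _).comp h
  have h3 := Complex.tendsto_one_add_pow_exp_of_tendsto
    (g := fun m : ℕ => (((1 + ρ) / 2 * (Real.cos ((s + t) / √m) - 1) +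
      (1 - ρ) / 2 * (Real.cos ((s - t) / √m) - 1) : ℝ) : ℂ)) (by
      refine h2.congr fun m => ?_
      simp only [Function.comp_def]
      push_cast
      ring)
  refine h3.congr fun m => ?_
  congr 1
  rw [← add_div, ← sub_div]
  push_cast
  ring

/-- The standard Gaussian measure on `ℝ^d`. -/
abbrev gaussPi (d : ℕ) : Measure (Fin d → ℝ) := Measure.pi fun _ => gaussianReal 0 1

/-- A pair of random vectors as a point of Euclidean space. -/
def pairVec {d : ℕ} (x y : Fin d → ℝ) : EuclideanSpace ℝ (Fin d ⊕ Fin d) :=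
  WithLp.toLp 2 (Sum.elim x y)

lemma continuous_pairVec {d : ℕ} :
    Continuous fun p : (Fin d → ℝ) × (Fin d → ℝ) => pairVec p.1 p.2 := by
  refine (PiLp.continuous_toLp 2 _).comp (continuous_pi fun i => ?_)
  rcases i with i | i <;> simp <;> fun_prop

lemma inner_pairVec {d : ℕ} (x y : Fin d → ℝ) (t : EuclideanSpace ℝ (Fin d ⊕ Fin d)) :
    ⟪pairVec x y, t⟫_ℝ = ∑ i, (t (Sum.inl i) * x i + t (Sum.inr i) * y i) := by
  simp [PiLp.inner_apply, pairVec, Finset.sum_add_distrib]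

lemma exp_sum_mul_I {ι : Type*} [Fintype ι] (f : ι → ℝ) :
    Complex.exp (((∑ i, f i : ℝ) : ℂ) * Complex.I) = ∏ i, Complex.exp ((f i : ℂ) * Complex.I) := by
  rw [← Complex.exp_sum, Complex.ofReal_sum, Finset.sum_mul]

/-- Normalized sums of correlated signs. -/
def signSum (d m : ℕ) (a : Fin d → Fin m → ℝ × ℝ) : EuclideanSpace ℝ (Fin d ⊕ Fin d) :=
  pairVec (fun i => (∑ l, (a i l).1) / √m) (fun i => (∑ l, (a i l).2) / √m)

/-- Correlated Gaussian vectors. -/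
def gaussCouple (d : ℕ) (ρ σ : ℝ) (p : (Fin d → ℝ) × (Fin d → ℝ)) :
    EuclideanSpace ℝ (Fin d ⊕ Fin d) :=
  pairVec p.1 (ρ • p.1 + σ • p.2)

lemma continuous_signSum (d m : ℕ) : Continuous (signSum d m) :=
  continuous_pairVec.comp (f := fun a : Fin d → Fin m → ℝ × ℝ =>
    ((fun i => (∑ l, (a i l).1) / √m : Fin d → ℝ), (fun i => (∑ l, (a i l).2) / √m : Fin d → ℝ)))
    (by fun_prop)

lemma continuous_gaussCouple (d : ℕ) (ρ σ : ℝ) : Continuous (gaussCouple d ρ σ) :=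
  continuous_pairVec.comp (f := fun p : (Fin d → ℝ) × (Fin d → ℝ) => (p.1, ρ • p.1 + σ • p.2))
    (by fun_prop)

lemma charFun_signSum {ρ : ℝ} (hρ0 : 0 ≤ ρ) (hρ1 : ρ ≤ 1) (d m : ℕ)
    (t : EuclideanSpace ℝ (Fin d ⊕ Fin d)) :
    charFun ((Measure.pi fun _ : Fin d => Measure.pi fun _ : Fin m => signPair ρ).map
      (signSum d m)) t =
      ∏ i, (((1 + ρ) / 2 * Real.cos (t (Sum.inl i) / √m + t (Sum.inr i) / √m) +
        (1 - ρ) / 2 * Real.cos (t (Sum.inl i) / √m - t (Sum.inr i) / √m) : ℝ) : ℂ) ^ m := by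
  have := isProbabilityMeasure_signPair hρ0 hρ1
  rw [charFun_apply, integral_map (continuous_signSum d m).measurable.aemeasurable (by fun_prop)]
  have h1 : ∀ a : Fin d → Fin m → ℝ × ℝ,
      Complex.exp (((⟪signSum d m a, t⟫_ℝ : ℝ) : ℂ) * Complex.I) = ∏ i, ∏ l,
        Complex.exp (((t (Sum.inl i) / √m * (a i l).1 + t (Sum.inr i) / √m * (a i l).2 : ℝ) : ℂ) *
          Complex.I) := by
    intro a
    rw [signSum, inner_pairVec, exp_sum_mul_I]
    refine Finset.prod_congr rfl fun i _ => ?_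
    rw [← exp_sum_mul_I]
    congr 3
    rw [Finset.sum_add_distrib, ← Finset.mul_sum, ← Finset.mul_sum]
    ring
  simp only [h1]
  rw [integral_fintype_prod_eq_prod (fun i (a : Fin m → ℝ × ℝ) => ∏ l,
        Complex.exp (((t (Sum.inl i) / √m * (a l).1 + t (Sum.inr i) / √m * (a l).2 : ℝ) : ℂ) *
          Complex.I))]
  refine Finset.prod_congr rfl fun i _ => ?_
  rw [integral_fintype_prod_eq_pow (fun p : ℝ × ℝ =>
        Complex.exp (((t (Sum.inl i) / √m * p.1 + t (Sum.inr i) / √m * p.2 : ℝ) : ℂ) *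
          Complex.I)), charFun_signPair hρ0 hρ1, Fintype.card_fin]

lemma charFun_gaussCouple {ρ σ : ℝ} (hσ : ρ ^ 2 + σ ^ 2 = 1) (d : ℕ)
    (t : EuclideanSpace ℝ (Fin d ⊕ Fin d)) :
    charFun (((gaussPi d).prod (gaussPi d)).map (gaussCouple d ρ σ)) t =
      ∏ i, Complex.exp ((-((t (Sum.inl i) ^ 2 + t (Sum.inr i) ^ 2 +
        2 * ρ * t (Sum.inl i) * t (Sum.inr i)) / 2) : ℝ) : ℂ) := by
  rw [charFun_apply, integral_map (continuous_gaussCouple d ρ σ).measurable.aemeasurable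
    (by fun_prop)]
  have h1 : ∀ p : (Fin d → ℝ) × (Fin d → ℝ),
      Complex.exp (((⟪gaussCouple d ρ σ p, t⟫_ℝ : ℝ) : ℂ) * Complex.I) =
        (∏ i, Complex.exp ((((t (Sum.inl i) + ρ * t (Sum.inr i)) * p.1 i : ℝ) : ℂ) * Complex.I)) *
        ∏ i, Complex.exp (((σ * t (Sum.inr i) * p.2 i : ℝ) : ℂ) * Complex.I) := by
    intro p
    rw [gaussCouple, inner_pairVec, exp_sum_mul_I, ← Finset.prod_mul_distrib]
    refine Finset.prod_congr rfl fun i _ => ?_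
    rw [← Complex.exp_add, ← add_mul, ← Complex.ofReal_add]
    congr 3
    simp
    ring
  simp only [h1]
  rw [integral_prod_mul (fun x : Fin d → ℝ => ∏ i, Complex.exp
      ((((t (Sum.inl i) + ρ * t (Sum.inr i)) * x i : ℝ) : ℂ) * Complex.I))
    (fun x : Fin d → ℝ => ∏ i, Complex.exp (((σ * t (Sum.inr i) * x i : ℝ) : ℂ) * Complex.I)),
    integral_fintype_prod_eq_prod (fun i (x : ℝ) => Complex.exp
      ((((t (Sum.inl i) + ρ * t (Sum.inr i)) * x : ℝ) : ℂ) * Complex.I)),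
    integral_fintype_prod_eq_prod (fun i (x : ℝ) =>
      Complex.exp (((σ * t (Sum.inr i) * x : ℝ) : ℂ) * Complex.I)), ← Finset.prod_mul_distrib]
  refine Finset.prod_congr rfl fun i _ => ?_
  have h2 : ∀ r : ℝ, ∫ x, Complex.exp (((r * x : ℝ) : ℂ) * Complex.I) ∂(gaussianReal 0 1) =
      Complex.exp ((-(r ^ 2 / 2) : ℝ) : ℂ) := by
    intro r
    have h3 := charFun_gaussianReal (μ := 0) (v := 1) r
    rw [charFun_apply_real] at h3
    push_cast at h3 ⊢
    rw [h3]
    congr 1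
    simp
  rw [h2, h2, ← Complex.exp_add, ← Complex.ofReal_add]
  congr 2
  have : σ ^ 2 = 1 - ρ ^ 2 := by linarith
  ring_nf
  rw [this]
  ring

/-! ### Gaussian hypercontractivity -/

/-- The hypercontractive inequality for correlated Gaussian vectors and bounded continuous
functions. -/
lemma lintegral_mul_gaussCouple_le {q ρ σ : ℝ} (hq1 : 1 < q) (hq2 : q ≤ 2) (hρ : ρ ^ 2 = q - 1)
    (hρ0 : 0 ≤ ρ) (hρ1 : ρ ≤ 1) (hσ : ρ ^ 2 + σ ^ 2 = 1) (d : ℕ)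
    {f g : (Fin d → ℝ) → NNReal} (hf : Continuous f) (hg : Continuous g) {K : NNReal}
    (hfK : ∀ x, f x ≤ K) (hgK : ∀ x, g x ≤ K) :
    ∫⁻ p, (f p.1 : ℝ≥0∞) * g (ρ • p.1 + σ • p.2) ∂((gaussPi d).prod (gaussPi d)) ≤
      (∫⁻ p, (f p.1 : ℝ≥0∞) ^ q ∂((gaussPi d).prod (gaussPi d))) ^ (1 / q) *
      (∫⁻ p, (g (ρ • p.1 + σ • p.2) : ℝ≥0∞) ^ (2 : ℝ) ∂((gaussPi d).prod (gaussPi d))) ^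
        (1 / 2 : ℝ) := by
  have := isProbabilityMeasure_signPair hρ0 hρ1
  let S : ∀ m : ℕ, Measure (Fin d → Fin m → ℝ × ℝ) :=
    fun m => Measure.pi fun _ => Measure.pi fun _ => signPair ρ
  let M : ℕ → ProbabilityMeasure (EuclideanSpace ℝ (Fin d ⊕ Fin d)) := fun m =>
    ⟨(S m).map (signSum d m), Measure.isProbabilityMeasure_map
      (continuous_signSum d m).measurable.aemeasurable⟩
  let G : ProbabilityMeasure (EuclideanSpace ℝ (Fin d ⊕ Fin d)) :=
    ⟨((gaussPi d).prod (gaussPi d)).map (gaussCouple d ρ σ), Measure.isProbabilityMeasure_map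
      (continuous_gaussCouple d ρ σ).measurable.aemeasurable⟩
  -- Lévy's continuity theorem: the characteristic functions are finite products over the
  -- coordinates, each factor converging.
  have hlim : Tendsto M atTop (𝓝 G) := by
    refine ProbabilityMeasure.tendsto_of_tendsto_charFun fun t => ?_
    change Tendsto (fun m => charFun ((S m).map (signSum d m)) t) atTop
      (𝓝 (charFun (((gaussPi d).prod (gaussPi d)).map (gaussCouple d ρ σ)) t))
    rw [charFun_gaussCouple hσ]
    simp only [S, charFun_signSum hρ0 hρ1]
    exact tendsto_finsetProd _ fun i _ => tendsto_charFun_signPair_pow ρ _ _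
  rw [ProbabilityMeasure.tendsto_iff_forall_lintegral_tendsto] at hlim
  have key : ∀ (h : EuclideanSpace ℝ (Fin d ⊕ Fin d) → NNReal) (L : NNReal), Continuous h →
      (∀ v, h v ≤ L) → Tendsto (fun m => ∫⁻ a, (h (signSum d m a) : ℝ≥0∞) ∂(S m)) atTop
        (𝓝 (∫⁻ p, (h (gaussCouple d ρ σ p) : ℝ≥0∞) ∂((gaussPi d).prod (gaussPi d)))) := by
    intro h L hh hL
    have h1 := hlim (BoundedContinuousFunction.mkOfBound ⟨h, hh⟩ L fun x y => by
      rw [NNReal.dist_eq, abs_le]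
      have a1 : (h x : ℝ) ≤ L := hL x
      have a2 : (h y : ℝ) ≤ L := hL y
      have a3 : (0 : ℝ) ≤ h x := (h x).2
      have a4 : (0 : ℝ) ≤ h y := (h y).2
      simp only [ContinuousMap.coe_mk]
      constructor <;> linarith)
    have hm : Measurable fun v => (h v : ℝ≥0∞) := hh.measurable.coe_nnreal_ennreal
    have h2 : ∫⁻ v, (h v : ℝ≥0∞) ∂(((gaussPi d).prod (gaussPi d)).map (gaussCouple d ρ σ)) =
        ∫⁻ p, (h (gaussCouple d ρ σ p) : ℝ≥0∞) ∂((gaussPi d).prod (gaussPi d)) :=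
      lintegral_map hm (continuous_gaussCouple d ρ σ).measurable
    have h3 : ∀ m, ∫⁻ v, (h v : ℝ≥0∞) ∂((S m).map (signSum d m)) =
        ∫⁻ a, (h (signSum d m a) : ℝ≥0∞) ∂(S m) := fun m =>
      lintegral_map hm (continuous_signSum d m).measurable
    rw [← h2]
    simp only [← h3]
    exact h1
  let X : EuclideanSpace ℝ (Fin d ⊕ Fin d) → (Fin d → ℝ) := fun v i => v (Sum.inl i)
  let Y : EuclideanSpace ℝ (Fin d ⊕ Fin d) → (Fin d → ℝ) := fun v i => v (Sum.inr i)
  have hX : Continuous X := by simp only [X]; fun_prop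
  have hY : Continuous Y := by simp only [Y]; fun_prop
  have hq0 : 0 ≤ q := by linarith
  have k1 := key (fun v => f (X v) * g (Y v)) (K * K) (by fun_prop)
    fun v => mul_le_mul' (hfK _) (hgK _)
  have k2 := key (fun v => f (X v) ^ q) (K ^ q)
    ((NNReal.continuous_rpow_const hq0).comp (hf.comp hX))
    fun v => NNReal.rpow_le_rpow (hfK _) hq0
  have k3 := key (fun v => g (Y v) ^ (2 : ℝ)) (K ^ (2 : ℝ))
    ((NNReal.continuous_rpow_const two_pos.le).comp (hg.comp hY))
    fun v => NNReal.rpow_le_rpow (hgK _) two_pos.le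
  have hE : ∀ (r : ℝ) (u : NNReal), 0 ≤ r → ((u ^ r : NNReal) : ℝ≥0∞) = (u : ℝ≥0∞) ^ r :=
    fun r u hr => (ENNReal.coe_rpow_of_nonneg u hr)
  simp only [ENNReal.coe_mul, hE q _ hq0, hE 2 _ two_pos.le] at k1 k2 k3
  have hfin : ∫⁻ p, (f (X (gaussCouple d ρ σ p)) : ℝ≥0∞) ^ q ∂((gaussPi d).prod (gaussPi d)) ≠ ⊤ := by
    refine ne_top_of_le_ne_top (b := (K : ℝ≥0∞) ^ q) (by simp [hq0]) ?_
    refine (lintegral_mono (g := fun _ => (K : ℝ≥0∞) ^ q) fun p => ?_).trans (by simp)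
    exact ENNReal.rpow_le_rpow (by exact_mod_cast hfK _) hq0
  have hfin2 : ∫⁻ p, (g (Y (gaussCouple d ρ σ p)) : ℝ≥0∞) ^ (2 : ℝ)
      ∂((gaussPi d).prod (gaussPi d)) ≠ ⊤ := by
    refine ne_top_of_le_ne_top (b := (K : ℝ≥0∞) ^ (2 : ℝ)) (by simp) ?_
    refine (lintegral_mono (g := fun _ => (K : ℝ≥0∞) ^ (2 : ℝ)) fun p => ?_).trans (by simp)
    exact ENNReal.rpow_le_rpow (by exact_mod_cast hgK _) two_pos.le
  -- Both limits are finite because `f` and `g` are bounded, which excludes the indeterminate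
  -- product `0 · ∞`.
  have k4 := ENNReal.Tendsto.mul (k2.ennrpow_const (1 / q)) (Or.inr (ENNReal.rpow_ne_top_of_nonneg
    (by norm_num) hfin2)) (k3.ennrpow_const (1 / 2 : ℝ)) (Or.inr (ENNReal.rpow_ne_top_of_nonneg
    (by positivity) hfin))
  refine le_of_tendsto_of_tendsto' k1 k4 fun m => ?_
  -- Before the limit: tensorize over the `m` signs in a sum, then over the `d` coordinates, and
  -- push forward by the normalized sums, which act on each half of the pair separately.
  have h1 := HyperPair.pi (by linarith) (hyperPair_signPair hq1 hq2 hρ hρ0 hρ1) measurable_fst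
    measurable_snd m
  have h2 := HyperPair.pi (by linarith) h1 (by fun_prop) (by fun_prop) d
  have h3 := h2.comp (φ := fun u i => (∑ l, u i l) / √m) (ψ := fun u i => (∑ l, u i l) / √m)
    (by fun_prop) (by fun_prop)
  exact h3 (fun u => f u) (fun u => g u) hf.measurable.coe_nnreal_ennreal
    hg.measurable.coe_nnreal_ennreal

lemma isGaussian_gaussPi (d : ℕ) : IsGaussian (gaussPi d) := by
  have h1 : iIndepFun (fun (i : Fin d) (x : Fin d → ℝ) => x i) (gaussPi d) :=
    iIndepFun_pi (X := fun _ (x : ℝ) => x) fun i => aemeasurable_id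
  have h2 : ∀ i : Fin d, HasGaussianLaw (fun x : Fin d → ℝ => x i) (gaussPi d) := fun i =>
    ⟨by rw [(measurePreserving_eval _ i).map_eq]; infer_instance⟩
  have h3 := iIndepFun.hasGaussianLaw h2 h1
  have := h3.isGaussian_map
  rwa [show (fun (x : Fin d → ℝ) i => x i) = id from rfl, Measure.map_id] at this

lemma integral_id_gaussPi (d : ℕ) : ∫ x, x ∂(gaussPi d) = 0 := by
  have := isGaussian_gaussPi d
  ext i
  have h1 := (ContinuousLinearMap.proj (R := ℝ) (φ := fun _ : Fin d => ℝ) i).integral_comp_comm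
    (IsGaussian.integrable_id (μ := gaussPi d))
  simp only [ContinuousLinearMap.proj_apply, id_eq] at h1
  have h2 : ∫ x : Fin d → ℝ, x i ∂(gaussPi d) = ∫ y, y ∂(gaussianReal 0 1) := by
    have h3 := measurePreserving_eval (fun _ : Fin d => gaussianReal 0 1) i
    rw [← h3.map_eq, integral_map h3.measurable.aemeasurable (by fun_prop)]
  rw [← h1, h2, integral_id_gaussianReal]
  rfl

/-- The standard Gaussian measure is invariant under rotations. -/
lemma lintegral_rotation_gaussPi {ρ σ : ℝ} (hσ : ρ ^ 2 + σ ^ 2 = 1) (d : ℕ)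
    {h : (Fin d → ℝ) → ℝ≥0∞} (hh : Measurable h) :
    ∫⁻ p, h (ρ • p.1 + σ • p.2) ∂((gaussPi d).prod (gaussPi d)) = ∫⁻ x, h x ∂(gaussPi d) := by
  have := isGaussian_gaussPi d
  obtain ⟨θ, hc, hs⟩ : ∃ θ : ℝ, Real.cos θ = ρ ∧ Real.sin θ = σ := by
    have hn : ‖(⟨ρ, σ⟩ : ℂ)‖ = 1 := by
      rw [Complex.norm_def, Complex.normSq_mk, Real.sqrt_eq_one]; linarith
    refine ⟨Complex.arg ⟨ρ, σ⟩, ?_, ?_⟩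
    · have h1 := Complex.norm_mul_cos_arg ⟨ρ, σ⟩
      rwa [hn, one_mul] at h1
    · have h1 := Complex.norm_mul_sin_arg ⟨ρ, σ⟩
      rwa [hn, one_mul] at h1
  have h1 := IsGaussian.map_rotation_eq_self (μ := gaussPi d) (integral_id_gaussPi d) θ
  have h2 : ∫⁻ p, h p.1 ∂((gaussPi d).prod (gaussPi d)) = ∫⁻ x, h x ∂(gaussPi d) :=
    measurePreserving_fst.lintegral_comp hh
  rw [← h2]
  conv_rhs => rw [← h1]
  rw [lintegral_map (by fun_prop) (by fun_prop), ← hc, ← hs]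
  rfl

lemma tendsto_lintegral_min {X : Type*} [MeasurableSpace X] (μ : Measure X) {f : X → ℝ≥0∞}
    (hf : Measurable f) {a : X → NNReal} (ha : Measurable a) {s : ℝ} (hs : 0 ≤ s) :
    Tendsto (fun L : ℕ => ∫⁻ x, f x * ((min (a x) L : NNReal) : ℝ≥0∞) ^ s ∂μ) atTop
      (𝓝 (∫⁻ x, f x * (a x : ℝ≥0∞) ^ s ∂μ)) := by
  have h1 : ∀ L : ℕ, Measurable fun x => f x * ((min (a x) L : NNReal) : ℝ≥0∞) ^ s := fun L =>
    hf.mul ((ha.min measurable_const).coe_nnreal_ennreal.pow_const s)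
  refine lintegral_tendsto_of_tendsto_of_monotone (fun L => (h1 L).aemeasurable) ?_ ?_
  · refine Eventually.of_forall fun x L L' hLL => ?_
    refine mul_le_mul_right (ENNReal.rpow_le_rpow
      (ENNReal.coe_le_coe.2 (min_le_min_left _ ?_)) hs) _
    exact_mod_cast hLL
  · refine Eventually.of_forall fun x => ?_
    refine tendsto_const_nhds.congr' ?_
    obtain ⟨N, hN⟩ := exists_nat_ge (a x)
    filter_upwards [eventually_ge_atTop N] with L hNL
    rw [min_eq_left (hN.trans (by exact_mod_cast hNL))]

/-- Rotation invariance gives `ρ x + σ z` the standard law, so the second norm is a norm on a single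
Gaussian space. The second function is truncated, and the bound is removed by monotone convergence.
-/
lemma lintegral_mul_rotation_le {q ρ σ : ℝ} (hq1 : 1 < q) (hq2 : q ≤ 2) (hρ : ρ ^ 2 = q - 1)
    (hρ0 : 0 ≤ ρ) (hρ1 : ρ ≤ 1) (hσ : ρ ^ 2 + σ ^ 2 = 1) (d : ℕ) {f a : (Fin d → ℝ) → NNReal}
    (hf : Continuous f) (ha : Continuous a) {M : NNReal} (hM : ∀ x, f x ≤ M) :
    ∫⁻ p, (f p.1 : ℝ≥0∞) * a (ρ • p.1 + σ • p.2) ∂((gaussPi d).prod (gaussPi d)) ≤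
      (∫⁻ x, (f x : ℝ≥0∞) ^ q ∂(gaussPi d)) ^ (1 / q) *
        (∫⁻ x, (a x : ℝ≥0∞) ^ (2 : ℝ) ∂(gaussPi d)) ^ (1 / 2 : ℝ) := by
  have hrm : Measurable fun p : (Fin d → ℝ) × (Fin d → ℝ) => a (ρ • p.1 + σ • p.2) :=
    (ha.comp (by fun_prop)).measurable
  have hfm : Measurable fun p : (Fin d → ℝ) × (Fin d → ℝ) => (f p.1 : ℝ≥0∞) :=
    (hf.comp continuous_fst).measurable.coe_nnreal_ennreal
  have h2 := tendsto_lintegral_min ((gaussPi d).prod (gaussPi d)) hfm hrm zero_le_one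
  simp only [ENNReal.rpow_one] at h2
  refine le_of_tendsto' h2 fun L => ?_
  have h1 := lintegral_mul_gaussCouple_le hq1 hq2 hρ hρ0 hρ1 hσ d (f := f)
    (g := fun x => min (a x) L) hf (ha.min continuous_const) (K := max M L)
    (fun x => le_max_of_le_left (hM x)) (fun x => le_max_of_le_right (min_le_right _ _))
  have h3 : ∫⁻ p, (f p.1 : ℝ≥0∞) ^ q ∂((gaussPi d).prod (gaussPi d)) =
      ∫⁻ x, (f x : ℝ≥0∞) ^ q ∂(gaussPi d) :=
    measurePreserving_fst.lintegral_comp (hf.measurable.coe_nnreal_ennreal.pow_const q)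
  rw [h3, lintegral_rotation_gaussPi hσ d
      (h := fun x => ((min (a x) L : NNReal) : ℝ≥0∞) ^ (2 : ℝ))
      ((ha.min continuous_const).measurable.coe_nnreal_ennreal.pow_const 2)] at h1
  refine h1.trans (mul_le_mul_right (ENNReal.rpow_le_rpow (lintegral_mono fun x => ?_)
    (by norm_num)) _)
  exact ENNReal.rpow_le_rpow (ENNReal.coe_le_coe.2 (min_le_left _ _)) two_pos.le

/-- The hypercontractive estimate for a truncation. -/
lemma lintegral_min_rpow_le {q ρ σ p : ℝ} (hp : 2 ≤ p) (hq : q = p / (p - 1)) (hρ : ρ ^ 2 = q - 1)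
    (hρ0 : 0 < ρ) (hρ1 : ρ ≤ 1) (hσ : ρ ^ 2 + σ ^ 2 = 1) (d : ℕ) {a : (Fin d → ℝ) → NNReal}
    (ha : Continuous a) {c : ℝ≥0∞}
    (hc : ∀ x, c * a x ≤ ∫⁻ z, a (ρ • x + σ • z) ∂(gaussPi d)) (M : ℕ) :
    c * (∫⁻ x, ((min (a x) M : NNReal) : ℝ≥0∞) ^ p ∂(gaussPi d)) ^ (1 / p) ≤
      (∫⁻ x, (a x : ℝ≥0∞) ^ (2 : ℝ) ∂(gaussPi d)) ^ (1 / 2 : ℝ) := by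
  have hp1 : 0 < p - 1 := by linarith
  have hq1 : 1 < q := by rw [hq, lt_div_iff₀ hp1]; linarith
  have hq2 : q ≤ 2 := by rw [hq, div_le_iff₀ hp1]; linarith
  have hq0 : 0 < q := by linarith
  obtain ⟨h, hh⟩ : ∃ h : (Fin d → ℝ) → NNReal, ∀ x, h x = min (a x) M := ⟨_, fun _ => rfl⟩
  have hhc : Continuous h := by
    rw [show h = fun x => min (a x) M from funext hh]; exact ha.min continuous_const
  simp only [← hh]
  obtain ⟨A, hAdef⟩ : ∃ A, A = ∫⁻ x, (h x : ℝ≥0∞) ^ p ∂(gaussPi d) := ⟨_, rfl⟩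
  obtain ⟨B, hB⟩ : ∃ B, B = (∫⁻ x, (a x : ℝ≥0∞) ^ (2 : ℝ) ∂(gaussPi d)) ^ (1 / 2 : ℝ) := ⟨_, rfl⟩
  rw [← hAdef, ← hB]
  -- The reason for truncating: the final step divides by a power of `A`.
  have hAtop : A ≠ ⊤ := by
    refine ne_top_of_le_ne_top (b := (M : ℝ≥0∞) ^ p)
      (ENNReal.rpow_ne_top_of_nonneg (by linarith) (by simp)) ?_
    rw [hAdef]
    refine (lintegral_mono (g := fun _ => (M : ℝ≥0∞) ^ p) fun x => ?_).trans (by simp [gaussPi])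
    refine ENNReal.rpow_le_rpow ?_ (by linarith)
    have : h x ≤ M := (hh x).trans_le (min_le_right _ _)
    exact_mod_cast this
  -- The function dual to `h` in `L^p`: both `f · h` and `f^q` equal `h^p`. The hypothesis on `a`
  -- bounds the correlation of `f` with `a` from below by `c A`, and hypercontractivity bounds it
  -- from above by `A^{1/q}` times the `L²` norm.
  obtain ⟨f, hf⟩ : ∃ f : (Fin d → ℝ) → NNReal, ∀ x, f x = h x ^ (p - 1) := ⟨_, fun _ => rfl⟩
  have hfc : Continuous f := by
    rw [show f = fun x => h x ^ (p - 1) from funext hf]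
    exact (NNReal.continuous_rpow_const hp1.le).comp hhc
  have hfE : ∀ x, (f x : ℝ≥0∞) = (h x : ℝ≥0∞) ^ (p - 1) := fun x => by
    rw [hf, ENNReal.coe_rpow_of_nonneg _ hp1.le]
  have hfq : ∫⁻ x, (f x : ℝ≥0∞) ^ q ∂(gaussPi d) = A := by
    rw [hAdef]
    refine lintegral_congr fun x => ?_
    rw [hfE, ← ENNReal.rpow_mul, hq, mul_div_cancel₀ _ hp1.ne']
  have hL2 := lintegral_mul_rotation_le hq1 hq2 hρ hρ0.le hρ1 hσ d hfc ha
    (M := (M : NNReal) ^ (p - 1)) fun x => by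
      rw [hf, hh]; exact NNReal.rpow_le_rpow (min_le_right _ _) hp1.le
  rw [hfq, ← hB] at hL2
  have hlow : c * A ≤ A ^ (1 / q) * B := by
    refine le_trans ?_ hL2
    have hm : Measurable fun p : (Fin d → ℝ) × (Fin d → ℝ) =>
        (f p.1 : ℝ≥0∞) * a (ρ • p.1 + σ • p.2) :=
      (hfc.comp continuous_fst).measurable.coe_nnreal_ennreal.mul
        (ha.comp (by fun_prop)).measurable.coe_nnreal_ennreal
    rw [lintegral_prod _ hm.aemeasurable, hAdef,
      ← lintegral_const_mul _ (hhc.measurable.coe_nnreal_ennreal.pow_const p)]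
    refine lintegral_mono fun x => ?_
    dsimp only
    have hm2 : Measurable fun z => (a (ρ • x + σ • z) : ℝ≥0∞) :=
      (ha.comp (by fun_prop)).measurable.coe_nnreal_ennreal
    rw [lintegral_const_mul _ hm2]
    calc c * (h x : ℝ≥0∞) ^ p = (f x : ℝ≥0∞) * (c * h x) := by
          rw [hfE, mul_left_comm]
          congr 1
          conv_lhs => rw [show p = p - 1 + 1 by ring, ENNReal.rpow_add_of_nonneg _ _ hp1.le
            zero_le_one, ENNReal.rpow_one]
      _ ≤ (f x : ℝ≥0∞) * (c * a x) := by
          have : h x ≤ a x := (hh x).trans_le (min_le_left _ _)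
          gcongr
      _ ≤ _ := mul_le_mul_right (hc x) _
  by_cases hA0 : A = 0
  · rw [hA0, ENNReal.zero_rpow_of_pos (by positivity), mul_zero]; exact zero_le
  have hAq0 : A ^ (1 / q) ≠ 0 := by
    rw [Ne, ENNReal.rpow_eq_zero_iff_of_pos (by positivity)]; exact hA0
  have hAqt : A ^ (1 / q) ≠ ⊤ := ENNReal.rpow_ne_top_of_nonneg (by positivity) hAtop
  have hsplit : A ^ (1 / q) * A ^ (1 / p) = A := by
    rw [← ENNReal.rpow_add_of_nonneg _ _ (by positivity) (by positivity)]
    have : 1 / q + 1 / p = 1 := by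
      have : p ≠ 0 := by linarith
      rw [hq]; field_simp; ring
    rw [this, ENNReal.rpow_one]
  refine (ENNReal.mul_le_mul_iff_right hAq0 hAqt).1 ?_
  calc A ^ (1 / q) * (c * A ^ (1 / p)) = c * (A ^ (1 / q) * A ^ (1 / p)) := by ring
    _ ≤ _ := by rw [hsplit]; exact hlow

/-- **Nelson's hypercontractivity** for functions that are dominated by an eigenfunction relation of
the Ornstein–Uhlenbeck semigroup. -/
theorem eLpNorm_gaussPi_le {d n : ℕ} {F : (Fin d → ℝ) → ℝ} (hF : Continuous F)
    (hM : ∀ ρ σ : ℝ, 0 < ρ → ρ ≤ 1 → ρ ^ 2 + σ ^ 2 = 1 → ∀ x,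
      ENNReal.ofReal (ρ ^ n) * ‖F x‖ₑ ≤ ∫⁻ z, ‖F (ρ • x + σ • z)‖ₑ ∂(gaussPi d))
    {p : ℝ} (hp : 2 ≤ p) :
    eLpNorm F (ENNReal.ofReal p) (gaussPi d) ≤
      ENNReal.ofReal ((p - 1) ^ ((n : ℝ) / 2)) * eLpNorm F 2 (gaussPi d) := by
  obtain ⟨q, hq⟩ : ∃ q, q = p / (p - 1) := ⟨_, rfl⟩
  have hp1 : 0 < p - 1 := by linarith
  have hq1 : 1 < q := by rw [hq, lt_div_iff₀ hp1]; linarith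
  have hq2 : q ≤ 2 := by rw [hq, div_le_iff₀ hp1]; linarith
  have hq0 : 0 < q := by linarith
  have hqs : q - 1 = 1 / (p - 1) := by rw [hq]; field_simp; ring
  -- The largest correlation allowed by the two-point inequality. For conjugate exponents `q - 1 =
  -- 1/(p-1)`, so `ρ^{-n} = (p-1)^{n/2}` is the asserted constant.
  obtain ⟨ρ, hρd⟩ : ∃ ρ, ρ = √(q - 1) := ⟨_, rfl⟩
  have hρ : ρ ^ 2 = q - 1 := by rw [hρd, Real.sq_sqrt (by linarith)]
  have hρ0 : 0 < ρ := by rw [hρd]; exact Real.sqrt_pos.2 (by linarith)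
  have hρ1 : ρ ≤ 1 := by rw [hρd]; exact Real.sqrt_le_one.2 (by linarith)
  obtain ⟨σ, hσd⟩ : ∃ σ, σ = √(1 - ρ ^ 2) := ⟨_, rfl⟩
  have hσ : ρ ^ 2 + σ ^ 2 = 1 := by
    rw [hσd, Real.sq_sqrt (show 0 ≤ 1 - ρ ^ 2 by nlinarith), add_sub_cancel]
  have hac : Continuous fun x => ‖F x‖₊ := hF.nnnorm
  have hpne : ENNReal.ofReal p ≠ 0 := by simp; linarith
  have e2 : eLpNorm F 2 (gaussPi d) =
      (∫⁻ x, (‖F x‖₊ : ℝ≥0∞) ^ (2 : ℝ) ∂(gaussPi d)) ^ (1 / 2 : ℝ) := by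
    rw [eLpNorm_eq_lintegral_rpow_enorm_toReal two_ne_zero ENNReal.ofNat_ne_top]; rfl
  have ep : eLpNorm F (ENNReal.ofReal p) (gaussPi d) =
      (∫⁻ x, (‖F x‖₊ : ℝ≥0∞) ^ p ∂(gaussPi d)) ^ (1 / p) := by
    rw [eLpNorm_eq_lintegral_rpow_enorm_toReal hpne ENNReal.ofReal_ne_top,
      ENNReal.toReal_ofReal (by linarith)]
    rfl
  have hCρ : ENNReal.ofReal ((p - 1) ^ ((n : ℝ) / 2)) * ENNReal.ofReal (ρ ^ n) = 1 := by
    rw [← ENNReal.ofReal_mul (by positivity), ← ENNReal.ofReal_one]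
    congr 1
    rw [hρd, hqs, Real.sqrt_eq_rpow, ← Real.rpow_natCast (_ ^ _), ← Real.rpow_mul (by positivity),
      one_div, Real.inv_rpow hp1.le, show 1 / 2 * (n : ℝ) = n / 2 by ring]
    exact mul_inv_cancel₀ (Real.rpow_pos_of_pos hp1 _).ne'
  have h1 := fun M : ℕ => lintegral_min_rpow_le hp hq hρ hρ0 hρ1 hσ d hac
    (c := ENNReal.ofReal (ρ ^ n)) (hM ρ σ hρ0 hρ1 hσ) M
  have h2 := tendsto_lintegral_min (gaussPi d) (f := fun _ => 1) measurable_const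
    hac.measurable (s := p) (by linarith)
  simp only [one_mul] at h2
  rw [e2, ep]
  refine le_of_tendsto' (Tendsto.ennrpow_const (1 / p) h2) fun M => ?_
  calc _ = ENNReal.ofReal ((p - 1) ^ ((n : ℝ) / 2)) * (ENNReal.ofReal (ρ ^ n) *
          (∫⁻ x, ((min ‖F x‖₊ M : NNReal) : ℝ≥0∞) ^ p ∂(gaussPi d)) ^ (1 / p)) := by
        rw [← mul_assoc, hCρ, one_mul]
    _ ≤ _ := mul_le_mul_right (h1 M) _

/-! ### Mehler's formula for integrated Hermite polynomials. -/

/-- Continuous functions of at most polynomial growth that are eigenfunctions of the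
Ornstein–Uhlenbeck semigroup, in the form of Mehler's formula. -/
def IsMehler {d : ℕ} (n : ℕ) (F : (Fin d → ℝ) → ℝ) : Prop :=
  Continuous F ∧ ∀ ρ σ : ℝ, ρ ^ 2 + σ ^ 2 = 1 → ∀ x,
    Integrable (fun z => F (ρ • x + σ • z)) (gaussPi d) ∧
      ∫ z, F (ρ • x + σ • z) ∂(gaussPi d) = ρ ^ n * F x

lemma IsMehler.sub {d n : ℕ} {F G : (Fin d → ℝ) → ℝ} (hF : IsMehler n F) (hG : IsMehler n G) :
    IsMehler n fun x => F x - G x := by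
  refine ⟨hF.1.sub hG.1, fun ρ σ h x => ?_⟩
  obtain ⟨i1, e1⟩ := hF.2 ρ σ h x
  obtain ⟨i2, e2⟩ := hG.2 ρ σ h x
  exact ⟨i1.sub i2, by rw [integral_sub i1 i2, e1, e2, mul_sub]⟩

/-- The triangle inequality for the integral turns the eigenfunction equation for `F` into the
one-sided inequality for `|F|` that the duality argument needs. -/
lemma IsMehler.eLpNorm_le {d n : ℕ} {F : (Fin d → ℝ) → ℝ} (hF : IsMehler n F)
    {p : ℝ} (hp : 2 ≤ p) :
    eLpNorm F (ENNReal.ofReal p) (gaussPi d) ≤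
      ENNReal.ofReal ((p - 1) ^ ((n : ℝ) / 2)) * eLpNorm F 2 (gaussPi d) := by
  refine eLpNorm_gaussPi_le hF.1 (fun ρ σ h0 _ h x => ?_) hp
  have h1 := enorm_integral_le_lintegral_enorm (μ := gaussPi d) fun z => F (ρ • x + σ • z)
  rw [(hF.2 ρ σ h x).2, enorm_mul, Real.enorm_of_nonneg (pow_nonneg h0.le n)] at h1
  exact h1

lemma map_sum_gaussPi {d : ℕ} (v : Fin d → ℝ) :
    (gaussPi d).map (fun x => ∑ i, v i * x i) =
      gaussianReal 0 (∑ i, v i ^ 2).toNNReal := by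
  have := isGaussian_gaussPi d
  let L : (Fin d → ℝ) →L[ℝ] ℝ := ∑ i, v i • ContinuousLinearMap.proj i
  have hL : ∀ x, L x = ∑ i, v i * x i := fun x => by simp [L]
  have h1 : HasGaussianLaw (fun x => ∑ i, v i * x i) (gaussPi d) := by
    simp only [← hL]
    exact ⟨inferInstance⟩
  rw [h1.map_eq_gaussianReal]
  congr 1
  · simp only [← hL]
    have := L.integral_comp_comm (IsGaussian.integrable_id (μ := gaussPi d))
    simp only [id_eq] at this
    rw [this, integral_id_gaussPi, map_zero]
  · congr 1
    have h2 : (fun x : Fin d → ℝ => ∑ i, v i * x i) =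
        ∑ i, fun x : Fin d → ℝ => (fun r : ℝ => v i * r) (x i) := by
      ext x; simp
    rw [h2, gaussPi, variance_sum_pi]
    · refine Finset.sum_congr rfl fun i _ => ?_
      change Var[fun x ↦ _ * (id x); gaussianReal 0 1] = _
      rw [variance_const_mul, variance_id_gaussianReal]
      simp
    · exact fun i ↦ IsGaussian.memLp_two_id.const_mul _

/-- Mehler's formula for Hermite polynomials. -/
lemma integral_hermiteVar_mehler {d : ℕ} (n : ℕ) (v x : Fin d → ℝ) {ρ σ : ℝ}
    (h : ρ ^ 2 + σ ^ 2 = 1) :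
    ∫ z, (hermiteVar (∑ i, v i ^ 2) n).eval (∑ i, v i * (ρ • x + σ • z) i) ∂(gaussPi d) =
      ρ ^ n * (hermiteVar (∑ i, v i ^ 2) n).eval (∑ i, v i * x i) := by
  set t := ∑ i, v i ^ 2 with ht
  have ht0 : 0 ≤ t := Finset.sum_nonneg fun i _ => sq_nonneg _
  have h1 : ∀ z : Fin d → ℝ, ∑ i, v i * (ρ • x + σ • z) i =
      ρ * (∑ i, v i * x i) + ∑ i, (fun j => σ * v j) i * z i := by
    intro z
    simp only [Pi.add_apply, Pi.smul_apply, smul_eq_mul, Finset.mul_sum, ← Finset.sum_add_distrib]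
    exact Finset.sum_congr rfl fun i _ => by ring
  have h2 : ∑ i, (fun j => σ * v j) i ^ 2 = σ ^ 2 * t := by
    rw [ht, Finset.mul_sum]
    exact Finset.sum_congr rfl fun i _ => by ring
  have h3 := map_sum_gaussPi fun j => σ * v j
  rw [h2] at h3
  -- The noise `σ ∑ v_i z_i` has variance `σ²t` and `ρ²t + σ²t = t`, so averaging leaves `H_n(ρu;
  -- ρ²t) = ρⁿ H_n(u; t)`.
  have h4 := integral_hermiteVar_add (ρ ^ 2 * t) (σ ^ 2 * t).toNNReal n (ρ * ∑ i, v i * x i)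
  rw [Real.coe_toNNReal _ (by positivity), ← add_mul, h, one_mul, hermiteVar_eval_mul, ← h3,
    integral_map (by fun_prop : Measurable _).aemeasurable (by fun_prop)] at h4
  simp only [h1]
  exact h4

/-- Growth that is uniform over bounded variances; it supplies the majorants for dominated
convergence and Fubini. -/
lemma exists_hermiteVar_bound (R : ℝ) (n : ℕ) :
    ∃ C, 0 ≤ C ∧ ∀ s, |s| ≤ R → ∀ u, |(hermiteVar s n).eval u| ≤ C * (1 + |u|) ^ n := by
  induction n using Nat.twoStepInduction with
  | zero => exact ⟨1, zero_le_one, fun s _ u => by simp [hermiteVar]⟩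
  | one => exact ⟨1, zero_le_one, fun s _ u => by simp [hermiteVar]⟩
  | more n ih1 ih2 =>
    obtain ⟨C1, h01, h1⟩ := ih1
    obtain ⟨C2, h02, h2⟩ := ih2
    refine ⟨C2 + |R| * (n + 1) * C1, by positivity, fun s hs u => ?_⟩
    have hu : 1 ≤ 1 + |u| := by linarith [abs_nonneg u]
    rw [hermiteVar_eval_add_two]
    refine (abs_sub _ _).trans ?_
    rw [add_mul]
    refine add_le_add ?_ ?_
    · rw [abs_mul]
      calc |u| * |(hermiteVar s (n + 1)).eval u| ≤ (1 + |u|) * (C2 * (1 + |u|) ^ (n + 1)) := by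
            gcongr
            · linarith
            · exact h2 s hs u
        _ = _ := by ring
    · rw [abs_mul, abs_mul, abs_of_nonneg (by positivity : (0 : ℝ) ≤ (n : ℝ) + 1)]
      calc |s| * (n + 1) * |(hermiteVar s n).eval u|
          ≤ |R| * (n + 1) * (C1 * (1 + |u|) ^ n) := by
            refine mul_le_mul (mul_le_mul_of_nonneg_right (hs.trans (le_abs_self R))
              (by positivity)) (h1 s hs u) (abs_nonneg _) (by positivity)
        _ ≤ |R| * (n + 1) * (C1 * (1 + |u|) ^ (n + 2)) := by
            have := pow_le_pow_right₀ hu (show n ≤ n + 2 by omega)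
            gcongr
        _ = _ := by ring

lemma continuous_hermiteVar (n : ℕ) : Continuous fun q : ℝ × ℝ => (hermiteVar q.1 n).eval q.2 := by
  induction n using Nat.twoStepInduction with
  | zero => simpa [hermiteVar] using continuous_const
  | one => simpa [hermiteVar] using continuous_snd
  | more n ih1 ih2 =>
    simp only [hermiteVar_eval_add_two]
    fun_prop

/-- A function on Gauss space obtained by integrating Hermite polynomials of linear forms. -/
def hermiteInt {d : ℕ} (n : ℕ) (v : T2 → Fin d → ℝ) (g : T2 → ℝ) (ξ : Fin d → ℝ) : ℝ :=
  ∫ y, (hermiteVar (∑ i, v y i ^ 2) n).eval (∑ i, v y i * ξ i) * g y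

lemma exists_hermiteVar_form_bound {d : ℕ} (n : ℕ) {v : T2 → Fin d → ℝ} (hv : Continuous v) :
    ∃ C V, 0 ≤ C ∧ 0 ≤ V ∧ ∀ (y : T2) (ξ : Fin d → ℝ), |(hermiteVar (∑ i, v y i ^ 2) n).eval (∑ i, v y i * ξ i)| ≤
      C * (1 + V * ‖ξ‖) ^ n := by
  obtain ⟨V, hV⟩ := isCompact_univ.exists_bound_of_continuousOn
    (f := fun y => ∑ i, |v y i|) (by fun_prop)
  obtain ⟨R, hR⟩ := isCompact_univ.exists_bound_of_continuousOn
    (f := fun y => ∑ i, v y i ^ 2) (by fun_prop)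
  obtain ⟨C, hC0, hC⟩ := exists_hermiteVar_bound R n
  refine ⟨C, V, hC0, (norm_nonneg _).trans (hV 0 (Set.mem_univ _)), fun y ξ => ?_⟩
  refine (hC _ (hR y (Set.mem_univ _)) _).trans ?_
  have h1 : |∑ i, v y i * ξ i| ≤ V * ‖ξ‖ := by
    calc |∑ i, v y i * ξ i| ≤ ∑ i, |v y i * ξ i| := Finset.abs_sum_le_sum_abs _ _
      _ ≤ ∑ i, |v y i| * ‖ξ‖ := by
        refine Finset.sum_le_sum fun i _ => ?_
        rw [abs_mul]
        exact mul_le_mul_of_nonneg_left (norm_le_pi_norm ξ i) (abs_nonneg _)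
      _ = (∑ i, |v y i|) * ‖ξ‖ := by rw [Finset.sum_mul]
      _ ≤ V * ‖ξ‖ := by
        gcongr
        exact (le_abs_self _).trans (hV y (Set.mem_univ _))
  gcongr

lemma continuous_hermiteVar_form {d : ℕ} (n : ℕ) {v : T2 → Fin d → ℝ} (hv : Continuous v) :
    Continuous fun q : T2 × (Fin d → ℝ) =>
      (hermiteVar (∑ i, v q.1 i ^ 2) n).eval (∑ i, v q.1 i * q.2 i) := by
  have h1 : Continuous fun q : T2 × (Fin d → ℝ) => ∑ i, v q.1 i ^ 2 := by fun_prop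
  have h2 : Continuous fun q : T2 × (Fin d → ℝ) => ∑ i, v q.1 i * q.2 i := by fun_prop
  exact (continuous_hermiteVar n).comp (h1.prodMk h2)

lemma continuous_hermiteInt {d : ℕ} (n : ℕ) {v : T2 → Fin d → ℝ} (hv : Continuous v) {g : T2 → ℝ}
    (hg : Integrable g) : Continuous (hermiteInt n v g) := by
  obtain ⟨C, V, hC, hV, hb⟩ := exists_hermiteVar_form_bound n hv
  have hc := continuous_hermiteVar_form n hv
  rw [continuous_iff_continuousAt]
  intro ξ
  refine continuousAt_of_dominated (bound := fun y => C * (1 + V * (‖ξ‖ + 1)) ^ n * |g y|)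
    (Eventually.of_forall fun η => ?_) ?_ (hg.abs.const_mul _) (Eventually.of_forall fun y => ?_)
  · exact (hc.comp (by fun_prop : Continuous fun y : T2 => (y, η))).aestronglyMeasurable.mul
      hg.aestronglyMeasurable
  · filter_upwards [Metric.ball_mem_nhds ξ one_pos] with η hη
    refine Eventually.of_forall fun y => ?_
    rw [Real.norm_eq_abs, abs_mul]
    have h1 : ‖η‖ ≤ ‖ξ‖ + 1 := by
      have := norm_sub_norm_le η ξ
      rw [Metric.mem_ball, dist_eq_norm] at hη
      linarith
    refine mul_le_mul_of_nonneg_right ((hb y η).trans ?_) (abs_nonneg _)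
    gcongr
  · exact ((hc.comp (by fun_prop : Continuous fun η : Fin d → ℝ => (y, η))).mul
      continuous_const).continuousAt

lemma integrable_growth_gaussPi {d : ℕ} (n : ℕ) {a b : ℝ} (ha : 0 ≤ a) (hb : 0 ≤ b) :
    Integrable (fun z : Fin d → ℝ => (a + b * ‖z‖) ^ n) (gaussPi d) := by
  have := isGaussian_gaussPi d
  rcases Nat.eq_zero_or_pos n with rfl | hn
  · simp
  have h1 : MemLp (fun z : Fin d → ℝ => z) (n : ℝ≥0∞) (gaussPi d) :=
    IsGaussian.memLp_id (gaussPi d) n (ENNReal.natCast_ne_top n)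
  have h2 : MemLp (fun z : Fin d → ℝ => b * ‖z‖) (n : ℝ≥0∞) (gaussPi d) := h1.norm.const_mul b
  have h3 : MemLp (fun _ : Fin d → ℝ => a) (n : ℝ≥0∞) (gaussPi d) := memLp_const a
  have h4 : MemLp (fun z : Fin d → ℝ => a + b * ‖z‖) (n : ℝ≥0∞) (gaussPi d) := h3.add h2
  refine (h4.integrable_norm_pow hn.ne').congr (Eventually.of_forall fun z => ?_)
  have h5 : 0 ≤ a + b * ‖z‖ := by positivity
  simp only [Real.norm_of_nonneg h5]

/-- Mehler's formula holds for each point `y` of the torus with the same eigenvalue, so Fubini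
carries it through the integral in `y`. -/
lemma isMehler_hermiteInt {d : ℕ} (n : ℕ) {v : T2 → Fin d → ℝ} (hv : Continuous v) {g : T2 → ℝ}
    (hg : Integrable g) : IsMehler n (hermiteInt n v g) := by
  refine ⟨continuous_hermiteInt n hv hg, fun ρ σ h x => ?_⟩
  have := isGaussian_gaussPi d
  obtain ⟨C, V, hC, hV, hb⟩ := exists_hermiteVar_form_bound n hv
  have hc := continuous_hermiteVar_form n hv
  have hpow := (integrable_growth_gaussPi (d := d) n (a := 1 + V * ‖ρ • x‖) (b := V * |σ|)
    (by positivity) (by positivity)).const_mul C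
  have hint : Integrable (Function.uncurry fun (z : Fin d → ℝ) (y : T2) =>
      (hermiteVar (∑ i, v y i ^ 2) n).eval (∑ i, v y i * (ρ • x + σ • z) i) * g y)
      ((gaussPi d).prod volume) := by
    refine (hpow.mul_prod hg).mono ?_ (Eventually.of_forall fun q => ?_)
    · exact (hc.comp (by fun_prop : Continuous fun q : (Fin d → ℝ) × T2 =>
        (q.2, ρ • x + σ • q.1))).aestronglyMeasurable.mul
        (hg.aestronglyMeasurable.comp_snd)
    · simp only [Function.uncurry, norm_mul]
      refine mul_le_mul_of_nonneg_right ((hb _ _).trans ?_) (norm_nonneg _)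
      rw [← norm_mul]
      refine le_trans ?_ (le_abs_self _)
      have h1 : ‖ρ • x + σ • q.1‖ ≤ ‖ρ • x‖ + |σ| * ‖q.1‖ := by
        refine (norm_add_le _ _).trans (le_of_eq ?_)
        rw [norm_smul σ, Real.norm_eq_abs]
      refine mul_le_mul_of_nonneg_left (pow_le_pow_left₀ (by positivity) ?_ n) hC
      nlinarith [mul_le_mul_of_nonneg_left h1 hV]
  refine ⟨hint.integral_prod_left, ?_⟩
  simp only [hermiteInt]
  rw [integral_integral_swap hint, ← integral_const_mul]
  refine integral_congr_ae (Eventually.of_forall fun y => ?_)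
  dsimp only
  rw [integral_mul_const, integral_hermiteVar_mehler n (v y) x h, mul_assoc]

/-! ### The heat kernel on the torus -/

/-- The character `x ↦ exp(i k·x)`. -/
def chr (k : ℤ × ℤ) (x : T2) : ℂ := fourier k.1 x.1 * fourier k.2 x.2

lemma continuous_chr (k : ℤ × ℤ) : Continuous (chr k) := by unfold chr; fun_prop

lemma norm_chr (k : ℤ × ℤ) (x : T2) : ‖chr k x‖ = 1 := by
  simp only [chr, fourier_apply, norm_mul, Circle.norm_coe, mul_one]

lemma chr_zero (x : T2) : chr 0 x = 1 := by simp [chr]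

lemma chr_add (k l : ℤ × ℤ) (x : T2) : chr (k + l) x = chr k x * chr l x := by
  simp only [chr, Prod.fst_add, Prod.snd_add, fourier_add]; ring

lemma chr_sum {ι : Type*} (s : Finset ι) (k : ι → ℤ × ℤ) (x : T2) :
    chr (∑ i ∈ s, k i) x = ∏ i ∈ s, chr (k i) x := by
  classical
  induction s using Finset.induction_on with
  | empty => simp [chr_zero]
  | insert a s ha ih => rw [Finset.sum_insert ha, Finset.prod_insert ha, chr_add, ih]

lemma expFn_eq_chr (k : ℤ × ℤ) (x : T2) :
    expFn k x = ((2 * Real.pi : ℝ) : ℂ)⁻¹ * chr k x := rfl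

lemma integral_chr (k : ℤ × ℤ) :
    ∫ x, chr k x = if k = 0 then ((4 * Real.pi ^ 2 : ℝ) : ℂ) else 0 := by
  have h := integral_expFn 0 k
  have h0 : ((2 * Real.pi : ℝ) : ℂ) ≠ 0 := by exact_mod_cast Real.two_pi_pos.ne'
  have h1 : ∀ x : T2, expFn k x * expFn (-0) x = ((2 * Real.pi : ℝ) : ℂ)⁻¹ ^ 2 * chr k x := by
    intro x
    rw [expFn_eq_chr, expFn_eq_chr, neg_zero, chr_zero]; ring
  simp only [h1, integral_const_mul] at h
  have h2 : ∫ x, chr k x = ((2 * Real.pi : ℝ) : ℂ) ^ 2 * (if (0 : ℤ × ℤ) = k then 1 else 0) := by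
    rw [← h]; field_simp
  rw [h2]
  simp only [eq_comm (a := (0 : ℤ × ℤ))]
  split_ifs
  · push_cast; ring
  · simp

lemma summable_exp_neg_mul_sq {t : ℝ} (ht : 0 < t) :
    Summable fun n : ℤ => Real.exp (-t * (n : ℝ) ^ 2) := by
  refine Summable.of_nonneg_of_le (fun n => (Real.exp_pos _).le) (fun n => ?_)
    (summable_inv_sq.mul_left (1 + t⁻¹))
  have h1 : 1 + t * (n : ℝ) ^ 2 ≤ Real.exp (t * (n : ℝ) ^ 2) := by
    linarith [Real.add_one_le_exp (t * (n : ℝ) ^ 2)]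
  rw [neg_mul, Real.exp_neg, ← div_eq_mul_inv, le_div_iff₀ (by positivity), inv_mul_le_iff₀ (Real.exp_pos _)]
  refine le_trans ?_ (mul_le_mul_of_nonneg_right h1 (by positivity))
  have : t * t⁻¹ = 1 := mul_inv_cancel₀ ht.ne'
  have h2 : 0 < t⁻¹ := inv_pos.2 ht
  nlinarith [sq_nonneg (n : ℝ), mul_nonneg ht.le (sq_nonneg (n : ℝ))]

/-- The periodic heat kernel in one dimension, up to normalization. -/
def theta (t : ℝ) (s : AddCircle (2 * Real.pi)) : ℂ :=
  ∑' n : ℤ, (Real.exp (-t * (n : ℝ) ^ 2) : ℂ) * fourier n s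

lemma norm_theta_term (t : ℝ) (n : ℤ) (s : AddCircle (2 * Real.pi)) :
    ‖(Real.exp (-t * (n : ℝ) ^ 2) : ℂ) * fourier n s‖ = Real.exp (-t * (n : ℝ) ^ 2) := by
  rw [norm_mul, Complex.norm_real, Real.norm_of_nonneg (Real.exp_pos _).le, fourier_apply,
    Circle.norm_coe, mul_one]

/-- Poisson summation: the Fourier series of the heat kernel is the periodization of the Gaussian
kernel of the line. -/
lemma theta_eq {t : ℝ} (ht : 0 < t) (s : ℝ) :
    theta t s = ((√(Real.pi / t) : ℝ) : ℂ) *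
      ∑' n : ℤ, ((Real.exp (-(2 * Real.pi * n - s) ^ 2 / (4 * t)) : ℝ) : ℂ) := by
  have hpi : (Real.pi : ℂ) ≠ 0 := by exact_mod_cast Real.pi_ne_zero
  have htc : (t : ℂ) ≠ 0 := by exact_mod_cast ht.ne'
  have h := Complex.tsum_exp_neg_quadratic (a := ((t / Real.pi : ℝ) : ℂ))
    (by rw [Complex.ofReal_re]; positivity) (Complex.I * s / (2 * Real.pi))
  have h1 : theta t s = ∑' n : ℤ, Complex.exp (-Real.pi * ((t / Real.pi : ℝ) : ℂ) * (n : ℂ) ^ 2 +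
      2 * Real.pi * (Complex.I * s / (2 * Real.pi)) * n) := by
    refine tsum_congr fun n => ?_
    rw [fourier_coe_apply, Complex.ofReal_exp, ← Complex.exp_add]
    congr 1
    push_cast
    field_simp
  rw [h1, h]
  congr 1
  · rw [show (1 / 2 : ℂ) = ((1 / 2 : ℝ) : ℂ) by norm_num, ← Complex.ofReal_cpow (by positivity),
      ← Real.sqrt_eq_rpow, ← Complex.ofReal_one, ← Complex.ofReal_div]
    congr 1
    rw [one_div, ← Real.sqrt_inv, inv_div]
  · refine tsum_congr fun n => ?_
    rw [Complex.ofReal_exp]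
    congr 1
    push_cast
    have hI : Complex.I * (Complex.I * s / (2 * Real.pi)) = -s / (2 * Real.pi) := by
      rw [← mul_div_assoc, ← mul_assoc, Complex.I_mul_I]; ring
    rw [hI]
    field_simp
    ring

/-- In the periodization the nearest image gives the Gaussian factor in the distance to `0`. The
other images together are of order `t`, as each is at distance at least `π|n|`. -/
lemma exists_norm_theta_le : ∃ K, 0 ≤ K ∧ ∀ t > 0, ∀ s : AddCircle (2 * Real.pi),
    ‖theta t s‖ ≤ √(Real.pi / t) * (Real.exp (-‖s‖ ^ 2 / (4 * t)) + K * t) := by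
  refine ⟨2 * ∑' n : ℤ, (1 + (n : ℝ) ^ 2)⁻¹, by positivity, fun t ht s => ?_⟩
  obtain ⟨r, hr, hs, hrn⟩ : ∃ r : ℝ, (r : AddCircle (2 * Real.pi)) = s ∧ ‖s‖ = |r| ∧
      |r| ≤ Real.pi := by
    obtain ⟨x, rfl⟩ := QuotientAddGroup.mk_surjective s
    refine ⟨x - round ((2 * Real.pi)⁻¹ * x) * (2 * Real.pi), ?_, AddCircle.norm_eq _, ?_⟩
    · rw [AddCircle.coe_sub, ← zsmul_eq_mul, AddCircle.coe_zsmul, AddCircle.coe_period, smul_zero,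
        sub_zero]
    · rw [← AddCircle.norm_eq]
      refine (AddCircle.norm_le_half_period _ Real.two_pi_pos.ne').trans ?_
      rw [abs_of_pos Real.two_pi_pos]; linarith
  have hpi := Real.pi_gt_three
  have hterm : ∀ n : ℤ, Real.exp (-(2 * Real.pi * n - r) ^ 2 / (4 * t)) ≤
      (if n = 0 then Real.exp (-r ^ 2 / (4 * t)) else 0) + t * (2 * (1 + (n : ℝ) ^ 2)⁻¹) := by
    intro n
    split_ifs with hn
    · subst hn
      have : 0 ≤ t * (2 * (1 + ((0 : ℤ) : ℝ) ^ 2)⁻¹) := by positivity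
      simp only [Int.cast_zero, mul_zero, zero_sub, neg_sq] at this ⊢
      linarith
    · rw [zero_add]
      have hn1 : (1 : ℝ) ≤ |(n : ℝ)| := by exact_mod_cast Int.one_le_abs hn
      have hn2 : 1 ≤ (n : ℝ) ^ 2 := by nlinarith [sq_abs (n : ℝ)]
      have h1 : Real.pi * |(n : ℝ)| ≤ |2 * Real.pi * n - r| := by
        have h2 := abs_sub_abs_le_abs_sub (2 * Real.pi * n) r
        rw [abs_mul, abs_of_pos Real.two_pi_pos] at h2
        nlinarith
      have h2 : Real.pi ^ 2 * (n : ℝ) ^ 2 ≤ (2 * Real.pi * n - r) ^ 2 := by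
        rw [← sq_abs (n : ℝ), ← mul_pow, ← sq_abs (2 * Real.pi * n - r)]
        gcongr
      -- For `n ≠ 0`, `π²n² ≥ 9n² ≥ 2(1+n²)`. With `e^{-y} ≤ 1/y` each remaining image is at most
      -- `2t/(1+n²)`, which is summable.
      have h3 : (1 + (n : ℝ) ^ 2) / (2 * t) ≤ (2 * Real.pi * n - r) ^ 2 / (4 * t) := by
        rw [div_le_div_iff₀ (by positivity) (by positivity)]
        have h3 : 2 * (1 + (n : ℝ) ^ 2) ≤ (2 * Real.pi * n - r) ^ 2 := by
          have hp9 : 9 ≤ Real.pi ^ 2 := by nlinarith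
          nlinarith [mul_le_mul_of_nonneg_right hp9 (sq_nonneg (n : ℝ))]
        nlinarith
      have h4 := Real.add_one_le_exp ((2 * Real.pi * n - r) ^ 2 / (4 * t))
      rw [neg_div, Real.exp_neg]
      have h5 : t * (2 * (1 + (n : ℝ) ^ 2)⁻¹) = ((1 + (n : ℝ) ^ 2) / (2 * t))⁻¹ := by
        rw [inv_div]; field_simp
      rw [h5]
      exact inv_anti₀ (by positivity) (by linarith)
  have hsum0 : Summable fun n : ℤ => (if n = 0 then Real.exp (-r ^ 2 / (4 * t)) else 0) :=
    (hasSum_ite_eq 0 _).summable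
  have hsum1 : Summable fun n : ℤ => t * (2 * (1 + (n : ℝ) ^ 2)⁻¹) :=
    (summable_inv_sq.mul_left 2).mul_left t
  have hsum : Summable fun n : ℤ => Real.exp (-(2 * Real.pi * n - r) ^ 2 / (4 * t)) :=
    Summable.of_nonneg_of_le (fun n => (Real.exp_pos _).le) hterm (hsum0.add hsum1)
  rw [← hr, theta_eq ht, norm_mul, Complex.norm_real, Real.norm_of_nonneg (Real.sqrt_nonneg _), hr,
    hs, sq_abs, ← Complex.ofReal_tsum, Complex.norm_real,
    Real.norm_of_nonneg (tsum_nonneg fun n => (Real.exp_pos _).le)]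
  refine mul_le_mul_of_nonneg_left ?_ (Real.sqrt_nonneg _)
  refine (hsum.tsum_le_tsum hterm (hsum0.add hsum1)).trans (le_of_eq ?_)
  rw [hsum0.tsum_add hsum1, tsum_ite_eq, tsum_mul_left, tsum_mul_left]
  ring

/-- The heat kernel of `1 - Δ` on the torus, up to normalization. -/
def heat (t : ℝ) (x : T2) : ℂ := (Real.exp (-t) : ℂ) * (theta t x.1 * theta t x.2)

lemma summable_theta {t : ℝ} (ht : 0 < t) (s : AddCircle (2 * Real.pi)) :
    Summable fun n : ℤ => ‖(Real.exp (-t * (n : ℝ) ^ 2) : ℂ) * fourier n s‖ := by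
  simp only [norm_theta_term]; exact summable_exp_neg_mul_sq ht

lemma exp_lam (t : ℝ) (k : ℤ × ℤ) : Real.exp (-(t * lam k)) =
    Real.exp (-t) * (Real.exp (-t * (k.1 : ℝ) ^ 2) * Real.exp (-t * (k.2 : ℝ) ^ 2)) := by
  rw [← Real.exp_add, ← Real.exp_add, lam]; congr 1; ring

lemma summable_exp_lam {t : ℝ} (ht : 0 < t) : Summable fun k => Real.exp (-(t * lam k)) := by
  simp only [exp_lam]
  exact (Summable.mul_of_nonneg (summable_exp_neg_mul_sq ht) (summable_exp_neg_mul_sq ht)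
    (fun n => (Real.exp_pos _).le) fun n => (Real.exp_pos _).le).mul_left _

lemma hasSum_heat {t : ℝ} (ht : 0 < t) (x : T2) :
    HasSum (fun k => (Real.exp (-(t * lam k)) : ℂ) * chr k x) (heat t x) := by
  have h1 := (summable_mul_of_summable_norm (summable_theta ht x.1) (summable_theta ht x.2)).hasSum
  rw [← tsum_mul_tsum_of_summable_norm (summable_theta ht x.1) (summable_theta ht x.2)] at h1
  have h2 : (fun k : ℤ × ℤ => (Real.exp (-(t * lam k)) : ℂ) * chr k x) = fun k =>
      (Real.exp (-t) : ℂ) * ((Real.exp (-t * (k.1 : ℝ) ^ 2) : ℂ) * fourier k.1 x.1 *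
        ((Real.exp (-t * (k.2 : ℝ) ^ 2) : ℂ) * fourier k.2 x.2)) := by
    funext k
    rw [exp_lam, chr, Complex.ofReal_mul, Complex.ofReal_mul]; ring
  rw [h2]
  exact h1.mul_left _

/-- For `t ≤ 1` the product of the two one-dimensional bounds is expanded: the cross terms carry a
factor `t` that cancels `π/t`, and the product of the Gaussians is at most the one of the larger
coordinate, as the norm is the maximum norm. For `t > 1` the Fourier series is dominated by its
value at time `1`, and the factor `e^{-t}` comes from the mass. -/
lemma exists_norm_heat_le : ∃ C, 0 ≤ C ∧ ∀ t > 0, ∀ x : T2,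
    ‖heat t x‖ ≤ (if t ≤ 1 then Real.pi / t * Real.exp (-‖x‖ ^ 2 / (4 * t)) else 0) +
      C * Real.exp (-t) := by
  obtain ⟨K, hK0, hK⟩ := exists_norm_theta_le
  set M := ∑' n : ℤ, Real.exp (-1 * (n : ℝ) ^ 2) with hM
  have hM0 : 0 ≤ M := tsum_nonneg fun n => (Real.exp_pos _).le
  refine ⟨Real.exp 1 * (Real.pi * (2 * K + K ^ 2)) + M ^ 2, by positivity, fun t ht x => ?_⟩
  rw [heat, norm_mul, Complex.norm_real, Real.norm_of_nonneg (Real.exp_pos _).le, norm_mul]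
  split_ifs with h1
  · have e1 : Real.exp (-t) ≤ 1 := Real.exp_le_one_iff.2 (by linarith)
    have e2 : 1 ≤ Real.exp 1 * Real.exp (-t) := by
      rw [← Real.exp_add]; exact Real.one_le_exp (by linarith)
    set a := Real.exp (-‖x.1‖ ^ 2 / (4 * t)) with ha
    set b := Real.exp (-‖x.2‖ ^ 2 / (4 * t)) with hb
    have ha0 : 0 < a := Real.exp_pos _
    have hb0 : 0 < b := Real.exp_pos _
    have neg : ∀ r : ℝ, -r ^ 2 / (4 * t) ≤ 0 := fun r => by
      rw [neg_div]; have : 0 ≤ r ^ 2 / (4 * t) := by positivity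
      linarith
    have ha1 : a ≤ 1 := Real.exp_le_one_iff.2 (neg _)
    have hb1 : b ≤ 1 := Real.exp_le_one_iff.2 (neg _)
    have hab : a * b ≤ Real.exp (-‖x‖ ^ 2 / (4 * t)) := by
      rcases le_total ‖x.1‖ ‖x.2‖ with h | h
      · rw [show ‖x‖ = ‖x.2‖ by rw [Prod.norm_def, max_eq_right h]]
        exact mul_le_of_le_one_left hb0.le ha1
      · rw [show ‖x‖ = ‖x.1‖ by rw [Prod.norm_def, max_eq_left h]]
        exact mul_le_of_le_one_right ha0.le hb1
    have h2 : ‖theta t x.1‖ * ‖theta t x.2‖ ≤ Real.pi / t * ((a + K * t) * (b + K * t)) := by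
      calc _ ≤ (√(Real.pi / t) * (a + K * t)) * (√(Real.pi / t) * (b + K * t)) :=
            mul_le_mul (hK t ht _) (hK t ht _) (norm_nonneg _) (by positivity)
        _ = (√(Real.pi / t) * √(Real.pi / t)) * ((a + K * t) * (b + K * t)) := by ring
        _ = _ := by rw [Real.mul_self_sqrt (by positivity)]
    have h3 : Real.pi / t * ((a + K * t) * (b + K * t)) =
        Real.pi / t * (a * b) + Real.pi * (K * (a + b) + K ^ 2 * t) := by
      field_simp; ring
    have h4 : Real.pi * (K * (a + b) + K ^ 2 * t) ≤ Real.pi * (2 * K + K ^ 2) := by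
      refine mul_le_mul_of_nonneg_left ?_ Real.pi_pos.le
      nlinarith [sq_nonneg K]
    have h5 : Real.pi / t * (a * b) ≤ Real.pi / t * Real.exp (-‖x‖ ^ 2 / (4 * t)) := by gcongr
    have h6 : 0 ≤ Real.pi * (2 * K + K ^ 2) := by positivity
    calc Real.exp (-t) * (‖theta t x.1‖ * ‖theta t x.2‖) ≤ 1 * (‖theta t x.1‖ * ‖theta t x.2‖) := by
          gcongr
      _ ≤ Real.pi / t * Real.exp (-‖x‖ ^ 2 / (4 * t)) + 1 * (Real.pi * (2 * K + K ^ 2)) := by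
          linarith
      _ ≤ Real.pi / t * Real.exp (-‖x‖ ^ 2 / (4 * t)) +
            (Real.exp 1 * Real.exp (-t)) * (Real.pi * (2 * K + K ^ 2)) := by gcongr
      _ ≤ _ := by nlinarith [mul_nonneg (sq_nonneg M) (Real.exp_pos (-t)).le]
  · push Not at h1
    have h2 : ∀ s, ‖theta t s‖ ≤ M := by
      intro s
      refine (norm_tsum_le_tsum_norm (summable_theta ht s)).trans ?_
      refine (summable_theta ht s).tsum_le_tsum (fun n => ?_) (summable_exp_neg_mul_sq one_pos)
      rw [norm_theta_term]
      exact Real.exp_le_exp.2 (by nlinarith [sq_nonneg (n : ℝ)])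
    have h3 : ‖theta t x.1‖ * ‖theta t x.2‖ ≤ M * M :=
      mul_le_mul (h2 _) (h2 _) (norm_nonneg _) hM0
    have h4 : 0 ≤ Real.exp 1 * (Real.pi * (2 * K + K ^ 2)) := by positivity
    nlinarith [Real.exp_pos (-t), mul_le_mul_of_nonneg_left h3 (Real.exp_pos (-t)).le,
      mul_nonneg h4 (Real.exp_pos (-t)).le]

/-! ### The regularized Green function -/

/-- The Fourier coefficients of the Green function after smoothing by the heat flow. -/
def greenCoeff (τ : ℝ) (k : ℤ × ℤ) : ℝ := Real.exp (-(τ * lam k)) / lam k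

lemma greenCoeff_nonneg (τ : ℝ) (k : ℤ × ℤ) : 0 ≤ greenCoeff τ k :=
  div_nonneg (Real.exp_pos _).le (lam_pos k).le

lemma summable_greenCoeff {τ : ℝ} (hτ : 0 < τ) : Summable (greenCoeff τ) :=
  Summable.of_nonneg_of_le (greenCoeff_nonneg τ)
    (fun k => div_le_self (Real.exp_pos _).le (one_le_lam k)) (summable_exp_lam hτ)

lemma tendsto_greenCoeff (k : ℤ × ℤ) :
    Tendsto (fun j : ℕ => greenCoeff (1 / ((j : ℝ) + 1)) k) atTop (𝓝 (lam k)⁻¹) := by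
  have h1 := (tendsto_one_div_add_atTop_nhds_zero_nat (𝕜 := ℝ)).mul_const (lam k)
  have h2 := ((Real.continuous_exp.tendsto _).comp h1.neg).div_const (lam k)
  simpa [greenCoeff] using h2

/-- The regularized Green function, up to normalization. -/
def green (τ : ℝ) (x : T2) : ℂ := ∑' k, (greenCoeff τ k : ℂ) * chr k x

lemma norm_green_term (τ : ℝ) (k : ℤ × ℤ) (x : T2) :
    ‖(greenCoeff τ k : ℂ) * chr k x‖ = greenCoeff τ k := by
  rw [norm_mul, norm_chr, mul_one, Complex.norm_real, Real.norm_of_nonneg (greenCoeff_nonneg τ k)]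

/-- `e^{-τλ}/λ = ∫_τ^∞ e^{-tλ} dt`. The smoothing makes the double sum absolutely convergent, and
enlarging the time interval to `(0, ∞)` makes the bound independent of `τ`. -/
lemma enorm_green_le {τ : ℝ} (hτ : 0 < τ) (x : T2) :
    ‖green τ x‖ₑ ≤ ∫⁻ t in Set.Ioi (0 : ℝ), ‖heat t x‖ₑ := by
  have hint : ∀ k : ℤ × ℤ, IntegrableOn (fun t : ℝ => Real.exp (-(t * lam k))) (Set.Ioi τ) := by
    intro k
    refine (integrableOn_exp_mul_Ioi (a := -lam k) (by linarith [lam_pos k]) τ).congr_fun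
      (fun t _ => ?_) measurableSet_Ioi
    change Real.exp _ = Real.exp _
    congr 1; ring
  have hval : ∀ k : ℤ × ℤ, ∫ t in Set.Ioi τ, Real.exp (-(t * lam k)) = greenCoeff τ k := by
    intro k
    have h := integral_exp_mul_Ioi (a := -lam k) (by linarith [lam_pos k]) τ
    rw [greenCoeff, show -(τ * lam k) = -lam k * τ by ring]
    rw [neg_div_neg_eq] at h
    rw [← h]
    congr 1; ext t; congr 1; ring
  have h1 := hasSum_integral_of_summable_integral_norm (μ := volume.restrict (Set.Ioi τ))
    (F := fun (k : ℤ × ℤ) (t : ℝ) => (Real.exp (-(t * lam k)) : ℂ) * chr k x)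
    (fun k => (hint k).ofReal.mul_const _) (by
      refine (summable_greenCoeff hτ).congr fun k => ?_
      rw [← hval]
      refine integral_congr_ae (Eventually.of_forall fun t => ?_)
      dsimp only
      rw [norm_mul, norm_chr, mul_one, Complex.norm_real, Real.norm_of_nonneg (Real.exp_pos _).le])
  have h2 : green τ x = ∫ t in Set.Ioi τ, heat t x := by
    rw [green]
    refine Eq.trans ?_ (h1.tsum_eq.trans ?_)
    · refine tsum_congr fun k => ?_
      rw [integral_mul_const, ← hval, integral_complex_ofReal]
    · refine setIntegral_congr_fun measurableSet_Ioi fun t ht => ?_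
      exact (hasSum_heat (hτ.trans ht) x).tsum_eq
  rw [h2]
  exact (enorm_integral_le_lintegral_enorm _).trans
    (lintegral_mono_set (Set.Ioi_subset_Ioi hτ.le))

/-! ### Integrals in time of the heat kernel bound -/

lemma exp_neg_div_le {r t : ℝ} (hr : 0 < r) (ht : 0 < t) :
    Real.exp (-r ^ 2 / (4 * t)) ≤ 4 * t / r ^ 2 := by
  have h : r ^ 2 / (4 * t) ≤ Real.exp (r ^ 2 / (4 * t)) := by
    linarith [Real.add_one_le_exp (r ^ 2 / (4 * t))]
  rw [neg_div, Real.exp_neg, ← inv_div (_ ^ _) (_ * _)]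
  exact inv_anti₀ (by positivity) h

lemma exp_neg_div_le_sq {r t : ℝ} (hr : 0 < r) (ht : 0 < t) :
    Real.exp (-r ^ 2 / (4 * t)) ≤ 32 * t ^ 2 / r ^ 4 := by
  have h : r ^ 4 / (32 * t ^ 2) ≤ Real.exp (r ^ 2 / (4 * t)) := by
    have h1 := Real.quadratic_le_exp_of_nonneg (x := r ^ 2 / (4 * t)) (by positivity)
    have h2 : 0 ≤ r ^ 2 / (4 * t) := by positivity
    have h3 : r ^ 4 / (32 * t ^ 2) = (r ^ 2 / (4 * t)) ^ 2 / 2 := by field_simp; norm_num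
    linarith
  rw [neg_div, Real.exp_neg, ← inv_div (_ ^ _) (_ * _)]
  exact inv_anti₀ (by positivity) h

/-- Splitting an integral over `(0, 1]` at a point, with a constant bound on the left part. -/
lemma lintegral_Ioc_split_le {q b c : ℝ} {f : ℝ → ℝ≥0∞} {g : ℝ → ℝ} (hq : 0 < q) (hq1 : q ≤ 1)
    (hb : 0 ≤ b) (hc0 : 0 ≤ c) (h1 : ∀ t, 0 < t → t ≤ q → f t ≤ ENNReal.ofReal b)
    (h2 : ∀ t, q < t → t ≤ 1 → f t ≤ ENNReal.ofReal (g t)) (hg : ∀ t, q < t → t ≤ 1 → 0 ≤ g t)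
    (hgi : IntervalIntegrable g volume q 1) (hc : ∫ t in q..1, g t ≤ c) :
    ∫⁻ t in Set.Ioc (0 : ℝ) 1, f t ≤ ENNReal.ofReal (b * q + c) := by
  rw [← Set.Ioc_union_Ioc_eq_Ioc hq.le hq1, ENNReal.ofReal_add (by positivity) hc0]
  refine (lintegral_union_le _ _ _).trans (add_le_add ?_ ?_)
  · calc ∫⁻ t in Set.Ioc 0 q, f t ≤ ∫⁻ _ in Set.Ioc 0 q, ENNReal.ofReal b :=
          setLIntegral_mono' measurableSet_Ioc fun t ht => h1 t ht.1 ht.2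
      _ = ENNReal.ofReal (b * q) := by
          rw [lintegral_const, Measure.restrict_apply_univ, Real.volume_Ioc, sub_zero,
            ENNReal.ofReal_mul hb]
  · calc ∫⁻ t in Set.Ioc q 1, f t ≤ ∫⁻ t in Set.Ioc q 1, ENNReal.ofReal (g t) :=
          setLIntegral_mono' measurableSet_Ioc fun t ht => h2 t ht.1 ht.2
      _ = ENNReal.ofReal (∫ t in Set.Ioc q 1, g t) := by
          rw [ofReal_integral_eq_lintegral_ofReal hgi.1]
          filter_upwards [ae_restrict_mem measurableSet_Ioc] with t ht using hg t ht.1 ht.2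
      _ ≤ ENNReal.ofReal c := by
          rw [← intervalIntegral.integral_of_le hq1]
          exact ENNReal.ofReal_le_ofReal hc

/-- The time integral is split at `min(r², 1)`. Below, `e^{-y} ≤ 1/y` bounds the integrand by
`4π/r²`; above, what remains is `π ∫ dt/t`. This gives the exact coefficient `2π` of the logarithm,
which determines the `4π` in the final estimate. -/
lemma lintegral_heat_log {r : ℝ} (hr : 0 < r) :
    ∫⁻ t in Set.Ioc (0 : ℝ) 1, ENNReal.ofReal (Real.pi / t * Real.exp (-r ^ 2 / (4 * t))) ≤
      ENNReal.ofReal (4 * Real.pi + 2 * Real.pi * Real.posLog r⁻¹) := by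
  have hpi := Real.pi_pos
  set q := min (r ^ 2) 1 with hq
  have hq0 : 0 < q := lt_min (by positivity) one_pos
  have hq1 : q ≤ 1 := min_le_right _ _
  have hqr : q ≤ r ^ 2 := min_le_left _ _
  refine (lintegral_Ioc_split_le (q := q) (b := 4 * Real.pi / r ^ 2) (g := fun t => Real.pi * t⁻¹)
    (c := 2 * Real.pi * Real.posLog r⁻¹) hq0 hq1 (by positivity) ?_ ?_ ?_ ?_ ?_ ?_).trans
    (ENNReal.ofReal_le_ofReal ?_)
  · exact mul_nonneg (by positivity) Real.posLog_nonneg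
  · intro t ht htq
    refine ENNReal.ofReal_le_ofReal ?_
    calc _ ≤ Real.pi / t * (4 * t / r ^ 2) := by gcongr; exact exp_neg_div_le hr ht
      _ = _ := by field_simp
  · intro t ht ht1
    have ht0 := hq0.trans ht
    refine ENNReal.ofReal_le_ofReal ?_
    rw [div_eq_mul_inv]
    refine mul_le_of_le_one_right (by positivity) (Real.exp_le_one_iff.2 ?_)
    rw [neg_div]
    have : 0 ≤ r ^ 2 / (4 * t) := by positivity
    linarith
  · intro t ht ht1
    have ht0 := hq0.trans ht
    positivity
  · refine (intervalIntegral.intervalIntegrable_inv (fun t ht => ?_) continuousOn_id).const_mul _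
    rw [Set.uIcc_of_le hq1] at ht
    exact (hq0.trans_le ht.1).ne'
  · rw [intervalIntegral.integral_const_mul, integral_inv_of_pos hq0 one_pos, one_div]
    have : Real.log q⁻¹ = 2 * Real.posLog r⁻¹ := by
      rcases le_total r 1 with h | h
      · rw [hq, min_eq_left (pow_le_one₀ hr.le h), Real.posLog_eq_log, ← inv_pow, Real.log_pow]
        · norm_cast
        · rw [abs_of_pos (by positivity)]; exact (one_le_inv₀ hr).2 h
      · rw [hq, min_eq_right (one_le_pow₀ h), (Real.posLog_eq_zero_iff _).2]
        · simp
        · rw [abs_of_pos (by positivity)]; exact inv_le_one_of_one_le₀ h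
    rw [this]; linarith
  · have : 4 * Real.pi / r ^ 2 * q ≤ 4 * Real.pi := by
      rw [div_mul_eq_mul_div, div_le_iff₀ (by positivity)]; gcongr
    linarith

/-- The same splitting with the weight `t^{α-1}`. Near `t = 0` the second-order bound `e^{-y} ≤
2/y²` is needed, as the first-order one leaves the unbounded factor `t^{α-1}`. The integral of
`t^{α-2}` above the splitting point produces `1/(1-α)`, the source of the restriction `α < 1`. -/
lemma lintegral_heat_rpow {r α : ℝ} (hr : 0 < r) (hα : α < 1) (hα0 : 0 < α) :
    ∫⁻ t in Set.Ioc (0 : ℝ) 1,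
      ENNReal.ofReal (t ^ (α - 1) * (Real.pi / t * Real.exp (-r ^ 2 / (4 * t)))) ≤
      ENNReal.ofReal (Real.pi * (32 + 1 / (1 - α)) * r ^ (2 * α - 2)) := by
  have hpi := Real.pi_pos
  set q := min (r ^ 2) 1 with hq
  have hq0 : 0 < q := lt_min (by positivity) one_pos
  have hq1 : q ≤ 1 := min_le_right _ _
  have hqr : q ≤ r ^ 2 := min_le_left _ _
  have h1α : 0 < 1 - α := by linarith
  have hsq : (r ^ 2) ^ (α - 1) = r ^ (2 * α - 2) := by
    rw [← Real.rpow_natCast r 2, ← Real.rpow_mul hr.le]; congr 1; push_cast; ring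
  have hsq' : (r ^ 2) ^ α = r ^ (2 * α - 2) * r ^ 2 := by
    rw [← hsq, Real.rpow_sub_one (by positivity)]; field_simp
  refine (lintegral_Ioc_split_le (q := q) (b := 32 * Real.pi * (r ^ 2) ^ α / r ^ 4)
    (g := fun t => Real.pi * t ^ (α - 2))
    (c := Real.pi * (1 / (1 - α)) * r ^ (2 * α - 2)) hq0 hq1 (by positivity) ?_ ?_ ?_ ?_ ?_ ?_).trans
    (ENNReal.ofReal_le_ofReal ?_)
  · positivity
  · intro t ht htq
    refine ENNReal.ofReal_le_ofReal ?_
    have h1 : t ^ α ≤ (r ^ 2) ^ α := Real.rpow_le_rpow ht.le (htq.trans hqr) hα0.le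
    calc _ ≤ t ^ (α - 1) * (Real.pi / t * (32 * t ^ 2 / r ^ 4)) := by
          gcongr; exact exp_neg_div_le_sq hr ht
      _ = 32 * Real.pi * t ^ α / r ^ 4 := by rw [Real.rpow_sub_one ht.ne']; field_simp
      _ ≤ _ := by gcongr
  · intro t ht ht1
    have ht0 := hq0.trans ht
    refine ENNReal.ofReal_le_ofReal ?_
    have : Real.exp (-r ^ 2 / (4 * t)) ≤ 1 := by
      refine Real.exp_le_one_iff.2 ?_
      rw [neg_div]
      have : 0 ≤ r ^ 2 / (4 * t) := by positivity
      linarith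
    calc _ ≤ t ^ (α - 1) * (Real.pi / t * 1) := by gcongr
      _ = _ := by
        rw [show α - 2 = α - 1 - 1 by ring, Real.rpow_sub_one ht0.ne' (α - 1)]; field_simp
  · intro t ht ht1
    have ht0 := hq0.trans ht
    positivity
  · refine (intervalIntegral.intervalIntegrable_rpow (Or.inr ?_)).const_mul _
    rw [Set.uIcc_of_le hq1]
    exact fun h => absurd h.1 (not_le.2 hq0)
  · rw [intervalIntegral.integral_const_mul, integral_rpow (Or.inr ⟨by linarith, by
      rw [Set.uIcc_of_le hq1]; exact fun h => absurd h.1 (not_le.2 hq0)⟩),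
      show α - 2 + 1 = -(1 - α) by ring, Real.one_rpow, mul_assoc]
    refine mul_le_mul_of_nonneg_left ?_ hpi.le
    rw [div_neg, ← neg_div, neg_sub, div_eq_mul_one_div, mul_comm]
    refine mul_le_mul_of_nonneg_left ?_ (by positivity)
    rcases le_total r 1 with h | h
    · rw [hq, min_eq_left (pow_le_one₀ hr.le h), show -(1 - α) = α - 1 by ring, hsq]; linarith
    · rw [hq, min_eq_right (one_le_pow₀ h), Real.one_rpow, sub_self]; positivity
  · have : 32 * Real.pi * (r ^ 2) ^ α / r ^ 4 * q ≤ 32 * Real.pi * r ^ (2 * α - 2) := by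
      calc _ ≤ 32 * Real.pi * (r ^ 2) ^ α / r ^ 4 * r ^ 2 := by gcongr
        _ = _ := by rw [hsq']; field_simp
    linarith

/-! ### Radial integrals on the torus -/

/-- On the fundamental square `(-π, π]²` the norm of the torus is the maximum norm of the plane. -/
lemma lintegral_norm_torus_le {F : ℝ → ℝ≥0∞} (hF : Measurable F) :
    ∫⁻ x : T2, F ‖x‖ ≤ ∫⁻ y : ℝ × ℝ, F ‖y‖ := by
  have hn : ∀ a ∈ Set.Ioc (-Real.pi) (-Real.pi + 2 * Real.pi),
      ‖(a : AddCircle (2 * Real.pi))‖ = ‖a‖ := by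
    intro a ha
    rw [(AddCircle.norm_coe_eq_abs_iff (2 * Real.pi) Real.two_pi_pos.ne').2, Real.norm_eq_abs]
    rw [abs_of_pos Real.two_pi_pos, abs_le]
    constructor <;> linarith [ha.1, ha.2]
  rw [Measure.volume_eq_prod, lintegral_prod _ (by fun_prop),
    Measure.volume_eq_prod, lintegral_prod _ (by fun_prop),
    ← AddCircle.lintegral_preimage (2 * Real.pi) (-Real.pi)]
  refine le_trans (setLIntegral_mono' (g := fun a : ℝ => ∫⁻ b : ℝ, F ‖(a, b)‖) measurableSet_Ioc
    fun a ha => ?_) (setLIntegral_le_lintegral _ _)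
  rw [← AddCircle.lintegral_preimage (2 * Real.pi) (-Real.pi)]
  refine le_trans (setLIntegral_mono' (g := fun b : ℝ => F ‖(a, b)‖) measurableSet_Ioc
    fun b hb => ?_) (setLIntegral_le_lintegral _ _)
  rw [Prod.norm_def, Prod.norm_def, hn a ha, hn b hb]

/-- Polar integration for the maximum norm of the plane: the constant is the dimension `2` times the
volume `4` of the unit ball. -/
lemma lintegral_radial_le {f : ℝ → ℝ} (hf : Measurable f) (h0 : ∀ r, 0 ≤ r → 0 ≤ f r)
    (hi : IntegrableOn (fun y : ℝ => y * f y) (Set.Ioi 0)) :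
    ∫⁻ x : T2, ENNReal.ofReal (f ‖x‖) ≤
      ENNReal.ofReal (8 * ∫ y in Set.Ioi (0 : ℝ), y * f y) := by
  have hdim : Module.finrank ℝ (ℝ × ℝ) = 2 := by simp
  have hi' : Integrable (fun y : ℝ × ℝ => f ‖y‖) := by
    rw [integrable_fun_norm_addHaar, hdim]
    simpa using hi
  have hball : (volume : Measure (ℝ × ℝ)).real (Metric.ball 0 1) = 4 := by
    rw [Measure.real, show (0 : ℝ × ℝ) = (0, 0) from rfl, ← ball_prod_same,
      Measure.volume_eq_prod, Measure.prod_prod, Real.volume_ball, ENNReal.toReal_mul,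
      ENNReal.toReal_ofReal (by norm_num)]
    norm_num
  refine (lintegral_norm_torus_le (F := fun r => ENNReal.ofReal (f r)) (by fun_prop)).trans ?_
  rw [← ofReal_integral_eq_lintegral_ofReal hi' (Eventually.of_forall fun y => h0 _ (norm_nonneg _)),
    integral_fun_norm_addHaar, hdim, hball]
  refine le_of_eq (congrArg _ ?_)
  simp only [Nat.add_one_sub_one, pow_one, smul_eq_mul, nsmul_eq_mul]
  push_cast
  ring

lemma integrableOn_pow_mul_exp {β : ℝ} (hβ : 0 < β) (n : ℕ) :
    IntegrableOn (fun u : ℝ => u ^ n * Real.exp (-(2 * β * u))) (Set.Ioi 0) ∧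
      ∫ u in Set.Ioi (0 : ℝ), u ^ n * Real.exp (-(2 * β * u)) = n.factorial / (2 * β) ^ (n + 1) := by
  have h := Real.integral_rpow_mul_exp_neg_mul_Ioi (a := n + 1) (r := 2 * β) (by positivity)
    (by positivity)
  have h1 : ∫ u in Set.Ioi (0 : ℝ), u ^ n * Real.exp (-(2 * β * u)) =
      n.factorial / (2 * β) ^ (n + 1) := by
    rw [Real.Gamma_nat_eq_factorial, add_sub_cancel_right] at h
    simp only [Real.rpow_natCast] at h
    rw [h, ← Nat.cast_succ, Real.rpow_natCast, one_div, inv_pow]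
    field_simp
  refine ⟨?_, h1⟩
  -- A nonintegrable function has integral `0` by convention, so the positive value just computed
  -- already proves integrability.
  refine Integrable.of_integral_ne_zero ?_
  rw [h1]
  positivity

/-- The substitution `y = e^{-u}` turns this into a Gamma integral. As `n ≠ 0`, the integrand
vanishes for `y ≥ 1`. -/
lemma integral_rpow_mul_log {β : ℝ} (hβ : 0 < β) {n : ℕ} (hn : n ≠ 0) :
    IntegrableOn (fun y : ℝ => y * (y ^ (2 * β - 2) * Real.posLog y⁻¹ ^ n)) (Set.Ioi 0) ∧
      ∫ y in Set.Ioi (0 : ℝ), y * (y ^ (2 * β - 2) * Real.posLog y⁻¹ ^ n) =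
        n.factorial / (2 * β) ^ (n + 1) := by
  set g : ℝ → ℝ := fun y => y * (y ^ (2 * β - 2) * Real.posLog y⁻¹ ^ n) with hg
  have himg : (fun u : ℝ => Real.exp (-u)) '' Set.Ioi 0 = Set.Ioo 0 1 := by
    ext y
    constructor
    · rintro ⟨u, hu, rfl⟩
      exact ⟨Real.exp_pos _, Real.exp_lt_one_iff.2 (by simpa using hu)⟩
    · rintro ⟨h0, h1⟩
      exact ⟨-Real.log y, by simpa using Real.log_neg h0 h1, by simp [Real.exp_log h0]⟩
  have hder : ∀ u ∈ Set.Ioi (0 : ℝ), HasDerivWithinAt (fun u : ℝ => Real.exp (-u))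
      (-Real.exp (-u)) (Set.Ioi 0) u := by
    intro u _
    have := ((hasDerivAt_neg u).exp).hasDerivWithinAt (s := Set.Ioi 0)
    simpa using this
  have hinj : Set.InjOn (fun u : ℝ => Real.exp (-u)) (Set.Ioi 0) := fun u _ v _ h => by
    simpa using h
  have hval : ∀ u ∈ Set.Ioi (0 : ℝ), |-Real.exp (-u)| • g (Real.exp (-u)) =
      u ^ n * Real.exp (-(2 * β * u)) := by
    intro u hu
    have hu0 : (0 : ℝ) < u := hu
    simp only [hg, abs_neg, abs_of_pos (Real.exp_pos _), smul_eq_mul]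
    rw [← Real.exp_neg, neg_neg, Real.posLog_eq_log (by
      rw [abs_of_pos (Real.exp_pos _)]; exact Real.one_le_exp hu0.le), Real.log_exp,
      ← Real.exp_mul, ← mul_assoc, ← mul_assoc, ← Real.exp_add, ← Real.exp_add, mul_comm]
    congr 2; ring
  have hzero : ∀ y ∈ Set.Ioi (0 : ℝ) \ Set.Ioo 0 1, g y = 0 := by
    rintro y ⟨h0, h1⟩
    have h0' : (0 : ℝ) < y := h0
    have hy : 1 ≤ y := by
      by_contra hc
      exact h1 ⟨h0, not_le.1 hc⟩
    simp only [hg]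
    rw [(Real.posLog_eq_zero_iff _).2, zero_pow hn, mul_zero, mul_zero]
    rw [abs_of_pos (by positivity)]
    exact inv_le_one_of_one_le₀ hy
  obtain ⟨i1, e1⟩ := integrableOn_pow_mul_exp hβ n
  have i2 : IntegrableOn g (Set.Ioo 0 1) := by
    rw [← himg, integrableOn_image_iff_integrableOn_abs_deriv_smul measurableSet_Ioi hder hinj]
    exact i1.congr_fun (fun u hu => (hval u hu).symm) measurableSet_Ioi
  have i3 : IntegrableOn g (Set.Ioi 0) :=
    i2.of_forall_sdiff_eq_zero measurableSet_Ioi hzero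
  refine ⟨i3, ?_⟩
  have e2 := setIntegral_eq_of_subset_of_forall_sdiff_eq_zero (μ := volume) measurableSet_Ioi
    Set.Ioo_subset_Ioi_self hzero
  rw [← e1, e2, ← himg,
    integral_image_eq_integral_abs_deriv_smul measurableSet_Ioi hder hinj]
  exact setIntegral_congr_fun measurableSet_Ioi hval

lemma integral_rpow_indicator {β : ℝ} (hβ : 0 < β) {R : ℝ} (hR : 0 < R) :
    IntegrableOn (fun y : ℝ => y * (Set.Iic R).indicator (fun r => r ^ (2 * β - 2)) y)
      (Set.Ioi 0) ∧
    ∫ y in Set.Ioi (0 : ℝ), y * (Set.Iic R).indicator (fun r => r ^ (2 * β - 2)) y =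
        R ^ (2 * β) / (2 * β) := by
  have h1 : ∀ y ∈ Set.Ioi (0 : ℝ), y * (Set.Iic R).indicator (fun r => r ^ (2 * β - 2)) y =
      (Set.Iic R).indicator (fun r => r ^ (2 * β - 1)) y := by
    intro y hy
    have hy0 : (0 : ℝ) < y := hy
    by_cases h : y ∈ Set.Iic R
    · rw [Set.indicator_of_mem h, Set.indicator_of_mem h, show 2 * β - 2 = 2 * β - 1 - 1 by ring,
        Real.rpow_sub_one hy0.ne']
      field_simp
    · rw [Set.indicator_of_notMem h, Set.indicator_of_notMem h, mul_zero]
  have hI : IntervalIntegrable (fun r : ℝ => r ^ (2 * β - 1)) volume 0 R :=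
    intervalIntegral.intervalIntegrable_rpow' (by linarith)
  constructor
  · refine IntegrableOn.congr_fun ?_ (fun y hy => (h1 y hy).symm) measurableSet_Ioi
    rw [IntegrableOn, integrable_indicator_iff measurableSet_Iic, IntegrableOn,
      Measure.restrict_restrict measurableSet_Iic, Set.Iic_inter_Ioi]
    exact hI.1
  · rw [setIntegral_congr_fun measurableSet_Ioi h1, setIntegral_indicator measurableSet_Iic,
      Set.Ioi_inter_Iic, ← intervalIntegral.integral_of_le hR.le, integral_rpow (Or.inl (by linarith)),
      sub_add_cancel, Real.zero_rpow (by positivity), sub_zero]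

/-! ### Moments of the logarithmic bound for the Green function. -/

/-- A weighted form of the convexity inequality for powers. -/
lemma add_pow_le_weighted {a b ε : ℝ} (ha : 0 ≤ a) (hb : 0 ≤ b) (hε : 0 < ε) {n : ℕ} (hn : n ≠ 0) :
    (a + b) ^ n ≤ (1 + ε) ^ (n - 1) * a ^ n + ((1 + ε) / ε) ^ (n - 1) * b ^ n := by
  obtain ⟨m, rfl⟩ := Nat.exists_eq_succ_of_ne_zero hn
  have h1 : 0 < 1 + ε := by linarith
  have hx : (1 + ε) * a ∈ Set.Ici (0 : ℝ) := Set.mem_Ici.2 (by positivity)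
  have hy : (1 + ε) / ε * b ∈ Set.Ici (0 : ℝ) := Set.mem_Ici.2 (by positivity)
  have hw1 : 0 ≤ 1 / (1 + ε) := by positivity
  have hw2 : 0 ≤ ε / (1 + ε) := by positivity
  -- Convexity is applied at the points `(1+ε) a` and `((1+ε)/ε) b`, with the weights `1/(1+ε)` and
  -- `ε/(1+ε)`.
  have hc : ConvexOn ℝ (Set.Ici (0 : ℝ)) fun x => x ^ (m + 1) := convexOn_pow (m + 1)
  have h := hc.2 hx hy hw1 hw2 (by field_simp)
  simp only [smul_eq_mul] at h
  have e1 : 1 / (1 + ε) * ((1 + ε) * a) + ε / (1 + ε) * ((1 + ε) / ε * b) = a + b := by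
    field_simp
  rw [e1] at h
  refine h.trans (le_of_eq ?_)
  simp only [Nat.succ_eq_add_one, Nat.add_sub_cancel, mul_pow, div_pow, pow_succ]
  field_simp

/-- The pointwise bound for the Green function. -/
def greenBound (C : ℝ) (x : T2) : ℝ := 2 * Real.pi * Real.posLog ‖x‖⁻¹ + C

lemma measurable_posLog : Measurable Real.posLog :=
  measurable_const.max Real.measurable_log

lemma measurable_greenBound (C : ℝ) : Measurable (greenBound C) :=
  ((measurable_posLog.comp measurable_norm.inv).const_mul _).add_const _

lemma greenBound_nonneg {C : ℝ} (hC : 0 ≤ C) (x : T2) : 0 ≤ greenBound C x :=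
  add_nonneg (mul_nonneg Real.two_pi_pos.le Real.posLog_nonneg) hC

lemma norm_torus_le (x : T2) : ‖x‖ ≤ Real.pi := by
  have h : ∀ s : AddCircle (2 * Real.pi), ‖s‖ ≤ Real.pi := fun s => by
    refine (AddCircle.norm_le_half_period _ Real.two_pi_pos.ne').trans ?_
    rw [abs_of_pos Real.two_pi_pos]; linarith
  exact max_le (h _) (h _)

/-- The leading constant is `8 β (2π)ⁿ n!/(2β)^{n+1} = 4 (π/β)ⁿ n!`. With `β = 1` the weight is
trivial, as needed for testing against `g ∈ H`; with `β = α` it is the singularity of the kernel of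
`(1-Δ)^{-α}`, as needed for `H^{-α}`. -/
lemma lintegral_greenBound_le {β C ε : ℝ} (hβ : 0 < β) (hβ1 : β ≤ 1) (hC : 0 ≤ C) (hε : 0 < ε)
    {n : ℕ} (hn : n ≠ 0) :
    ∫⁻ x : T2, ENNReal.ofReal (β * ‖x‖ ^ (2 * β - 2) * greenBound C x ^ n) ≤
      ENNReal.ofReal (4 * (Real.pi / β) ^ n * n.factorial * (1 + ε) ^ (n - 1) +
        4 * Real.pi ^ 2 * C ^ n * ((1 + ε) / ε) ^ (n - 1)) := by
  have hpi := Real.pi_pos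
  obtain ⟨i1, e1⟩ := integral_rpow_mul_log hβ hn
  obtain ⟨i2, e2⟩ := integral_rpow_indicator hβ Real.pi_pos
  set A := β * (1 + ε) ^ (n - 1) * (2 * Real.pi) ^ n with hA
  set B := β * ((1 + ε) / ε) ^ (n - 1) * C ^ n with hB
  have hA0 : 0 ≤ A := by positivity
  have hB0 : 0 ≤ B := by positivity
  set f : ℝ → ℝ := fun r => A * (r ^ (2 * β - 2) * Real.posLog r⁻¹ ^ n) +
    B * (Set.Iic Real.pi).indicator (fun r => r ^ (2 * β - 2)) r with hf
  have hfm : Measurable f := by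
    have := measurable_posLog
    refine Measurable.add (Measurable.const_mul (Measurable.mul (by fun_prop)
      ((measurable_posLog.comp measurable_inv).pow_const n)) _)
      (Measurable.const_mul (Measurable.indicator (by fun_prop) measurableSet_Iic) _)
  have hf0 : ∀ r, 0 ≤ r → 0 ≤ f r := by
    intro r hr
    have h1 : 0 ≤ r ^ (2 * β - 2) := Real.rpow_nonneg hr _
    have h2 : 0 ≤ (Set.Iic Real.pi).indicator (fun r : ℝ => r ^ (2 * β - 2)) r := by
      by_cases h : r ∈ Set.Iic Real.pi
      · rwa [Set.indicator_of_mem h]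
      · rw [Set.indicator_of_notMem h]
    have h3 : 0 ≤ Real.posLog r⁻¹ := Real.posLog_nonneg
    simp only [hf]; positivity
  have hyf : (fun y : ℝ => y * f y) = fun y =>
      A * (y * (y ^ (2 * β - 2) * Real.posLog y⁻¹ ^ n)) +
      B * (y * (Set.Iic Real.pi).indicator (fun r => r ^ (2 * β - 2)) y) := by
    funext y; simp only [hf]; ring
  have hfi : IntegrableOn (fun y : ℝ => y * f y) (Set.Ioi 0) := by
    rw [hyf]; exact (i1.const_mul A).add (i2.const_mul B)
  refine le_trans (lintegral_mono fun x => ?_) ((lintegral_radial_le hfm hf0 hfi).trans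
    (ENNReal.ofReal_le_ofReal ?_))
  · refine ENNReal.ofReal_le_ofReal ?_
    have h1 := add_pow_le_weighted (a := 2 * Real.pi * Real.posLog ‖x‖⁻¹) (b := C)
      (mul_nonneg (by positivity) Real.posLog_nonneg) hC hε hn
    have h2 : 0 ≤ β * ‖x‖ ^ (2 * β - 2) := by positivity
    refine (mul_le_mul_of_nonneg_left h1 h2).trans (le_of_eq ?_)
    simp only [hf]
    rw [Set.indicator_of_mem (show ‖x‖ ∈ Set.Iic Real.pi from norm_torus_le x), hA, hB]
    ring
  · rw [hyf, integral_add (i1.const_mul A) (i2.const_mul B), integral_const_mul,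
      integral_const_mul, e1, e2, mul_add]
    refine add_le_add (le_of_eq ?_) ?_
    · rw [hA, div_pow, mul_pow, mul_pow, pow_succ, pow_succ]
      field_simp
      norm_num
    · have h1 : Real.pi ^ (2 * β) ≤ Real.pi ^ 2 := by
        rw [← Real.rpow_natCast]
        exact Real.rpow_le_rpow_of_exponent_le (by linarith [Real.pi_gt_three]) (by push_cast; linarith)
      have h2 : 8 * (B * (Real.pi ^ (2 * β) / (2 * β))) =
          4 * Real.pi ^ (2 * β) * C ^ n * ((1 + ε) / ε) ^ (n - 1) := by
        rw [hB]; field_simp; ring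
      rw [h2]
      gcongr

lemma norm_torus_pos {x : T2} (hx : x ≠ 0) : 0 < ‖x‖ := norm_pos_iff.2 hx

/-- The times `t ≤ 1` give the logarithm and `4π`, the remainder gives `C ∫ e^{-t} dt`; nothing
depends on `τ`. The origin has to be excluded: there the logarithmic term is `0` by the convention
for the inverse of `0`, while the Green function is unbounded as `τ → 0`. -/
lemma exists_enorm_green_le : ∃ C, 0 ≤ C ∧ ∀ τ > 0, ∀ x : T2, x ≠ 0 →
    ‖green τ x‖ₑ ≤ ENNReal.ofReal (greenBound C x) := by
  obtain ⟨C, hC0, hC⟩ := exists_norm_heat_le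
  have hpi := Real.pi_pos
  refine ⟨4 * Real.pi + C, by positivity, fun τ hτ x hx => (enorm_green_le hτ x).trans ?_⟩
  have hr := norm_torus_pos hx
  have h1 : ∫⁻ t in Set.Ioi (0 : ℝ), ‖heat t x‖ₑ ≤ ∫⁻ t in Set.Ioi (0 : ℝ),
      ((Set.Ioc (0 : ℝ) 1).indicator (fun t => ENNReal.ofReal
        (Real.pi / t * Real.exp (-‖x‖ ^ 2 / (4 * t)))) t + ENNReal.ofReal (C * Real.exp (-t))) := by
    refine setLIntegral_mono' measurableSet_Ioi fun t ht => ?_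
    have ht0 : (0 : ℝ) < t := ht
    rw [← ofReal_norm]
    refine (ENNReal.ofReal_le_ofReal (hC t ht0 x)).trans (ENNReal.ofReal_add_le.trans ?_)
    refine add_le_add_left ?_ _
    split_ifs with h
    · rw [Set.indicator_of_mem (show t ∈ Set.Ioc (0 : ℝ) 1 from ⟨ht0, h⟩)]
    · simp
  have h2 : ∫⁻ t in Set.Ioi (0 : ℝ), ENNReal.ofReal (C * Real.exp (-t)) = ENNReal.ofReal C := by
    have hi : IntegrableOn (fun t : ℝ => C * Real.exp (-t)) (Set.Ioi 0) :=
      (integrableOn_exp_neg_Ioi 0).const_mul C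
    rw [← ofReal_integral_eq_lintegral_ofReal hi (Eventually.of_forall fun t => by positivity),
      integral_const_mul, integral_exp_neg_Ioi_zero, mul_one]
  refine h1.trans ?_
  rw [lintegral_add_right _ (by fun_prop), h2, lintegral_indicator measurableSet_Ioc,
    Measure.restrict_restrict measurableSet_Ioc,
    Set.inter_eq_left.2 Set.Ioc_subset_Ioi_self]
  refine (add_le_add_left (lintegral_heat_log hr) _).trans ?_
  rw [← ENNReal.ofReal_add (add_nonneg (by positivity)
    (mul_nonneg (by positivity) Real.posLog_nonneg)) hC0]
  refine ENNReal.ofReal_le_ofReal (le_of_eq ?_)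
  rw [greenBound]; ring

/-! ### Sums over tuples of frequencies -/

/-- The product of the `λ⁻¹` over a tuple of frequencies. -/
def wgt {n : ℕ} (κ : Fin n → ℤ × ℤ) : ℝ := ∏ i, (lam (κ i))⁻¹

lemma wgt_nonneg {n : ℕ} (κ : Fin n → ℤ × ℤ) : 0 ≤ wgt κ :=
  Finset.prod_nonneg fun _ _ => inv_nonneg.2 (lam_pos _).le

/-- The tuples of frequencies in `S`. -/
abbrev tuples (n : ℕ) (S : Finset (ℤ × ℤ)) : Finset (Fin n → ℤ × ℤ) :=
  Fintype.piFinset fun _ => S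

lemma sum_chr_pow (a : ℤ × ℤ → ℂ) (S : Finset (ℤ × ℤ)) (n : ℕ) (x : T2) :
    (∑ k ∈ S, a k * chr k x) ^ n =
      ∑ κ ∈ tuples n S, (∏ i, a (κ i)) * chr (∑ i, κ i) x := by
  have h := Finset.prod_univ_sum (fun _ : Fin n => S) fun _ k => a k * chr k x
  rw [Finset.prod_const, Finset.card_univ, Fintype.card_fin] at h
  rw [h]
  refine Finset.sum_congr rfl fun κ _ => ?_
  rw [Finset.prod_mul_distrib, chr_sum]

lemma summable_green {τ : ℝ} (hτ : 0 < τ) (x : T2) :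
    Summable fun k => (greenCoeff τ k : ℂ) * chr k x :=
  Summable.of_norm ((summable_greenCoeff hτ).congr fun k => (norm_green_term τ k x).symm)

/-- The full sum over tuples is the integral of `W` against the `n`-th power of the Green function.
All terms are nonnegative, so each finite partial sum is at most the whole, and absolute values may
then be taken inside the integral. -/
lemma sum_greenCoeff_le {W : T2 → ℂ} (hW : Continuous W) {w : ℤ × ℤ → ℝ} (hw : ∀ k, 0 ≤ w k)
    (hWw : ∀ k, ∫ x, W x * chr k x = (w k : ℂ)) {τ : ℝ} (hτ : 0 < τ) (n : ℕ)
    (S : Finset (ℤ × ℤ)) :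
    ENNReal.ofReal (∑ κ ∈ tuples n S, (∏ i, greenCoeff τ (κ i)) * w (∑ i, κ i)) ≤
      ∫⁻ x, ‖W x‖ₑ * ‖green τ x‖ₑ ^ n := by
  set r : Finset (ℤ × ℤ) → ℝ := fun S =>
    ∑ κ ∈ tuples n S, (∏ i, greenCoeff τ (κ i)) * w (∑ i, κ i) with hr
  have hterm : ∀ κ : Fin n → ℤ × ℤ, 0 ≤ (∏ i, greenCoeff τ (κ i)) * w (∑ i, κ i) := fun κ =>
    mul_nonneg (Finset.prod_nonneg fun i _ => greenCoeff_nonneg τ _) (hw _)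
  have hr0 : ∀ S, 0 ≤ r S := fun S => Finset.sum_nonneg fun κ _ => hterm κ
  have hmono : ∀ S', S ⊆ S' → r S ≤ r S' := fun S' h =>
    Finset.sum_le_sum_of_subset_of_nonneg (Fintype.piFinset_subset _ _ fun _ => h)
      fun κ _ _ => hterm κ
  -- Expanding the power of the trigonometric polynomial into characters produces the coefficient of
  -- `W` at the sum of the tuple.
  have hrI : ∀ S, (r S : ℂ) = ∫ x, W x * (∑ k ∈ S, (greenCoeff τ k : ℂ) * chr k x) ^ n := by
    intro S
    simp only [sum_chr_pow, Finset.mul_sum]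
    rw [integral_finsetSum]
    · simp only [hr, Complex.ofReal_sum, Complex.ofReal_mul, Complex.ofReal_prod, ← hWw,
        ← integral_const_mul]
      refine Finset.sum_congr rfl fun κ _ => integral_congr_ae (Eventually.of_forall fun x => ?_)
      dsimp only; ring
    · exact fun κ _ => integrable_of_continuous (hW.mul (continuous_const.mul (continuous_chr _)))
  have hlim : Tendsto (fun S => (r S : ℂ)) atTop (𝓝 (∫ x, W x * green τ x ^ n)) := by
    simp only [hrI]
    refine tendsto_integral_filter_of_dominated_convergence
      (fun x => ‖W x‖ * (∑' k, greenCoeff τ k) ^ n) ?_ ?_ ?_ ?_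
    · exact Eventually.of_forall fun S => (hW.mul ((continuous_finsetSum _ fun k _ =>
        continuous_const.mul (continuous_chr k)).pow n)).aestronglyMeasurable
    · refine Eventually.of_forall fun S => Eventually.of_forall fun x => ?_
      rw [norm_mul, norm_pow]
      gcongr
      refine (norm_sum_le _ _).trans ?_
      simp only [norm_green_term]
      exact (summable_greenCoeff hτ).sum_le_tsum _ fun k _ => greenCoeff_nonneg τ k
    · have : Integrable fun x => ‖W x‖ := (integrable_of_continuous hW).norm
      exact this.mul_const _
    · exact Eventually.of_forall fun x => ((summable_green hτ x).hasSum.pow n).const_mul _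
  have h1 : r S ≤ ‖∫ x, W x * green τ x ^ n‖ := by
    refine ge_of_tendsto hlim.norm ?_
    filter_upwards [eventually_ge_atTop S] with S' hS'
    rw [Complex.norm_real, Real.norm_of_nonneg (hr0 S')]
    exact hmono S' hS'
  calc ENNReal.ofReal (r S) ≤ ENNReal.ofReal ‖∫ x, W x * green τ x ^ n‖ :=
        ENNReal.ofReal_le_ofReal h1
    _ = ‖∫ x, W x * green τ x ^ n‖ₑ := ofReal_norm _
    _ ≤ ∫⁻ x, ‖W x * green τ x ^ n‖ₑ := enorm_integral_le_lintegral_enorm _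
    _ = _ := by simp only [enorm_mul, enorm_pow]

lemma ae_ne_zero : ∀ᵐ x : T2, x ≠ 0 := by
  have h : (volume : Measure T2) {0} = 0 := by
    rw [show ({0} : Set T2) = {0} ×ˢ {0} by ext; simp [Prod.ext_iff], Measure.volume_eq_prod,
      Measure.prod_prod]
    have h0 : (volume : Measure (AddCircle (2 * Real.pi))) {0} = 0 := by
      rw [← Metric.closedBall_zero, AddCircle.volume_closedBall]
      simp [Real.two_pi_pos.le]
    rw [h0, zero_mul]
  exact compl_mem_ae_iff.2 h

/-- For a fixed finite set of frequencies the smoothed coefficients tend to `(lam k)⁻¹` as `τ → 0`,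
while the bound on the right is uniform in `τ`. -/
lemma exists_sum_wgt_le : ∃ C, 0 ≤ C ∧ ∀ (W : T2 → ℂ), Continuous W → ∀ w : ℤ × ℤ → ℝ,
    (∀ k, 0 ≤ w k) → (∀ k, ∫ x, W x * chr k x = (w k : ℂ)) → ∀ (n : ℕ) (S : Finset (ℤ × ℤ)),
    ENNReal.ofReal (∑ κ ∈ tuples n S, wgt κ * w (∑ i, κ i)) ≤
      ∫⁻ x, ‖W x‖ₑ * ENNReal.ofReal (greenBound C x ^ n) := by
  obtain ⟨C, hC0, hC⟩ := exists_enorm_green_le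
  refine ⟨C, hC0, fun W hW w hw hWw n S => ?_⟩
  have h1 : ∀ τ > 0, ENNReal.ofReal
      (∑ κ ∈ tuples n S, (∏ i, greenCoeff τ (κ i)) * w (∑ i, κ i)) ≤
      ∫⁻ x, ‖W x‖ₑ * ENNReal.ofReal (greenBound C x ^ n) := by
    intro τ hτ
    refine (sum_greenCoeff_le hW hw hWw hτ n S).trans (lintegral_mono_ae ?_)
    filter_upwards [ae_ne_zero] with x hx
    rw [ENNReal.ofReal_pow (greenBound_nonneg hC0 x)]
    gcongr
    exact hC τ hτ x hx
  have h2 : Tendsto (fun j : ℕ => ENNReal.ofReal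
      (∑ κ ∈ tuples n S, (∏ i, greenCoeff (1 / ((j : ℝ) + 1)) (κ i)) * w (∑ i, κ i))) atTop
      (𝓝 (ENNReal.ofReal (∑ κ ∈ tuples n S, wgt κ * w (∑ i, κ i)))) := by
    refine ENNReal.tendsto_ofReal (tendsto_finsetSum _ fun κ _ => Tendsto.mul_const _ ?_)
    exact tendsto_finsetProd _ fun i _ => tendsto_greenCoeff _
  exact le_of_tendsto' h2 fun j => h1 _ (by positivity)

/-- The bound for the sums over tuples with prescribed sum. -/
theorem exists_sum_wgt_fiber_le : ∃ C : ℝ, 1 ≤ C ∧ ∀ (n : ℕ) (ε : ℝ) (S : Finset (ℤ × ℤ))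
    (k : ℤ × ℤ), n ≠ 0 → 0 < ε →
    ((4 * Real.pi ^ 2) ^ (n - 1))⁻¹ * ∑ κ ∈ tuples n S, wgt κ * (if ∑ i, κ i = k then 1 else 0) ≤
      C * (((1 + ε) / (4 * Real.pi)) ^ (n - 1) * n.factorial +
        C ^ n * ((1 + ε) / ε) ^ (n - 1)) := by
  obtain ⟨C, hC0, hC⟩ := exists_sum_wgt_le
  have hpi := Real.pi_pos
  have hpi3 := Real.pi_gt_three
  refine ⟨max 1 C, le_max_left _ _, fun n ε S k hn hε => ?_⟩
  have h4 : ((4 * Real.pi ^ 2 : ℝ) : ℂ) ≠ 0 := by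
    exact_mod_cast (by positivity : (4 * Real.pi ^ 2 : ℝ) ≠ 0)
  -- A normalized character has the indicator of a single frequency as its coefficients, which
  -- selects the tuples with sum `k`.
  have h1 := hC (fun x => ((4 * Real.pi ^ 2 : ℝ) : ℂ)⁻¹ * chr (-k) x)
    (continuous_const.mul (continuous_chr _)) (fun l => if l = k then 1 else 0)
    (fun l => by split_ifs <;> norm_num) (fun l => by
      simp only [mul_assoc, ← chr_add, integral_const_mul, integral_chr, neg_add_eq_zero,
        eq_comm (a := k)]
      split_ifs
      · rw [inv_mul_cancel₀ h4]; simp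
      · simp) n S
  have h2 := lintegral_greenBound_le one_pos le_rfl hC0 hε hn
  have h3 : ∀ x : T2, ‖((4 * Real.pi ^ 2 : ℝ) : ℂ)⁻¹ * chr (-k) x‖ₑ =
      ENNReal.ofReal (4 * Real.pi ^ 2)⁻¹ := by
    intro x
    rw [← ofReal_norm, norm_mul, norm_chr, mul_one, norm_inv, Complex.norm_real,
      Real.norm_of_nonneg (by positivity)]
  simp only [h3] at h1
  simp only [mul_one, sub_self, Real.rpow_zero, one_mul, div_one] at h2
  rw [lintegral_const_mul _ ((measurable_greenBound C).pow_const n).ennreal_ofReal] at h1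
  have h5 := h1.trans (mul_le_mul_right h2 _)
  rw [← ENNReal.ofReal_mul (by positivity), ENNReal.ofReal_le_ofReal_iff (by positivity)] at h5
  have hM : C ≤ max 1 C := le_max_right _ _
  have hM1 : (1 : ℝ) ≤ max 1 C := le_max_left _ _
  set M := max 1 C
  obtain ⟨m, rfl⟩ := Nat.exists_eq_succ_of_ne_zero hn
  simp only [Nat.succ_eq_add_one, Nat.add_sub_cancel] at h5 ⊢
  have hp1 : 1 ≤ (4 * Real.pi ^ 2) ^ m := one_le_pow₀ (by nlinarith)
  calc _ ≤ ((4 * Real.pi ^ 2) ^ m)⁻¹ * ((4 * Real.pi ^ 2)⁻¹ *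
        (4 * Real.pi ^ (m + 1) * (m + 1).factorial * (1 + ε) ^ m +
          4 * Real.pi ^ 2 * C ^ (m + 1) * ((1 + ε) / ε) ^ m)) := by gcongr
    -- Here the base `4π` appears: `4 π^{m+1} / (4π²)^{m+1} = π⁻¹ (4π)^{-m}`.
    _ = Real.pi⁻¹ * (((1 + ε) / (4 * Real.pi)) ^ m * (m + 1).factorial) +
        ((4 * Real.pi ^ 2) ^ m)⁻¹ * (C ^ (m + 1) * ((1 + ε) / ε) ^ m) := by
      simp only [div_pow, mul_pow, pow_succ]; field_simp; simp only [one_pow, one_mul]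
    _ ≤ 1 * (((1 + ε) / (4 * Real.pi)) ^ m * (m + 1).factorial) +
        1 * (M ^ (m + 1) * ((1 + ε) / ε) ^ m) := by
      gcongr
      · exact inv_le_one_of_one_le₀ (by linarith)
      · exact inv_le_one_of_one_le₀ hp1
    _ ≤ _ := by
      rw [← mul_add]
      gcongr

/-! ### Negative powers of `1 - Δ` through the heat flow. -/

lemma continuous_theta {t : ℝ} (ht : 0 < t) : Continuous (theta t) :=
  continuous_tsum (fun n => by fun_prop) (summable_exp_neg_mul_sq ht) fun n s =>
    (norm_theta_term t n s).le

lemma continuous_heat {t : ℝ} (ht : 0 < t) : Continuous (heat t) :=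
  continuous_const.mul (((continuous_theta ht).comp continuous_fst).mul
    ((continuous_theta ht).comp continuous_snd))

lemma integral_heat_mul_chr {t : ℝ} (ht : 0 < t) (k : ℤ × ℤ) :
    ∫ x, heat t x * chr k x = ((4 * Real.pi ^ 2 * Real.exp (-(t * lam k)) : ℝ) : ℂ) := by
  have h1 := hasSum_integral_of_summable_integral_norm (μ := (volume : Measure T2))
    (F := fun (l : ℤ × ℤ) x => (Real.exp (-(t * lam l)) : ℂ) * chr l x * chr k x)
    (fun l => integrable_of_continuous
      ((continuous_const.mul (continuous_chr _)).mul (continuous_chr _))) (by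
      simp only [norm_mul, norm_chr, mul_one, Complex.norm_real,
        Real.norm_of_nonneg (Real.exp_pos _).le, integral_const, smul_eq_mul]
      exact (summable_exp_lam ht).mul_left _)
  have h2 : ∀ x, ∑' l, (Real.exp (-(t * lam l)) : ℂ) * chr l x * chr k x =
      heat t x * chr k x := fun x => ((hasSum_heat ht x).mul_right _).tsum_eq
  simp only [h2] at h1
  refine h1.unique ?_
  have h3 : ∀ l, ∫ x, (Real.exp (-(t * lam l)) : ℂ) * chr l x * chr k x =
      if l = -k then ((4 * Real.pi ^ 2 * Real.exp (-(t * lam k)) : ℝ) : ℂ) else 0 := by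
    intro l
    simp only [mul_assoc, ← chr_add, integral_const_mul, integral_chr]
    by_cases h : l = -k
    · rw [if_pos h, if_pos (by rw [h, neg_add_cancel]), h, lam_neg]
      push_cast; ring
    · rw [if_neg h, if_neg (fun h' => h (eq_neg_of_add_eq_zero_left h')), mul_zero]
  simp only [h3]
  exact hasSum_ite_eq _ _

/-- `l^{-α}` is the integral of `α t^{α-1}` over `(0, 1/l]`, where `e · e^{-tl} ≥ 1`. Compared with
the Gamma integral this loses only the factor `e` and uses times at most `1`, where the heat kernel
bound is Gaussian; the factor `α` is kept explicit. -/
lemma rpow_neg_le_lintegral {l α : ℝ} (hl : 1 ≤ l) (hα : 0 < α) :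
    ENNReal.ofReal (l ^ (-α)) ≤ ∫⁻ t in Set.Ioc (0 : ℝ) 1,
      ENNReal.ofReal (Real.exp 1 * α * t ^ (α - 1)) * ENNReal.ofReal (Real.exp (-(t * l))) := by
  have hl0 : 0 < l := by linarith
  have hl1 : l⁻¹ ≤ 1 := inv_le_one_of_one_le₀ hl
  have hi : IntervalIntegrable (fun t : ℝ => t ^ (α - 1)) volume 0 l⁻¹ :=
    intervalIntegral.intervalIntegrable_rpow' (by linarith)
  have h1 : ENNReal.ofReal (l ^ (-α)) =
      ∫⁻ t in Set.Ioc (0 : ℝ) l⁻¹, ENNReal.ofReal (α * t ^ (α - 1)) := by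
    rw [← ofReal_integral_eq_lintegral_ofReal (hi.1.const_mul α),
      ← intervalIntegral.integral_of_le (inv_nonneg.2 hl0.le), intervalIntegral.integral_const_mul,
      integral_rpow (Or.inl (by linarith)), sub_add_cancel, Real.zero_rpow hα.ne', sub_zero,
      mul_div_cancel₀ _ hα.ne', Real.inv_rpow hl0.le, Real.rpow_neg hl0.le]
    filter_upwards [ae_restrict_mem measurableSet_Ioc] with t ht
    have := ht.1
    positivity
  rw [h1]
  refine le_trans (setLIntegral_mono' measurableSet_Ioc fun t ht => ?_)
    (lintegral_mono_set (Set.Ioc_subset_Ioc_right hl1))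
  have ht0 := ht.1
  rw [← ENNReal.ofReal_mul (by positivity)]
  refine ENNReal.ofReal_le_ofReal ?_
  have h2 : 1 ≤ Real.exp 1 * Real.exp (-(t * l)) := by
    rw [← Real.exp_add]
    refine Real.one_le_exp ?_
    have : t * l ≤ l⁻¹ * l := by gcongr; exact ht.2
    rw [inv_mul_cancel₀ hl0.ne'] at this
    linarith
  calc α * t ^ (α - 1) = 1 * (α * t ^ (α - 1)) := (one_mul _).symm
    _ ≤ (Real.exp 1 * Real.exp (-(t * l))) * (α * t ^ (α - 1)) := by gcongr
    _ = _ := by ring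

/-- For each time `t` the normalized heat kernel plays the role of `W`, with coefficients `e^{-tλ}`.
Integrating against `e α t^{α-1}` and exchanging the integrals leaves, at each point, the time
integral of `lintegral_heat_rpow` and a constant. -/
lemma exists_sum_wgt_rpow_le_lintegral : ∃ C K, 0 ≤ C ∧ 0 ≤ K ∧ ∀ (α : ℝ) (n : ℕ)
    (S : Finset (ℤ × ℤ)), 0 < α → α < 1 →
    ENNReal.ofReal (∑ κ ∈ tuples n S, wgt κ * lam (∑ i, κ i) ^ (-α)) ≤
      ENNReal.ofReal (Real.exp 1) * ∫⁻ x : T2,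
        (ENNReal.ofReal (α * (Real.pi * (32 + 1 / (1 - α)) * ‖x‖ ^ (2 * α - 2))) +
          ENNReal.ofReal K) * ENNReal.ofReal (greenBound C x ^ n) := by
  obtain ⟨C, hC0, hC⟩ := exists_sum_wgt_le
  obtain ⟨K, hK0, hK⟩ := exists_norm_heat_le
  have hpi := Real.pi_pos
  refine ⟨C, K, hC0, hK0, fun α n S hα hα1 => ?_⟩
  have hgm : Measurable fun x => ENNReal.ofReal (greenBound C x ^ n) :=
    ((measurable_greenBound C).pow_const n).ennreal_ofReal
  -- the bound for a fixed time
  have h1 : ∀ t, 0 < t → t ≤ 1 →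
      ENNReal.ofReal (∑ κ ∈ tuples n S, wgt κ * Real.exp (-(t * lam (∑ i, κ i)))) ≤
      ∫⁻ x : T2, ENNReal.ofReal (Real.pi / t * Real.exp (-‖x‖ ^ 2 / (4 * t)) + K) *
        ENNReal.ofReal (greenBound C x ^ n) := by
    intro t ht ht1
    have h4 : ((4 * Real.pi ^ 2 : ℝ) : ℂ) ≠ 0 := by
      exact_mod_cast (by positivity : (4 * Real.pi ^ 2 : ℝ) ≠ 0)
    refine (hC (fun x => ((4 * Real.pi ^ 2 : ℝ) : ℂ)⁻¹ * heat t x)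
      (continuous_const.mul (continuous_heat ht)) (fun k => Real.exp (-(t * lam k)))
      (fun k => (Real.exp_pos _).le) (fun k => by
        simp only [mul_assoc _ (heat t _), integral_const_mul, integral_heat_mul_chr ht]
        rw [Complex.ofReal_mul (4 * Real.pi ^ 2), ← mul_assoc, inv_mul_cancel₀ h4, one_mul]) n S).trans ?_
    refine lintegral_mono fun x => mul_le_mul_left ?_ _
    rw [← ofReal_norm, norm_mul, norm_inv, Complex.norm_real, Real.norm_of_nonneg (by positivity)]
    refine ENNReal.ofReal_le_ofReal ?_
    have h5 := hK t ht x
    rw [if_pos ht1] at h5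
    have h6 : (4 * Real.pi ^ 2)⁻¹ ≤ 1 :=
      inv_le_one_of_one_le₀ (by nlinarith [Real.pi_gt_three])
    have h7 : K * Real.exp (-t) ≤ K :=
      mul_le_of_le_one_right hK0 (Real.exp_le_one_iff.2 (by linarith))
    calc _ ≤ 1 * ‖heat t x‖ := by gcongr
      _ ≤ _ := by linarith
  have hm2 : Measurable (Function.uncurry fun (t : ℝ) (x : T2) =>
      ENNReal.ofReal (Real.exp 1 * α * t ^ (α - 1)) *
        (ENNReal.ofReal (Real.pi / t * Real.exp (-‖x‖ ^ 2 / (4 * t)) + K) *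
        ENNReal.ofReal (greenBound C x ^ n))) := by
    refine Measurable.mul (by fun_prop) (Measurable.mul (by fun_prop) (hgm.comp measurable_snd))
  calc ENNReal.ofReal (∑ κ ∈ tuples n S, wgt κ * lam (∑ i, κ i) ^ (-α))
      = ∑ κ ∈ tuples n S, ENNReal.ofReal (wgt κ) * ENNReal.ofReal (lam (∑ i, κ i) ^ (-α)) := by
        rw [ENNReal.ofReal_sum_of_nonneg fun κ _ => mul_nonneg (wgt_nonneg κ)
          (Real.rpow_nonneg (lam_pos _).le _)]
        exact Finset.sum_congr rfl fun κ _ => ENNReal.ofReal_mul (wgt_nonneg κ)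
    _ ≤ ∑ κ ∈ tuples n S, ENNReal.ofReal (wgt κ) * ∫⁻ t in Set.Ioc (0 : ℝ) 1,
          ENNReal.ofReal (Real.exp 1 * α * t ^ (α - 1)) *
            ENNReal.ofReal (Real.exp (-(t * lam (∑ i, κ i)))) :=
        Finset.sum_le_sum fun κ _ =>
          mul_le_mul_right (rpow_neg_le_lintegral (one_le_lam _) hα) _
    _ = ∫⁻ t in Set.Ioc (0 : ℝ) 1, ENNReal.ofReal (Real.exp 1 * α * t ^ (α - 1)) *
          ENNReal.ofReal (∑ κ ∈ tuples n S, wgt κ * Real.exp (-(t * lam (∑ i, κ i)))) := by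
        simp only [← lintegral_const_mul' _ _ ENNReal.ofReal_ne_top]
        rw [← lintegral_finsetSum _ fun κ _ => by fun_prop]
        refine lintegral_congr fun t => ?_
        rw [ENNReal.ofReal_sum_of_nonneg fun κ _ => mul_nonneg (wgt_nonneg κ)
          (Real.exp_pos _).le, Finset.mul_sum]
        refine Finset.sum_congr rfl fun κ _ => ?_
        rw [ENNReal.ofReal_mul (wgt_nonneg κ)]
        ring
    _ ≤ ∫⁻ t in Set.Ioc (0 : ℝ) 1, ∫⁻ x : T2, ENNReal.ofReal (Real.exp 1 * α * t ^ (α - 1)) *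
        (ENNReal.ofReal (Real.pi / t * Real.exp (-‖x‖ ^ 2 / (4 * t)) + K) *
        ENNReal.ofReal (greenBound C x ^ n)) := by
        refine setLIntegral_mono' measurableSet_Ioc fun t ht => ?_
        rw [lintegral_const_mul' _ _ ENNReal.ofReal_ne_top]
        exact mul_le_mul_right (h1 t ht.1 ht.2) _
    _ = ∫⁻ x : T2, ∫⁻ t in Set.Ioc (0 : ℝ) 1, ENNReal.ofReal (Real.exp 1 * α * t ^ (α - 1)) *
        (ENNReal.ofReal (Real.pi / t * Real.exp (-‖x‖ ^ 2 / (4 * t)) + K) *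
        ENNReal.ofReal (greenBound C x ^ n)) := lintegral_lintegral_swap hm2.aemeasurable
    _ ≤ ∫⁻ x : T2, ENNReal.ofReal (Real.exp 1) *
        ((ENNReal.ofReal (α * (Real.pi * (32 + 1 / (1 - α)) * ‖x‖ ^ (2 * α - 2))) +
          ENNReal.ofReal K) * ENNReal.ofReal (greenBound C x ^ n)) := by
        refine lintegral_mono_ae ?_
        filter_upwards [ae_ne_zero] with x hx
        have hr := norm_torus_pos hx
        simp only [← mul_assoc (ENNReal.ofReal _) (ENNReal.ofReal _) (ENNReal.ofReal _)]
        rw [lintegral_mul_const' _ _ ENNReal.ofReal_ne_top, ← mul_assoc]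
        refine mul_le_mul_left ?_ _
        have h2 : ∀ t ∈ Set.Ioc (0 : ℝ) 1, ENNReal.ofReal (Real.exp 1 * α * t ^ (α - 1)) *
            ENNReal.ofReal (Real.pi / t * Real.exp (-‖x‖ ^ 2 / (4 * t)) + K) =
            ENNReal.ofReal (Real.exp 1) * (ENNReal.ofReal α * ENNReal.ofReal (t ^ (α - 1) *
              (Real.pi / t * Real.exp (-‖x‖ ^ 2 / (4 * t)))) +
              ENNReal.ofReal (K * α * t ^ (α - 1))) := by
          intro t ht
          have ht0 := ht.1
          rw [← ENNReal.ofReal_mul hα.le, ← ENNReal.ofReal_add (by positivity) (by positivity),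
            ← ENNReal.ofReal_mul (by positivity), ← ENNReal.ofReal_mul (by positivity)]
          congr 1; ring
        rw [setLIntegral_congr_fun measurableSet_Ioc h2,
          lintegral_const_mul' _ _ ENNReal.ofReal_ne_top, lintegral_add_right _ (by fun_prop),
          lintegral_const_mul' _ _ ENNReal.ofReal_ne_top, ENNReal.ofReal_mul hα.le]
        refine mul_le_mul_right (add_le_add (mul_le_mul_right (lintegral_heat_rpow hr hα1 hα) _)
          (le_of_eq ?_)) _
        have hi : IntervalIntegrable (fun t : ℝ => t ^ (α - 1)) volume 0 1 :=
          intervalIntegral.intervalIntegrable_rpow' (by linarith)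
        rw [← ofReal_integral_eq_lintegral_ofReal (hi.1.const_mul (K * α)),
          ← intervalIntegral.integral_of_le zero_le_one, intervalIntegral.integral_const_mul,
          integral_rpow (Or.inl (by linarith)), sub_add_cancel, Real.zero_rpow hα.ne', sub_zero,
          Real.one_rpow]
        · congr 1; field_simp
        filter_upwards [ae_restrict_mem measurableSet_Ioc] with t ht
        have := ht.1
        positivity
    _ = _ := lintegral_const_mul' _ _ ENNReal.ofReal_ne_top

/-- The bound for the sums over tuples that are weighted by a negative power of `λ`. -/
theorem exists_sum_wgt_rpow_le {α₀ : ℝ} (hα₀ : α₀ < 1) : ∃ C : ℝ, 1 ≤ C ∧ ∀ (α : ℝ) (n : ℕ) (ε : ℝ)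
    (S : Finset (ℤ × ℤ)), 0 < α → α ≤ α₀ → n ≠ 0 → 0 < ε →
    ((4 * Real.pi ^ 2) ^ (n - 1))⁻¹ * ∑ κ ∈ tuples n S, wgt κ * lam (∑ i, κ i) ^ (-α) ≤
      C * ((α ^ 2)⁻¹ * ((1 + ε) / (4 * Real.pi * α)) ^ (n - 1) * n.factorial +
        C ^ n * ((1 + ε) / ε) ^ (n - 1)) := by
  obtain ⟨C, K, hC0, hK0, hC⟩ := exists_sum_wgt_rpow_le_lintegral
  have hpi := Real.pi_pos
  have hpi3 := Real.pi_gt_three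
  have h1α₀ : 0 < 1 - α₀ := by linarith
  -- `1/(1-α)` is replaced by its value at `α₀`: this is where `α` has to stay away from `1`.
  set D := Real.exp 1 * (Real.pi * (32 + 1 / (1 - α₀)) + K) with hD
  have hD0 : 0 ≤ D := by positivity
  refine ⟨1 + C + 4 * Real.pi ^ 2 * D, by
    have : 0 ≤ 4 * Real.pi ^ 2 * D := by positivity
    linarith, fun α n ε S hα hα' hn hε => ?_⟩
  have hα1 : α < 1 := by linarith
  have h1α : 0 < 1 - α := by linarith
  have h1 := hC α n S hα hα1
  have hgm : Measurable fun x => ENNReal.ofReal (greenBound C x ^ n) :=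
    ((measurable_greenBound C).pow_const n).ennreal_ofReal
  have h2 := lintegral_greenBound_le hα hα1.le hC0 hε hn
  have h3 := lintegral_greenBound_le one_pos le_rfl hC0 hε hn
  set J := 4 * (Real.pi / α) ^ n * n.factorial * (1 + ε) ^ (n - 1) +
        4 * Real.pi ^ 2 * C ^ n * ((1 + ε) / ε) ^ (n - 1) with hJ
  have hJ0 : 0 ≤ J := by positivity
  -- The unweighted integral is no larger than the weighted one because `α < 1`, so one quantity `J`
  -- bounds both contributions.
  have hJ1 : 4 * (Real.pi / 1) ^ n * n.factorial * (1 + ε) ^ (n - 1) +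
        4 * Real.pi ^ 2 * C ^ n * ((1 + ε) / ε) ^ (n - 1) ≤ J := by
    rw [hJ]; gcongr
  simp only [mul_one, sub_self, Real.rpow_zero, one_mul] at h3
  have h4 : ∀ x : T2, (ENNReal.ofReal (α * (Real.pi * (32 + 1 / (1 - α)) * ‖x‖ ^ (2 * α - 2))) +
          ENNReal.ofReal K) * ENNReal.ofReal (greenBound C x ^ n) =
      ENNReal.ofReal (Real.pi * (32 + 1 / (1 - α))) *
        ENNReal.ofReal (α * ‖x‖ ^ (2 * α - 2) * greenBound C x ^ n) +
      ENNReal.ofReal K * ENNReal.ofReal (greenBound C x ^ n) := by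
    intro x
    rw [add_mul, ← ENNReal.ofReal_mul (by positivity), ← ENNReal.ofReal_mul (by positivity)]
    congr 1
    rw [← ENNReal.ofReal_mul (by positivity)]
    congr 1; ring
  have hbound : ∑ κ ∈ tuples n S, wgt κ * lam (∑ i, κ i) ^ (-α) ≤ D * J := by
    rw [← ENNReal.ofReal_le_ofReal_iff (by positivity)]
    refine h1.trans ?_
    simp only [h4]
    rw [lintegral_add_right _ (hgm.const_mul _), lintegral_const_mul' _ _ ENNReal.ofReal_ne_top,
      lintegral_const_mul' _ _ ENNReal.ofReal_ne_top, hD, mul_assoc,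
      ENNReal.ofReal_mul (Real.exp_pos 1).le, add_mul, ENNReal.ofReal_add (by positivity)
        (by positivity), ENNReal.ofReal_mul (p := Real.pi * _) (by positivity), ENNReal.ofReal_mul hK0]
    refine mul_le_mul_right (add_le_add (mul_le_mul' (ENNReal.ofReal_le_ofReal ?_) h2)
      (mul_le_mul_right (h3.trans (ENNReal.ofReal_le_ofReal hJ1)) _)) _
    gcongr
  obtain ⟨m, rfl⟩ := Nat.exists_eq_succ_of_ne_zero hn
  simp only [Nat.succ_eq_add_one, Nat.add_sub_cancel] at hbound hJ ⊢
  have hp1 : 1 ≤ (4 * Real.pi ^ 2) ^ m := one_le_pow₀ (by nlinarith)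
  have hM : C ≤ 1 + C + 4 * Real.pi ^ 2 * D := by
    have : 0 ≤ 4 * Real.pi ^ 2 * D := by positivity
    linarith
  have hM2 : 4 * Real.pi ^ 2 * D ≤ 1 + C + 4 * Real.pi ^ 2 * D := by linarith
  set M := 1 + C + 4 * Real.pi ^ 2 * D
  have hM0 : 0 ≤ M := hC0.trans hM
  calc _ ≤ ((4 * Real.pi ^ 2) ^ m)⁻¹ * (D * J) := by gcongr
    _ = D * ((4 * Real.pi) * (α⁻¹ * ((1 + ε) / (4 * Real.pi * α)) ^ m * (m + 1).factorial) +
        (4 * Real.pi ^ 2) * (((4 * Real.pi ^ 2) ^ m)⁻¹ * (C ^ (m + 1) * ((1 + ε) / ε) ^ m))) := by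
      rw [hJ]
      simp only [div_pow, mul_pow, pow_succ]; field_simp; simp only [one_pow, one_mul]
    -- The computation gives the factor `α⁻¹`; it is weakened to the factor `α⁻²` of the stated
    -- estimate, using `α < 1`.
    _ ≤ D * ((4 * Real.pi ^ 2) * ((α ^ 2)⁻¹ * ((1 + ε) / (4 * Real.pi * α)) ^ m *
          (m + 1).factorial) +
        (4 * Real.pi ^ 2) * (1 * (M ^ (m + 1) * ((1 + ε) / ε) ^ m))) := by
      gcongr
      · nlinarith
      · nlinarith
      · exact inv_le_one_of_one_le₀ hp1
    _ = (4 * Real.pi ^ 2 * D) * ((α ^ 2)⁻¹ * ((1 + ε) / (4 * Real.pi * α)) ^ m *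
          (m + 1).factorial + M ^ (m + 1) * ((1 + ε) / ε) ^ m) := by ring
    _ ≤ _ := by gcongr

/-! ### Real coordinates of real distributions -/

/-- The distribution is real. -/
def IsRealDistr (u : distr) : Prop := ∀ k, fc u (-k) = (starRingEnd ℂ) (fc u k)

lemma Sobolev.isReal {s : ℝ} (u : Sobolev s) : IsRealDistr u.toDistr := u.2.2

/-- The coordinate of a real distribution with respect to `Re e_k + Im e_k`. -/
def rc (u : distr) (k : ℤ × ℤ) : ℝ := (fc u k).re - (fc u k).im

lemma rc_add (u v : distr) (k : ℤ × ℤ) : rc (u + v) k = rc u k + rc v k := by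
  simp only [rc, fc_add, Complex.add_re, Complex.add_im]; ring

lemma rc_smul (c : ℝ) (u : distr) (k : ℤ × ℤ) : rc (c • u) k = c * rc u k := by
  simp only [rc, fc_smul, Complex.re_ofReal_mul, Complex.im_ofReal_mul]; ring

lemma rc_sub (u v : distr) (k : ℤ × ℤ) : rc (u - v) k = rc u k - rc v k := by
  rw [sub_eq_add_neg, show -v = (-1 : ℝ) • v from (neg_one_smul ℝ v).symm, rc_add, rc_smul]; ring

lemma rc_zero (k : ℤ × ℤ) : rc 0 k = 0 := by simp [rc, fc_zero]

lemma IsRealDistr.rc_neg {u : distr} (hu : IsRealDistr u) (k : ℤ × ℤ) :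
    rc u (-k) = (fc u k).re + (fc u k).im := by
  rw [rc, hu k, Complex.conj_re, Complex.conj_im]; ring

lemma IsRealDistr.norm_sq {u : distr} (hu : IsRealDistr u) (k : ℤ × ℤ) :
    ‖fc u k‖ ^ 2 = (rc u k ^ 2 + rc u (-k) ^ 2) / 2 := by
  rw [hu.rc_neg, rc, ← Complex.normSq_eq_norm_sq, Complex.normSq_apply]; ring

lemma IsRealDistr.re_mul {u v : distr} (hu : IsRealDistr u) (hv : IsRealDistr v) (k : ℤ × ℤ) :
    (fc u k * fc v (-k)).re = (rc u k * rc v k + rc u (-k) * rc v (-k)) / 2 := by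
  rw [hu.rc_neg, hv.rc_neg, hv k, rc, rc, Complex.mul_re, Complex.conj_re, Complex.conj_im]; ring

lemma IsRealDistr.rc_sq_le {u : distr} (hu : IsRealDistr u) (k : ℤ × ℤ) :
    rc u k ^ 2 ≤ 2 * ‖fc u k‖ ^ 2 := by
  rw [hu.norm_sq]; nlinarith [sq_nonneg (rc u (-k))]

lemma IsRealDistr.fc_eq {u : distr} (hu : IsRealDistr u) (k : ℤ × ℤ) :
    fc u k = ((rc u k + rc u (-k)) / 2 : ℝ) + ((rc u (-k) - rc u k) / 2 : ℝ) * Complex.I := by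
  rw [hu.rc_neg, rc]
  apply Complex.ext <;> simp

lemma eq_of_rc {u v : distr} (hu : IsRealDistr u) (hv : IsRealDistr v) (h : ∀ k, rc u k = rc v k) :
    u = v := by
  rw [← sub_eq_zero]
  refine eq_zero_of_fc _ fun k => ?_
  rw [sub_eq_add_neg, show -v = (-1 : ℝ) • v from (neg_one_smul ℝ v).symm, fc_add, fc_smul, hu.fc_eq, hv.fc_eq, h, h]
  push_cast; ring

lemma hasSum_symm {f : ℤ × ℤ → ℝ} {S : ℝ} (h : HasSum f S) :
    HasSum (fun k => (f k + f (-k)) / 2) S := by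
  have h2 : HasSum (fun k => f (-k)) S := (Equiv.neg (ℤ × ℤ)).hasSum_iff.2 h
  have h3 := (h.add h2).div_const 2
  rwa [add_self_div_two] at h3

/-- The complex and the real expressions differ only by averaging over `k` and `-k`, which does not
change the sum when the weights are even. In this way every Sobolev quantity is computed in the real
coordinates, which are subject to no symmetry constraint. -/
lemma hasSum_re_mul {u v : distr} (hu : IsRealDistr u) (hv : IsRealDistr v) {w : ℤ × ℤ → ℝ}
    (hw : ∀ k, w (-k) = w k) {S : ℝ} (h : HasSum (fun k => w k * (rc u k * rc v k)) S) :
    HasSum (fun k => w k * (fc u k * fc v (-k)).re) S := by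
  convert hasSum_symm h using 2 with k
  rw [hu.re_mul hv, hw]; ring

lemma lam_rpow_pos (k : ℤ × ℤ) (s : ℝ) : 0 < lam k ^ s := Real.rpow_pos_of_pos (lam_pos k) s

lemma IsRealDistr.summable_rc_sq {u : distr} (hu : IsRealDistr u) {w : ℤ × ℤ → ℝ}
    (hw : ∀ k, 0 ≤ w k) (h : Summable fun k => w k * ‖fc u k‖ ^ 2) :
    Summable fun k => w k * rc u k ^ 2 := by
  refine Summable.of_nonneg_of_le (fun k => mul_nonneg (hw k) (sq_nonneg _)) (fun k => ?_)
    (h.mul_left 2)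
  nlinarith [mul_le_mul_of_nonneg_left (hu.rc_sq_le k) (hw k)]

lemma Sobolev.summable_rc {s : ℝ} (u : Sobolev s) :
    Summable fun k => lam k ^ s * rc u.toDistr k ^ 2 :=
  u.isReal.summable_rc_sq (fun k => (lam_rpow_pos k s).le) u.2.1

lemma Sobolev.summable_rc_mul {s : ℝ} (u v : Sobolev s) :
    Summable fun k => lam k ^ s * (rc u.toDistr k * rc v.toDistr k) := by
  refine Summable.of_norm_bounded (u.summable_rc.add v.summable_rc) fun k => ?_
  rw [norm_mul, Real.norm_of_nonneg (lam_rpow_pos k s).le, Real.norm_eq_abs, ← mul_add]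
  refine mul_le_mul_of_nonneg_left ?_ (lam_rpow_pos k s).le
  rw [abs_le]
  constructor <;> nlinarith [sq_nonneg (rc u.toDistr k + rc v.toDistr k),
    sq_nonneg (rc u.toDistr k - rc v.toDistr k), sq_nonneg (rc u.toDistr k),
    sq_nonneg (rc v.toDistr k)]

lemma Sobolev.hasSum_inner {s : ℝ} (u v : Sobolev s) :
    HasSum (fun k => lam k ^ s * (rc u.toDistr k * rc v.toDistr k)) ⟪u, v⟫_ℝ := by
  have h1 := (Sobolev.summable_rc_mul u v).hasSum
  have h2 := hasSum_re_mul u.isReal v.isReal (w := fun k => lam k ^ s)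
    (fun k => by rw [lam_neg]) h1
  have h3 : ⟪u, v⟫_ℝ = ∑' k, lam k ^ s * (u.coeff k * v.coeff (-k)).re := rfl
  rw [h3, h2.tsum_eq]
  exact h1

lemma Sobolev.hasSum_norm_sq {s : ℝ} (u : Sobolev s) :
    HasSum (fun k => lam k ^ s * rc u.toDistr k ^ 2) (‖u‖ ^ 2) := by
  have h := Sobolev.hasSum_inner u u
  rw [real_inner_self_eq_norm_sq] at h
  simpa only [pow_two] using h

lemma Sobolev.toDistr_sub {s : ℝ} (u v : Sobolev s) :
    (u - v).toDistr = u.toDistr - v.toDistr := rfl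

lemma Sobolev.toDistr_add {s : ℝ} (u v : Sobolev s) :
    (u + v).toDistr = u.toDistr + v.toDistr := rfl

lemma Sobolev.toDistr_smul {s : ℝ} (c : ℝ) (u : Sobolev s) :
    (c • u).toDistr = c • u.toDistr := rfl

lemma Sobolev.toDistr_sum {s : ℝ} {ι : Type*} (F : Finset ι) (u : ι → Sobolev s) :
    (∑ i ∈ F, u i).toDistr = ∑ i ∈ F, (u i).toDistr := by
  classical
  induction F using Finset.induction_on with
  | empty => rfl
  | insert a F ha ih => rw [Finset.sum_insert ha, Finset.sum_insert ha, Sobolev.toDistr_add, ih]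

lemma rc_sum {ι : Type*} (F : Finset ι) (u : ι → distr) (k : ℤ × ℤ) :
    rc (∑ i ∈ F, u i) k = ∑ i ∈ F, rc (u i) k := by
  classical
  induction F using Finset.induction_on with
  | empty => exact rc_zero k
  | insert a F ha ih => rw [Finset.sum_insert ha, Finset.sum_insert ha, rc_add, ih]

/-- The duality pairing in real coordinates. -/
lemma hasSum_pairing {u v : distr} {s : ℝ} (hu : u ∈ sobolevSet (-s)) (hv : v ∈ sobolevSet s) :
    HasSum (fun k => rc u k * rc v k) (pairing u v) := by
  have hu' : IsRealDistr u := hu.2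
  have hv' : IsRealDistr v := hv.2
  have hS : Summable fun k => ‖fc u k * fc v (-k)‖ := by
    refine Summable.of_nonneg_of_le (fun k => norm_nonneg _) (fun k => ?_) (hu.1.add hv.1)
    rw [norm_mul, hv' k, RCLike.norm_conj]
    have h1 : lam k ^ (-s) * lam k ^ s = 1 := by
      rw [← Real.rpow_add (lam_pos k), neg_add_cancel, Real.rpow_zero]
    set a := lam k ^ (-s)
    set b := lam k ^ s
    have ha : 0 < a := lam_rpow_pos k _
    have hb : 0 < b := lam_rpow_pos k _
    have h2 : (‖fc u k‖ * ‖fc v k‖) ^ 2 = (a * ‖fc u k‖ ^ 2) * (b * ‖fc v k‖ ^ 2) := by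
      linear_combination (-(‖fc u k‖ ^ 2 * ‖fc v k‖ ^ 2)) * h1
    have h3 : 0 ≤ a * ‖fc u k‖ ^ 2 := by positivity
    have h4 : 0 ≤ b * ‖fc v k‖ ^ 2 := by positivity
    -- The weights `λ^{-s}` and `λ^s` have product `1`, so the square of each term is the product of
    -- the two summable terms and is at most the square of their sum.
    refine abs_le_of_sq_le_sq' ?_ (by positivity) |>.2
    rw [h2]
    nlinarith
  have hR : Summable fun k => rc u k * rc v k := by
    have h1 := hu'.summable_rc_sq (fun k => (lam_rpow_pos k (-s)).le) hu.1
    have h2 := hv'.summable_rc_sq (fun k => (lam_rpow_pos k s).le) hv.1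
    refine Summable.of_norm_bounded (h1.add h2) fun k => ?_
    have h1 : lam k ^ (-s) * lam k ^ s = 1 := by
      rw [← Real.rpow_add (lam_pos k), neg_add_cancel, Real.rpow_zero]
    set a := lam k ^ (-s)
    set b := lam k ^ s
    have ha : 0 < a := lam_rpow_pos k _
    have hb : 0 < b := lam_rpow_pos k _
    have h3 : 0 ≤ a * rc u k ^ 2 := by positivity
    have h4 : 0 ≤ b * rc v k ^ 2 := by positivity
    rw [Real.norm_eq_abs]
    refine abs_le_of_sq_le_sq ?_ (by positivity)
    have h2 : (rc u k * rc v k) ^ 2 = (a * rc u k ^ 2) * (b * rc v k ^ 2) := by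
      linear_combination (-(rc u k ^ 2 * rc v k ^ 2)) * h1
    rw [h2]
    nlinarith
  have h1 := hasSum_re_mul hu' hv' (w := fun _ => 1) (fun _ => rfl)
    (by simpa only [one_mul] using hR.hasSum)
  simp only [one_mul] at h1
  have h2 := Complex.hasSum_re hS.of_norm.hasSum
  rw [pairing, h2.unique h1]
  exact hR.hasSum

/-! ### Distributions with prescribed coordinates -/

lemma fcFn_add (φ ψ : testFn) (k : ℤ × ℤ) :
    fcFn (φ + ψ : testFn).1 k = fcFn φ.1 k + fcFn ψ.1 k := by
  unfold fcFn
  rw [← integral_add]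
  · congr 1
    ext x
    exact add_mul _ _ _
  · exact integrable_of_continuous ((continuous_of_mem φ.2).mul (continuous_expFn _))
  · exact integrable_of_continuous ((continuous_of_mem ψ.2).mul (continuous_expFn _))

lemma fcFn_smul (c : ℂ) (φ : testFn) (k : ℤ × ℤ) :
    fcFn (c • φ : testFn).1 k = c * fcFn φ.1 k := by
  unfold fcFn
  rw [← integral_const_mul]
  congr 1
  ext x
  exact mul_assoc _ _ _

lemma fcFn_expT (k l : ℤ × ℤ) : fcFn (expT k).1 l = if l = k then 1 else 0 := by
  rw [fcFn, ← integral_expFn]; rfl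

/-- The Fourier coefficients of a smooth function decay, in terms of its derivatives. -/
lemma norm_fcFn_mul_le (φ : testFn) {M : ℝ}
    (hM : ∀ i j : ℕ, i + j ≤ 4 → ∀ x, ‖partialDeriv i j φ x‖ ≤ M) (k : ℤ × ℤ) :
    (1 + (k.1 : ℝ) ^ 2) * ((1 + (k.2 : ℝ) ^ 2) * ‖fcFn φ.1 k‖) ≤ 16 * Real.pi ^ 2 * M := by
  have hL : ∀ (v : ℝ × ℝ) (ψ : testFn) (k : ℤ × ℤ),
      fcFn (ψ - dirDeriv v (dirDeriv v ψ) : testFn).1 k =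
        ((1 + (k.1 * v.1 + k.2 * v.2) ^ 2 : ℝ) : ℂ) * fcFn ψ.1 k := by
    intro v ψ k
    rw [fcFn_sub, fcFn_dirDeriv, fcFn_dirDeriv]
    push_cast
    linear_combination (-((k.1 * v.1 + k.2 * v.2 : ℂ) ^ 2 * fcFn ψ.1 k)) * Complex.I_sq
  -- Applying `1 - ∂²` in each variable multiplies the coefficient by `(1+k₁²)(1+k₂²)`. The result
  -- consists of four terms of order at most `4`, each bounded by `M`, on a torus of volume `4π²`.
  set ψ : testFn := φ - dirDeriv (0, 1) (dirDeriv (0, 1) φ) with hψ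
  set χ : testFn := ψ - dirDeriv (1, 0) (dirDeriv (1, 0) ψ) with hχ
  have hd : ∀ i j, i + j ≤ 4 → ∀ x : T2,
      ‖((dirDeriv (1, 0))^[i] ((dirDeriv (0, 1))^[j] φ)).1 x‖ ≤ M := by
    intro i j hij x
    obtain ⟨x, rfl⟩ := proj_surjective x
    rw [← partialDeriv_eq]
    exact hM i j hij x
  have hb : ∀ x, ‖χ.1 x‖ ≤ 4 * M := by
    intro x
    have h1 : χ.1 x = (φ.1 x - (dirDeriv (0, 1) (dirDeriv (0, 1) φ)).1 x) -
        ((dirDeriv (1, 0) (dirDeriv (1, 0) φ)).1 x -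
          (dirDeriv (1, 0) (dirDeriv (1, 0) (dirDeriv (0, 1) (dirDeriv (0, 1) φ)))).1 x) := by
      rw [hχ, hψ, map_sub, map_sub]; rfl
    rw [h1]
    have a1 := hd 0 0 (by norm_num) x
    have a2 := hd 0 2 (by norm_num) x
    have a3 := hd 2 0 (by norm_num) x
    have a4 := hd 2 2 (by norm_num) x
    have b1 := norm_sub_le (φ.1 x - (dirDeriv (0, 1) (dirDeriv (0, 1) φ)).1 x)
      ((dirDeriv (1, 0) (dirDeriv (1, 0) φ)).1 x -
          (dirDeriv (1, 0) (dirDeriv (1, 0) (dirDeriv (0, 1) (dirDeriv (0, 1) φ)))).1 x)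
    have b2 := norm_sub_le (φ.1 x) ((dirDeriv (0, 1) (dirDeriv (0, 1) φ)).1 x)
    have b3 := norm_sub_le ((dirDeriv (1, 0) (dirDeriv (1, 0) φ)).1 x)
      ((dirDeriv (1, 0) (dirDeriv (1, 0) (dirDeriv (0, 1) (dirDeriv (0, 1) φ)))).1 x)
    simp only [Function.iterate_succ, Function.iterate_zero, Function.comp_apply, id_eq] at a1 a2 a3 a4
    linarith
  have hvol : (volume : Measure T2).real Set.univ = 4 * Real.pi ^ 2 := by
    rw [Measure.real, Measure.volume_eq_prod, ← Set.univ_prod_univ, Measure.prod_prod,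
      AddCircle.measure_univ, ← ENNReal.ofReal_mul Real.two_pi_pos.le, ENNReal.toReal_ofReal
      (by positivity)]
    ring
  have hn : ‖fcFn χ.1 k‖ ≤ 16 * Real.pi ^ 2 * M := by
    have hM0 : 0 ≤ 4 * M := (norm_nonneg _).trans (hb 0)
    rw [fcFn]
    refine (norm_integral_le_of_norm_le_const (C := 4 * M) (Eventually.of_forall fun x => ?_)).trans
      (le_of_eq ?_)
    · rw [norm_mul]
      exact (mul_le_of_le_one_right (norm_nonneg _) (norm_expFn_le _ _)).trans (hb x)
    · rw [hvol]; ring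
  rw [hχ, hL, hψ, hL, norm_mul, norm_mul, Complex.norm_real, Complex.norm_real,
    Real.norm_of_nonneg (by positivity), Real.norm_of_nonneg (by positivity)] at hn
  simpa using hn

section

/-- The Fourier coefficients of the real distribution with coordinates `c`. -/
def coordFc (c : ℤ × ℤ → ℝ) (k : ℤ × ℤ) : ℂ :=
  ((c k + c (-k)) / 2 : ℝ) + ((c (-k) - c k) / 2 : ℝ) * Complex.I

lemma norm_sq_coordFc (c : ℤ × ℤ → ℝ) (k : ℤ × ℤ) :
    ‖coordFc c k‖ ^ 2 = (c k ^ 2 + c (-k) ^ 2) / 2 := by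
  rw [coordFc, ← Complex.normSq_eq_norm_sq, Complex.normSq_add_mul_I]; ring

lemma summable_coordFc {c w : ℤ × ℤ → ℝ} (hw : ∀ k, w (-k) = w k)
    (h : Summable fun k => w k * c k ^ 2) : Summable fun k => w k * ‖coordFc c k‖ ^ 2 := by
  refine (hasSum_symm h.hasSum).summable.congr fun k => ?_
  rw [norm_sq_coordFc, hw]; ring

lemma exists_partialDeriv_bound (φ : testFn) (N : ℕ) :
    ∃ M, ∀ i j : ℕ, i + j ≤ N → ∀ x, ‖partialDeriv i j φ x‖ ≤ M := by
  choose K hK using fun i j : ℕ => exists_bound ((dirDeriv (1, 0))^[i] ((dirDeriv (0, 1))^[j] φ))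
  refine ⟨∑ i ∈ Finset.range (N + 1), ∑ j ∈ Finset.range (N + 1), K i j, fun i j hij x => ?_⟩
  have hK0 : ∀ i j, 0 ≤ K i j := fun i j => (norm_nonneg _).trans (hK i j 0)
  rw [partialDeriv_eq]
  refine (hK i j _).trans ?_
  refine (Finset.single_le_sum (f := fun j => K i j) (fun j _ => hK0 i j)
    (Finset.mem_range.2 (by omega : j < N + 1))).trans ?_
  exact Finset.single_le_sum (f := fun i => ∑ j ∈ Finset.range (N + 1), K i j)
    (fun i _ => Finset.sum_nonneg fun j _ => hK0 i j) (Finset.mem_range.2 (by omega : i < N + 1))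

lemma lam_le_mul (k : ℤ × ℤ) : lam k ≤ (1 + (k.1 : ℝ) ^ 2) * (1 + (k.2 : ℝ) ^ 2) := by
  rw [lam]; nlinarith [mul_nonneg (sq_nonneg (k.1 : ℝ)) (sq_nonneg (k.2 : ℝ))]

lemma summable_inv_mul_inv :
    Summable fun k : ℤ × ℤ => (1 + (k.1 : ℝ) ^ 2)⁻¹ * (1 + (k.2 : ℝ) ^ 2)⁻¹ :=
  summable_inv_sq.mul_of_nonneg summable_inv_sq (fun n => by positivity) (fun n => by positivity)

/-- The test function enters the majorant only through `M`, so summing over `k` shows at once that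
the series converges and that it is a distribution of order at most `4`. Membership of the
coordinates in `H^{-1}` is enough. -/
lemma norm_coordFc_mul_le (c : ℤ × ℤ → ℝ) (φ : testFn) {M : ℝ}
    (hM : ∀ i j : ℕ, i + j ≤ 4 → ∀ x, ‖partialDeriv i j φ x‖ ≤ M) (k : ℤ × ℤ) :
    ‖coordFc c k * fcFn φ.1 (-k)‖ ≤ 16 * Real.pi ^ 2 * M *
      (lam k ^ (-1 : ℝ) * ‖coordFc c k‖ ^ 2 + (1 + (k.1 : ℝ) ^ 2)⁻¹ * (1 + (k.2 : ℝ) ^ 2)⁻¹) := by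
  have h := norm_fcFn_mul_le φ hM (-k)
  have hM0 : 0 ≤ M := (norm_nonneg _).trans (hM 0 0 (by norm_num) 0)
  simp only [Prod.fst_neg, Prod.snd_neg, Int.cast_neg, neg_sq] at h
  have hl := lam_le_mul k
  have hl0 := lam_pos k
  rw [← mul_assoc] at h
  set p := (1 + (k.1 : ℝ) ^ 2) * (1 + (k.2 : ℝ) ^ 2) with hp
  have hp0 : 0 < p := by positivity
  set a := ‖coordFc c k‖
  set f := ‖fcFn φ.1 (-k)‖
  have ha : 0 ≤ a := norm_nonneg _
  rw [← mul_inv, ← hp, Real.rpow_neg_one, norm_mul]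
  have h1 : a * p⁻¹ ≤ (lam k)⁻¹ * a ^ 2 + p⁻¹ := by
    have h2 : p⁻¹ ≤ (lam k)⁻¹ := inv_anti₀ hl0 hl
    have h3 : 0 < p⁻¹ := inv_pos.2 hp0
    nlinarith [mul_nonneg h3.le (sq_nonneg (a - 1)), mul_le_mul_of_nonneg_right h2 (sq_nonneg a)]
  have h2 : f ≤ 16 * Real.pi ^ 2 * M * p⁻¹ := by
    rw [← div_eq_mul_inv, le_div_iff₀ hp0]; linarith
  calc a * f ≤ a * (16 * Real.pi ^ 2 * M * p⁻¹) := by gcongr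
    _ = 16 * Real.pi ^ 2 * M * (a * p⁻¹) := by ring
    _ ≤ _ := by gcongr

lemma summable_coordFc_bound {c : ℤ × ℤ → ℝ} (h : Summable fun k => lam k ^ (-1 : ℝ) * c k ^ 2) :
    Summable fun k => lam k ^ (-1 : ℝ) * ‖coordFc c k‖ ^ 2 +
      (1 + (k.1 : ℝ) ^ 2)⁻¹ * (1 + (k.2 : ℝ) ^ 2)⁻¹ :=
  (summable_coordFc (w := fun k => lam k ^ (-1 : ℝ)) (fun k => by rw [lam_neg]) h).add
    summable_inv_mul_inv

lemma summable_coordFc_mul {c : ℤ × ℤ → ℝ} (h : Summable fun k => lam k ^ (-1 : ℝ) * c k ^ 2)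
    (φ : testFn) : Summable fun k => coordFc c k * fcFn φ.1 (-k) := by
  obtain ⟨M, hM⟩ := exists_partialDeriv_bound φ 4
  exact Summable.of_norm_bounded ((summable_coordFc_bound h).mul_left _)
    (norm_coordFc_mul_le c φ hM)

/-- The real distribution with coordinates `c`. -/
def coordDistr (c : ℤ × ℤ → ℝ) (h : Summable fun k => lam k ^ (-1 : ℝ) * c k ^ 2) : distr :=
  ⟨{ toFun := fun φ => ∑' k, coordFc c k * fcFn φ.1 (-k)
     map_add' := fun φ ψ => by
      rw [← (summable_coordFc_mul h φ).tsum_add (summable_coordFc_mul h ψ)]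
      refine tsum_congr fun k => ?_
      rw [fcFn_add, mul_add]
     map_smul' := fun a φ => by
      rw [RingHom.id_apply, smul_eq_mul, ← tsum_mul_left]
      refine tsum_congr fun k => ?_
      rw [fcFn_smul]; ring }, by
    have hs := summable_coordFc_bound h
    refine ⟨4, 16 * Real.pi ^ 2 * (∑' k, (lam k ^ (-1 : ℝ) * ‖coordFc c k‖ ^ 2 +
      (1 + (k.1 : ℝ) ^ 2)⁻¹ * (1 + (k.2 : ℝ) ^ 2)⁻¹)), ?_, fun φ M hM => ?_⟩
    · have hterm : ∀ k : ℤ × ℤ, 0 < lam k ^ (-1 : ℝ) * ‖coordFc c k‖ ^ 2 +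
          (1 + (k.1 : ℝ) ^ 2)⁻¹ * (1 + (k.2 : ℝ) ^ 2)⁻¹ := fun k => by
        have := lam_rpow_pos k (-1)
        positivity
      have := hs.tsum_pos (fun k => (hterm k).le) 0 (hterm 0)
      positivity
    · refine (tsum_of_norm_bounded (hs.mul_left _).hasSum (norm_coordFc_mul_le c φ hM)).trans
        (le_of_eq ?_)
      rw [tsum_mul_left]; ring⟩

lemma fc_coordDistr (c : ℤ × ℤ → ℝ) (h : Summable fun k => lam k ^ (-1 : ℝ) * c k ^ 2)
    (k : ℤ × ℤ) : fc (coordDistr c h) k = coordFc c k := by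
  change ∑' l, coordFc c l * fcFn (expT (-k)).1 (-l) = _
  simp only [fcFn_expT, neg_inj, mul_ite, mul_one, mul_zero]
  exact tsum_ite_eq k _

lemma rc_coordDistr (c : ℤ × ℤ → ℝ) (h : Summable fun k => lam k ^ (-1 : ℝ) * c k ^ 2)
    (k : ℤ × ℤ) : rc (coordDistr c h) k = c k := by
  rw [rc, fc_coordDistr, coordFc]
  simp only [Complex.add_re, Complex.add_im, Complex.ofReal_re, Complex.ofReal_im, Complex.mul_re,
    Complex.mul_im, Complex.I_re, Complex.I_im]
  ring

lemma isReal_coordDistr (c : ℤ × ℤ → ℝ) (h : Summable fun k => lam k ^ (-1 : ℝ) * c k ^ 2) :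
    IsRealDistr (coordDistr c h) := by
  intro k
  rw [fc_coordDistr, fc_coordDistr, coordFc, coordFc, neg_neg, map_add, map_mul,
    Complex.conj_ofReal, Complex.conj_ofReal, Complex.conj_I]
  push_cast; ring

lemma coordDistr_mem {c : ℤ × ℤ → ℝ} (h : Summable fun k => lam k ^ (-1 : ℝ) * c k ^ 2) {s : ℝ}
    (hs : Summable fun k => lam k ^ s * c k ^ 2) : coordDistr c h ∈ sobolevSet s := by
  refine ⟨?_, isReal_coordDistr c h⟩
  simp only [fc_coordDistr]
  exact summable_coordFc (w := fun k => lam k ^ s) (fun k => by rw [lam_neg]) hs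

/-! ### The trigonometric basis -/

/-- The real trigonometric function `Re e_k + Im e_k`. -/
def cas (k : ℤ × ℤ) (x : T2) : ℝ := (expFn k x).re + (expFn k x).im

lemma continuous_cas (k : ℤ × ℤ) : Continuous (cas k) :=
  (Complex.continuous_re.comp (continuous_expFn k)).add
    (Complex.continuous_im.comp (continuous_expFn k))

lemma memLp_continuous {f : T2 → ℝ} (hf : Continuous f) : MemLp f 2 (volume : Measure T2) := by
  obtain ⟨K, hK⟩ := isCompact_univ.exists_bound_of_continuousOn hf.continuousOn
  exact MemLp.of_bound hf.aestronglyMeasurable K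
    (Eventually.of_forall fun x => hK x (Set.mem_univ x))

/-- `Re e_k + Im e_k` in `L²`. -/
def casLp (k : ℤ × ℤ) : L2 := (memLp_continuous (continuous_cas k)).toLp _

lemma coeFn_casLp (k : ℤ × ℤ) : casLp k =ᵐ[volume] cas k := MemLp.coeFn_toLp _

lemma rc_toDistr (g : L2) (k : ℤ × ℤ) : rc (L2.toDistr g) k = ∫ x, g x * cas k x := by
  have hi : Integrable fun x => (g x : ℂ) * expFn (-k) x :=
    integrable_mul_testFn g ⟨_, expFn_mem (-k)⟩
  have h1 : (fc (L2.toDistr g) k).re = ∫ x, ((g x : ℂ) * expFn (-k) x).re := by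
    rw [fc_toDistr]; exact (integral_re hi).symm
  have h2 : (fc (L2.toDistr g) k).im = ∫ x, ((g x : ℂ) * expFn (-k) x).im := by
    rw [fc_toDistr]; exact (integral_im hi).symm
  have hre : Integrable fun x => ((g x : ℂ) * expFn (-k) x).re := hi.re
  have him : Integrable fun x => ((g x : ℂ) * expFn (-k) x).im := hi.im
  rw [rc, h1, h2, ← integral_sub hre him]
  refine integral_congr_ae (Eventually.of_forall fun x => ?_)
  dsimp only
  rw [← conj_expFn, Complex.re_ofReal_mul, Complex.im_ofReal_mul, Complex.conj_re,
    Complex.conj_im, cas]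
  ring

lemma isReal_toDistr (g : L2) : IsRealDistr (L2.toDistr g) := (g.toSobolev 0 le_rfl).2.2

lemma cas_eq (m : ℤ × ℤ) (x : T2) : (cas m x : ℂ) =
    (1 - Complex.I) / 2 * expFn m x + (1 + Complex.I) / 2 * expFn (-m) x := by
  rw [← conj_expFn, cas]
  apply Complex.ext <;> simp <;> ring

/-- The functions `Re e_k + Im e_k`, over all `k`, form an orthonormal system in `L²`. -/
lemma rc_casLp (m k : ℤ × ℤ) : rc (L2.toDistr (casLp m)) k = if k = m then 1 else 0 := by
  have h1 : fc (L2.toDistr (casLp m)) k = (1 - Complex.I) / 2 * (if k = m then 1 else 0) +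
      (1 + Complex.I) / 2 * (if k = -m then 1 else 0) := by
    rw [fc_toDistr, ← integral_expFn, ← integral_expFn, ← integral_const_mul, ← integral_const_mul,
      ← integral_add]
    · refine integral_congr_ae ?_
      filter_upwards [coeFn_casLp m] with x hx
      rw [hx, cas_eq]; ring
    · exact integrable_of_continuous
        (continuous_const.mul ((continuous_expFn _).mul (continuous_expFn _)))
    · exact integrable_of_continuous
        (continuous_const.mul ((continuous_expFn _).mul (continuous_expFn _)))
  rw [rc, h1]
  split_ifs <;> simp <;> norm_num

lemma casLp_mem (m : ℤ × ℤ) (s : ℝ) : L2.toDistr (casLp m) ∈ sobolevSet s := by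
  refine ⟨summable_of_hasFiniteSupport ((Set.toFinite {m, -m}).subset fun k hk => ?_),
    isReal_toDistr _⟩
  by_contra h
  simp only [Set.mem_insert_iff, Set.mem_singleton_iff, not_or] at h
  refine hk ?_
  have h' : -k ≠ m := fun e => h.2 (by rw [← e, neg_neg])
  dsimp only
  rw [(isReal_toDistr _).norm_sq, rc_casLp, rc_casLp, if_neg h.1, if_neg h']
  simp

/-- `Re e_k + Im e_k` in `H^s`. -/
def casS (s : ℝ) (m : ℤ × ℤ) : Sobolev s := ⟨L2.toDistr (casLp m), casLp_mem m s⟩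

lemma rc_casS (s : ℝ) (m k : ℤ × ℤ) : rc (casS s m).toDistr k = if k = m then 1 else 0 :=
  rc_casLp m k

lemma rc_sum_casS {s : ℝ} (F : Finset (ℤ × ℤ)) (a : ℤ × ℤ → ℝ) (k : ℤ × ℤ) :
    rc (∑ m ∈ F, a m • casS s m).toDistr k = if k ∈ F then a k else 0 := by
  rw [Sobolev.toDistr_sum, rc_sum]
  simp only [Sobolev.toDistr_smul, rc_smul, rc_casS, mul_ite, mul_one, mul_zero,
    Finset.sum_ite_eq]

lemma Sobolev.hasSum_casS {s : ℝ} (u : Sobolev s) :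
    HasSum (fun k => rc u.toDistr k • casS s k) u := by
  rw [HasSum, tendsto_iff_norm_sub_tendsto_zero]
  have h1 : ∀ F : Finset (ℤ × ℤ), ‖(∑ k ∈ F, rc u.toDistr k • casS s k) - u‖ ^ 2 =
      ‖u‖ ^ 2 - ∑ k ∈ F, lam k ^ s * rc u.toDistr k ^ 2 := by
    intro F
    refine (Sobolev.hasSum_norm_sq _).unique ?_
    have h2 := (Sobolev.hasSum_norm_sq u).sub
      (hasSum_sum_of_ne_finset_zero (s := F)
        (f := fun k => if k ∈ F then lam k ^ s * rc u.toDistr k ^ 2 else 0)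
        fun k hk => if_neg hk)
    rw [Finset.sum_congr rfl fun k hk => if_pos hk] at h2
    have e : (fun k => lam k ^ s *
        rc ((∑ k ∈ F, rc u.toDistr k • casS s k) - u).toDistr k ^ 2) = fun k =>
        lam k ^ s * rc u.toDistr k ^ 2 - if k ∈ F then lam k ^ s * rc u.toDistr k ^ 2 else 0 := by
      funext k
      rw [Sobolev.toDistr_sub, rc_sub, rc_sum_casS]
      split_ifs <;> ring
    rw [e]
    exact h2
  have h3 := ((Sobolev.hasSum_norm_sq u).const_sub (‖u‖ ^ 2)).sqrt
  simp only [← h1, Real.sqrt_sq (norm_nonneg _), sub_self, Real.sqrt_zero] at h3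
  exact h3

/-- The box of frequencies of size `N`. -/
def box (N : ℕ) : Finset (ℤ × ℤ) := Finset.Icc (-(N : ℤ), -(N : ℤ)) (N, N)

lemma mem_box {N : ℕ} {k : ℤ × ℤ} : k ∈ box N ↔ |k.1| ≤ N ∧ |k.2| ≤ N := by
  simp only [box, Finset.mem_Icc, Prod.le_def, abs_le]
  tauto

lemma box_mono {M N : ℕ} (h : M ≤ N) : box M ⊆ box N := by
  intro k hk
  rw [mem_box] at hk ⊢
  have : (M : ℤ) ≤ N := by exact_mod_cast h
  exact ⟨hk.1.trans this, hk.2.trans this⟩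

lemma exists_subset_box (F : Finset (ℤ × ℤ)) : ∃ N, F ⊆ box N := by
  refine ⟨∑ k ∈ F, (k.1.natAbs + k.2.natAbs), fun k hk => ?_⟩
  have h := Finset.single_le_sum (f := fun k : ℤ × ℤ => k.1.natAbs + k.2.natAbs)
    (fun _ _ => Nat.zero_le _) hk
  rw [mem_box, Int.abs_eq_natAbs, Int.abs_eq_natAbs]
  constructor <;> exact_mod_cast by omega

lemma tendsto_box : Tendsto box atTop atTop :=
  tendsto_atTop_finset_of_monotone (fun _ _ h => box_mono h) fun k => by
    obtain ⟨N, hN⟩ := exists_subset_box {k}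
    exact ⟨N, hN (Finset.mem_singleton_self k)⟩

/-! ### Integrability of Sobolev-valued maps in terms of the coordinates -/

variable {Ω : Type*} {mΩ : MeasurableSpace Ω} {P : Measure Ω}

/-- Every element is the sum of its expansion in the trigonometric basis, so the map is a pointwise
limit of finite combinations of its coordinates. -/
lemma aestronglyMeasurable_sobolev {s : ℝ} {U : Ω → Sobolev s}
    (h : ∀ k, AEStronglyMeasurable (fun z => rc (U z).toDistr k) P) : AEStronglyMeasurable U P := by
  refine aestronglyMeasurable_of_tendsto_ae atTop
    (f := fun (F : Finset (ℤ × ℤ)) z => ∑ k ∈ F, rc (U z).toDistr k • casS s k) (fun F => ?_)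
    (Eventually.of_forall fun z => (U z).hasSum_casS)
  exact Finset.aestronglyMeasurable_fun_sum _ fun k _ => (h k).smul_const _

/-- The squared Sobolev norm is a weighted sum of squared coordinates; the claim is the triangle
inequality in `L^{p/2}`, hence the condition `2 ≤ p`. -/
lemma eLpNorm_sum_casS_le {s : ℝ} {f : ℤ × ℤ → Ω → ℝ} (h : ∀ k, AEStronglyMeasurable (f k) P)
    {p : ℝ} (hp : 2 ≤ p) (F : Finset (ℤ × ℤ)) :
    eLpNorm (fun z => ∑ k ∈ F, f k z • casS s k) (ENNReal.ofReal p) P ^ 2 ≤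
      ∑ k ∈ F, ENNReal.ofReal (lam k ^ s) * eLpNorm (f k) (ENNReal.ofReal p) P ^ 2 := by
  have hp2 : ENNReal.ofReal (p / 2) * ENNReal.ofReal 2 = ENNReal.ofReal p := by
    rw [← ENNReal.ofReal_mul (by linarith)]; congr 1; ring
  have h1 : ∀ (V : Ω → Sobolev s), eLpNorm V (ENNReal.ofReal p) P ^ 2 =
      eLpNorm (fun z => ‖V z‖ ^ (2 : ℝ)) (ENNReal.ofReal (p / 2)) P := by
    intro V
    rw [eLpNorm_norm_rpow V two_pos, hp2, ENNReal.rpow_two]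
  have h2 : ∀ (V : Ω → ℝ), eLpNorm V (ENNReal.ofReal p) P ^ 2 =
      eLpNorm (fun z => ‖V z‖ ^ (2 : ℝ)) (ENNReal.ofReal (p / 2)) P := by
    intro V
    rw [eLpNorm_norm_rpow V two_pos, hp2, ENNReal.rpow_two]
  have h3 : (fun z => ‖∑ k ∈ F, f k z • casS s k‖ ^ (2 : ℝ)) =
      ∑ k ∈ F, fun z => (lam k ^ s) • ‖f k z‖ ^ (2 : ℝ) := by
    funext z
    rw [Finset.sum_apply]
    simp only [Real.rpow_two]
    refine (Sobolev.hasSum_norm_sq _).unique ?_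
    have h2 : HasSum (fun k => if k ∈ F then lam k ^ s * f k z ^ 2 else 0) _ :=
      hasSum_sum_of_ne_finset_zero (s := F) fun k hk => if_neg hk
    have e : (fun k => lam k ^ s * rc (∑ m ∈ F, f m z • casS s m).toDistr k ^ 2) =
        fun k => if k ∈ F then lam k ^ s * f k z ^ 2 else 0 := by
      funext k
      rw [rc_sum_casS]
      split_ifs <;> ring
    rw [e]
    convert h2 using 1
    refine Finset.sum_congr rfl fun k hk => ?_
    rw [if_pos hk, Real.norm_eq_abs, sq_abs, smul_eq_mul]
  rw [h1, h3]
  refine (eLpNorm_sum_le (fun k _ => ?_) ?_).trans (Finset.sum_le_sum fun k _ => ?_)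
  · exact (((h k).norm.aemeasurable.pow_const (2 : ℝ)).const_smul (lam k ^ s)).aestronglyMeasurable
  · rw [ENNReal.one_le_ofReal]; linarith
  · rw [h2, ← Real.enorm_of_nonneg (lam_rpow_pos k s).le, ← eLpNorm_const_smul]
    rfl

/-- Minkowski's inequality for Sobolev-valued maps. -/
lemma eLpNorm_sobolev_le {s : ℝ} {U : Ω → Sobolev s}
    (h : ∀ k, AEStronglyMeasurable (fun z => rc (U z).toDistr k) P) {p : ℝ} (hp : 2 ≤ p) :
    eLpNorm U (ENNReal.ofReal p) P ^ 2 ≤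
      ∑' k, ENNReal.ofReal (lam k ^ s) *
        eLpNorm (fun z => rc (U z).toDistr k) (ENNReal.ofReal p) P ^ 2 := by
  -- Fatou's lemma passes from the partial sums over boxes to the map itself.
  have h1 := Lp.eLpNorm_lim_le_liminf_eLpNorm (p := ENNReal.ofReal p) (μ := P)
    (f := fun (N : ℕ) z => ∑ k ∈ box N, rc (U z).toDistr k • casS s k)
    (fun N => Finset.aestronglyMeasurable_fun_sum _ fun k _ => (h k).smul_const _) U
    (Eventually.of_forall fun z => (U z).hasSum_casS.comp tendsto_box)
  set T := ∑' k, ENNReal.ofReal (lam k ^ s) *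
        eLpNorm (fun z => rc (U z).toDistr k) (ENNReal.ofReal p) P ^ 2 with hT
  have h2 : ∀ N : ℕ, eLpNorm (fun z => ∑ k ∈ box N, rc (U z).toDistr k • casS s k)
      (ENNReal.ofReal p) P ≤ T ^ (1 / 2 : ℝ) := by
    intro N
    have h3 := (eLpNorm_sum_casS_le (s := s) h hp (box N)).trans (ENNReal.sum_le_tsum _)
    rw [← ENNReal.rpow_two] at h3
    have h4 := ENNReal.rpow_le_rpow h3 (by norm_num : (0 : ℝ) ≤ 1 / 2)
    rw [← ENNReal.rpow_mul] at h4
    norm_num at h4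
    simpa using h4
  have h5 : eLpNorm U (ENNReal.ofReal p) P ≤ T ^ (1 / 2 : ℝ) := by
    refine h1.trans ?_
    refine (liminf_le_liminf (Eventually.of_forall h2)).trans ?_
    simp
  calc _ ≤ (T ^ (1 / 2 : ℝ)) ^ 2 := by gcongr
    _ = T := by rw [← ENNReal.rpow_two, ← ENNReal.rpow_mul]; norm_num

end

/-! ### Second moments of integrated Hermite polynomials -/

lemma hasGaussianLaw_form_gaussPi {d : ℕ} (v w : Fin d → ℝ) :
    HasGaussianLaw (fun ξ : Fin d → ℝ => (∑ i, v i * ξ i, ∑ i, w i * ξ i)) (gaussPi d) := by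
  have := isGaussian_gaussPi d
  let L : (Fin d → ℝ) →L[ℝ] ℝ × ℝ := (∑ i, v i • ContinuousLinearMap.proj i).prod
    (∑ i, w i • ContinuousLinearMap.proj i)
  have hL : (fun ξ : Fin d → ℝ => (∑ i, v i * ξ i, ∑ i, w i * ξ i)) = L := by
    funext ξ
    simp [L]
  rw [hL]
  exact ⟨inferInstance⟩

lemma integral_form_gaussPi {d : ℕ} (v : Fin d → ℝ) :
    ∫ ξ, ∑ i, v i * ξ i ∂(gaussPi d) = 0 := by
  have hm : AEMeasurable (fun x : Fin d → ℝ => ∑ i, v i * x i) (gaussPi d) := by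
    refine Measurable.aemeasurable ?_
    fun_prop
  have h := integral_map (μ := gaussPi d) (φ := fun x => ∑ i, v i * x i) (f := fun x : ℝ => x)
    hm (by fun_prop)
  rw [← h, map_sum_gaussPi, integral_id_gaussianReal]

lemma integral_form_sq_gaussPi {d : ℕ} (v : Fin d → ℝ) :
    ∫ ξ, (∑ i, v i * ξ i) ^ 2 ∂(gaussPi d) = ∑ i, v i ^ 2 := by
  have hm : AEMeasurable (fun x : Fin d → ℝ => ∑ i, v i * x i) (gaussPi d) := by
    refine Measurable.aemeasurable ?_
    fun_prop
  have h := integral_map (μ := gaussPi d) (φ := fun x => ∑ i, v i * x i) (f := fun x : ℝ => x ^ 2)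
    hm (by fun_prop)
  rw [← h, map_sum_gaussPi]
  have h2 := integral_hermiteVar_sq (∑ i, v i ^ 2).toNNReal 1
  simp only [hermiteVar, Polynomial.eval_X, Nat.factorial_one, Nat.cast_one, pow_one, one_mul] at h2
  rw [h2, Real.coe_toNNReal _ (Finset.sum_nonneg fun i _ => sq_nonneg _)]

lemma integral_form_mul_gaussPi {d : ℕ} (v w : Fin d → ℝ) :
    ∫ ξ, (∑ i, v i * ξ i) * (∑ i, w i * ξ i) ∂(gaussPi d) = ∑ i, v i * w i := by
  have hX : ∀ u : Fin d → ℝ, Integrable (fun ξ => (∑ i, u i * ξ i) ^ 2) (gaussPi d) := by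
    intro u
    have h := memLp_polynomial_gaussian (P := gaussPi d) (hasGaussianLaw_form_gaussPi u u).fst
      (integral_form_gaussPi u) Polynomial.X
    simp only [Polynomial.eval_X] at h
    exact h.integrable_sq
  have e : (fun ξ : Fin d → ℝ => (∑ i, v i * ξ i) * (∑ i, w i * ξ i)) = fun ξ =>
      ((∑ i, (v + w) i * ξ i) ^ 2 - (∑ i, v i * ξ i) ^ 2 - (∑ i, w i * ξ i) ^ 2) / 2 := by
    funext ξ
    have : ∑ i, (v + w) i * ξ i = ∑ i, v i * ξ i + ∑ i, w i * ξ i := by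
      rw [← Finset.sum_add_distrib]
      exact Finset.sum_congr rfl fun i _ => by rw [Pi.add_apply, add_mul]
    rw [this]; ring
  have hs : Integrable (fun ξ : Fin d → ℝ =>
      (∑ i, (v + w) i * ξ i) ^ 2 - (∑ i, v i * ξ i) ^ 2) (gaussPi d) := (hX _).sub (hX _)
  rw [e, integral_div, integral_sub hs (hX _), integral_sub (hX _) (hX _),
    integral_form_sq_gaussPi, integral_form_sq_gaussPi, integral_form_sq_gaussPi,
    ← Finset.sum_sub_distrib, ← Finset.sum_sub_distrib, Finset.sum_div]
  exact Finset.sum_congr rfl fun i _ => by rw [Pi.add_apply]; ring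

lemma integral_hermiteVar_form_mul {d : ℕ} (n : ℕ) (v w : Fin d → ℝ) (hw : ∑ i, w i ^ 2 ≠ 0) :
    ∫ ξ, (hermiteVar (∑ i, v i ^ 2) n).eval (∑ i, v i * ξ i) *
      (hermiteVar (∑ i, w i ^ 2) n).eval (∑ i, w i * ξ i) ∂(gaussPi d) =
      n.factorial * (∑ i, v i * w i) ^ n :=
  integral_hermiteVar_mul (hasGaussianLaw_form_gaussPi v w) (integral_form_gaussPi v)
    (integral_form_gaussPi w) (integral_form_sq_gaussPi v) (integral_form_sq_gaussPi w)
    (integral_form_mul_gaussPi v w) hw n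

/-- Fubini reduces the second moment to pairs of points, where it is `n! Cov(X, Y)ⁿ`. The polynomial
growth of the Hermite polynomials and the Gaussian tails provide the majorant. -/
lemma integral_hermiteInt_mul {d : ℕ} (n : ℕ) {v w : T2 → Fin d → ℝ} (hv : Continuous v)
    (hw : Continuous w) {g h : T2 → ℝ} (hg : Integrable g) (hh : Integrable h)
    (hw0 : ∀ y, ∑ i, w y i ^ 2 ≠ 0) :
    ∫ ξ, hermiteInt n v g ξ * hermiteInt n w h ξ ∂(gaussPi d) = n.factorial *
      ∫ q, (∑ i, v q.1 i * w q.2 i) ^ n * (g q.1 * h q.2)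
        ∂((volume : Measure T2).prod volume) := by
  obtain ⟨C, V, hC, hV, hb⟩ := exists_hermiteVar_form_bound n hv
  obtain ⟨C', V', hC', hV', hb'⟩ := exists_hermiteVar_form_bound n hw
  let Hv : T2 → (Fin d → ℝ) → ℝ := fun y ξ =>
    (hermiteVar (∑ i, v y i ^ 2) n).eval (∑ i, v y i * ξ i)
  let Hw : T2 → (Fin d → ℝ) → ℝ := fun y ξ =>
    (hermiteVar (∑ i, w y i ^ 2) n).eval (∑ i, w y i * ξ i)
  have hcv : Continuous fun q : T2 × (Fin d → ℝ) => Hv q.1 q.2 := continuous_hermiteVar_form n hv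
  have hcw : Continuous fun q : T2 × (Fin d → ℝ) => Hw q.1 q.2 := continuous_hermiteVar_form n hw
  have h1 : ∀ ξ, hermiteInt n v g ξ * hermiteInt n w h ξ =
      ∫ q : T2 × T2, Hv q.1 ξ * Hw q.2 ξ * (g q.1 * h q.2)
        ∂((volume : Measure T2).prod volume) := by
    intro ξ
    rw [hermiteInt, hermiteInt, ← integral_prod_mul]
    refine integral_congr_ae (Eventually.of_forall fun q => ?_)
    dsimp only [Hv, Hw]
    ring
  simp only [h1]
  have hgh : Integrable (fun q : T2 × T2 => g q.1 * h q.2)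
      ((volume : Measure T2).prod volume) := hg.mul_prod hh
  have hos : OpensMeasurableSpace ((Fin d → ℝ) × (T2 × T2)) := Prod.opensMeasurableSpace
  have hcont : Continuous fun p : (Fin d → ℝ) × (T2 × T2) => Hv p.2.1 p.1 * Hw p.2.2 p.1 :=
    (hcv.comp (f := fun p : (Fin d → ℝ) × (T2 × T2) => (p.2.1, p.1)) (by fun_prop)).mul
      (hcw.comp (f := fun p : (Fin d → ℝ) × (T2 × T2) => (p.2.2, p.1)) (by fun_prop))
  have hgr : Integrable (fun ξ : Fin d → ℝ => C * C' * (1 + (V + V') * ‖ξ‖) ^ (n + n))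
      (gaussPi d) := (integrable_growth_gaussPi (n + n) zero_le_one (by positivity)).const_mul _
  have hint : Integrable (Function.uncurry fun (ξ : Fin d → ℝ) (q : T2 × T2) =>
      Hv q.1 ξ * Hw q.2 ξ * (g q.1 * h q.2))
      ((gaussPi d).prod ((volume : Measure T2).prod volume)) := by
    refine (hgr.mul_prod hgh.norm).mono'
      (hcont.aestronglyMeasurable.mul hgh.aestronglyMeasurable.comp_snd)
      (Eventually.of_forall fun p => ?_)
    change ‖Hv p.2.1 p.1 * Hw p.2.2 p.1 * (g p.2.1 * h p.2.2)‖ ≤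
      C * C' * (1 + (V + V') * ‖p.1‖) ^ (n + n) * ‖g p.2.1 * h p.2.2‖
    rw [norm_mul]
    refine mul_le_mul_of_nonneg_right ?_ (norm_nonneg _)
    rw [norm_mul, pow_add, mul_mul_mul_comm]
    have hn := norm_nonneg p.1
    refine mul_le_mul ((hb _ _).trans ?_) ((hb' _ _).trans ?_) (norm_nonneg _) (by positivity)
    · refine mul_le_mul_of_nonneg_left (pow_le_pow_left₀ (by positivity) ?_ n) hC
      nlinarith [mul_nonneg hV' hn]
    · refine mul_le_mul_of_nonneg_left (pow_le_pow_left₀ (by positivity) ?_ n) hC'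
      nlinarith [mul_nonneg hV hn]
  rw [integral_integral_swap hint, ← integral_const_mul]
  refine integral_congr_ae (Eventually.of_forall fun q => ?_)
  dsimp only
  have h2 : ∫ ξ, Hv q.1 ξ * Hw q.2 ξ ∂(gaussPi d) = n.factorial * (∑ i, v q.1 i * w q.2 i) ^ n :=
    integral_hermiteVar_form_mul n (v q.1) (w q.2) (hw0 q.2)
  rw [integral_mul_const, h2, mul_assoc]

/-! ### Symmetric sets of frequencies -/

/-- Symmetric finite sets of frequencies that contain `0`. -/
structure IsSymm (S : Finset (ℤ × ℤ)) : Prop where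
  neg_mem : ∀ k ∈ S, -k ∈ S
  zero_mem : (0 : ℤ × ℤ) ∈ S

lemma IsSymm.inter {S S' : Finset (ℤ × ℤ)} (h : IsSymm S) (h' : IsSymm S') : IsSymm (S ∩ S') where
  neg_mem k hk := by
    rw [Finset.mem_inter] at hk ⊢
    exact ⟨h.neg_mem k hk.1, h'.neg_mem k hk.2⟩
  zero_mem := Finset.mem_inter.2 ⟨h.zero_mem, h'.zero_mem⟩

lemma isSymm_box (N : ℕ) : IsSymm (box N) where
  neg_mem k hk := by
    rw [mem_box] at hk ⊢
    simpa using hk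
  zero_mem := by simp [mem_box]

lemma IsSymm.sum_neg {M : Type*} [AddCommMonoid M] {S : Finset (ℤ × ℤ)} (h : IsSymm S)
    (f : ℤ × ℤ → M) : ∑ k ∈ S, f (-k) = ∑ k ∈ S, f k :=
  Finset.sum_nbij' (fun k => -k) (fun k => -k) h.neg_mem h.neg_mem (fun k _ => neg_neg k)
    (fun k _ => neg_neg k) fun _ _ => rfl

lemma IsSymm.sum_eq_half {S : Finset (ℤ × ℤ)} (h : IsSymm S) (f : ℤ × ℤ → ℝ) :
    ∑ k ∈ S, f k = ∑ k ∈ S, (f k + f (-k)) / 2 := by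
  rw [← Finset.sum_div, Finset.sum_add_distrib, h.sum_neg, add_self_div_two]

lemma cas_neg (k : ℤ × ℤ) (x : T2) : cas (-k) x = (expFn k x).re - (expFn k x).im := by
  rw [cas, ← conj_expFn, Complex.conj_re, Complex.conj_im]; ring

/-- Passing from real functions to characters shows that the covariance of the field is a function
of `x - y`; the symmetry of `S` makes the sum real. -/
lemma IsSymm.sum_cas_mul_cas {S : Finset (ℤ × ℤ)} (h : IsSymm S) (x y : T2) :
    ((∑ k ∈ S, (lam k)⁻¹ * (cas k x * cas k y) : ℝ) : ℂ) =
      ∑ k ∈ S, ((lam k)⁻¹ : ℝ) * (expFn k x * expFn (-k) y) := by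
  have him : (∑ k ∈ S, (((lam k)⁻¹ : ℝ) : ℂ) * (expFn k x * expFn (-k) y)).im = 0 := by
    rw [← Complex.conj_eq_iff_im, map_sum, ← h.sum_neg]
    refine Finset.sum_congr rfl fun k _ => ?_
    rw [map_mul, map_mul, conj_expFn, conj_expFn, Complex.conj_ofReal, lam_neg, neg_neg]
  have hre : (∑ k ∈ S, (((lam k)⁻¹ : ℝ) : ℂ) * (expFn k x * expFn (-k) y)).re =
      ∑ k ∈ S, (lam k)⁻¹ * (cas k x * cas k y) := by
    rw [h.sum_eq_half, Complex.re_sum]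
    refine Finset.sum_congr rfl fun k _ => ?_
    rw [Complex.re_ofReal_mul, lam_neg, cas_neg, cas_neg, cas, cas, ← conj_expFn, Complex.mul_re,
      Complex.conj_re, Complex.conj_im]
    ring
  apply Complex.ext
  · rw [hre, Complex.ofReal_re]
  · rw [him, Complex.ofReal_im]

/-- The variance of the field with frequencies in `S`. -/
def rhoSq (S : Finset (ℤ × ℤ)) : ℝ := (4 * Real.pi ^ 2)⁻¹ * ∑ k ∈ S, (lam k)⁻¹

lemma IsSymm.rhoSq_pos {S : Finset (ℤ × ℤ)} (h : IsSymm S) : 0 < rhoSq S := by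
  refine mul_pos (by positivity) (Finset.sum_pos (fun k _ => inv_pos.2 (lam_pos k)) ⟨0, h.zero_mem⟩)

lemma expFn_mul_expFn_neg (k : ℤ × ℤ) (x y : T2) : expFn k x * expFn (-k) y =
    ((4 * Real.pi ^ 2)⁻¹ : ℝ) * (chr k x * chr (-k) y) := by
  rw [expFn_eq_chr, expFn_eq_chr]
  push_cast
  rw [show (4 * (Real.pi : ℂ) ^ 2) = (2 * Real.pi) * (2 * Real.pi) by ring, mul_inv]
  ring

lemma chr_mul_chr_neg (k : ℤ × ℤ) (x : T2) : chr k x * chr (-k) x = 1 := by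
  rw [← chr_add, add_neg_cancel, chr_zero]

/-- On the diagonal `|e_k|²` is constant, so a single variance serves all points. -/
lemma IsSymm.sum_cas_sq {S : Finset (ℤ × ℤ)} (h : IsSymm S) (x : T2) :
    ∑ k ∈ S, (lam k)⁻¹ * cas k x ^ 2 = rhoSq S := by
  have h1 := h.sum_cas_mul_cas x x
  simp only [expFn_mul_expFn_neg, chr_mul_chr_neg] at h1
  have h2 : ∑ k ∈ S, (lam k)⁻¹ * (cas k x * cas k x) =
      ∑ k ∈ S, (lam k)⁻¹ * (4 * Real.pi ^ 2)⁻¹ := by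
    apply Complex.ofReal_injective
    rw [h1]; push_cast; simp
  simp only [pow_two] at h2 ⊢
  rw [h2, rhoSq, ← Finset.sum_mul, mul_comm, pow_two]

/-! ### Variances of tested Wick powers. -/

/-- The variance of the Wick power with frequencies in `S`, tested against `g`. -/
def wickVar (n : ℕ) (S : Finset (ℤ × ℤ)) (g : L2) : ℝ :=
  n.factorial * (4 * Real.pi ^ 2 * ((4 * Real.pi ^ 2) ^ n)⁻¹ *
    ∑ κ ∈ tuples n S, wgt κ * ‖fc (L2.toDistr g) (∑ i, κ i)‖ ^ 2)

lemma fc_toDistr_eq (g : L2) (k : ℤ × ℤ) :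
    fc (L2.toDistr g) k = ((2 * Real.pi : ℝ) : ℂ)⁻¹ * ∫ x, (g x : ℂ) * chr (-k) x := by
  rw [fc_toDistr, ← integral_const_mul]
  refine integral_congr_ae (Eventually.of_forall fun x => ?_)
  dsimp only
  rw [expFn_eq_chr]; ring

lemma integrable_L2 (g : L2) : Integrable g volume := (Lp.memLp g).integrable one_le_two

lemma integrable_mul_chr (g : L2) (k : ℤ × ℤ) : Integrable (fun x => (g x : ℂ) * chr k x) :=
  (integrable_L2 g).ofReal.mul_bdd (c := 1) (continuous_chr k).aestronglyMeasurable
    (Eventually.of_forall fun x => (norm_chr k x).le)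

lemma chr_sub (k : ℤ × ℤ) (x y : T2) : chr k (x - y) = chr k x * chr (-k) y := by
  rw [sub_eq_add_neg]
  simp only [chr, Prod.fst_add, Prod.snd_add, Prod.fst_neg, Prod.snd_neg, fourier_apply,
    smul_add, smul_neg, neg_smul, AddCircle.toCircle_add, Circle.coe_mul]
  ring

/-- The `n`-th power of the covariance expands into characters of the sums of tuples, and the double
integral factors into two conjugate Fourier coefficients of `g`. The normalization contributes
`(4π²)^{-n}` from the covariance and `4π²` from the two coefficients. -/
lemma IsSymm.wickVar_eq {S : Finset (ℤ × ℤ)} (h : IsSymm S) (n : ℕ) (g : L2) :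
    n.factorial * ∫ q, (∑ k ∈ S, (lam k)⁻¹ * (cas k q.1 * cas k q.2)) ^ n * (g q.1 * g q.2)
        ∂((volume : Measure T2).prod volume) = wickVar n S g := by
  rw [wickVar]
  congr 1
  apply Complex.ofReal_injective
  rw [← integral_complex_ofReal]
  have h1 : ∀ q : T2 × T2, (((∑ k ∈ S, (lam k)⁻¹ * (cas k q.1 * cas k q.2)) ^ n *
      (g q.1 * g q.2) : ℝ) : ℂ) = ∑ κ ∈ tuples n S, ((((4 * Real.pi ^ 2) ^ n)⁻¹ : ℝ) : ℂ) *
        (wgt κ : ℂ) * (((g q.1 : ℂ) * chr (∑ i, κ i) q.1) * ((g q.2 : ℂ) * chr (-∑ i, κ i) q.2)) := by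
    intro q
    have h2 := sum_chr_pow (fun k => (((lam k)⁻¹ : ℝ) : ℂ)) S n (q.1 - q.2)
    have h3 : ∀ k, (((lam k)⁻¹ : ℝ) : ℂ) * (expFn k q.1 * expFn (-k) q.2) =
        ((4 * Real.pi ^ 2)⁻¹ : ℝ) *
          ((((lam k)⁻¹ : ℝ) : ℂ) * chr k (q.1 - q.2)) := by
      intro k
      rw [expFn_mul_expFn_neg, chr_sub]; ring
    rw [Complex.ofReal_mul, Complex.ofReal_pow, h.sum_cas_mul_cas]
    simp only [h3]
    rw [← Finset.mul_sum, mul_pow, h2, Finset.mul_sum, Finset.sum_mul]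
    refine Finset.sum_congr rfl fun κ _ => ?_
    rw [chr_sub, wgt]
    push_cast
    rw [inv_pow]
    ring
  simp only [h1]
  rw [integral_finsetSum]
  · rw [Finset.mul_sum, Complex.ofReal_sum]
    refine Finset.sum_congr rfl fun κ _ => ?_
    rw [integral_const_mul, integral_prod_mul (fun x : T2 => (g x : ℂ) * chr (∑ i, κ i) x)
      (fun x : T2 => (g x : ℂ) * chr (-∑ i, κ i) x)]
    have h4 := fc_toDistr_eq g (∑ i, κ i)
    have h5 := fc_toDistr_eq g (-∑ i, κ i)
    rw [isReal_toDistr g, neg_neg] at h5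
    have h6 : ((‖fc (L2.toDistr g) (∑ i, κ i)‖ ^ 2 : ℝ) : ℂ) =
        fc (L2.toDistr g) (∑ i, κ i) * (starRingEnd ℂ) (fc (L2.toDistr g) (∑ i, κ i)) := by
      rw [Complex.mul_conj, Complex.normSq_eq_norm_sq]
    have hpi : (Real.pi : ℂ) ≠ 0 := by exact_mod_cast Real.pi_ne_zero
    rw [Complex.ofReal_mul (4 * Real.pi ^ 2 * _), Complex.ofReal_mul (wgt κ), h6, h5, h4]
    push_cast
    field_simp
    ring
  · intro κ _
    exact ((integrable_mul_chr g _).mul_prod (integrable_mul_chr g _)).const_mul _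

section

/-! ### Bounds for the variances -/

lemma tuples_mono (n : ℕ) {S S' : Finset (ℤ × ℤ)} (h : S ⊆ S') : tuples n S ⊆ tuples n S' :=
  Fintype.piFinset_subset _ _ fun _ => h

lemma wickVar_nonneg (n : ℕ) (S : Finset (ℤ × ℤ)) (g : L2) : 0 ≤ wickVar n S g := by
  have : 0 ≤ ∑ κ ∈ tuples n S, wgt κ * ‖fc (L2.toDistr g) (∑ i, κ i)‖ ^ 2 :=
    Finset.sum_nonneg fun κ _ => mul_nonneg (wgt_nonneg κ) (sq_nonneg _)
  unfold wickVar
  positivity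

lemma wickVar_mono (n : ℕ) (g : L2) {S S' : Finset (ℤ × ℤ)} (h : S ⊆ S') :
    wickVar n S g ≤ wickVar n S' g := by
  unfold wickVar
  have := Finset.sum_le_sum_of_subset_of_nonneg (tuples_mono n h)
    (f := fun κ => wgt κ * ‖fc (L2.toDistr g) (∑ i, κ i)‖ ^ 2)
    fun κ _ _ => mul_nonneg (wgt_nonneg κ) (sq_nonneg _)
  gcongr

lemma sum_norm_fc_sq_le (g : L2) (K : Finset (ℤ × ℤ)) :
    ∑ k ∈ K, ‖fc (L2.toDistr g) k‖ ^ 2 ≤ ‖g‖ ^ 2 := by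
  have hg : MemLp (fun x => (g x : ℂ)) 2 (volume : Measure T2) := (Lp.memLp g).ofReal
  have hn : ‖hg.toLp _‖ = ‖g‖ := by
    rw [Lp.norm_toLp, Lp.norm_def]
    congr 1
    exact eLpNorm_congr_norm_ae (Eventually.of_forall fun x => Complex.norm_real _)
  rw [← hn]
  refine le_of_eq_of_le (Finset.sum_congr rfl fun k _ => ?_)
    (orthonormal_expLp.sum_inner_products_le (hg.toLp _) (s := K))
  congr 2
  rw [fc_toDistr, L2.inner_def]
  refine integral_congr_ae ?_
  filter_upwards [hg.coeFn_toLp, ContinuousMap.coeFn_toLp (E := ℂ) (p := 2) (𝕜 := ℂ)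
    (volume : Measure T2) ⟨expFn k, continuous_expFn k⟩] with x hx hk
  rw [hx, expLp, hk, ContinuousMap.coe_mk, RCLike.inner_apply, conj_expFn]

/-- Tuples are grouped by their sum `k`; each group has total weight at most `B`, and Bessel's
inequality bounds the remaining sum of the coefficients of `g`. -/
lemma wickVar_le_of_fiber {n : ℕ} {S : Finset (ℤ × ℤ)} {B : ℝ}
    (hB : ∀ k, 4 * Real.pi ^ 2 * ((4 * Real.pi ^ 2) ^ n)⁻¹ *
      ∑ κ ∈ tuples n S, wgt κ * (if ∑ i, κ i = k then 1 else 0) ≤ B) (g : L2) :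
    wickVar n S g ≤ n.factorial * (B * ‖g‖ ^ 2) := by
  classical
  refine mul_le_mul_of_nonneg_left ?_ (Nat.cast_nonneg _)
  set K := (tuples n S).image fun κ => ∑ i, κ i with hK
  set c := 4 * Real.pi ^ 2 * ((4 * Real.pi ^ 2) ^ n)⁻¹ with hc
  have h0 : 0 ≤ B := le_trans (mul_nonneg (by positivity) (Finset.sum_nonneg fun κ _ =>
    mul_nonneg (wgt_nonneg κ) (by split_ifs <;> norm_num))) (hB 0)
  have h1 : ∑ κ ∈ tuples n S, wgt κ * ‖fc (L2.toDistr g) (∑ i, κ i)‖ ^ 2 =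
      ∑ k ∈ K, (∑ κ ∈ tuples n S, wgt κ * (if ∑ i, κ i = k then 1 else 0)) *
        ‖fc (L2.toDistr g) k‖ ^ 2 := by
    simp only [Finset.sum_mul]
    rw [Finset.sum_comm]
    refine Finset.sum_congr rfl fun κ hκ => ?_
    rw [Finset.sum_eq_single (∑ i, κ i)]
    · simp
    · intro k _ hk
      simp [hk.symm]
    · intro h
      exact absurd (Finset.mem_image_of_mem _ hκ) h
  rw [h1, Finset.mul_sum]
  calc ∑ k ∈ K, c * ((∑ κ ∈ tuples n S, wgt κ * (if ∑ i, κ i = k then 1 else 0)) *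
        ‖fc (L2.toDistr g) k‖ ^ 2) ≤ ∑ k ∈ K, B * ‖fc (L2.toDistr g) k‖ ^ 2 := by
        refine Finset.sum_le_sum fun k _ => ?_
        rw [← mul_assoc]
        exact mul_le_mul_of_nonneg_right (hB k) (sq_nonneg _)
    _ ≤ B * ‖g‖ ^ 2 := by
        rw [← Finset.mul_sum]
        exact mul_le_mul_of_nonneg_left (sum_norm_fc_sq_le g K) h0

lemma const_pow_pred {n : ℕ} (hn : n ≠ 0) :
    4 * Real.pi ^ 2 * ((4 * Real.pi ^ 2) ^ n)⁻¹ = ((4 * Real.pi ^ 2) ^ (n - 1))⁻¹ := by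
  have hpi := Real.pi_pos
  obtain ⟨m, rfl⟩ := Nat.exists_eq_succ_of_ne_zero hn
  rw [Nat.succ_sub_one, Nat.succ_eq_add_one]
  field_simp
  ring

lemma exists_wickVar_le_pos : ∃ C : ℝ, 1 ≤ C ∧ ∀ (n : ℕ) (ε : ℝ) (S : Finset (ℤ × ℤ)) (g : L2),
    n ≠ 0 → 0 < ε → wickVar n S g ≤ n.factorial * (C * (((1 + ε) / (4 * Real.pi)) ^ (n - 1) *
      n.factorial + C ^ n * ((1 + ε) / ε) ^ (n - 1)) * ‖g‖ ^ 2) := by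
  obtain ⟨C, hC1, hC⟩ := exists_sum_wgt_fiber_le
  refine ⟨C, hC1, fun n ε S g hn hε => wickVar_le_of_fiber (fun k => ?_) g⟩
  rw [const_pow_pred hn]
  exact hC n ε S k hn hε

lemma sum_tuples_zero (S : Finset (ℤ × ℤ)) (f : (Fin 0 → ℤ × ℤ) → ℝ) :
    ∑ κ ∈ tuples 0 S, f κ = f 0 := by
  have : tuples 0 S = {0} := by
    ext κ
    simp [tuples, eq_iff_true_of_subsingleton]
  rw [this, Finset.sum_singleton]

lemma wgt_fin_zero (κ : Fin 0 → ℤ × ℤ) : wgt κ = 1 := by simp [wgt]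

lemma exists_wickVar_le (n : ℕ) (g : L2) : ∃ B : ℝ, ∀ S : Finset (ℤ × ℤ), wickVar n S g ≤ B := by
  obtain ⟨C, hC1, hC⟩ := exists_wickVar_le_pos
  rcases Nat.eq_zero_or_pos n with rfl | hn
  · refine ⟨(4 * Real.pi ^ 2) * ‖fc (L2.toDistr g) 0‖ ^ 2, fun S => ?_⟩
    rw [wickVar, sum_tuples_zero, wgt_fin_zero]
    simp
  · exact ⟨_, fun S => hC n 1 S g hn.ne' one_pos⟩

/-- The squared coefficient of the basis function `m` at `k` is half the indicator of `m = k` plus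
half that of `m = -k`, and `lam` is even. -/
lemma sum_rpow_mul_norm_fc_casLp_le (α : ℝ) (M : Finset (ℤ × ℤ)) (k : ℤ × ℤ) :
    ∑ m ∈ M, lam m ^ (-α) * ‖fc (L2.toDistr (casLp m)) k‖ ^ 2 ≤ lam k ^ (-α) := by
  have h1 : ∀ m, lam m ^ (-α) * ‖fc (L2.toDistr (casLp m)) k‖ ^ 2 =
      (if k = m then lam k ^ (-α) / 2 else 0) + (if -k = m then lam k ^ (-α) / 2 else 0) := by
    intro m
    rw [(isReal_toDistr _).norm_sq, rc_casLp, rc_casLp]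
    by_cases h : k = m <;> by_cases h' : -k = m
    · rw [if_pos h, if_pos h', if_pos h, if_pos h', ← h]; ring
    · rw [if_pos h, if_neg h', if_pos h, if_neg h', ← h]; ring
    · rw [if_neg h, if_pos h', if_neg h, if_pos h', ← h', lam_neg]; ring
    · rw [if_neg h, if_neg h', if_neg h, if_neg h']; ring
  have h2 := (lam_rpow_pos k (-α)).le
  simp only [h1, Finset.sum_add_distrib, Finset.sum_ite_eq]
  split_ifs <;> linarith

/-- Summing over the basis replaces `|ĝ|²` by the weight `λ^{-α}` at the sum of the tuple; this is
the bound for the second moment of the norm in `H^{-α}`. -/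
lemma sum_wickVar_casLp_le (α : ℝ) (n : ℕ) (M S : Finset (ℤ × ℤ)) :
    ∑ m ∈ M, lam m ^ (-α) * wickVar n S (casLp m) ≤ n.factorial *
      (4 * Real.pi ^ 2 * ((4 * Real.pi ^ 2) ^ n)⁻¹ *
        ∑ κ ∈ tuples n S, wgt κ * lam (∑ i, κ i) ^ (-α)) := by
  have h1 : ∑ m ∈ M, lam m ^ (-α) * wickVar n S (casLp m) = n.factorial *
      (4 * Real.pi ^ 2 * ((4 * Real.pi ^ 2) ^ n)⁻¹ * ∑ κ ∈ tuples n S, wgt κ *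
        ∑ m ∈ M, lam m ^ (-α) * ‖fc (L2.toDistr (casLp m)) (∑ i, κ i)‖ ^ 2) := by
    simp only [wickVar, Finset.mul_sum]
    rw [Finset.sum_comm]
    refine Finset.sum_congr rfl fun κ _ => Finset.sum_congr rfl fun m _ => ?_
    ring
  rw [h1]
  refine mul_le_mul_of_nonneg_left (mul_le_mul_of_nonneg_left ?_ (by positivity))
    (Nat.cast_nonneg _)
  exact Finset.sum_le_sum fun κ _ =>
    mul_le_mul_of_nonneg_left (sum_rpow_mul_norm_fc_casLp_le α M _) (wgt_nonneg κ)

lemma exists_sum_wickVar_le_pos {α₀ : ℝ} (hα₀ : α₀ < 1) : ∃ C : ℝ, 1 ≤ C ∧ ∀ (α : ℝ) (n : ℕ) (ε : ℝ)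
    (M S : Finset (ℤ × ℤ)), 0 < α → α ≤ α₀ → n ≠ 0 → 0 < ε →
    ∑ m ∈ M, lam m ^ (-α) * wickVar n S (casLp m) ≤ n.factorial *
      (C * ((α ^ 2)⁻¹ * ((1 + ε) / (4 * Real.pi * α)) ^ (n - 1) * n.factorial +
        C ^ n * ((1 + ε) / ε) ^ (n - 1))) := by
  obtain ⟨C, hC1, hC⟩ := exists_sum_wgt_rpow_le hα₀
  refine ⟨C, hC1, fun α n ε M S h0 h1 hn hε => (sum_wickVar_casLp_le α n M S).trans ?_⟩
  rw [const_pow_pred hn]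
  exact mul_le_mul_of_nonneg_left (hC α n ε S h0 h1 hn hε) (Nat.cast_nonneg _)

lemma exists_sum_wickVar_le (n : ℕ) {α : ℝ} (hα : 0 < α) : ∃ B : ℝ, 0 ≤ B ∧
    ∀ M S : Finset (ℤ × ℤ), ∑ m ∈ M, lam m ^ (-α) * wickVar n S (casLp m) ≤ B := by
  rcases Nat.eq_zero_or_pos n with rfl | hn
  · refine ⟨4 * Real.pi ^ 2, by positivity, fun M S => (sum_wickVar_casLp_le α 0 M S).trans ?_⟩
    rw [sum_tuples_zero, wgt_fin_zero]
    simp [lam]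
  · obtain ⟨C, hC1, hC⟩ := exists_sum_wickVar_le_pos (α₀ := 1 / 2) (by norm_num)
    -- As `lam ≥ 1`, lowering the exponent only enlarges the weights; `1/2` keeps it away from `1`.
    have h0 : 0 < min α (1 / 2) := lt_min hα (by norm_num)
    have h1 := fun M S => hC (min α (1 / 2)) n 1 M S h0 (min_le_right _ _) hn.ne' one_pos
    refine ⟨_, (by simpa using h1 ∅ ∅), fun M S => le_trans (Finset.sum_le_sum fun m _ => ?_) (h1 M S)⟩
    refine mul_le_mul_of_nonneg_right ?_ (wickVar_nonneg _ _ _)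
    exact Real.rpow_le_rpow_of_exponent_le (one_le_lam m) (by linarith [min_le_left α (1 / 2)])

/-! ### The law of the coordinates of the free field -/

variable {δ : ℝ} {μ : Measure (Sobolev (-δ))}

/-- A coordinate is the inner product with a fixed vector, so coordinates are continuous linear
functionals and their joint law is Gaussian. -/
lemma inner_casS (k : ℤ × ℤ) (z : Sobolev (-δ)) :
    ⟪lam k ^ δ • casS (-δ) k, z⟫_ℝ = rc z.toDistr k := by
  refine (Sobolev.hasSum_inner _ _).unique ?_
  have h : (fun j => lam j ^ (-δ) * (rc (lam k ^ δ • casS (-δ) k).toDistr j * rc z.toDistr j)) =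
      fun j => if j = k then rc z.toDistr k else 0 := by
    funext j
    rw [Sobolev.toDistr_smul, rc_smul, rc_casS]
    split_ifs with h
    · rw [h, mul_one, ← mul_assoc, ← Real.rpow_add (lam_pos k)]
      simp
    · simp
  rw [h]
  exact hasSum_ite_eq k _

lemma continuous_rc (k : ℤ × ℤ) : Continuous fun z : Sobolev (-δ) => rc z.toDistr k := by
  simp only [← inner_casS]
  fun_prop

lemma IsFreeField.integral_rc (h : IsFreeField δ μ) (k : ℤ × ℤ) :
    ∫ z, rc z.toDistr k ∂μ = 0 := by
  simp only [← inner_casS]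
  exact h.mean _

lemma IsFreeField.integral_rc_mul (h : IsFreeField δ μ) (k l : ℤ × ℤ) :
    ∫ z, rc z.toDistr k * rc z.toDistr l ∂μ = if k = l then (lam k)⁻¹ else 0 := by
  simp only [← inner_casS]
  rw [h.covariance]
  set u := lam k ^ δ • casS (-δ) k
  set v := lam l ^ δ • casS (-δ) l
  have h1 : HasSum (fun j => lam j ^ (-δ) * lam j ^ (-(1 + δ)) * (rc u.toDistr j * rc v.toDistr j))
      (if k = l then (lam k)⁻¹ else 0) := by
    have e : (fun j => lam j ^ (-δ) * lam j ^ (-(1 + δ)) * (rc u.toDistr j * rc v.toDistr j)) =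
        fun j => if j = k then (if k = l then (lam k)⁻¹ else 0) else 0 := by
      funext j
      simp only [u, v, Sobolev.toDistr_smul, rc_smul, rc_casS]
      by_cases hj : j = k
      · subst hj
        by_cases hl : j = l
        · subst hl
          -- The exponents add up to `-δ - (1+δ) + 2δ = -1`: the variance of a coordinate does not
          -- depend on `δ`.
          rw [if_pos rfl, if_pos rfl, if_pos rfl, mul_one, ← Real.rpow_add (lam_pos j),
            ← Real.rpow_add (lam_pos j), ← Real.rpow_add (lam_pos j), ← Real.rpow_neg_one]
          congr 1; ring
        · simp [hl]
      · simp [hj]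
    rw [e]
    exact hasSum_ite_eq k _
  have h2 := hasSum_re_mul u.isReal v.isReal (fun j => by simp only [lam_neg]) h1
  rw [← h2.tsum_eq]
  refine tsum_congr fun j => ?_
  rw [mul_assoc ((lam j ^ (-(1 + δ)) : ℝ) : ℂ), Complex.re_ofReal_mul, mul_assoc]

/-- Finitely many normalized coordinates of the free field are independent standard Gaussians. -/
lemma IsFreeField.map_coord (h : IsFreeField δ μ) {d : ℕ} (e : Fin d → ℤ × ℤ)
    (he : Function.Injective e) :
    μ.map (fun z i => √(lam (e i)) * rc z.toDistr (e i)) = gaussPi d := by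
  have := h.isGaussian
  let X : Fin d → Sobolev (-δ) → ℝ := fun i z => √(lam (e i)) * rc z.toDistr (e i)
  have hc : ∀ i, Continuous (X i) := fun i => (continuous_rc (e i)).const_mul _
  let L : Sobolev (-δ) →L[ℝ] (Fin d → ℝ) := ContinuousLinearMap.pi fun i =>
    √(lam (e i)) • innerSL ℝ (lam (e i) ^ δ • casS (-δ) (e i))
  have hL : (fun z => (X · z)) = L := by
    funext z i
    simp only [X, L, ContinuousLinearMap.coe_pi', smul_apply, innerSL_apply_apply,
      inner_casS, smul_eq_mul]
  have hG : HasGaussianLaw (fun z => (X · z)) μ := by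
    rw [hL]; exact ⟨inferInstance⟩
  have hG' : ∀ i, HasGaussianLaw (X i) μ := fun i => hG.eval i
  have hmean : ∀ i, ∫ z, X i z ∂μ = 0 := fun i => by
    simp only [X]
    rw [integral_const_mul, h.integral_rc, mul_zero]
  have hcov : ∀ i j, ∫ z, X i z * X j z ∂μ = if i = j then 1 else 0 := by
    intro i j
    have e1 : ∀ z, X i z * X j z = √(lam (e i)) * √(lam (e j)) *
        (rc z.toDistr (e i) * rc z.toDistr (e j)) := fun z => by simp only [X]; ring
    simp only [e1]
    rw [integral_const_mul, h.integral_rc_mul]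
    by_cases hij : i = j
    · subst hij
      rw [if_pos rfl, if_pos rfl, Real.mul_self_sqrt (lam_pos _).le, mul_inv_cancel₀ (lam_pos _).ne']
    · rw [if_neg (fun h => hij (he h)), if_neg hij, mul_zero]
  have hI : iIndepFun X μ := by
    -- Jointly Gaussian variables that are uncorrelated are independent.
    refine hG.iIndepFun_of_covariance_eq_zero fun i j hij => ?_
    rw [ProbabilityTheory.covariance, hmean, hmean]
    simp only [sub_zero]
    rw [hcov, if_neg hij]
  have := (iIndepFun_iff_map_fun_eq_pi_map fun i => (hc i).measurable.aemeasurable).1 hI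
  change μ.map (fun z i => X i z) = _
  rw [this, gaussPi]
  congr 1
  funext i
  rw [(hG' i).map_eq_gaussianReal, hmean,
    variance_of_integral_eq_zero (hc i).measurable.aemeasurable (hmean i)]
  simp only [pow_two]
  rw [hcov, if_pos rfl, Real.toNNReal_one]

end

section

/-! ### Regularized Wick powers as functions of finitely many coordinates -/

lemma eLpNorm_two_sq {Ω : Type*} {mΩ : MeasurableSpace Ω} {P : Measure Ω} {f : Ω → ℝ}
    (hf : MemLp f 2 P) : eLpNorm f 2 P ^ 2 = ENNReal.ofReal (∫ z, f z ^ 2 ∂P) := by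
  have h := hf.eLpNorm_eq_integral_rpow_norm (by norm_num) (by norm_num)
  have h0 : 0 ≤ ∫ z, f z ^ 2 ∂P := integral_nonneg fun z => sq_nonneg _
  simp only [ENNReal.toReal_ofNat, Real.rpow_two, Real.norm_eq_abs, sq_abs] at h
  rw [h, ← ENNReal.ofReal_pow (by positivity), ← Real.rpow_natCast, ← Real.rpow_mul h0]
  norm_num

/-- The field with frequencies in `S`. -/
def fld (S : Finset (ℤ × ℤ)) (u : distr) (x : T2) : ℝ := ∑ k ∈ S, rc u k * cas k x

/-- The Wick power with frequencies in `S`, tested against `g`. -/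
def wickInt (n : ℕ) (S : Finset (ℤ × ℤ)) (g : T2 → ℝ) (u : distr) : ℝ :=
  ∫ x, (hermiteVar (rhoSq S) n).eval (fld S u x) * g x

/-- The coefficients of the field in the normalized coordinates. -/
def fldForm (S : Finset (ℤ × ℤ)) {d : ℕ} (e : Fin d → ℤ × ℤ) (x : T2) (i : Fin d) : ℝ :=
  if e i ∈ S then (√(lam (e i)))⁻¹ * cas (e i) x else 0

lemma continuous_fldForm (S : Finset (ℤ × ℤ)) {d : ℕ} (e : Fin d → ℤ × ℤ) :
    Continuous (fldForm S e) := by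
  refine continuous_pi fun i => ?_
  unfold fldForm
  split_ifs
  · exact (continuous_cas _).const_mul _
  · exact continuous_const

lemma sum_ite_range {S : Finset (ℤ × ℤ)} {d : ℕ} {e : Fin d → ℤ × ℤ}
    (he : Function.Injective e) (hS : ∀ k ∈ S, k ∈ Set.range e) (f : ℤ × ℤ → ℝ) :
    ∑ i, (if e i ∈ S then f (e i) else 0) = ∑ k ∈ S, f k := by
  classical
  rw [← Finset.sum_image (s := Finset.univ) (g := e) (f := fun k => if k ∈ S then f k else 0)
    (fun _ _ _ _ h => he h), Finset.sum_ite_mem]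
  congr 1
  refine Finset.inter_eq_right.2 fun k hk => ?_
  obtain ⟨i, rfl⟩ := hS k hk
  exact Finset.mem_image_of_mem _ (Finset.mem_univ i)

/-- Distinct coordinates are orthogonal, so two truncated fields are correlated through their common
frequencies only. -/
lemma sum_fldForm_mul {S S' : Finset (ℤ × ℤ)} {d : ℕ} {e : Fin d → ℤ × ℤ}
    (he : Function.Injective e) (hS : ∀ k ∈ S, k ∈ Set.range e) (x y : T2) :
    ∑ i, fldForm S e x i * fldForm S' e y i =
      ∑ k ∈ S ∩ S', (lam k)⁻¹ * (cas k x * cas k y) := by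
  rw [← sum_ite_range he (fun k hk => hS k (Finset.mem_inter.1 hk).1)]
  refine Finset.sum_congr rfl fun i _ => ?_
  unfold fldForm
  by_cases h : e i ∈ S <;> by_cases h' : e i ∈ S'
  · rw [if_pos h, if_pos h', if_pos (Finset.mem_inter.2 ⟨h, h'⟩), mul_mul_mul_comm, ← mul_inv,
      Real.mul_self_sqrt (lam_pos _).le]
  · rw [if_neg h', if_neg (fun hh => h' (Finset.mem_inter.1 hh).2), mul_zero]
  · rw [if_neg h, if_neg (fun hh => h (Finset.mem_inter.1 hh).1), zero_mul]
  · rw [if_neg h, if_neg (fun hh => h (Finset.mem_inter.1 hh).1), zero_mul]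

lemma IsSymm.sum_fldForm_sq {S : Finset (ℤ × ℤ)} (h : IsSymm S) {d : ℕ} {e : Fin d → ℤ × ℤ}
    (he : Function.Injective e) (hS : ∀ k ∈ S, k ∈ Set.range e) (x : T2) :
    ∑ i, fldForm S e x i ^ 2 = rhoSq S := by
  simp only [pow_two]
  rw [sum_fldForm_mul he hS, Finset.inter_self, ← h.sum_cas_sq x]
  simp only [pow_two]

lemma sum_fldForm_coord {S : Finset (ℤ × ℤ)} {d : ℕ} {e : Fin d → ℤ × ℤ}
    (he : Function.Injective e) (hS : ∀ k ∈ S, k ∈ Set.range e) (x : T2) (u : distr) :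
    ∑ i, fldForm S e x i * (√(lam (e i)) * rc u (e i)) = fld S u x := by
  rw [fld, ← sum_ite_range he hS]
  refine Finset.sum_congr rfl fun i _ => ?_
  unfold fldForm
  split_ifs with h
  · have := (Real.sqrt_pos.2 (lam_pos (e i))).ne'
    field_simp
  · rw [zero_mul]

lemma IsSymm.wickInt_eq {S : Finset (ℤ × ℤ)} (h : IsSymm S) (n : ℕ) (g : T2 → ℝ) {d : ℕ}
    {e : Fin d → ℤ × ℤ} (he : Function.Injective e) (hS : ∀ k ∈ S, k ∈ Set.range e) (u : distr) :
    wickInt n S g u =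
      hermiteInt n (fldForm S e) g fun i => √(lam (e i)) * rc u (e i) := by
  simp only [hermiteInt, h.sum_fldForm_sq he hS, sum_fldForm_coord he hS, wickInt]

lemma exists_enum (U : Finset (ℤ × ℤ)) : ∃ (d : ℕ) (e : Fin d → ℤ × ℤ), Function.Injective e ∧
    ∀ k ∈ U, k ∈ Set.range e :=
  ⟨U.card, fun i => (U.equivFin.symm i : ℤ × ℤ),
    fun i j hij => U.equivFin.symm.injective (Subtype.ext hij),
    fun k hk => ⟨U.equivFin ⟨k, hk⟩, by simp⟩⟩

lemma memLp_hermiteInt {d : ℕ} (n : ℕ) {v : T2 → Fin d → ℝ} (hv : Continuous v) {g : T2 → ℝ}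
    (hg : Integrable g) : MemLp (hermiteInt n v g) 2 (gaussPi d) := by
  obtain ⟨C, V, hC, hV, hb⟩ := exists_hermiteVar_form_bound n hv
  have hm := (continuous_hermiteInt n hv hg).aestronglyMeasurable (μ := gaussPi d)
  have hgr : Integrable (fun ξ : Fin d → ℝ => (C * ∫ x, |g x|) ^ 2 * (1 + V * ‖ξ‖) ^ (n * 2))
      (gaussPi d) := (integrable_growth_gaussPi (n * 2) zero_le_one hV).const_mul _
  rw [memLp_two_iff_integrable_sq hm]
  refine hgr.mono' (hm.pow 2) (Eventually.of_forall fun ξ => ?_)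
  have h1 : |hermiteInt n v g ξ| ≤ C * (1 + V * ‖ξ‖) ^ n * ∫ x, |g x| := by
    rw [← integral_const_mul, hermiteInt, ← Real.norm_eq_abs]
    refine norm_integral_le_of_norm_le (hg.abs.const_mul (C * (1 + V * ‖ξ‖) ^ n))
      (Eventually.of_forall fun x => ?_)
    rw [norm_mul]
    exact mul_le_mul_of_nonneg_right (hb x ξ) (abs_nonneg _)
  rw [Real.norm_eq_abs, abs_pow]
  refine (pow_le_pow_left₀ (abs_nonneg _) h1 2).trans (le_of_eq ?_)
  rw [pow_mul]; ring

variable {δ : ℝ} {μ : Measure (Sobolev (-δ))}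

lemma aemeasurable_coord {d : ℕ} (e : Fin d → ℤ × ℤ) :
    AEMeasurable (fun (z : Sobolev (-δ)) i => √(lam (e i)) * rc z.toDistr (e i)) μ := by
  have : Continuous (fun (z : Sobolev (-δ)) i => √(lam (e i)) * rc z.toDistr (e i)) :=
    continuous_pi fun i => (continuous_rc (e i)).const_mul _
  exact this.measurable.aemeasurable

lemma IsFreeField.memLp_wickInt (hμ : IsFreeField δ μ) {S : Finset (ℤ × ℤ)} (hS : IsSymm S) (n : ℕ)
    {g : T2 → ℝ} (hg : Integrable g) : MemLp (fun z => wickInt n S g z.toDistr) 2 μ := by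
  obtain ⟨d, e, he, hU⟩ := exists_enum S
  have h1 := memLp_hermiteInt n (continuous_fldForm S e) hg
  rw [← hμ.map_coord e he] at h1
  simp only [hS.wickInt_eq n g he hU]
  exact h1.comp_of_map (aemeasurable_coord e)

/-- The inner product depends on the two sets through `S ∩ S'` alone, as for increments of a
martingale. Monotonicity and boundedness of `wickVar` therefore suffice for convergence. -/
lemma IsFreeField.integral_wickInt_mul (hμ : IsFreeField δ μ) {S S' : Finset (ℤ × ℤ)}
    (hS : IsSymm S) (hS' : IsSymm S') (n : ℕ) (g : L2) :
    ∫ z, wickInt n S g z.toDistr * wickInt n S' g z.toDistr ∂μ = wickVar n (S ∩ S') g := by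
  obtain ⟨d, e, he, hU⟩ := exists_enum (S ∪ S')
  have hU1 : ∀ k ∈ S, k ∈ Set.range e := fun k hk => hU k (Finset.mem_union_left _ hk)
  have hU2 : ∀ k ∈ S', k ∈ Set.range e := fun k hk => hU k (Finset.mem_union_right _ hk)
  have hg := integrable_L2 g
  have h1 := integral_hermiteInt_mul n (continuous_fldForm S e) (continuous_fldForm S' e) hg hg
    (fun y => by rw [hS'.sum_fldForm_sq he hU2]; exact hS'.rhoSq_pos.ne')
  simp only [sum_fldForm_mul he hU1] at h1
  rw [(hS.inter hS').wickVar_eq, ← hμ.map_coord e he, integral_map (aemeasurable_coord e)] at h1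
  · simp only [hS.wickInt_eq n g he hU1, hS'.wickInt_eq n g he hU2]
    exact h1
  · exact ((continuous_hermiteInt n (continuous_fldForm S e) hg).mul
      (continuous_hermiteInt n (continuous_fldForm S' e) hg)).aestronglyMeasurable

/-! ### Hypercontractivity of tested Wick powers. -/

/-- Hypercontractivity. -/
def IsHyper {Ω : Type*} {mΩ : MeasurableSpace Ω} (P : Measure Ω) (n : ℕ) (F : Ω → ℝ) : Prop :=
  ∀ p : ℝ, 2 ≤ p → eLpNorm F (ENNReal.ofReal p) P ≤
    ENNReal.ofReal ((p - 1) ^ ((n : ℝ) / 2)) * eLpNorm F 2 P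

lemma IsFreeField.isHyper_comp (hμ : IsFreeField δ μ) {d : ℕ} {e : Fin d → ℤ × ℤ}
    (he : Function.Injective e) {n : ℕ} {F : (Fin d → ℝ) → ℝ} (hF : IsMehler n F) :
    IsHyper μ n fun z => F fun i => √(lam (e i)) * rc z.toDistr (e i) := by
  have key : ∀ q, eLpNorm F q (gaussPi d) =
      eLpNorm (fun z : Sobolev (-δ) => F fun i => √(lam (e i)) * rc z.toDistr (e i)) q μ := by
    intro q
    rw [← hμ.map_coord e he]
    exact eLpNorm_map_measure hF.1.aestronglyMeasurable (aemeasurable_coord e)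
  intro p hp
  rw [← key, ← key]
  exact hF.eLpNorm_le hp

lemma IsFreeField.isHyper_wickInt (hμ : IsFreeField δ μ) {S : Finset (ℤ × ℤ)} (hS : IsSymm S)
    (n : ℕ) {g : T2 → ℝ} (hg : Integrable g) : IsHyper μ n fun z => wickInt n S g z.toDistr := by
  obtain ⟨d, e, he, hU⟩ := exists_enum S
  simp only [hS.wickInt_eq n g he hU]
  exact hμ.isHyper_comp he (isMehler_hermiteInt n (continuous_fldForm S e) hg)

/-- Both terms are written in one enumeration of `S ∪ S'`, so that they are eigenfunctions with the
same eigenvalue on one Gauss space and so is their difference. -/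
lemma IsFreeField.isHyper_wickInt_sub (hμ : IsFreeField δ μ) {S S' : Finset (ℤ × ℤ)}
    (hS : IsSymm S) (hS' : IsSymm S') (n : ℕ) {g : T2 → ℝ} (hg : Integrable g) :
    IsHyper μ n fun z => wickInt n S g z.toDistr - wickInt n S' g z.toDistr := by
  obtain ⟨d, e, he, hU⟩ := exists_enum (S ∪ S')
  have hU1 : ∀ k ∈ S, k ∈ Set.range e := fun k hk => hU k (Finset.mem_union_left _ hk)
  have hU2 : ∀ k ∈ S', k ∈ Set.range e := fun k hk => hU k (Finset.mem_union_right _ hk)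
  obtain ⟨F, hF⟩ : ∃ F : (Fin d → ℝ) → ℝ, F = fun ξ =>
    hermiteInt n (fldForm S e) g ξ - hermiteInt n (fldForm S' e) g ξ := ⟨_, rfl⟩
  have h1 : IsMehler n F := by
    rw [hF]
    exact (isMehler_hermiteInt n (continuous_fldForm S e) hg).sub
      (isMehler_hermiteInt n (continuous_fldForm S' e) hg)
  have h2 : (fun z : Sobolev (-δ) => wickInt n S g z.toDistr - wickInt n S' g z.toDistr) =
      fun z => F fun i => √(lam (e i)) * rc z.toDistr (e i) := by
    funext z
    rw [hF, hS.wickInt_eq n g he hU1, hS'.wickInt_eq n g he hU2]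
  rw [h2]
  exact hμ.isHyper_comp he h1

/-- Hypercontractivity is preserved by limits in `L²`. -/
lemma IsHyper.of_tendsto {Ω : Type*} {mΩ : MeasurableSpace Ω} {P : Measure Ω} {n : ℕ}
    {F : ℕ → Ω → ℝ} {G : Ω → ℝ} (hF : ∀ N, IsHyper P n (F N)) (hFm : ∀ N, MemLp (F N) 2 P)
    (hG : MemLp G 2 P)
    (h : Tendsto (fun N => eLpNorm (fun z => F N z - G z) 2 P) atTop (𝓝 0)) : IsHyper P n G := by
  intro p hp
  -- A subsequence converges almost everywhere; Fatou's lemma bounds the `L^p` norm of the limit,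
  -- and the `L²` norms on the right converge.
  have h1 : TendstoInMeasure P F atTop G :=
    tendstoInMeasure_of_tendsto_eLpNorm (by norm_num) (fun N => (hFm N).1) hG.1 h
  obtain ⟨ns, hns, hae⟩ := h1.exists_seq_tendsto_ae
  have h2 := Lp.eLpNorm_lim_le_liminf_eLpNorm (p := ENNReal.ofReal p) (μ := P)
    (f := fun i => F (ns i)) (fun i => (hFm _).1) G hae
  refine h2.trans ?_
  have h3 : Tendsto (fun i => ENNReal.ofReal ((p - 1) ^ ((n : ℝ) / 2)) *
      (eLpNorm (fun z => F (ns i) z - G z) 2 P + eLpNorm G 2 P)) atTop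
      (𝓝 (ENNReal.ofReal ((p - 1) ^ ((n : ℝ) / 2)) * (0 + eLpNorm G 2 P))) :=
    ENNReal.Tendsto.const_mul ((h.comp hns.tendsto_atTop).add tendsto_const_nhds)
      (Or.inr ENNReal.ofReal_ne_top)
  rw [zero_add] at h3
  rw [← h3.liminf_eq]
  refine liminf_le_liminf (Eventually.of_forall fun i => (hF (ns i) p hp).trans ?_)
  refine mul_le_mul_right ?_ _
  have h4 := eLpNorm_add_le ((hFm (ns i)).sub hG).1 hG.1 (one_le_two (α := ℝ≥0∞))
  have h5 : F (ns i) - G + G = F (ns i) := sub_add_cancel _ _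
  rw [h5] at h4
  exact h4

end

section

/-! ### Convergence in `L²` -/

/-- The variance of the Wick power tested against `g`. -/
def wickQ (n : ℕ) (g : L2) : ℝ := ⨆ N : ℕ, wickVar n (box N) g

lemma bddAbove_wickVar (n : ℕ) (g : L2) : BddAbove (Set.range fun N : ℕ => wickVar n (box N) g) := by
  obtain ⟨B, hB⟩ := exists_wickVar_le n g
  exact ⟨B, by rintro _ ⟨N, rfl⟩; exact hB _⟩

lemma wickVar_le_wickQ (n : ℕ) (S : Finset (ℤ × ℤ)) (g : L2) : wickVar n S g ≤ wickQ n g := by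
  obtain ⟨N, hN⟩ := exists_subset_box S
  exact (wickVar_mono n g hN).trans (le_ciSup (bddAbove_wickVar n g) N)

lemma wickQ_le {n : ℕ} {g : L2} {B : ℝ} (h : ∀ S, wickVar n S g ≤ B) : wickQ n g ≤ B :=
  ciSup_le fun _ => h _

lemma wickQ_nonneg (n : ℕ) (g : L2) : 0 ≤ wickQ n g :=
  (wickVar_nonneg n ∅ g).trans (wickVar_le_wickQ n ∅ g)

lemma tendsto_wickVar (n : ℕ) (g : L2) :
    Tendsto (fun N : ℕ => wickVar n (box N) g) atTop (𝓝 (wickQ n g)) :=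
  tendsto_atTop_ciSup (fun _ _ h => wickVar_mono n g (box_mono h)) (bddAbove_wickVar n g)

/-- A bound for the variance of the error when frequencies outside `box M` are dropped. -/
def wickDev (n M : ℕ) (g : L2) : ℝ := 2 * (wickQ n g - wickVar n (box M) g)

lemma wickDev_nonneg (n M : ℕ) (g : L2) : 0 ≤ wickDev n M g := by
  have := wickVar_le_wickQ n (box M) g
  unfold wickDev; linarith

lemma wickDev_le (n M : ℕ) (g : L2) : wickDev n M g ≤ 2 * wickQ n g := by
  have := wickVar_nonneg n (box M) g
  unfold wickDev; linarith

lemma tendsto_wickDev (n : ℕ) (g : L2) : Tendsto (fun M => wickDev n M g) atTop (𝓝 0) := by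
  have h := ((tendsto_wickVar n g).const_sub (wickQ n g)).const_mul 2
  rwa [sub_self, mul_zero] at h

variable {δ : ℝ} {μ : Measure (Sobolev (-δ))}

lemma IsFreeField.eLpNorm_wickInt_sq (hμ : IsFreeField δ μ) {S : Finset (ℤ × ℤ)} (hS : IsSymm S)
    (n : ℕ) (g : L2) :
    eLpNorm (fun z => wickInt n S g z.toDistr) 2 μ ^ 2 = ENNReal.ofReal (wickVar n S g) := by
  rw [eLpNorm_two_sq (hμ.memLp_wickInt hS n (integrable_L2 g))]
  simp only [pow_two]
  rw [hμ.integral_wickInt_mul hS hS, Finset.inter_self]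

lemma IsFreeField.eLpNorm_wickInt_sub_sq (hμ : IsFreeField δ μ) {S S' : Finset (ℤ × ℤ)}
    (hS : IsSymm S) (hS' : IsSymm S') (n : ℕ) (g : L2) :
    eLpNorm (fun z => wickInt n S g z.toDistr - wickInt n S' g z.toDistr) 2 μ ^ 2 =
      ENNReal.ofReal (wickVar n S g + wickVar n S' g - 2 * wickVar n (S ∩ S') g) := by
  have h1 := hμ.memLp_wickInt hS n (integrable_L2 g)
  have h2 := hμ.memLp_wickInt hS' n (integrable_L2 g)
  have i1 := h1.integrable_sq
  have i2 := h2.integrable_sq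
  have i3 : Integrable (fun z : Sobolev (-δ) => wickInt n S g z.toDistr * wickInt n S' g z.toDistr)
    μ := h1.integrable_mul h2
  have i4 : Integrable (fun z : Sobolev (-δ) =>
      wickInt n S g z.toDistr ^ 2 + wickInt n S' g z.toDistr ^ 2) μ := i1.add i2
  have e : ∀ z : Sobolev (-δ), (wickInt n S g z.toDistr - wickInt n S' g z.toDistr) ^ 2 =
      wickInt n S g z.toDistr ^ 2 + wickInt n S' g z.toDistr ^ 2 -
        2 * (wickInt n S g z.toDistr * wickInt n S' g z.toDistr) := fun z => by ring
  have h3 : MemLp (fun z : Sobolev (-δ) => wickInt n S g z.toDistr - wickInt n S' g z.toDistr) 2 μ :=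
    h1.sub h2
  rw [eLpNorm_two_sq h3]
  simp only [e]
  rw [integral_sub i4 (i3.const_mul 2), integral_add i1 i2, integral_const_mul,
    hμ.integral_wickInt_mul hS hS']
  simp only [pow_two]
  rw [hμ.integral_wickInt_mul hS hS, hμ.integral_wickInt_mul hS' hS', Finset.inter_self,
    Finset.inter_self]

/-- In `V(S) + V(S') - 2 V(S ∩ S')` the first two terms are at most the supremum, and the last is at
least `V(box M)` because both sets contain the box. -/
lemma IsFreeField.eLpNorm_wickInt_sub_le (hμ : IsFreeField δ μ) {S S' : Finset (ℤ × ℤ)}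
    (hS : IsSymm S) (hS' : IsSymm S') (n : ℕ) (g : L2) {M : ℕ} (h : box M ⊆ S) (h' : box M ⊆ S') :
    eLpNorm (fun z => wickInt n S g z.toDistr - wickInt n S' g z.toDistr) 2 μ ≤
      ENNReal.ofReal √(wickDev n M g) := by
  rw [← ENNReal.pow_le_pow_left_iff two_ne_zero, hμ.eLpNorm_wickInt_sub_sq hS hS',
    ← ENNReal.ofReal_pow (Real.sqrt_nonneg _), Real.sq_sqrt (wickDev_nonneg n M g)]
  refine ENNReal.ofReal_le_ofReal ?_
  have h1 := wickVar_le_wickQ n S g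
  have h2 := wickVar_le_wickQ n S' g
  have h3 := wickVar_mono n g (Finset.subset_inter h h')
  unfold wickDev
  linarith

lemma IsFreeField.eLpNorm_wickInt_le (hμ : IsFreeField δ μ) {S : Finset (ℤ × ℤ)} (hS : IsSymm S)
    (n : ℕ) (g : L2) :
    eLpNorm (fun z => wickInt n S g z.toDistr) 2 μ ≤ ENNReal.ofReal √(wickQ n g) := by
  rw [← ENNReal.pow_le_pow_left_iff two_ne_zero, hμ.eLpNorm_wickInt_sq hS,
    ← ENNReal.ofReal_pow (Real.sqrt_nonneg _), Real.sq_sqrt (wickQ_nonneg n g)]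
  exact ENNReal.ofReal_le_ofReal (wickVar_le_wickQ n S g)

lemma tendsto_ofReal_sqrt {f : ℕ → ℝ} (h : Tendsto f atTop (𝓝 0)) :
    Tendsto (fun M => ENNReal.ofReal √(f M)) atTop (𝓝 0) := by
  have := ENNReal.tendsto_ofReal h.sqrt
  rwa [Real.sqrt_zero, ENNReal.ofReal_zero] at this

lemma IsFreeField.exists_wickLim (hμ : IsFreeField δ μ) (n : ℕ) (g : L2) :
    ∃ G : Sobolev (-δ) → ℝ, MemLp G 2 μ ∧
      Tendsto (fun N => eLpNorm (fun z => wickInt n (box N) g z.toDistr - G z) 2 μ) atTop (𝓝 0) := by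
  have hm := fun N => hμ.memLp_wickInt (isSymm_box N) n (integrable_L2 g)
  have hc : CauchySeq fun N => (hm N).toLp _ := by
    rw [Lp.cauchySeq_Lp_iff_cauchySeq_eLpNorm]
    have h1 : Tendsto (fun p : ℕ × ℕ => ENNReal.ofReal √(wickDev n (min p.1 p.2) g)) atTop (𝓝 0) :=
      (tendsto_ofReal_sqrt (tendsto_wickDev n g)).comp
        (tendsto_atTop.2 fun b => by
          filter_upwards [eventually_ge_atTop (b, b)] with p hp
          exact le_min hp.1 hp.2)
    refine tendsto_of_tendsto_of_tendsto_of_le_of_le tendsto_const_nhds h1 (fun _ => zero_le)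
      fun p => ?_
    refine le_of_eq_of_le (eLpNorm_congr_ae ?_) (hμ.eLpNorm_wickInt_sub_le (isSymm_box p.1)
      (isSymm_box p.2) n g (box_mono (min_le_left p.1 p.2)) (box_mono (min_le_right p.1 p.2)))
    filter_upwards [(hm p.1).coeFn_toLp, (hm p.2).coeFn_toLp] with z h1 h2
    rw [Pi.sub_apply, h1, h2]
  obtain ⟨G, hG⟩ := cauchySeq_tendsto_of_complete hc
  refine ⟨G, Lp.memLp G, ?_⟩
  rw [Lp.tendsto_Lp_iff_tendsto_eLpNorm'] at hG
  refine hG.congr fun N => eLpNorm_congr_ae ?_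
  filter_upwards [(hm N).coeFn_toLp] with z h1
  rw [Pi.sub_apply, h1]

/-- The Wick power of the free field, tested against `g`. -/
def wickLim (hμ : IsFreeField δ μ) (n : ℕ) (g : L2) : Sobolev (-δ) → ℝ :=
  (hμ.exists_wickLim n g).choose

lemma IsFreeField.memLp_wickLim (hμ : IsFreeField δ μ) (n : ℕ) (g : L2) :
    MemLp (wickLim hμ n g) 2 μ := (hμ.exists_wickLim n g).choose_spec.1

lemma IsFreeField.tendsto_wickLim (hμ : IsFreeField δ μ) (n : ℕ) (g : L2) :
    Tendsto (fun N => eLpNorm (fun z => wickInt n (box N) g z.toDistr - wickLim hμ n g z) 2 μ)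
      atTop (𝓝 0) := (hμ.exists_wickLim n g).choose_spec.2

lemma IsFreeField.isHyper_wickLim (hμ : IsFreeField δ μ) (n : ℕ) (g : L2) :
    IsHyper μ n (wickLim hμ n g) :=
  IsHyper.of_tendsto (fun N => hμ.isHyper_wickInt (isSymm_box N) n (integrable_L2 g))
    (fun N => hμ.memLp_wickInt (isSymm_box N) n (integrable_L2 g)) (hμ.memLp_wickLim n g)
    (hμ.tendsto_wickLim n g)

lemma eLpNorm_sub_le_add {Ω : Type*} {mΩ : MeasurableSpace Ω} {P : Measure Ω} {p : ℝ≥0∞}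
    (hp : 1 ≤ p) {f g h : Ω → ℝ} (hf : AEStronglyMeasurable f P) (hg : AEStronglyMeasurable g P)
    (hh : AEStronglyMeasurable h P) : eLpNorm (fun z => f z - h z) p P ≤
      eLpNorm (fun z => f z - g z) p P + eLpNorm (fun z => g z - h z) p P := by
  refine le_of_eq_of_le (congrArg (fun F => eLpNorm F p P) ?_)
    (eLpNorm_add_le (hf.sub hg) (hg.sub hh) hp)
  funext z
  simp only [Pi.add_apply, sub_add_sub_cancel]

lemma IsFreeField.tendsto_sub_wickLim (hμ : IsFreeField δ μ) (S : Finset (ℤ × ℤ)) (n : ℕ) (g : L2) :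
    Tendsto (fun N => eLpNorm (fun z => wickInt n S g z.toDistr - wickInt n (box N) g z.toDistr -
      (wickInt n S g z.toDistr - wickLim hμ n g z)) 2 μ) atTop (𝓝 0) := by
  refine (hμ.tendsto_wickLim n g).congr fun N => eLpNorm_congr_norm_ae (Eventually.of_forall ?_)
  intro z
  rw [← norm_neg]
  congr 1; ring

lemma IsFreeField.isHyper_sub_wickLim (hμ : IsFreeField δ μ) {S : Finset (ℤ × ℤ)} (hS : IsSymm S)
    (n : ℕ) (g : L2) : IsHyper μ n fun z => wickInt n S g z.toDistr - wickLim hμ n g z :=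
  IsHyper.of_tendsto (fun N => hμ.isHyper_wickInt_sub hS (isSymm_box N) n (integrable_L2 g))
    (fun N => (hμ.memLp_wickInt hS n (integrable_L2 g)).sub
      (hμ.memLp_wickInt (isSymm_box N) n (integrable_L2 g)))
    ((hμ.memLp_wickInt hS n (integrable_L2 g)).sub (hμ.memLp_wickLim n g))
    (hμ.tendsto_sub_wickLim S n g)

/-- The limit is defined along boxes; comparing `S` with larger and larger boxes shows that any
symmetric sets exhausting the frequencies lead to the same limit. -/
lemma IsFreeField.eLpNorm_two_sub_wickLim_le (hμ : IsFreeField δ μ) {S : Finset (ℤ × ℤ)}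
    (hS : IsSymm S) (n : ℕ) (g : L2) {M : ℕ} (h : box M ⊆ S) :
    eLpNorm (fun z => wickInt n S g z.toDistr - wickLim hμ n g z) 2 μ ≤
      ENNReal.ofReal √(wickDev n M g) := by
  have h1 := (tendsto_const_nhds (x := ENNReal.ofReal √(wickDev n M g))).add
    (hμ.tendsto_wickLim n g)
  rw [add_zero] at h1
  refine ge_of_tendsto h1 ?_
  filter_upwards [eventually_ge_atTop M] with N hN
  refine (eLpNorm_sub_le_add one_le_two (hμ.memLp_wickInt hS n (integrable_L2 g)).1
    (hμ.memLp_wickInt (isSymm_box N) n (integrable_L2 g)).1 (hμ.memLp_wickLim n g).1).trans ?_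
  exact add_le_add_left (hμ.eLpNorm_wickInt_sub_le hS (isSymm_box N) n g h (box_mono hN)) _

lemma IsFreeField.eLpNorm_two_wickLim_le (hμ : IsFreeField δ μ) (n : ℕ) (g : L2) :
    eLpNorm (wickLim hμ n g) 2 μ ≤ ENNReal.ofReal √(wickQ n g) := by
  have h1 := (tendsto_const_nhds (x := ENNReal.ofReal √(wickQ n g))).add
    (hμ.tendsto_wickLim n g)
  rw [add_zero] at h1
  refine ge_of_tendsto' h1 fun N => ?_
  have hm := (hμ.memLp_wickInt (isSymm_box N) n (integrable_L2 g)).1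
  have h2 := eLpNorm_sub_le hm (hm.sub (hμ.memLp_wickLim n g).1) (one_le_two (α := ℝ≥0∞))
  rw [sub_sub_cancel] at h2
  exact h2.trans (add_le_add_left (hμ.eLpNorm_wickInt_le (isSymm_box N) n g) _)

/-- The hypercontractivity constant. -/
abbrev hyperC (n : ℕ) (p : ℝ) : ℝ := (p - 1) ^ ((n : ℝ) / 2)

lemma IsFreeField.eLpNorm_sub_wickLim_le (hμ : IsFreeField δ μ) {S : Finset (ℤ × ℤ)}
    (hS : IsSymm S) (n : ℕ) (g : L2) {M : ℕ} (h : box M ⊆ S) {p : ℝ} (hp : 2 ≤ p) :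
    eLpNorm (fun z => wickInt n S g z.toDistr - wickLim hμ n g z) (ENNReal.ofReal p) μ ≤
      ENNReal.ofReal (hyperC n p * √(wickDev n M g)) := by
  rw [ENNReal.ofReal_mul (Real.rpow_nonneg (by linarith) _)]
  exact (hμ.isHyper_sub_wickLim hS n g p hp).trans
    (mul_le_mul_right (hμ.eLpNorm_two_sub_wickLim_le hS n g h) _)

lemma IsFreeField.eLpNorm_wickLim_le (hμ : IsFreeField δ μ) (n : ℕ) (g : L2) {p : ℝ} (hp : 2 ≤ p) :
    eLpNorm (wickLim hμ n g) (ENNReal.ofReal p) μ ≤ ENNReal.ofReal (hyperC n p * √(wickQ n g)) := by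
  rw [ENNReal.ofReal_mul (Real.rpow_nonneg (by linarith) _)]
  exact (hμ.isHyper_wickLim n g p hp).trans (mul_le_mul_right (hμ.eLpNorm_two_wickLim_le n g) _)

lemma IsFreeField.eLpNorm_wickInt_rpow_le (hμ : IsFreeField δ μ) {S : Finset (ℤ × ℤ)}
    (hS : IsSymm S) (n : ℕ) (g : L2) {p : ℝ} (hp : 2 ≤ p) :
    eLpNorm (fun z => wickInt n S g z.toDistr) (ENNReal.ofReal p) μ ≤
      ENNReal.ofReal (hyperC n p * √(wickQ n g)) := by
  rw [ENNReal.ofReal_mul (Real.rpow_nonneg (by linarith) _)]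
  exact (hμ.isHyper_wickInt hS n (integrable_L2 g) p hp).trans
    (mul_le_mul_right (hμ.eLpNorm_wickInt_le hS n g) _)

end

section

/-! ### Cutoffs -/

lemma IsCutoff.mem_smul {Λ : Set (ℝ × ℝ)} (h : IsCutoff Λ) (N : ℕ) (k : ℤ × ℤ) :
    k ∈ intFinset ((N : ℝ) • Λ) ↔ ((k.1 : ℝ), (k.2 : ℝ)) ∈ (N : ℝ) • Λ :=
  mem_intFinset (h.isCompact.smul (N : ℝ)) k

lemma IsCutoff.isSymm {Λ : Set (ℝ × ℝ)} (h : IsCutoff Λ) (N : ℕ) :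
    IsSymm (intFinset ((N : ℝ) • Λ)) where
  neg_mem k hk := by
    rw [h.mem_smul] at hk ⊢
    obtain ⟨y, hy, hyk⟩ := Set.mem_smul_set.1 hk
    refine Set.mem_smul_set.2 ⟨-y, ?_, ?_⟩
    · rw [← h.symm]; simpa using hy
    · rw [smul_neg, hyk]; simp
  zero_mem := by
    rw [h.mem_smul]
    exact Set.mem_smul_set.2 ⟨0, interior_subset h.zero_mem, by simp [Prod.zero_eq_mk]⟩

/-- Here `0` is an interior point of `Λ`: a ball of radius `r` for the maximum norm lies in `Λ`, and
`N > M/r` suffices. -/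
lemma IsCutoff.eventually_box_subset {Λ : Set (ℝ × ℝ)} (h : IsCutoff Λ) (M : ℕ) :
    ∀ᶠ N : ℕ in atTop, box M ⊆ intFinset ((N : ℝ) • Λ) := by
  obtain ⟨r, hr, hb⟩ := Metric.mem_nhds_iff.1 (mem_interior_iff_mem_nhds.1 h.zero_mem)
  obtain ⟨N₀, hN₀⟩ := exists_nat_gt (M / r)
  filter_upwards [eventually_ge_atTop (N₀ + 1)] with N hN k hk
  have hN1 : (M : ℝ) / r < N := hN₀.trans_le (by exact_mod_cast (Nat.le_succ N₀).trans hN)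
  have hN0 : (0 : ℝ) < N := lt_of_le_of_lt (by positivity) hN1
  rw [h.mem_smul]
  refine Set.mem_smul_set.2 ⟨(N : ℝ)⁻¹ • ((k.1 : ℝ), (k.2 : ℝ)), hb ?_, ?_⟩
  · rw [mem_ball_zero_iff, norm_smul, norm_inv, Real.norm_of_nonneg hN0.le, inv_mul_lt_iff₀ hN0]
    rw [mem_box] at hk
    have h1 : ‖((k.1 : ℝ), (k.2 : ℝ))‖ ≤ M := by
      rw [Prod.norm_mk, Real.norm_eq_abs, Real.norm_eq_abs]
      exact max_le (by exact_mod_cast hk.1) (by exact_mod_cast hk.2)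
    rw [div_lt_iff₀ hr] at hN1
    linarith
  · rw [smul_smul, mul_inv_cancel₀ hN0.ne', one_smul]

lemma cutoffField_eq {Λ : Set (ℝ × ℝ)} (h : IsSymm (intFinset Λ)) {s : ℝ} (z : Sobolev s) (x : T2) :
    cutoffField Λ z x = fld (intFinset Λ) z.toDistr x := by
  rw [cutoffField, fld, h.sum_eq_half, Complex.re_sum]
  refine Finset.sum_congr rfl fun k _ => ?_
  rw [z.isReal.rc_neg, rc, cas_neg, cas, Complex.mul_re]
  ring

lemma rho_sq (Λ : Set (ℝ × ℝ)) : rho Λ ^ 2 = rhoSq (intFinset Λ) := by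
  have hpi := Real.pi_pos
  rw [rho, rhoSq, mul_pow, Real.sq_sqrt (Finset.sum_nonneg fun k _ => (inv_pos.2 (lam_pos k)).le)]
  congr 1
  field_simp; norm_num

/-- The normalization by `√(n!)` cancels, and `ρⁿ He_n(u/ρ) = H_n(u; ρ²)`. The variance is positive
because `0` is one of the frequencies. -/
lemma wickReg_eq {Λ : Set (ℝ × ℝ)} (h : IsSymm (intFinset Λ)) (n : ℕ) {s : ℝ} (z : Sobolev s)
    (x : T2) : wickReg n Λ z x =
      (hermiteVar (rhoSq (intFinset Λ)) n).eval (fld (intFinset Λ) z.toDistr x) := by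
  have hρ : rho Λ ≠ 0 := fun h0 => by
    have h1 := h.rhoSq_pos
    rw [← rho_sq, h0] at h1
    norm_num at h1
  have hf : √(n.factorial : ℝ) ≠ 0 := (Real.sqrt_pos.2 (by exact_mod_cast n.factorial_pos)).ne'
  rw [wickReg, hermiteFn, cutoffField_eq h, ← rho_sq, ← pow_mul_aeval_hermite hρ]
  field_simp

lemma wickRegTest_eq {Λ : Set (ℝ × ℝ)} (h : IsSymm (intFinset Λ)) (n : ℕ) (g : L2) {s : ℝ}
    (z : Sobolev s) : wickRegTest n Λ g z = wickInt n (intFinset Λ) g z.toDistr := by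
  simp only [wickRegTest, wickReg_eq h, wickInt]

/-- Each coordinate of the Sobolev-valued power is the power tested against a basis function, so the
first part of the theorem reduces to estimates for the second. -/
lemma rc_wickRegSobolev {Λ : Set (ℝ × ℝ)} (h : IsSymm (intFinset Λ)) (n : ℕ) {α : ℝ} (hα : 0 ≤ α)
    {s : ℝ} (z : Sobolev s) (m : ℤ × ℤ) : rc (wickRegSobolev n Λ α hα z).toDistr m =
      wickInt n (intFinset Λ) (casLp m) z.toDistr := by
  have h1 : (wickRegSobolev n Λ α hα z).toDistr = L2.toDistr ((memLp_wickReg n Λ z).toLp _) := rfl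
  rw [h1, rc_toDistr, wickInt]
  refine integral_congr_ae ?_
  filter_upwards [(memLp_wickReg n Λ z).coeFn_toLp, coeFn_casLp m] with x hx hm
  rw [hx, hm, wickReg_eq h]

/-! ### Sobolev-valued Wick powers -/

lemma sum_wickQ_le {n : ℕ} {α B : ℝ} (hB : ∀ M S : Finset (ℤ × ℤ),
    ∑ m ∈ M, lam m ^ (-α) * wickVar n S (casLp m) ≤ B) (M : Finset (ℤ × ℤ)) :
    ∑ m ∈ M, lam m ^ (-α) * wickQ n (casLp m) ≤ B :=
  le_of_tendsto' (tendsto_finsetSum M fun m _ => (tendsto_wickVar n (casLp m)).const_mul _)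
    fun N => hB M (box N)

lemma summable_wickQ (n : ℕ) {α : ℝ} (hα : 0 < α) :
    Summable fun m => lam m ^ (-α) * wickQ n (casLp m) := by
  obtain ⟨B, -, hB⟩ := exists_sum_wickVar_le n hα
  exact summable_of_sum_le (fun m => mul_nonneg (lam_rpow_pos m _).le (wickQ_nonneg n _))
    (sum_wickQ_le hB)

lemma tsum_wickQ_le {n : ℕ} {α B : ℝ} (hα : 0 < α) (hB : ∀ M S : Finset (ℤ × ℤ),
    ∑ m ∈ M, lam m ^ (-α) * wickVar n S (casLp m) ≤ B) :
    ∑' m, lam m ^ (-α) * wickQ n (casLp m) ≤ B :=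
  (summable_wickQ n hα).tsum_le_of_sum_le (sum_wickQ_le hB)

lemma summable_wickDev (n M : ℕ) {α : ℝ} (hα : 0 < α) :
    Summable fun m => lam m ^ (-α) * wickDev n M (casLp m) := by
  refine Summable.of_nonneg_of_le
    (fun m => mul_nonneg (lam_rpow_pos m _).le (wickDev_nonneg n M _)) (fun m => ?_)
    ((summable_wickQ n hα).mul_left 2)
  nlinarith [mul_le_mul_of_nonneg_left (wickDev_le n M (casLp m)) (lam_rpow_pos m (-α)).le]

/-- Each term tends to `0`, and twice the summable family of limiting variances dominates. -/
lemma tendsto_tsum_wickDev (n : ℕ) {α : ℝ} (hα : 0 < α) :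
    Tendsto (fun M => ∑' m, lam m ^ (-α) * wickDev n M (casLp m)) atTop (𝓝 0) := by
  have h := tendsto_tsum_of_dominated_convergence
    (f := fun (M : ℕ) m => lam m ^ (-α) * wickDev n M (casLp m)) (g := fun _ => 0)
    (𝓕 := atTop) ((summable_wickQ n hα).mul_left 2) (fun m => ?_)
    (Eventually.of_forall fun M m => ?_)
  · simpa using h
  · have := (tendsto_wickDev n (casLp m)).const_mul (lam m ^ (-α))
    rwa [mul_zero] at this
  · rw [Real.norm_of_nonneg (mul_nonneg (lam_rpow_pos m _).le (wickDev_nonneg n M _))]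
    nlinarith [mul_le_mul_of_nonneg_left (wickDev_le n M (casLp m)) (lam_rpow_pos m (-α)).le]

lemma eLpNorm_sobolev_le_of {Ω : Type*} {mΩ : MeasurableSpace Ω} {P : Measure Ω} {s : ℝ}
    {U : Ω → Sobolev s} (h : ∀ k, AEStronglyMeasurable (fun z => rc (U z).toDistr k) P) {p : ℝ}
    (hp : 2 ≤ p) {A : ℝ} (hA : 0 ≤ A) {b : ℤ × ℤ → ℝ} (hb : ∀ k, 0 ≤ b k)
    (hs : Summable fun k => lam k ^ s * b k)
    (hU : ∀ k, eLpNorm (fun z => rc (U z).toDistr k) (ENNReal.ofReal p) P ≤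
      ENNReal.ofReal (A * √(b k))) :
    eLpNorm U (ENNReal.ofReal p) P ≤ ENNReal.ofReal (A * √(∑' k, lam k ^ s * b k)) := by
  have h0 : ∀ k, 0 ≤ lam k ^ s * b k := fun k => mul_nonneg (lam_rpow_pos k s).le (hb k)
  rw [← ENNReal.pow_le_pow_left_iff two_ne_zero, ← ENNReal.ofReal_pow (by positivity), mul_pow,
    Real.sq_sqrt (tsum_nonneg h0), ← tsum_mul_left, ENNReal.ofReal_tsum_of_nonneg
      (fun k => mul_nonneg (sq_nonneg A) (h0 k)) (hs.mul_left _)]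
  refine (eLpNorm_sobolev_le h hp).trans (ENNReal.tsum_le_tsum fun k => ?_)
  calc _ ≤ ENNReal.ofReal (lam k ^ s) * ENNReal.ofReal (A * √(b k)) ^ 2 :=
        mul_le_mul_right (pow_le_pow_left₀ zero_le (hU k) 2) _
    _ = _ := by
        rw [← ENNReal.ofReal_pow (by positivity), mul_pow, Real.sq_sqrt (hb k),
          ← ENNReal.ofReal_mul (lam_rpow_pos k s).le]
        congr 1; ring

variable {δ : ℝ} {μ : Measure (Sobolev (-δ))}

/-- The expectation of the weighted sum of squares is at most the finite sum of `λ^{-α} wickQ`, so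
the sum is finite almost surely. -/
lemma IsFreeField.ae_summable (hμ : IsFreeField δ μ) (n : ℕ) {α : ℝ} (hα : 0 < α) :
    ∀ᵐ z ∂μ, Summable fun m => lam m ^ (-α) * wickLim hμ n (casLp m) z ^ 2 := by
  have hm : ∀ m, AEMeasurable (fun z => ENNReal.ofReal (lam m ^ (-α)) *
      ENNReal.ofReal (wickLim hμ n (casLp m) z ^ 2)) μ := fun m =>
    (((hμ.memLp_wickLim n (casLp m)).1.aemeasurable.pow_const 2).ennreal_ofReal).const_mul _
  have h1 : ∫⁻ z, ∑' m, ENNReal.ofReal (lam m ^ (-α)) *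
      ENNReal.ofReal (wickLim hμ n (casLp m) z ^ 2) ∂μ ≠ ⊤ := by
    rw [lintegral_tsum hm]
    refine ne_top_of_le_ne_top ?_ (ENNReal.tsum_le_tsum
      (g := fun m => ENNReal.ofReal (lam m ^ (-α) * wickQ n (casLp m))) fun m => ?_)
    rotate_left
    · rw [lintegral_const_mul'' _
        ((hμ.memLp_wickLim n (casLp m)).1.aemeasurable.pow_const 2).ennreal_ofReal,
        ← ofReal_integral_eq_lintegral_ofReal (hμ.memLp_wickLim n (casLp m)).integrable_sq
          (Eventually.of_forall fun z => sq_nonneg _), ← eLpNorm_two_sq (hμ.memLp_wickLim n _),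
        ENNReal.ofReal_mul (lam_rpow_pos m _).le]
      refine mul_le_mul_right ((pow_le_pow_left₀ zero_le
        (hμ.eLpNorm_two_wickLim_le n (casLp m)) 2).trans (le_of_eq ?_)) _
      rw [← ENNReal.ofReal_pow (Real.sqrt_nonneg _), Real.sq_sqrt (wickQ_nonneg _ _)]
    · rw [← ENNReal.ofReal_tsum_of_nonneg
        (fun m => mul_nonneg (lam_rpow_pos m _).le (wickQ_nonneg n _)) (summable_wickQ n hα)]
      exact ENNReal.ofReal_ne_top
  filter_upwards [ae_lt_top' (AEMeasurable.tsum hm) h1] with z hz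
  simp only [← ENNReal.ofReal_mul (lam_rpow_pos _ (-α)).le] at hz
  have h2 := ENNReal.summable_toReal hz.ne
  refine h2.congr fun m => ?_
  rw [ENNReal.toReal_ofReal (mul_nonneg (lam_rpow_pos m _).le (sq_nonneg _))]

lemma summable_lam_of_le {c : ℤ × ℤ → ℝ} {s t : ℝ} (hst : s ≤ t)
    (h : Summable fun k => lam k ^ t * c k ^ 2) : Summable fun k => lam k ^ s * c k ^ 2 :=
  Summable.of_nonneg_of_le (fun k => mul_nonneg (lam_rpow_pos k s).le (sq_nonneg _))
    (fun k => mul_le_mul_of_nonneg_right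
      (Real.rpow_le_rpow_of_exponent_le (one_le_lam k) hst) (sq_nonneg _)) h

/-- The distribution in `⋂ H^{-α}` with coordinates `c`, if there is one, and `0` otherwise. -/
def minusOfCoord (c : ℤ × ℤ → ℝ) : SobolevMinus :=
  open scoped Classical in
  if h : ∀ j : ℕ, Summable fun k => lam k ^ (-((j : ℝ) + 1)⁻¹) * c k ^ 2 then
    ⟨coordDistr c (summable_lam_of_le (by simp) (h 0)), fun α hα => by
      -- The countably many exponents `1/(j+1)` suffice since the spaces are nested; this lets the
      -- exceptional null set be chosen independently of `α`.
      obtain ⟨j, hj⟩ := exists_nat_gt α⁻¹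
      refine coordDistr_mem _ (summable_lam_of_le ?_ (h j))
      rw [neg_le_neg_iff]
      exact (inv_le_comm₀ (by positivity) hα).2 (by linarith)⟩
  else ⟨0, fun _ _ => Submodule.zero_mem _⟩

lemma rc_minusOfCoord {c : ℤ × ℤ → ℝ}
    (h : ∀ j : ℕ, Summable fun k => lam k ^ (-((j : ℝ) + 1)⁻¹) * c k ^ 2) (k : ℤ × ℤ) :
    rc (minusOfCoord c).1 k = c k := by
  have h1 : (minusOfCoord c).1 = coordDistr c (summable_lam_of_le (by simp) (h 0)) :=
    congrArg Subtype.val (dif_pos h)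
  rw [h1, rc_coordDistr]

lemma SobolevMinus.toDistr_toSobolev (u : SobolevMinus) {α : ℝ} (hα : 0 < α) :
    (u.toSobolev α hα).toDistr = u.1 := rfl

/-- The Wick power of the free field. -/
def wickPow (hμ : IsFreeField δ μ) (n : ℕ) (z : Sobolev (-δ)) : SobolevMinus :=
  minusOfCoord fun m => wickLim hμ n (casLp m) z

lemma IsFreeField.ae_rc_wickPow (hμ : IsFreeField δ μ) (n : ℕ) :
    ∀ᵐ z ∂μ, ∀ m, rc (wickPow hμ n z).1 m = wickLim hμ n (casLp m) z := by
  have h := ae_all_iff.2 fun j : ℕ =>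
    hμ.ae_summable n (α := ((j : ℝ) + 1)⁻¹) (by positivity)
  filter_upwards [h] with z hz m
  exact rc_minusOfCoord hz m

lemma IsFreeField.aestronglyMeasurable_rc_wickPow (hμ : IsFreeField δ μ) (n : ℕ) (m : ℤ × ℤ) :
    AEStronglyMeasurable (fun z => rc (wickPow hμ n z).1 m) μ :=
  (hμ.memLp_wickLim n (casLp m)).1.congr ((hμ.ae_rc_wickPow n).mono fun _ hz => (hz m).symm)

lemma hyperC_nonneg (n : ℕ) {p : ℝ} (hp : 2 ≤ p) : 0 ≤ hyperC n p :=
  Real.rpow_nonneg (by linarith) _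

lemma IsFreeField.eLpNorm_wickPow_le (hμ : IsFreeField δ μ) (n : ℕ) {α : ℝ} (hα : 0 < α) {p : ℝ}
    (hp : 2 ≤ p) :
    eLpNorm (fun z => (wickPow hμ n z).toSobolev α hα) (ENNReal.ofReal p) μ ≤
      ENNReal.ofReal (hyperC n p * √(∑' m, lam m ^ (-α) * wickQ n (casLp m))) := by
  refine eLpNorm_sobolev_le_of (fun m => ?_) hp
    (hyperC_nonneg n hp) (fun m => wickQ_nonneg n (casLp m)) (summable_wickQ n hα) fun m => ?_
  · simp only [SobolevMinus.toDistr_toSobolev]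
    exact hμ.aestronglyMeasurable_rc_wickPow n m
  · simp only [SobolevMinus.toDistr_toSobolev]
    rw [eLpNorm_congr_ae ((hμ.ae_rc_wickPow n).mono fun z hz => hz m)]
    exact hμ.eLpNorm_wickLim_le n (casLp m) hp

lemma IsFreeField.memLp_wickPow (hμ : IsFreeField δ μ) (n : ℕ) {α : ℝ} (hα : 0 < α) {p : ℝ}
    (hp : 2 ≤ p) : MemLp (fun z => (wickPow hμ n z).toSobolev α hα) (ENNReal.ofReal p) μ :=
  ⟨aestronglyMeasurable_sobolev fun m => by
      simp only [SobolevMinus.toDistr_toSobolev]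
      exact hμ.aestronglyMeasurable_rc_wickPow n m,
    (hμ.eLpNorm_wickPow_le n hα hp).trans_lt ENNReal.ofReal_lt_top⟩

lemma IsFreeField.aestronglyMeasurable_rc_wickRegSobolev (hμ : IsFreeField δ μ) (n : ℕ) {α : ℝ}
    (hα : 0 < α) {Λ : Set (ℝ × ℝ)} (h : IsSymm (intFinset Λ)) (m : ℤ × ℤ) :
    AEStronglyMeasurable
      (fun z : Sobolev (-δ) => rc (wickRegSobolev n Λ α hα.le z).toDistr m) μ := by
  simp only [rc_wickRegSobolev h]
  exact (hμ.memLp_wickInt h n (integrable_L2 _)).1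

lemma IsFreeField.memLp_wickRegSobolev (hμ : IsFreeField δ μ) (n : ℕ) {α : ℝ} (hα : 0 < α)
    {Λ : Set (ℝ × ℝ)} (h : IsSymm (intFinset Λ)) {p : ℝ} (hp : 2 ≤ p) :
    MemLp (fun z : Sobolev (-δ) => wickRegSobolev n Λ α hα.le z) (ENNReal.ofReal p) μ := by
  refine ⟨aestronglyMeasurable_sobolev (hμ.aestronglyMeasurable_rc_wickRegSobolev n hα h), ?_⟩
  refine lt_of_le_of_lt (eLpNorm_sobolev_le_of
    (hμ.aestronglyMeasurable_rc_wickRegSobolev n hα h) hp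
    (hyperC_nonneg n hp) (fun m => wickQ_nonneg n (casLp m)) (summable_wickQ n hα) fun m => ?_)
    ENNReal.ofReal_lt_top
  simp only [rc_wickRegSobolev h]
  exact hμ.eLpNorm_wickInt_rpow_le h n (casLp m) hp

lemma IsFreeField.eLpNorm_wickRegSobolev_sub_le (hμ : IsFreeField δ μ) (n : ℕ) {α : ℝ} (hα : 0 < α)
    {Λ : Set (ℝ × ℝ)} (h : IsSymm (intFinset Λ)) {M : ℕ} (hM : box M ⊆ intFinset Λ) {p : ℝ}
    (hp : 2 ≤ p) :
    eLpNorm (fun z => wickRegSobolev n Λ α hα.le z - (wickPow hμ n z).toSobolev α hα)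
      (ENNReal.ofReal p) μ ≤
      ENNReal.ofReal (hyperC n p * √(∑' m, lam m ^ (-α) * wickDev n M (casLp m))) := by
  have hrc : ∀ m (z : Sobolev (-δ)),
      rc (wickRegSobolev n Λ α hα.le z - (wickPow hμ n z).toSobolev α hα).toDistr m =
      rc (wickRegSobolev n Λ α hα.le z).toDistr m - rc (wickPow hμ n z).1 m := fun m z => by
    rw [Sobolev.toDistr_sub, rc_sub, SobolevMinus.toDistr_toSobolev]
  refine eLpNorm_sobolev_le_of (fun m => ?_) hp
    (hyperC_nonneg n hp) (fun m => wickDev_nonneg n M _) (summable_wickDev n M hα) fun m => ?_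
  · simp only [hrc]
    exact (hμ.aestronglyMeasurable_rc_wickRegSobolev n hα h m).sub
      (hμ.aestronglyMeasurable_rc_wickPow n m)
  · refine le_of_eq_of_le (eLpNorm_congr_ae ?_) (hμ.eLpNorm_sub_wickLim_le h n (casLp m) hM hp)
    filter_upwards [hμ.ae_rc_wickPow n] with z hz
    rw [hrc, rc_wickRegSobolev h, hz]

end

section

/-! ### Duality -/

/-- Parseval's identity for a smooth first factor: its Fourier series converges uniformly and may be
integrated against `g` term by term. -/
lemma pairing_toDistr {f : T2 → ℝ} (hf : MemLp f 2 (volume : Measure T2))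
    (hφ : (fun x => (f x : ℂ)) ∈ testFn) (g : L2) :
    pairing (L2.toDistr (hf.toLp f)) (L2.toDistr g) = ∫ x, f x * g x := by
  have h1 : ∀ k, fc (L2.toDistr (hf.toLp f)) k = fcFn (fun x => (f x : ℂ)) k := fun k => by
    rw [fc_toDistr, fcFn]
    refine integral_congr_ae ?_
    filter_upwards [hf.coeFn_toLp] with x hx
    rw [hx]
  have hgi : Integrable (fun x => (g x : ℂ)) := (integrable_L2 g).ofReal
  have hmul : ∀ F : C(T2, ℂ), Integrable fun x => F x * (g x : ℂ) := fun F => by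
    have := hgi.bdd_mul (c := ‖F‖) (f := F) F.continuous.aestronglyMeasurable
      (Eventually.of_forall fun x => F.norm_coe_le_norm x)
    exact this
  let L : C(T2, ℂ) →L[ℂ] ℂ := LinearMap.mkContinuous
    { toFun := fun F => ∫ x, F x * (g x : ℂ)
      map_add' := fun F F' => by
        rw [← integral_add (hmul F) (hmul F')]
        simp only [ContinuousMap.add_apply, add_mul]
      map_smul' := fun c F => by
        rw [RingHom.id_apply, smul_eq_mul, ← integral_const_mul]
        simp only [ContinuousMap.smul_apply, smul_eq_mul, mul_assoc] }
    (∫ x, ‖(g x : ℂ)‖) fun F => by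
      change ‖∫ x, F x * (g x : ℂ)‖ ≤ _
      rw [mul_comm (∫ x, _), ← integral_const_mul]
      refine norm_integral_le_of_norm_le (hgi.norm.const_mul _) (Eventually.of_forall fun x => ?_)
      rw [norm_mul]
      exact mul_le_mul_of_nonneg_right (F.norm_coe_le_norm x) (norm_nonneg _)
  have h2 := L.hasSum (hasSum_fcFn ⟨_, hφ⟩)
  have h3 : ∀ k, L (fcFn (fun x => (f x : ℂ)) k • expC k) =
      fc (L2.toDistr (hf.toLp f)) k * fc (L2.toDistr g) (-k) := fun k => by
    rw [map_smul, smul_eq_mul, h1, fc_toDistr, neg_neg]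
    congr 1
    refine integral_congr_ae (Eventually.of_forall fun x => ?_)
    exact mul_comm (expFn k x) (g x : ℂ)
  have h4 : L ⟨fun x => (f x : ℂ), continuous_of_mem hφ⟩ = ((∫ x, f x * g x : ℝ) : ℂ) := by
    rw [← integral_complex_ofReal]
    refine integral_congr_ae (Eventually.of_forall fun x => ?_)
    exact (Complex.ofReal_mul _ _).symm
  simp only [h3] at h2
  rw [pairing, h2.tsum_eq]
  exact (congrArg Complex.re h4).trans (Complex.ofReal_re _)

lemma contDiff_cas (k : ℤ × ℤ) : ContDiff ℝ ∞ fun x : ℝ × ℝ => cas k (proj x) := by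
  have h : ContDiff ℝ ∞ fun x : ℝ × ℝ => expFn k (proj x) := expFn_mem k
  exact (Complex.reCLM.contDiff.comp h).add (Complex.imCLM.contDiff.comp h)

lemma wickReg_mem_testFn {Λ : Set (ℝ × ℝ)} (h : IsSymm (intFinset Λ)) (n : ℕ) {s : ℝ}
    (z : Sobolev s) : (fun x => (wickReg n Λ z x : ℂ)) ∈ testFn := by
  change ContDiff ℝ ∞ fun x => (wickReg n Λ z (proj x) : ℂ)
  simp only [wickReg_eq h, fld]
  have h1 : ContDiff ℝ ∞ fun u : ℝ => (hermiteVar (rhoSq (intFinset Λ)) n).eval u := by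
    simpa using (hermiteVar (rhoSq (intFinset Λ)) n).contDiff_aeval (𝕜 := ℝ) ∞
  exact Complex.ofRealCLM.contDiff.comp (h1.comp (ContDiff.sum fun k _ => contDiff_const.mul (contDiff_cas k)))

lemma pairing_wickRegSobolev {Λ : Set (ℝ × ℝ)} (h : IsSymm (intFinset Λ)) (n : ℕ) {α : ℝ}
    (hα : 0 ≤ α) {s : ℝ} (z : Sobolev s) (g : L2) :
    pairing (wickRegSobolev n Λ α hα z).toDistr (L2.toDistr g) =
      wickInt n (intFinset Λ) g z.toDistr := by
  rw [← wickRegTest_eq h]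
  exact pairing_toDistr (memLp_wickReg n Λ z) (wickReg_mem_testFn h n z) g

lemma hasSum_pairing' {s : ℝ} (u : Sobolev (-s)) (v : Sobolev s) :
    HasSum (fun k => rc u.toDistr k * rc v.toDistr k) (pairing u.toDistr v.toDistr) :=
  hasSum_pairing u.2 v.2

lemma pairing_sub {s : ℝ} (u u' : Sobolev (-s)) (v : Sobolev s) :
    pairing (u - u').toDistr v.toDistr = pairing u.toDistr v.toDistr - pairing u'.toDistr v.toDistr := by
  refine (hasSum_pairing' (u - u') v).unique ?_
  have h := (hasSum_pairing' u v).sub (hasSum_pairing' u' v)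
  simpa only [Sobolev.toDistr_sub, rc_sub, sub_mul] using h

/-- Cauchy–Schwarz on finite sums, with the weights `λ^{-s/2}` and `λ^{s/2}` distributed over the
two factors. -/
lemma abs_pairing_le {s : ℝ} (u : Sobolev (-s)) (v : Sobolev s) :
    |pairing u.toDistr v.toDistr| ≤ ‖v‖ * ‖u‖ := by
  refine abs_le_of_sq_le_sq ?_ (by positivity)
  refine le_of_tendsto ((hasSum_pairing' u v).pow 2) (Eventually.of_forall fun F => ?_)
  have h1 := Finset.sum_mul_sq_le_sq_mul_sq F
    (fun k => lam k ^ (-s / 2) * rc u.toDistr k) (fun k => lam k ^ (s / 2) * rc v.toDistr k)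
  have e1 : ∀ k, lam k ^ (-s / 2) * rc u.toDistr k * (lam k ^ (s / 2) * rc v.toDistr k) =
      rc u.toDistr k * rc v.toDistr k := fun k => by
    have : lam k ^ (-s / 2) * lam k ^ (s / 2) = 1 := by
      rw [← Real.rpow_add (lam_pos k), neg_div, neg_add_cancel, Real.rpow_zero]
    linear_combination (rc u.toDistr k * rc v.toDistr k) * this
  have e2 : ∀ (t : ℝ) (k : ℤ × ℤ) (c : ℝ), (lam k ^ (t / 2) * c) ^ 2 = lam k ^ t * c ^ 2 := by
    intro t k c
    rw [mul_pow, ← Real.rpow_natCast, ← Real.rpow_mul (lam_pos k).le]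
    norm_num
  simp only [e1, e2] at h1
  have h2 := sum_le_hasSum F (fun k _ => mul_nonneg (lam_rpow_pos k _).le (sq_nonneg _))
    (Sobolev.hasSum_norm_sq u)
  have h3 := sum_le_hasSum F (fun k _ => mul_nonneg (lam_rpow_pos k _).le (sq_nonneg _))
    (Sobolev.hasSum_norm_sq v)
  refine h1.trans ((mul_le_mul h2 h3 (Finset.sum_nonneg fun k _ =>
    mul_nonneg (lam_rpow_pos k _).le (sq_nonneg _)) (sq_nonneg _)).trans (le_of_eq ?_))
  ring

variable {δ : ℝ} {μ : Measure (Sobolev (-δ))}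

lemma exists_isCutoff : ∃ Λ : Set (ℝ × ℝ), IsCutoff Λ :=
  ⟨Metric.closedBall 0 1, isCompact_closedBall 0 1, by simp,
    mem_interior_iff_mem_nhds.2 (Metric.closedBall_mem_nhds 0 one_pos)⟩

lemma tendsto_of_forall_box {f : ℕ → ℝ≥0∞} {b : ℕ → ℝ} (hb : Tendsto b atTop (𝓝 0)) {A : ℝ}
    (h : ∀ M, ∀ᶠ N in atTop, f N ≤ ENNReal.ofReal (A * √(b M))) : Tendsto f atTop (𝓝 0) := by
  have h1 : Tendsto (fun M => ENNReal.ofReal (A * √(b M))) atTop (𝓝 0) := by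
    have := ENNReal.tendsto_ofReal ((hb.sqrt).const_mul A)
    rwa [Real.sqrt_zero, mul_zero, ENNReal.ofReal_zero] at this
  rw [ENNReal.tendsto_nhds_zero] at h1 ⊢
  intro ε hε
  obtain ⟨M, hM⟩ := (h1 ε hε).exists
  exact (h M).mono fun N hN => hN.trans hM

lemma IsFreeField.tendsto_wickRegTest (hμ : IsFreeField δ μ) (n : ℕ) (g : L2) {Λ : Set (ℝ × ℝ)}
    (h : IsCutoff Λ) {p : ℝ} (hp : 2 ≤ p) :
    Tendsto (fun N : ℕ => eLpNorm (fun z => wickRegTest n ((N : ℝ) • Λ) g z - wickLim hμ n g z)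
      (ENNReal.ofReal p) μ) atTop (𝓝 0) := by
  refine tendsto_of_forall_box (A := hyperC n p) (tendsto_wickDev n g) fun M => ?_
  filter_upwards [h.eventually_box_subset M] with N hN
  simp only [wickRegTest_eq (h.isSymm N)]
  exact hμ.eLpNorm_sub_wickLim_le (h.isSymm N) n g hN hp

lemma IsFreeField.tendsto_wickRegSobolev (hμ : IsFreeField δ μ) (n : ℕ) {α : ℝ} (hα : 0 < α)
    {Λ : Set (ℝ × ℝ)} (h : IsCutoff Λ) {p : ℝ} (hp : 2 ≤ p) :
    Tendsto (fun N : ℕ => eLpNorm (fun z => wickRegSobolev n ((N : ℝ) • Λ) α hα.le z -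
      (wickPow hμ n z).toSobolev α hα) (ENNReal.ofReal p) μ) atTop (𝓝 0) := by
  refine tendsto_of_forall_box (A := hyperC n p) (tendsto_tsum_wickDev n hα) fun M => ?_
  filter_upwards [h.eventually_box_subset M] with N hN
  exact hμ.eLpNorm_wickRegSobolev_sub_le n hα (h.isSymm N) hN hp

/-- For the regularized powers the identity is Parseval's. Both sides converge in `L²` along one
cutoff: the tested power by construction, the pairing because it is bounded by the norm in `H^{-α}`
times that of `g` in `H^α`. -/
lemma IsFreeField.wickLim_ae_eq_pairing (hμ : IsFreeField δ μ) (n : ℕ) {α : ℝ} (hα : 0 < α)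
    (g : L2) (hg : L2.toDistr g ∈ sobolevSet α) :
    ∀ᵐ z ∂μ, wickLim hμ n g z = pairing (wickPow hμ n z).1 (L2.toDistr g) := by
  obtain ⟨Λ, hΛ⟩ := exists_isCutoff
  let v : Sobolev α := ⟨L2.toDistr g, hg⟩
  let R : Sobolev (-δ) → ℝ := fun z => pairing (wickPow hμ n z).1 (L2.toDistr g)
  let T : ℕ → Sobolev (-δ) → ℝ := fun N z => wickRegTest n ((N : ℝ) • Λ) g z
  have hR : AEStronglyMeasurable R μ := by
    refine aestronglyMeasurable_of_tendsto_ae atTop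
      (f := fun (F : Finset (ℤ × ℤ)) z => ∑ k ∈ F, rc (wickPow hμ n z).1 k * rc (L2.toDistr g) k)
      (fun F => ?_) (Eventually.of_forall fun z =>
        hasSum_pairing' ((wickPow hμ n z).toSobolev α hα) v)
    exact Finset.aestronglyMeasurable_fun_sum _ fun k _ =>
      (hμ.aestronglyMeasurable_rc_wickPow n k).mul_const _
  have hT : ∀ N, AEStronglyMeasurable (T N) μ := fun N => by
    simp only [T, wickRegTest_eq (hΛ.isSymm N)]
    exact (hμ.memLp_wickInt (hΛ.isSymm N) n (integrable_L2 g)).1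
  have h2 : ENNReal.ofReal 2 = 2 := by norm_num
  have t1 := hμ.tendsto_wickRegTest n g hΛ le_rfl
  have t2 := ENNReal.Tendsto.const_mul (a := ENNReal.ofReal ‖v‖)
    (hμ.tendsto_wickRegSobolev n hα hΛ le_rfl) (Or.inr ENNReal.ofReal_ne_top)
  rw [h2] at t1 t2
  rw [mul_zero] at t2
  have h3 : ∀ N, eLpNorm (fun z => wickLim hμ n g z - R z) 2 μ ≤
      eLpNorm (fun z => T N z - wickLim hμ n g z) 2 μ +
      ENNReal.ofReal ‖v‖ * eLpNorm (fun z => wickRegSobolev n ((N : ℝ) • Λ) α hα.le z -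
        (wickPow hμ n z).toSobolev α hα) 2 μ := by
    intro N
    refine (eLpNorm_sub_le_add one_le_two (hμ.memLp_wickLim n g).1 (hT N) hR).trans
      (add_le_add (le_of_eq (eLpNorm_congr_norm_ae (Eventually.of_forall fun z => ?_))) ?_)
    · exact norm_sub_rev _ _
    · refine eLpNorm_le_mul_eLpNorm_of_ae_le_mul (Eventually.of_forall fun z => ?_) 2
      have h4 : T N z - R z = pairing (wickRegSobolev n ((N : ℝ) • Λ) α hα.le z -
          (wickPow hμ n z).toSobolev α hα).toDistr v.toDistr := by
        rw [pairing_sub]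
        congr 1
        exact (wickRegTest_eq (hΛ.isSymm N) n g z).trans
          (pairing_wickRegSobolev (hΛ.isSymm N) n hα.le z g).symm
      rw [h4, Real.norm_eq_abs]
      exact abs_pairing_le _ _
  have h5 : eLpNorm (fun z => wickLim hμ n g z - R z) 2 μ = 0 := by
    have := ge_of_tendsto' (t1.add t2) h3
    simpa using this
  filter_upwards [(eLpNorm_eq_zero_iff ((hμ.memLp_wickLim n g).1.sub hR) two_ne_zero).1 h5] with z hz
  exact sub_eq_zero.1 hz

end

section

/-! ### Wiener chaos -/

variable {δ : ℝ} {μ : Measure (Sobolev (-δ))}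

/-- The representing `f` is a normalized trigonometric polynomial, hence already lies in `H^δ`, and
a constant approximating sequence works. Its norm in `H^{-1}` is `1` because the squared norm before
normalization is `rhoSq S`. -/
lemma IsSymm.isWhiteNoise_fld (hμ : IsFreeField δ μ) (hδ : 0 < δ) {S : Finset (ℤ × ℤ)}
    (hS : IsSymm S) (x : T2) : ∃ f : Sobolev (-1), ‖f‖ = 1 ∧
      IsWhiteNoise hδ μ f fun z => (√(rhoSq S))⁻¹ * fld S z.toDistr x := by
  have hρ := Real.sqrt_pos.2 hS.rhoSq_pos
  refine ⟨∑ k ∈ S, ((√(rhoSq S))⁻¹ * cas k x) • casS (-1) k, ?_, ?_, fun _ =>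
    ∑ k ∈ S, ((√(rhoSq S))⁻¹ * cas k x) • casS δ k, ?_, ?_⟩
  · rw [← sq_eq_sq₀ (norm_nonneg _) zero_le_one, one_pow]
    refine (Sobolev.hasSum_norm_sq _).unique ?_
    have h1 : HasSum (fun k => if k ∈ S then lam k ^ (-1 : ℝ) *
        ((√(rhoSq S))⁻¹ * cas k x) ^ 2 else 0) _ :=
      hasSum_sum_of_ne_finset_zero (s := S) fun k hk => if_neg hk
    have e : (fun k => lam k ^ (-1 : ℝ) *
        rc (∑ k ∈ S, ((√(rhoSq S))⁻¹ * cas k x) • casS (-1) k).toDistr k ^ 2) =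
        fun k => if k ∈ S then lam k ^ (-1 : ℝ) * ((√(rhoSq S))⁻¹ * cas k x) ^ 2 else 0 := by
      funext k
      rw [rc_sum_casS]
      split_ifs <;> ring
    rw [e]
    convert h1 using 1
    have h2 : ∀ k ∈ S, (if k ∈ S then lam k ^ (-1 : ℝ) * ((√(rhoSq S))⁻¹ * cas k x) ^ 2 else 0) =
        (rhoSq S)⁻¹ * ((lam k)⁻¹ * cas k x ^ 2) := fun k hk => by
      rw [if_pos hk, Real.rpow_neg_one, mul_pow, inv_pow, Real.sq_sqrt hS.rhoSq_pos.le]; ring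
    rw [Finset.sum_congr rfl h2, ← Finset.mul_sum, hS.sum_cas_sq,
      inv_mul_cancel₀ hS.rhoSq_pos.ne']
  · have := hμ.isGaussian
    have h2 : ∀ k, MemLp (fun z : Sobolev (-δ) => rc z.toDistr k) 2 μ := fun k => by
      simp only [← inner_casS]
      exact IsGaussian.memLp_dual μ (innerSL ℝ (lam k ^ δ • casS (-δ) k)) 2 (by norm_num)
    exact (memLp_finsetSum S fun k _ => (h2 k).mul_const _).const_mul _
  · have h1 : ((∑ k ∈ S, ((√(rhoSq S))⁻¹ * cas k x) • casS δ k).incl (by linarith : -1 ≤ δ)) =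
        ∑ k ∈ S, ((√(rhoSq S))⁻¹ * cas k x) • casS (-1) k := by
      refine Subtype.ext ?_
      change (∑ k ∈ S, ((√(rhoSq S))⁻¹ * cas k x) • casS δ k).toDistr =
        (∑ k ∈ S, ((√(rhoSq S))⁻¹ * cas k x) • casS (-1) k).toDistr
      refine eq_of_rc (Sobolev.isReal _) (Sobolev.isReal _) fun k => ?_
      rw [rc_sum_casS, rc_sum_casS]
    simp only [h1]
    exact tendsto_const_nhds
  · have h1 : ∀ z : Sobolev (-δ), pairing z.toDistr
        (∑ k ∈ S, ((√(rhoSq S))⁻¹ * cas k x) • casS δ k).toDistr =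
        (√(rhoSq S))⁻¹ * fld S z.toDistr x := fun z => by
      refine (hasSum_pairing' z _).unique ?_
      simp only [rc_sum_casS]
      have h2 : HasSum (fun k => rc z.toDistr k * if k ∈ S then (√(rhoSq S))⁻¹ * cas k x else 0) _ :=
        hasSum_sum_of_ne_finset_zero (s := S) fun k hk => by rw [if_neg hk, mul_zero]
      convert h2 using 1
      rw [fld, Finset.mul_sum]
      refine Finset.sum_congr rfl fun k hk => ?_
      rw [if_pos hk]; ring
    simp only [h1, sub_self]
    simp

lemma continuous_fld (S : Finset (ℤ × ℤ)) :
    Continuous fun q : Sobolev (-δ) × T2 => fld S q.1.toDistr q.2 :=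
  continuous_finsetSum _ fun k _ => ((continuous_rc k).comp continuous_fst).mul
    ((continuous_cas k).comp continuous_snd)

lemma IsFreeField.exists_fld_bound (hμ : IsFreeField δ μ) {S : Finset (ℤ × ℤ)} (hS : IsSymm S)
    (n : ℕ) : ∃ Γ : Sobolev (-δ) → ℝ, MemLp Γ 2 μ ∧ ∀ z x,
      |(hermiteVar (rhoSq S) n).eval (fld S z.toDistr x)| ≤ Γ z := by
  obtain ⟨d, e, he, hU⟩ := exists_enum S
  obtain ⟨C, V, hC, hV, hb⟩ := exists_hermiteVar_form_bound n (continuous_fldForm S e)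
  let Γ : (Fin d → ℝ) → ℝ := fun ξ => C * (1 + V * ‖ξ‖) ^ n
  have hc : Continuous Γ := by fun_prop
  have hΓ : MemLp Γ 2 (gaussPi d) := by
    rw [memLp_two_iff_integrable_sq hc.aestronglyMeasurable]
    refine ((integrable_growth_gaussPi (d := d) (n * 2) zero_le_one hV).const_mul (C ^ 2)).congr
      (Eventually.of_forall fun ξ => ?_)
    simp only [Γ]
    rw [pow_mul]; ring
  rw [← hμ.map_coord e he] at hΓ
  refine ⟨_, hΓ.comp_of_map (aemeasurable_coord e), fun z x => ?_⟩
  have h := hb x fun i => √(lam (e i)) * rc z.toDistr (e i)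
  rwa [hS.sum_fldForm_sq he hU, sum_fldForm_coord he hU] at h

lemma hermiteVar_eq_hermiteFn {S : Finset (ℤ × ℤ)} (hS : IsSymm S) (n : ℕ) (u : ℝ) :
    (hermiteVar (rhoSq S) n).eval u =
      √(rhoSq S) ^ n * √(n.factorial : ℝ) * hermiteFn n ((√(rhoSq S))⁻¹ * u) := by
  have hρ := Real.sqrt_pos.2 hS.rhoSq_pos
  have hf : √(n.factorial : ℝ) ≠ 0 := (Real.sqrt_pos.2 (by exact_mod_cast n.factorial_pos)).ne'
  have h := pow_mul_aeval_hermite hρ.ne' n u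
  rw [Real.sq_sqrt hS.rhoSq_pos.le] at h
  rw [← h, hermiteFn]
  field_simp

/-- A closed subspace is its own double orthogonal complement. If `h` is orthogonal to the chaos, it
is orthogonal to the Hermite polynomial of the field at every point, and Fubini gives orthogonality
to the integral against `g`. -/
lemma IsFreeField.toLp_wickInt_mem_wienerChaos (hμ : IsFreeField δ μ) (hδ : 0 < δ)
    {S : Finset (ℤ × ℤ)} (hS : IsSymm S) (n : ℕ) {g : T2 → ℝ} (hg : Integrable g) :
    (hμ.memLp_wickInt hS n hg).toLp _ ∈ wienerChaos hδ μ n := by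
  have := hμ.isGaussian
  obtain ⟨Γ, hΓ, hb⟩ := hμ.exists_fld_bound hS n
  have hcont : Continuous fun q : Sobolev (-δ) × T2 =>
      (hermiteVar (rhoSq S) n).eval (fld S q.1.toDistr q.2) :=
    (hermiteVar (rhoSq S) n).continuous.comp (continuous_fld S)
  have hmem : ∀ x, MemLp (fun z : Sobolev (-δ) =>
      (hermiteVar (rhoSq S) n).eval (fld S z.toDistr x)) 2 μ := fun x =>
    hΓ.mono' (hcont.comp (Continuous.prodMk_left x)).aestronglyMeasurable
      (Eventually.of_forall fun z => hb z x)
  rw [wienerChaos, ← Submodule.orthogonal_orthogonal_eq_closure, Submodule.mem_orthogonal]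
  intro h hh
  have h0 : ∀ x, ∫ z, h z * (hermiteVar (rhoSq S) n).eval (fld S z.toDistr x) ∂μ = 0 := by
    intro x
    obtain ⟨f, hf, hW⟩ := hS.isWhiteNoise_fld hμ hδ x
    have hc : √(rhoSq S) ^ n * √(n.factorial : ℝ) ≠ 0 :=
      mul_ne_zero (pow_ne_zero _ (Real.sqrt_pos.2 hS.rhoSq_pos).ne')
        (Real.sqrt_pos.2 (by exact_mod_cast n.factorial_pos)).ne'
    have hm : MemLp (fun z : Sobolev (-δ) =>
        hermiteFn n ((√(rhoSq S))⁻¹ * fld S z.toDistr x)) 2 μ := by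
      refine ((hmem x).const_mul (√(rhoSq S) ^ n * √(n.factorial : ℝ))⁻¹).ae_eq
        (Eventually.of_forall fun z => ?_)
      dsimp only
      rw [hermiteVar_eq_hermiteFn hS, inv_mul_cancel_left₀ hc]
    have h1 := (Submodule.mem_orthogonal _ h).1 hh (hm.toLp _)
      (Submodule.subset_span ⟨f, _, hf, hW, hm.coeFn_toLp⟩)
    rw [L2.inner_def] at h1
    have h2 : ∫ z, h z * hermiteFn n ((√(rhoSq S))⁻¹ * fld S z.toDistr x) ∂μ = 0 := by
      rw [← h1]
      refine integral_congr_ae ?_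
      filter_upwards [hm.coeFn_toLp] with z hz
      rw [hz]; simp
    simp only [hermiteVar_eq_hermiteFn hS]
    simp only [← mul_assoc, mul_comm _ (√(rhoSq S) ^ n * √(n.factorial : ℝ))]
    simp only [mul_assoc]
    rw [integral_const_mul, integral_const_mul, h2, mul_zero, mul_zero]
  have hh2 : MemLp h 2 μ := Lp.memLp h
  have hint : Integrable (Function.uncurry fun (z : Sobolev (-δ)) (x : T2) =>
      h z * ((hermiteVar (rhoSq S) n).eval (fld S z.toDistr x) * g x)) (μ.prod volume) := by
    have hd : Integrable (fun z => h z * Γ z) μ := hh2.integrable_mul hΓ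
    refine (hd.mul_prod hg).mono (hh2.1.comp_fst.mul
      (hcont.aestronglyMeasurable.mul hg.aestronglyMeasurable.comp_snd))
      (Eventually.of_forall fun q => ?_)
    change ‖h q.1 * ((hermiteVar (rhoSq S) n).eval (fld S q.1.toDistr q.2) * g q.2)‖ ≤
      ‖h q.1 * Γ q.1 * g q.2‖
    rw [norm_mul, norm_mul, norm_mul, norm_mul, mul_assoc]
    refine mul_le_mul_of_nonneg_left (mul_le_mul_of_nonneg_right ?_ (norm_nonneg _)) (norm_nonneg _)
    exact (hb q.1 q.2).trans (le_abs_self _)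
  rw [L2.inner_def]
  calc _ = ∫ z, (∫ x, h z * ((hermiteVar (rhoSq S) n).eval (fld S z.toDistr x) * g x)) ∂μ := by
        refine integral_congr_ae ?_
        filter_upwards [(hμ.memLp_wickInt hS n hg).coeFn_toLp] with z hz
        rw [hz, integral_const_mul]
        simp [wickInt, mul_comm]
    _ = 0 := by
        rw [integral_integral_swap hint]
        have : ∀ x, ∫ z, h z * ((hermiteVar (rhoSq S) n).eval (fld S z.toDistr x) * g x) ∂μ = 0 := by
          intro x
          simp only [← mul_assoc]
          rw [integral_mul_const, h0, zero_mul]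
        simp only [this, integral_zero]

lemma IsFreeField.exists_mem_wienerChaos (hμ : IsFreeField δ μ) (hδ : 0 < δ) (n : ℕ) (g : L2) :
    ∃ F ∈ wienerChaos hδ μ n, F =ᵐ[μ] wickLim hμ n g := by
  refine ⟨(hμ.memLp_wickLim n g).toLp _, ?_, (hμ.memLp_wickLim n g).coeFn_toLp⟩
  have hclosed : IsClosed (wienerChaos hδ μ n : Set (Lp ℝ 2 μ)) :=
    Submodule.isClosed_topologicalClosure _
  refine hclosed.mem_of_tendsto (b := atTop) (f := fun N =>
    (hμ.memLp_wickInt (isSymm_box N) n (integrable_L2 g)).toLp _) ?_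
    (Eventually.of_forall fun N =>
      hμ.toLp_wickInt_mem_wienerChaos hδ (isSymm_box N) n (integrable_L2 g))
  rw [Lp.tendsto_Lp_iff_tendsto_eLpNorm'' _ (fun N =>
    hμ.memLp_wickInt (isSymm_box N) n (integrable_L2 g)) _ (hμ.memLp_wickLim n g)]
  exact hμ.tendsto_wickLim n g

end

section

/-! ### Bounds and convergence for all exponents -/

/-- Since `C ≥ 1` one has `√C ≤ C`, so one constant can serve both in front of the root and inside
it. -/
lemma sqrt_mul_le {C f X : ℝ} (hC : 1 ≤ C) (hf : 0 ≤ f) :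
    √(f * (C * X)) ≤ C * √f * √X := by
  have h1 : √C ≤ C := Real.sqrt_le_self_iff.2 (Or.inr hC)
  rw [Real.sqrt_mul hf, Real.sqrt_mul (by linarith)]
  nlinarith [mul_le_mul_of_nonneg_right h1 (mul_nonneg (Real.sqrt_nonneg f) (Real.sqrt_nonneg X))]

variable {δ : ℝ} {μ : Measure (Sobolev (-δ))}

lemma IsFreeField.isProbabilityMeasure (hμ : IsFreeField δ μ) : IsProbabilityMeasure μ := by
  have := hμ.isGaussian
  infer_instance

lemma tendsto_eLpNorm_of_le {ι Ω E : Type*} {mΩ : MeasurableSpace Ω} {P : Measure Ω}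
    [IsProbabilityMeasure P] [NormedAddCommGroup E] {l : Filter ι} {f : ι → Ω → E} {p q : ℝ≥0∞}
    (hpq : p ≤ q) (hf : ∀ i, AEStronglyMeasurable (f i) P)
    (h : Tendsto (fun i => eLpNorm (f i) q P) l (𝓝 0)) :
    Tendsto (fun i => eLpNorm (f i) p P) l (𝓝 0) :=
  tendsto_of_tendsto_of_tendsto_of_le_of_le tendsto_const_nhds h (fun _ => zero_le)
    fun i => eLpNorm_le_eLpNorm_of_exponent_le hpq (hf i)

lemma tendsto_eLpNorm_sub {Ω E : Type*} {mΩ : MeasurableSpace Ω} {P : Measure Ω}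
    [NormedAddCommGroup E] {f : ℕ → Ω → E} {g : Ω → E} {p : ℝ≥0∞} (hp : 1 ≤ p)
    (hf : ∀ i, AEStronglyMeasurable (f i) P) (hg : AEStronglyMeasurable g P)
    (h : Tendsto (fun i => eLpNorm (fun z => f i z - g z) p P) atTop (𝓝 0)) :
    Tendsto (fun q : ℕ × ℕ => eLpNorm (fun z => f q.1 z - f q.2 z) p P) atTop (𝓝 0) := by
  have h1 : Tendsto (fun q : ℕ × ℕ => eLpNorm (fun z => f q.1 z - g z) p P +
      eLpNorm (fun z => f q.2 z - g z) p P) atTop (𝓝 0) := by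
    rw [← prod_atTop_atTop_eq, ← add_zero (0 : ℝ≥0∞)]
    exact (h.comp tendsto_fst).add (h.comp tendsto_snd)
  refine tendsto_of_tendsto_of_tendsto_of_le_of_le tendsto_const_nhds h1 (fun _ => zero_le)
    fun q => ?_
  have h2 := eLpNorm_sub_le ((hf q.1).sub hg) ((hf q.2).sub hg) hp
  rw [sub_sub_sub_cancel_right] at h2
  exact h2

/-- The estimates hold for exponents at least `2`; on a probability space the convergence for `max p
2` implies the one for `p`. -/
lemma IsFreeField.wickPow_convergence (hμ : IsFreeField δ μ) (n : ℕ) (p : ℝ) {α : ℝ} (hp : 1 ≤ p)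
    (hα : 0 < α) : MemLp (fun z => (wickPow hμ n z).toSobolev α hα) (ENNReal.ofReal p) μ ∧
      ∀ Λ : Set (ℝ × ℝ), IsCutoff Λ →
        (∀ N : ℕ, MemLp (wickRegSobolev n ((N : ℝ) • Λ) α hα.le) (ENNReal.ofReal p) μ) ∧
        Tendsto (fun MN : ℕ × ℕ => eLpNorm (fun z =>
            wickRegSobolev n ((MN.1 : ℝ) • Λ) α hα.le z -
            wickRegSobolev n ((MN.2 : ℝ) • Λ) α hα.le z) (ENNReal.ofReal p) μ)
          atTop (𝓝 0) ∧
        Tendsto (fun N : ℕ => eLpNorm (fun z =>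
            wickRegSobolev n ((N : ℝ) • Λ) α hα.le z - (wickPow hμ n z).toSobolev α hα)
            (ENNReal.ofReal p) μ)
          atTop (𝓝 0) := by
  have := hμ.isProbabilityMeasure
  have hpq : ENNReal.ofReal p ≤ ENNReal.ofReal (max p 2) := ENNReal.ofReal_le_ofReal (le_max_left _ _)
  have h2 : 2 ≤ max p 2 := le_max_right _ _
  have hm := (hμ.memLp_wickPow n hα h2).mono_exponent hpq
  refine ⟨hm, fun Λ hΛ => ?_⟩
  have hmN : ∀ N : ℕ, MemLp (fun z : Sobolev (-δ) => wickRegSobolev n ((N : ℝ) • Λ) α hα.le z)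
      (ENNReal.ofReal p) μ := fun N =>
    (hμ.memLp_wickRegSobolev n hα (hΛ.isSymm N) h2).mono_exponent hpq
  have hs : ∀ N : ℕ, AEStronglyMeasurable (fun z : Sobolev (-δ) =>
      wickRegSobolev n ((N : ℝ) • Λ) α hα.le z - (wickPow hμ n z).toSobolev α hα) μ :=
    fun N => (hmN N).1.sub hm.1
  have hlim := tendsto_eLpNorm_of_le hpq hs (hμ.tendsto_wickRegSobolev n hα hΛ h2)
  have hp1 : 1 ≤ ENNReal.ofReal p := ENNReal.one_le_ofReal.2 hp
  have hc := tendsto_eLpNorm_sub (f := fun (N : ℕ) (z : Sobolev (-δ)) =>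
    wickRegSobolev n ((N : ℝ) • Λ) α hα.le z) hp1 (fun N => (hmN N).1) hm.1 hlim
  exact ⟨hmN, hc, hlim⟩

lemma IsFreeField.wickLim_convergence (hμ : IsFreeField δ μ) (n : ℕ) (g : L2) (p : ℝ) :
    MemLp (wickLim hμ n g) (ENNReal.ofReal p) μ ∧
      ∀ Λ : Set (ℝ × ℝ), IsCutoff Λ →
        (∀ N : ℕ, MemLp (wickRegTest n ((N : ℝ) • Λ) g) (ENNReal.ofReal p) μ) ∧
        Tendsto (fun N : ℕ => eLpNorm (fun z =>
            wickRegTest n ((N : ℝ) • Λ) g z - wickLim hμ n g z) (ENNReal.ofReal p) μ)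
          atTop (𝓝 0) := by
  have := hμ.isProbabilityMeasure
  have hpq : ENNReal.ofReal p ≤ ENNReal.ofReal (max p 2) := ENNReal.ofReal_le_ofReal (le_max_left _ _)
  have h2 : 2 ≤ max p 2 := le_max_right _ _
  have hm : MemLp (wickLim hμ n g) (ENNReal.ofReal p) μ :=
    MemLp.mono_exponent ⟨(hμ.memLp_wickLim n g).1,
      (hμ.eLpNorm_wickLim_le n g h2).trans_lt ENNReal.ofReal_lt_top⟩ hpq
  refine ⟨hm, fun Λ hΛ => ?_⟩
  have hmN : ∀ N : ℕ, MemLp (fun z : Sobolev (-δ) => wickRegTest n ((N : ℝ) • Λ) g z)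
      (ENNReal.ofReal p) μ := fun N => by
    simp only [wickRegTest_eq (hΛ.isSymm N)]
    exact MemLp.mono_exponent ⟨(hμ.memLp_wickInt (hΛ.isSymm N) n (integrable_L2 g)).1,
      (hμ.eLpNorm_wickInt_rpow_le (hΛ.isSymm N) n g h2).trans_lt ENNReal.ofReal_lt_top⟩ hpq
  exact ⟨hmN, tendsto_eLpNorm_of_le hpq (fun N => (hmN N).1.sub hm.1)
    (hμ.tendsto_wickRegTest n g hΛ h2)⟩

lemma IsFreeField.exists_wickPow_le (hμ : IsFreeField δ μ) {α₀ : ℝ} (hα₀ : α₀ < 1) :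
    ∃ C : ℝ, 0 < C ∧ ∀ (α : ℝ) (hα : 0 < α) (n : ℕ) (p ε : ℝ), α ≤ α₀ → 1 ≤ n → 2 ≤ p → 0 < ε →
      eLpNorm (fun z => (wickPow hμ n z).toSobolev α hα) (ENNReal.ofReal p) μ ≤
        ENNReal.ofReal (C * (p - 1) ^ ((n : ℝ) / 2) * √(n.factorial : ℝ) *
          √((α ^ 2)⁻¹ * ((1 + ε) / (4 * Real.pi * α)) ^ (n - 1) * n.factorial +
            C ^ n * ((1 + ε) / ε) ^ (n - 1))) := by
  obtain ⟨C, hC1, hC⟩ := exists_sum_wickVar_le_pos hα₀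
  refine ⟨C, by linarith, fun α hα n p ε h1 hn hp hε => (hμ.eLpNorm_wickPow_le n hα hp).trans
    (ENNReal.ofReal_le_ofReal ?_)⟩
  have h2 := Real.sqrt_le_sqrt (tsum_wickQ_le hα fun M S => hC α n ε M S hα h1 (by omega) hε)
  refine (mul_le_mul_of_nonneg_left (h2.trans (sqrt_mul_le hC1 (Nat.cast_nonneg _)))
    (hyperC_nonneg n hp)).trans (le_of_eq ?_)
  ring

/-- When the constant may depend on `α` and `n`, finiteness of the second moment is enough: the
factor `√(n!)` and the root are at least `1`, as the second summand under the root is a product of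
powers of numbers at least `1`. -/
lemma IsFreeField.exists_wickPow_le' (hμ : IsFreeField δ μ) {α : ℝ} (hα : 0 < α) (n : ℕ) :
    ∃ C : ℝ, 0 < C ∧ ∀ (p ε : ℝ), 2 ≤ p → 0 < ε →
      eLpNorm (fun z => (wickPow hμ n z).toSobolev α hα) (ENNReal.ofReal p) μ ≤
        ENNReal.ofReal (C * (p - 1) ^ ((n : ℝ) / 2) * √(n.factorial : ℝ) *
          √((α ^ 2)⁻¹ * ((1 + ε) / (4 * Real.pi * α)) ^ (n - 1) * n.factorial +
            C ^ n * ((1 + ε) / ε) ^ (n - 1))) := by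
  obtain ⟨B, hB0, hB⟩ := exists_sum_wickVar_le n hα
  have hC1 : 1 ≤ max 1 B := le_max_left _ _
  refine ⟨max 1 B, by linarith, fun p ε hp hε => (hμ.eLpNorm_wickPow_le n hα hp).trans
    (ENNReal.ofReal_le_ofReal ?_)⟩
  have h1 : √(∑' m, lam m ^ (-α) * wickQ n (casLp m)) ≤ max 1 B :=
    (Real.sqrt_le_sqrt ((tsum_wickQ_le hα hB).trans (le_max_right 1 B))).trans
      (Real.sqrt_le_self_iff.2 (Or.inr hC1))
  have h2 : 1 ≤ √(n.factorial : ℝ) := Real.one_le_sqrt.2 (by exact_mod_cast n.factorial_pos)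
  have h3 : 1 ≤ √((α ^ 2)⁻¹ * ((1 + ε) / (4 * Real.pi * α)) ^ (n - 1) * n.factorial +
      max 1 B ^ n * ((1 + ε) / ε) ^ (n - 1)) := by
    rw [Real.one_le_sqrt]
    have h4 : 0 ≤ (α ^ 2)⁻¹ * ((1 + ε) / (4 * Real.pi * α)) ^ (n - 1) * n.factorial := by
      have := Real.pi_pos
      positivity
    have h5 : 1 ≤ (1 + ε) / ε := by rw [one_le_div hε]; linarith
    have h6 := one_le_mul_of_one_le_of_one_le (one_le_pow₀ hC1 (n := n))
      (one_le_pow₀ h5 (n := n - 1))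
    linarith
  have h7 := one_le_mul_of_one_le_of_one_le h2 h3
  have h8 := hyperC_nonneg n hp
  calc hyperC n p * √(∑' m, lam m ^ (-α) * wickQ n (casLp m)) ≤ hyperC n p * max 1 B :=
        mul_le_mul_of_nonneg_left h1 h8
    _ ≤ hyperC n p * max 1 B * (√(n.factorial : ℝ) *
        √((α ^ 2)⁻¹ * ((1 + ε) / (4 * Real.pi * α)) ^ (n - 1) * n.factorial +
          max 1 B ^ n * ((1 + ε) / ε) ^ (n - 1))) :=
        le_mul_of_one_le_right (by positivity) h7
    _ = _ := by ring

lemma IsFreeField.exists_wickLim_le (hμ : IsFreeField δ μ) :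
    ∃ C : ℝ, 0 < C ∧ ∀ (n : ℕ) (g : L2) (p ε : ℝ), 1 ≤ n → 2 ≤ p → 0 < ε →
      eLpNorm (wickLim hμ n g) (ENNReal.ofReal p) μ ≤
        ENNReal.ofReal (C * (p - 1) ^ ((n : ℝ) / 2) * √(n.factorial : ℝ) *
          √(((1 + ε) / (4 * Real.pi)) ^ (n - 1) * n.factorial +
            C ^ n * ((1 + ε) / ε) ^ (n - 1)) * ‖g‖) := by
  obtain ⟨C, hC1, hC⟩ := exists_wickVar_le_pos
  refine ⟨C, by linarith, fun n g p ε hn hp hε => (hμ.eLpNorm_wickLim_le n g hp).trans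
    (ENNReal.ofReal_le_ofReal ?_)⟩
  set X := ((1 + ε) / (4 * Real.pi)) ^ (n - 1) * n.factorial + C ^ n * ((1 + ε) / ε) ^ (n - 1)
  have h2 : √(wickQ n g) ≤ √(n.factorial * (C * X)) * ‖g‖ := by
    have h3 : wickQ n g ≤ n.factorial * (C * X) * ‖g‖ ^ 2 :=
      (wickQ_le fun S => hC n ε S g (by omega) hε).trans (le_of_eq (by ring))
    refine (Real.sqrt_le_sqrt h3).trans (le_of_eq ?_)
    rw [Real.sqrt_mul' _ (sq_nonneg _), Real.sqrt_sq (norm_nonneg g)]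
  refine (mul_le_mul_of_nonneg_left (h2.trans (mul_le_mul_of_nonneg_right
    (sqrt_mul_le hC1 (Nat.cast_nonneg _)) (norm_nonneg g))) (hyperC_nonneg n hp)).trans
    (le_of_eq ?_)
  ring

end

end WickTorus

end

theorem proposition3p1 (δ : ℝ) (hδ : 0 < δ) (μ₀ : Measure (Sobolev (-δ)))
    (hμ₀ : IsFreeField δ μ₀) :
    ∃ (Φ : ℕ → Sobolev (-δ) → SobolevMinus) (Ψ : ℕ → L2 → Sobolev (-δ) → ℝ),
      -- (1) convergence of the regularized Wick powers, with the same limit for every cutoff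
      (∀ (n : ℕ) (p α : ℝ) (_ : 1 ≤ p) (hα : 0 < α),
        MemLp (fun z => (Φ n z).toSobolev α hα) (ENNReal.ofReal p) μ₀ ∧
        ∀ Λ : Set (ℝ × ℝ), IsCutoff Λ →
          (∀ N : ℕ, MemLp (wickRegSobolev n ((N : ℝ) • Λ) α hα.le) (ENNReal.ofReal p) μ₀) ∧
          Tendsto (fun MN : ℕ × ℕ => eLpNorm (fun z =>
              wickRegSobolev n ((MN.1 : ℝ) • Λ) α hα.le z -
              wickRegSobolev n ((MN.2 : ℝ) • Λ) α hα.le z) (ENNReal.ofReal p) μ₀)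
            atTop (𝓝 0) ∧
          Tendsto (fun N : ℕ => eLpNorm (fun z =>
              wickRegSobolev n ((N : ℝ) • Λ) α hα.le z - (Φ n z).toSobolev α hα)
              (ENNReal.ofReal p) μ₀)
            atTop (𝓝 0)) ∧
      -- (1) the bound, for `0 < α < 1`: the constant is uniform for `α` bounded away from `1`
      (∀ α₀ : ℝ, α₀ < 1 → ∃ C : ℝ, 0 < C ∧
        ∀ (α : ℝ) (hα : 0 < α) (n : ℕ) (p ε : ℝ), α ≤ α₀ → 1 ≤ n → 2 ≤ p → 0 < ε →
          eLpNorm (fun z => (Φ n z).toSobolev α hα) (ENNReal.ofReal p) μ₀ ≤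
            ENNReal.ofReal (C * (p - 1) ^ ((n : ℝ) / 2) * √(n.factorial : ℝ) *
              √((α ^ 2)⁻¹ * ((1 + ε) / (4 * Real.pi * α)) ^ (n - 1) * n.factorial +
                C ^ n * ((1 + ε) / ε) ^ (n - 1)))) ∧
      -- (1) the bound, for `1 ≤ α`: the constant may also depend on `n`
      (∀ (α : ℝ) (hα : 0 < α) (n : ℕ), 1 ≤ α → 1 ≤ n → ∃ C : ℝ, 0 < C ∧
        ∀ (p ε : ℝ), 2 ≤ p → 0 < ε →
          eLpNorm (fun z => (Φ n z).toSobolev α hα) (ENNReal.ofReal p) μ₀ ≤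
            ENNReal.ofReal (C * (p - 1) ^ ((n : ℝ) / 2) * √(n.factorial : ℝ) *
              √((α ^ 2)⁻¹ * ((1 + ε) / (4 * Real.pi * α)) ^ (n - 1) * n.factorial +
                C ^ n * ((1 + ε) / ε) ^ (n - 1)))) ∧
      -- (2) convergence of the tested versions, with the same limit for every cutoff
      (∀ (n : ℕ) (g : L2) (p : ℝ), 1 ≤ p →
        MemLp (Ψ n g) (ENNReal.ofReal p) μ₀ ∧
        ∀ Λ : Set (ℝ × ℝ), IsCutoff Λ →
          (∀ N : ℕ, MemLp (wickRegTest n ((N : ℝ) • Λ) g) (ENNReal.ofReal p) μ₀) ∧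
          Tendsto (fun N : ℕ => eLpNorm (fun z =>
              wickRegTest n ((N : ℝ) • Λ) g z - Ψ n g z) (ENNReal.ofReal p) μ₀)
            atTop (𝓝 0)) ∧
      -- (2) the limit lies in the chaos of order `n`
      (∀ (n : ℕ) (g : L2), ∃ F ∈ wienerChaos hδ μ₀ n, F =ᵐ[μ₀] Ψ n g) ∧
      -- (2) the bound
      (∃ C : ℝ, 0 < C ∧ ∀ (n : ℕ) (g : L2) (p ε : ℝ), 1 ≤ n → 2 ≤ p → 0 < ε →
        eLpNorm (Ψ n g) (ENNReal.ofReal p) μ₀ ≤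
          ENNReal.ofReal (C * (p - 1) ^ ((n : ℝ) / 2) * √(n.factorial : ℝ) *
            √(((1 + ε) / (4 * Real.pi)) ^ (n - 1) * n.factorial +
              C ^ n * ((1 + ε) / ε) ^ (n - 1)) * ‖g‖)) ∧
      -- (2) the duality identity, for `g ∈ H^α`
      (∀ (n : ℕ) (α : ℝ) (g : L2), 0 < α → L2.toDistr g ∈ sobolevSet α →
        ∀ᵐ z ∂μ₀, Ψ n g z = pairing (Φ n z).1 (L2.toDistr g)) := by
  -- Both witnesses are chosen before `p`, `α` and the cutoff, which is the independence of the
  -- limit from them.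
  refine ⟨wickPow hμ₀, wickLim hμ₀, fun n p α hp hα => hμ₀.wickPow_convergence n p hp hα,
    fun α₀ hα₀ => hμ₀.exists_wickPow_le hα₀, fun α hα n _ _ => hμ₀.exists_wickPow_le' hα n,
    fun n g p _ => hμ₀.wickLim_convergence n g p, hμ₀.exists_mem_wienerChaos hδ,
    hμ₀.exists_wickLim_le, fun n α g hα hg => hμ₀.wickLim_ae_eq_pairing n hα g hg⟩
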